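/- **Setting.** Let $d\in\{2,3\}$, let $\Omega\subset\mathbb R^d$ be a bounded polygonal/polyhedral domain, and let $A\in L^\infty(\Omega;\mathbb R^{d\times d})$ be symmetric with eigenvalues bounded above and below by positive constants. Let $\mathcal T_h$ be a conforming partition of $\Omega$ into elements $T=\Phi_T(\hat T)$, with $\Phi_T$ affine and $\hat T$ either the unit simplex (for all $T$) or the unit cube (for all $T$; the elements are then parallelotopes). Its facets $E=\Phi_E(\hat E)$ form the set $\mathcal E_h$; $h_T,h_E$ are diameters, $\boldsymbol n$ is the outward unit normal on $\partial T$, and $[\cdot]$ is the jump across a facet (the trace itself if $E\subset\partial\Omega$). The partition is shape regular with constant $\sigma$: each $T$ contains a ball of diameter $h_T/\sigma$. Let $p\ge 0$, let $\mathcal P_p$ denote the polynomials of total degree at most $p$ (simplices) or of degree at most $p$ in each variable (cubes), and let $$\boldsymbol\Sigma_h^p=\{\boldsymbol r:\ \boldsymbol r|_T=(\det\Phi_T')^{-1}\Phi_T'\,\hat{\boldsymbol r}\circ\Phi_T^{-1},\ \hat{\boldsymbol r}\in \mathrm{RT}_p(\hat T)\},\qquad V_h^p=\{v:\ v|_T=\hat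 v\circ\Phi_T^{-1},\ \hat v\in\mathcal P_p(\hat T)\},$$ $$M_{h,0}^p=\{\mu\in L^2(\mathcal E_h):\ \mu|_E=\hat\mu\circ\Phi_E^{-1},\ \hat\mu\in\mathcal P_p(\hat E);\ \mu|_E=0 \text{ for } E\subset\partial\Omega\}.$$ On simplices $\mathrm{RT}_p(\hat T)=[\mathcal P_p]^d+\mathbf x\,\mathcal P_p$. On cubes $\mathrm{RT}_p(\hat T)$ is the standard Raviart--Thomas space, whose $i$-th component ranges over $\mathcal P_p+x_i\mathcal P_p$; if $p\ge1$, $\mathrm{RT}_p(\hat T)=[\mathcal P_p]^d+\mathbf x\,\mathcal P_p$ (with scalar factor) is allowed on cubes as well. Write $(\cdot,\cdot)$ for the $L^2(\Omega)$ inner product, $(v,w)_{\mathcal T_h}=\sum_T\int_T vw$, $(v,w)_{\partial\mathcal T_h}=\sum_T\int_{\partial T}vw\,ds$, $\nabla_h$ for the broken gradient and $H^1(\mathcal T_h)$ for the broken $H^1$ space. Put $$\mathcal B_h(\boldsymbol r,(v,\hat v))=(\boldsymbol r,\nabla_h v)_{\mathcal T_h}-(v-\hat v,\boldsymbol r\cdot\boldsymbol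 n)_{\partial\mathcal T_h},$$ $$\mathcal A_h((\boldsymbol q,u,\hat u),(\boldsymbol r,v,\hat v))=(A^{-1}\boldsymbol q,\boldsymbol r)_{\mathcal T_h}+\mathcal B_h(\boldsymbol r,(u,\hat u))-\mathcal B_h(\boldsymbol q,(v,\hat v)),$$ $$|||(\boldsymbol q,v,\hat v)|||^2=\|A^{-1/2}\boldsymbol q\|^2_{L^2(\Omega)}+\|A^{1/2}\nabla_h v\|^2_{L^2(\Omega)}+\sum_T h_T^{-1}\|v-\hat v\|^2_{L^2(\partial T)},$$ $$\|w\|_{\mathrm{DG}}^2=\|A^{1/2}\nabla_h w\|_{L^2(\Omega)}^2+\sum_{E\in\mathcal E_h}h_E^{-1}\|[w]\|_{L^2(E)}^2,\qquad \|v\|_{H^1(\mathcal T_h)^*}=\sup_{w\in H^1(\mathcal T_h)}\frac{(v,w)}{\|w\|_{\mathrm{DG}}}.$$ Let $\mathcal U(\psi)(x)=\Upsilon(x,\psi(x))$, where $\Upsilon:\Omega\times\mathbb R\to\mathbb R$ is a Carathéodory function such that, for a.e. $x$, $\Upsilon(x,\cdot)$ is an increasing bijection of $\mathbb R$ onto an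 open interval $(\underline u(x),\overline u(x))$ (possibly unbounded), and assume that $\mathcal U$ is Fréchet differentiable on $L^\infty(\Omega)$, its derivative at $\psi$ being multiplication by the function $\mathcal U'(\psi)=\partial_z\Upsilon(\cdot,\psi(\cdot))\in L^\infty(\Omega)$, with $\mathcal U'(\psi)>0$ a.e. in $\Omega$. **Lemma (first stability estimate).** Let $\alpha>0$, $\psi\in L^\infty(\Omega)$, $\tilde f,\chi\in L^2(\Omega)$ and $\phi\in H^1_0(\Omega)$. The problem of finding $(\boldsymbol q_h,u_h,\hat u_h)\in\boldsymbol\Sigma_h^p\times V_h^p\times M_{h,0}^p$ and $\delta_h\in V_h^p$ such that $$\alpha\,\mathcal A_h((\boldsymbol q_h,u_h,\hat u_h),(\boldsymbol r_h,v_h,\hat v_h))+(\delta_h,v_h)=(\tilde f,v_h)\quad\forall(\boldsymbol r_h,v_h,\hat v_h)\in\boldsymbol\Sigma_h^p\times V_h^p\times M_{h,0}^p,$$ $$(u_h,q_h)-(\mathcal U'(\psi)\delta_h,q_h)=(\phi+\chi,q_h)\quad\forall q_h\in V_h^p$$ has a unique solution, and $$\alpha\,|||(\boldsymbol q_h,u_h,\hat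 u_h)|||+\|\delta_h\|_{H^1(\mathcal T_h)^*}+\|\mathcal U'(\psi)^{1/2}\delta_h\|_{L^2(\Omega)}\le C\Big(\|\tilde f\|_{H^1(\mathcal T_h)^*}+\|\nabla\phi\|_{L^2(\Omega)}+\|\mathcal U'(\psi)^{-1/2}\chi\|_{L^2(\Omega)}\Big),$$ where $C$ may depend on $\Omega$, $A$, $p$, $\alpha$, $\sigma$ and the choices of $\hat T$ and $\mathrm{RT}_p(\hat T)$, but not on the mesh (in particular not on $h$), nor on $\Upsilon$, $\psi$, $\tilde f$, $\phi$, $\chi$. (If $\mathcal U'(\psi)^{-1/2}\chi\notin L^2(\Omega)$, the right-hand side is $+\infty$.) -/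

import Mathlib

open MeasureTheory Filter Topology Set
open scoped ENNReal NNReal ContDiff

noncomputable section

namespace FOSPG

/-- Euclidean space `ℝ^d`. -/
abbrev Space (d : ℕ) : Type := EuclideanSpace ℝ (Fin d)

/-- The bilinear form `ξ ⬝ B η` of a matrix `B`. -/
def matForm {d : ℕ} (B : Matrix (Fin d) (Fin d) ℝ) (ξ η : Space d) : ℝ :=
  ∑ i, ∑ j, ξ i * B i j * η j

/-! ### Domain, coefficient, obstacle maps -/

/-- Bounded polygonal / polyhedral domain: open, connected, lying locally on one side of its
boundary, with closure a finite union of convex polytopes. -/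
structure IsPolyhedralDomain {d : ℕ} (Ω : Set (Space d)) : Prop where
  isOpen : IsOpen Ω
  isConnected : IsConnected Ω
  interior_closure : interior (closure Ω) = Ω
  polyhedral : ∃ S : Set (Set (Space d)), S.Finite ∧
    (∀ P ∈ S, ∃ F : Finset (Space d), P = convexHull ℝ (F : Set (Space d))) ∧ closure Ω = ⋃₀ S

/-- A symmetric diffusion tensor in `L^∞(Ω; ℝ^{d×d})` whose eigenvalues are bounded above and below
by positive constants. -/
structure IsDiffusionTensor {d : ℕ} (Ω : Set (Space d))
    (A : Space d → Matrix (Fin d) (Fin d) ℝ) : Prop where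
  measurable : ∀ i j, AEStronglyMeasurable (fun x => A x i j) (volume.restrict Ω)
  symm : ∀ᵐ x ∂(volume.restrict Ω), (A x).IsSymm
  elliptic : ∃ lo hi : ℝ, 0 < lo ∧ ∀ᵐ x ∂(volume.restrict Ω), ∀ ξ : Space d,
    lo * ‖ξ‖ ^ 2 ≤ matForm (A x) ξ ξ ∧ matForm (A x) ξ ξ ≤ hi * ‖ξ‖ ^ 2

/-- The superposition operator `𝒰(ψ)(x) = Υ(x, ψ(x))`. -/
def superposition {d : ℕ} (Υ : Space d → ℝ → ℝ) (ψ : Space d → ℝ) (x : Space d) : ℝ :=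
  Υ x (ψ x)

/-- The function `x ↦ ∂Υ/∂z (x, ψ(x))`, multiplication by which is `𝒰'(ψ)`. -/
def superpositionDeriv {d : ℕ} (Υ : Space d → ℝ → ℝ) (ψ : Space d → ℝ) (x : Space d) : ℝ :=
  deriv (Υ x) (ψ x)

/-- `Υ` is a Carathéodory function such that, for a.e. `x ∈ Ω`, `Υ(x, ·)` is an increasing bijection
from `ℝ` onto the (possibly unbounded) interval `(ulow x, uupp x)`; the superposition operator
`𝒰` is Fréchet differentiable on `L^∞(Ω)`, and `𝒰'(ψ) > 0` a.e. in `Ω`. -/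
structure IsObstacleMap {d : ℕ} (Ω : Set (Space d)) (ulow uupp : Space d → EReal)
    (Υ : Space d → ℝ → ℝ) : Prop where
  measurable : ∀ z, AEStronglyMeasurable (fun x => Υ x z) (volume.restrict Ω)
  bijective : ∀ᵐ x ∂(volume.restrict Ω), Continuous (Υ x) ∧ StrictMono (Υ x) ∧
    ∀ y : ℝ, y ∈ range (Υ x) ↔ ulow x < (y : EReal) ∧ (y : EReal) < uupp x
  memLp : ∀ ψ, MemLp ψ ∞ (volume.restrict Ω) →
    MemLp (superposition Υ ψ) ∞ (volume.restrict Ω)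
  memLp_deriv : ∀ ψ, MemLp ψ ∞ (volume.restrict Ω) →
    MemLp (superpositionDeriv Υ ψ) ∞ (volume.restrict Ω)
  frechet : ∀ ψ, MemLp ψ ∞ (volume.restrict Ω) → ∀ ε : ℝ, 0 < ε → ∃ η : ℝ, 0 < η ∧
    ∀ k, MemLp k ∞ (volume.restrict Ω) → eLpNorm k ∞ (volume.restrict Ω) ≤ ENNReal.ofReal η →
      eLpNorm (fun x => superposition Υ (ψ + k) x - superposition Υ ψ x
          - superpositionDeriv Υ ψ x * k x) ∞ (volume.restrict Ω)
        ≤ ENNReal.ofReal ε * eLpNorm k ∞ (volume.restrict Ω)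
  deriv_pos : ∀ ψ, MemLp ψ ∞ (volume.restrict Ω) →
    ∀ᵐ x ∂(volume.restrict Ω), 0 < superpositionDeriv Υ ψ x

/-! ### Sobolev spaces and traces -/

/-- `w` has the weak gradient `G` on the open set `U`. -/
def HasWeakGradient {d : ℕ} (U : Set (Space d)) (w : Space d → ℝ) (G : Space d → Space d) : Prop :=
  ∀ η : Space d → ℝ, ContDiff ℝ ∞ η → HasCompactSupport η → tsupport η ⊆ U →
    ∫ x in U, w x • gradient η x = - ∫ x in U, η x • G x

/-- `φ ∈ H^1_0(Ω)` (the closure of `C_c^∞(Ω)` in `H^1(Ω)`), with `∇φ = G`. -/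
def IsH10 {d : ℕ} (Ω : Set (Space d)) (φ : Space d → ℝ) (G : Space d → Space d) : Prop :=
  MemLp φ 2 (volume.restrict Ω) ∧ MemLp G 2 (volume.restrict Ω) ∧
  ∃ s : ℕ → Space d → ℝ,
    (∀ k, ContDiff ℝ ∞ (s k) ∧ HasCompactSupport (s k) ∧ tsupport (s k) ⊆ Ω) ∧
    Tendsto (fun k => eLpNorm (s k - φ) 2 (volume.restrict Ω)) atTop (𝓝 0) ∧
    Tendsto (fun k => eLpNorm (gradient (s k) - G) 2 (volume.restrict Ω)) atTop (𝓝 0)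

/-! ### Reference elements and reference polynomial spaces -/

/-- The two types of meshes. -/
inductive Shape
  | simplex
  | cube

/-- The reference element: the unit simplex or the unit cube. -/
def refElem : Shape → (d : ℕ) → Set (Space d)
  | .simplex, _ => {x | (∀ i, 0 ≤ x i) ∧ ∑ i, x i ≤ 1}
  | .cube, _ => {x | ∀ i, 0 ≤ x i ∧ x i ≤ 1}

/-- The facets of the reference element. -/
def refFacets : (s : Shape) → (d : ℕ) → Set (Set (Space d))
  | .simplex, d => {F | (∃ i, F = {x ∈ refElem .simplex d | x i = 0}) ∨
      F = {x ∈ refElem .simplex d | ∑ i, x i = 1}}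
  | .cube, d => {F | ∃ i, F = {x ∈ refElem .cube d | x i = 0} ∨
      F = {x ∈ refElem .cube d | x i = 1}}

/-- `𝒫_p` on the reference element: polynomials of total degree at most `p` on the simplex,
polynomials of degree at most `p` in each variable on the cube. -/
def polySpace : (s : Shape) → (d p : ℕ) → Submodule ℝ (MvPolynomial (Fin d) ℝ)
  | .simplex, d, p => MvPolynomial.restrictTotalDegree (Fin d) ℝ p
  | .cube, d, p => MvPolynomial.restrictDegree (Fin d) ℝ p

/-- The two readings of `RT_p = [𝒫_p]^d + x 𝒫_p`: `x` times a scalar polynomial, or componentwise. -/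
inductive RTForm
  | scalar
  | componentwise

/-- The Raviart--Thomas space on the reference element. In the form `scalar` it is
`{r + x s : r ∈ [𝒫_p]^d, s ∈ 𝒫_p}`. In the form `componentwise` the `i`-th component ranges over
`𝒫_p + x_i 𝒫_p`; on the cube this is the usual Raviart--Thomas space, whose `i`-th component has
degree at most `p + 1` in `x_i` and at most `p` in the other variables. -/
def rtSpace (s : Shape) (d p : ℕ) : RTForm → Submodule ℝ (Fin d → MvPolynomial (Fin d) ℝ)
  | .scalar => Submodule.pi univ (fun _ => polySpace s d p) ⊔
      (polySpace s d p).map (LinearMap.pi fun i => LinearMap.mulLeft ℝ (MvPolynomial.X i))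
  | .componentwise => Submodule.pi univ fun i => polySpace s d p ⊔
      (polySpace s d p).map (LinearMap.mulLeft ℝ (MvPolynomial.X i))

/-- The pairs of a Raviart--Thomas form and a shape which give a Raviart--Thomas element of
degree `p`: the scalar form on simplices, and on cubes either the componentwise form or, if `p ≥ 1`,
the scalar form. -/
def RTForm.Admissible : RTForm → Shape → ℕ → Prop
  | .scalar, .simplex, _ => True
  | .scalar, .cube, p => 1 ≤ p
  | .componentwise, .simplex, _ => False
  | .componentwise, .cube, _ => True

/-! ### Meshes -/

/-- A conforming partition of `Ω ⊆ ℝ^{n+1}` into affine images of the reference element. Elements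
are indexed by `ι`, facets by `κ`. The element `T` is `Φ_T(T̂)`, and the facet `E` is `Ψ_E(Ê)`. A
facet in `∂Ω` belongs to one element `side₁ E = side₂ E`; any other facet is shared by exactly
two elements, `side₁ E` and `side₂ E` (in an arbitrary order). -/
structure Mesh (s : Shape) (n : ℕ) (Ω : Set (Space (n + 1))) (ι κ : Type) where
  Φ : ι → Space (n + 1) ≃ᵃ[ℝ] Space (n + 1)
  Ψ : κ → Space n →ᵃ[ℝ] Space (n + 1)
  side₁ : κ → ι
  side₂ : κ → ι
  normal : ι → κ → Space (n + 1)
  cover : ⋃ T, Φ T '' refElem s (n + 1) = closure Ω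
  disjoint_interiors : ∀ T T', T ≠ T' →
    Disjoint (interior (Φ T '' refElem s (n + 1))) (interior (Φ T' '' refElem s (n + 1)))
  Ψ_injective : ∀ E, Function.Injective (Ψ E)
  facet_injective : Function.Injective fun E => Ψ E '' refElem s n
  exists_facet : ∀ T, ∀ F ∈ refFacets s (n + 1), ∃ E, Ψ E '' refElem s n = Φ T '' F
  incident : ∀ E T, (∃ F ∈ refFacets s (n + 1), Ψ E '' refElem s n = Φ T '' F) ↔
    T = side₁ E ∨ T = side₂ E
  boundary : ∀ E, side₁ E = side₂ E ↔ Ψ E '' refElem s n ⊆ frontier Ω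
  /-- `normal T E` is the unit normal on the facet `E` of `T`, outward with respect to `T`. -/
  normal_spec : ∀ T E, (T = side₁ E ∨ T = side₂ E) → ‖normal T E‖ = 1 ∧
    ∀ x ∈ Φ T '' refElem s (n + 1), ∀ y ∈ Ψ E '' refElem s n, inner ℝ (normal T E) (x - y) ≤ 0

namespace Mesh

variable {s : Shape} {n : ℕ} {Ω : Set (Space (n + 1))} {ι κ : Type} (M : Mesh s n Ω ι κ)

/-- The element `T`. -/
def elem (T : ι) : Set (Space (n + 1)) := M.Φ T '' refElem s (n + 1)

/-- The facet `E`. -/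
def facet (E : κ) : Set (Space (n + 1)) := M.Ψ E '' refElem s n

/-- The diameter `h_T`. -/
def hElem (T : ι) : ℝ := Metric.diam (M.elem T)

/-- The diameter `h_E`. -/
def hFacet (E : κ) : ℝ := Metric.diam (M.facet E)

/-- Shape regularity with constant `σ`: every element `T` contains a ball of diameter `h_T / σ`. -/
def ShapeRegular (σ : ℝ) : Prop :=
  ∀ T, ∃ x, Metric.closedBall x (M.hElem T / (2 * σ)) ⊆ M.elem T

open Classical in
/-- The facets of the element `T`. -/
def facetsOf [Fintype κ] (T : ι) : Finset κ :=
  Finset.univ.filter fun E => T = M.side₁ E ∨ T = M.side₂ E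

/-- The surface element of the facet `E` with respect to its affine parametrization: the square
root of the Gram determinant of the columns of the matrix of `Ψ_E`. -/
def facetJac (E : κ) : ℝ :=
  Real.sqrt (Matrix.of fun i j : Fin n =>
    inner ℝ ((M.Ψ E).linear (EuclideanSpace.single i 1))
      ((M.Ψ E).linear (EuclideanSpace.single j 1))).det

/-- The surface integral over `E` of a function given in the coordinates of the reference facet:
`∫_E g ∘ Ψ_E⁻¹ ds`. -/
def facetIntegral (E : κ) (g : Space n → ℝ) : ℝ :=
  M.facetJac E * ∫ y in refElem s n, g y

/-! Functions on the mesh. A *broken function* `v : ι → Space (n+1) → ℝ` stands for the function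
(defined a.e. in `Ω`) which equals `v T` on the element `T`. -/

section Spaces

variable (s n ι κ)

/-- Coordinates of `V_h^p`: a reference polynomial `v̂ ∈ 𝒫_p(T̂)` for each element. -/
def V (p : ℕ) : Submodule ℝ (ι → MvPolynomial (Fin (n + 1)) ℝ) :=
  Submodule.pi univ fun _ => polySpace s (n + 1) p

/-- Coordinates of `Σ_h^p`: a reference field `r̂ ∈ RT_p(T̂)` for each element. -/
def Sig (r : RTForm) (p : ℕ) : Submodule ℝ (ι → Fin (n + 1) → MvPolynomial (Fin (n + 1)) ℝ) :=
  Submodule.pi univ fun _ => rtSpace s (n + 1) p r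

end Spaces

open Classical in
/-- Coordinates of `M_{h,0}^p`: a reference polynomial `μ̂ ∈ 𝒫_p(Ê)` for each facet, zero for the
facets in `∂Ω`. -/
def M0 (p : ℕ) : Submodule ℝ (κ → MvPolynomial (Fin n) ℝ) :=
  Submodule.pi univ fun E => if M.facet E ⊆ frontier Ω then ⊥ else polySpace s n p

/-- The broken function `v|_T = v̂ ∘ Φ_T⁻¹`. -/
def fn (v : ι → MvPolynomial (Fin (n + 1)) ℝ) (T : ι) (x : Space (n + 1)) : ℝ :=
  MvPolynomial.eval (fun i => (M.Φ T).symm x i) (v T)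

/-- The broken vector field `r|_T = (det Φ_T')⁻¹ Φ_T' r̂ ∘ Φ_T⁻¹`. -/
def field (r : ι → Fin (n + 1) → MvPolynomial (Fin (n + 1)) ℝ) (T : ι) (x : Space (n + 1)) :
    Space (n + 1) :=
  (LinearMap.det ((M.Φ T).linear : Space (n + 1) →ₗ[ℝ] Space (n + 1)))⁻¹ •
    (M.Φ T).linear
      (WithLp.toLp 2 fun i => MvPolynomial.eval (fun j => (M.Φ T).symm x j) (r T i))

/-- The facet function `μ|_E = μ̂ ∘ Φ_E⁻¹`, in the coordinates of the reference facet. -/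
def facetFn {n : ℕ} {κ : Type} (μ : κ → MvPolynomial (Fin n) ℝ) (E : κ) (y : Space n) : ℝ :=
  MvPolynomial.eval (fun i => y i) (μ E)

variable [Fintype ι]

/-- The `L²(Ω)` inner product `(v, w) = ∑_T ∫_T v w` of broken functions. -/
def ip (v w : ι → Space (n + 1) → ℝ) : ℝ :=
  ∑ T, ∫ x in M.elem T, v T x * w T x

variable [Fintype κ]

/-! ### The DG norm and the dual norm -/

/-- `w ∈ H^1(𝒯_h)`, with broken gradient `G` and with `t T E` the trace of `w|_T` on the facet `E`
of `T` (in the coordinates of the reference facet). The trace is the continuous extension to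
`H^1(T)` of the restriction of smooth functions. -/
def IsBrokenH1 (w : Space (n + 1) → ℝ) (G : ι → Space (n + 1) → Space (n + 1))
    (t : ι → κ → Space n → ℝ) : Prop :=
  MemLp w 2 (volume.restrict Ω) ∧
  ∀ T, MemLp (G T) 2 (volume.restrict (M.elem T)) ∧
    HasWeakGradient (interior (M.elem T)) w (G T) ∧
    (∀ E ∈ M.facetsOf T, MemLp (t T E) 2 (volume.restrict (refElem s n))) ∧
    ∃ a : ℕ → Space (n + 1) → ℝ, (∀ k, ContDiff ℝ ∞ (a k)) ∧
      Tendsto (fun k => eLpNorm (a k - w) 2 (volume.restrict (M.elem T))) atTop (𝓝 0) ∧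
      Tendsto (fun k => eLpNorm (gradient (a k) - G T) 2 (volume.restrict (M.elem T)))
        atTop (𝓝 0) ∧
      ∀ E ∈ M.facetsOf T,
        Tendsto (fun k => eLpNorm (fun y => a k (M.Ψ E y) - t T E y) 2
          (volume.restrict (refElem s n))) atTop (𝓝 0)

open Classical in
/-- The jump on `E`, or the single trace if `E ⊆ ∂Ω`. -/
def jump (t : ι → κ → Space n → ℝ) (E : κ) (y : Space n) : ℝ :=
  if M.facet E ⊆ frontier Ω then t (M.side₁ E) E y
  else t (M.side₁ E) E y - t (M.side₂ E) E y

/-- The DG norm of a function with broken gradient `G` and traces `t`, with `|A^{1/2} ξ|²` written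
as `ξ ⬝ A ξ`. -/
def dgNorm (A : Space (n + 1) → Matrix (Fin (n + 1)) (Fin (n + 1)) ℝ)
    (G : ι → Space (n + 1) → Space (n + 1)) (t : ι → κ → Space n → ℝ) : ℝ :=
  Real.sqrt ((∑ T, ∫ x in M.elem T, matForm (A x) (G T x) (G T x)) +
    ∑ E, (M.hFacet E)⁻¹ * M.facetIntegral E (fun y => M.jump t E y ^ 2))

/-- The dual norm `‖v‖_{H^1(𝒯_h)^*} = sup_{w ∈ H^1(𝒯_h)} (v, w) / ‖w‖_DG`, with `0 / 0 = 0`. -/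
def dualNorm (A : Space (n + 1) → Matrix (Fin (n + 1)) (Fin (n + 1)) ℝ)
    (v : ι → Space (n + 1) → ℝ) : ℝ≥0∞ :=
  ⨆ (w : Space (n + 1) → ℝ) (G : ι → Space (n + 1) → Space (n + 1)) (t : ι → κ → Space n → ℝ)
    (_ : M.IsBrokenH1 w G t), ENNReal.ofReal (M.ip v (fun _ => w) / M.dgNorm A G t)

/-! ### The hybrid mixed forms and the energy norm -/

/-- `ℬ_h(r, (v, v̂)) = (r, ∇_h v)_{𝒯_h} - (v - v̂, r ⬝ n)_{∂𝒯_h}`. -/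
def formB (r : ι → Fin (n + 1) → MvPolynomial (Fin (n + 1)) ℝ)
    (v : ι → MvPolynomial (Fin (n + 1)) ℝ) (vh : κ → MvPolynomial (Fin n) ℝ) : ℝ :=
  (∑ T, ∫ x in M.elem T, inner ℝ (M.field r T x) (gradient (M.fn v T) x)) -
    ∑ T, ∑ E ∈ M.facetsOf T, M.facetIntegral E fun y =>
      (M.fn v T (M.Ψ E y) - facetFn vh E y) * inner ℝ (M.field r T (M.Ψ E y)) (M.normal T E)

/-- `𝒜_h((q, u, û), (r, v, v̂)) = (A⁻¹ q, r)_{𝒯_h} + ℬ_h(r, (u, û)) - ℬ_h(q, (v, v̂))`. -/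
def formA (A : Space (n + 1) → Matrix (Fin (n + 1)) (Fin (n + 1)) ℝ)
    (q : ι → Fin (n + 1) → MvPolynomial (Fin (n + 1)) ℝ)
    (u : ι → MvPolynomial (Fin (n + 1)) ℝ) (uh : κ → MvPolynomial (Fin n) ℝ)
    (r : ι → Fin (n + 1) → MvPolynomial (Fin (n + 1)) ℝ)
    (v : ι → MvPolynomial (Fin (n + 1)) ℝ) (vh : κ → MvPolynomial (Fin n) ℝ) : ℝ :=
  (∑ T, ∫ x in M.elem T, matForm (A x)⁻¹ (M.field r T x) (M.field q T x)) +
    M.formB r u uh - M.formB q v vh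

/-- The energy norm: the square root of
`‖A^{-1/2} q‖² + ‖A^{1/2} ∇_h v‖² + ∑_T h_T⁻¹ ‖v - v̂‖²_{L²(∂T)}`. -/
def tripleNorm (A : Space (n + 1) → Matrix (Fin (n + 1)) (Fin (n + 1)) ℝ)
    (q : ι → Fin (n + 1) → MvPolynomial (Fin (n + 1)) ℝ)
    (v : ι → MvPolynomial (Fin (n + 1)) ℝ) (vh : κ → MvPolynomial (Fin n) ℝ) : ℝ :=
  Real.sqrt ((∑ T, ∫ x in M.elem T, matForm (A x)⁻¹ (M.field q T x) (M.field q T x)) +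
    (∑ T, ∫ x in M.elem T, matForm (A x) (gradient (M.fn v T) x) (gradient (M.fn v T) x)) +
    ∑ T, (M.hElem T)⁻¹ * ∑ E ∈ M.facetsOf T, M.facetIntegral E fun y =>
      (M.fn v T (M.Ψ E y) - facetFn vh E y) ^ 2)

/-- The unknowns (and test functions) `(q_h, u_h, û_h, δ_h) ∈ Σ_h^p × V_h^p × M_{h,0}^p × V_h^p`. -/
abbrev Unknowns (M : Mesh s n Ω ι κ) (r : RTForm) (p : ℕ) : Type :=
  Sig s n ι r p × V s n ι p × M.M0 p × V s n ι p

/-- `(q_h, u_h, û_h, δ_h)` solves the linearized problem with data `f`, `φ + χ = g` and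
`𝒰'(ψ) = m`. -/
def IsSolution (A : Space (n + 1) → Matrix (Fin (n + 1)) (Fin (n + 1)) ℝ) (r : RTForm) (p : ℕ)
    (α : ℝ) (m f g : Space (n + 1) → ℝ) (X : M.Unknowns r p) : Prop :=
  (∀ (τ : Sig s n ι r p) (v : V s n ι p) (vh : M.M0 p),
    α * M.formA A X.1 X.2.1 X.2.2.1 τ v vh + M.ip (M.fn X.2.2.2) (M.fn v) =
      M.ip (fun _ => f) (M.fn v)) ∧
  ∀ w : V s n ι p,
    M.ip (M.fn X.2.1) (M.fn w) - M.ip (fun T x => m x * M.fn X.2.2.2 T x) (M.fn w) =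
      M.ip (fun _ => g) (M.fn w)

/-- `‖m^{1/2} v‖_{L²(Ω)}` for a broken function `v`. -/
def weightedNorm (m : Space (n + 1) → ℝ) (v : ι → Space (n + 1) → ℝ) : ℝ :=
  Real.sqrt (∑ T, ∫ x in M.elem T, (Real.sqrt (m x) * v T x) ^ 2)

end Mesh

end FOSPG

end

open FOSPG

noncomputable section

namespace FOSPG

/-! Write `m` for `𝒰'(ψ)`, `d = n + 1`, and let `(q, u, û, δ)` solve the discrete system. The
estimate rests on local facts on the elements and a single quadratic inequality; neither a global
Poincaré inequality nor a global inf-sup construction is needed.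

The flux controls the primal pair. Testing with a flux `r` alone gives `(A⁻¹ q, r) + ℬ_h(r, (u, û))
= 0`. Fluxes are discontinuous across facets, so `r` may live on one element. On the reference
element, a pair `(u, μ)` annihilated by all Raviart--Thomas fields satisfies `∇u = 0` and `u = μ` on
every facet (`bRef_kernel`, proved by explicit test fields on the simplex and on the cube). In
finite dimension this becomes a quantitative local inf-sup condition (`exists_energyRef_le`). The
Piola transform preserves `ℬ_h` up to the sign of the determinant (`Mesh.formB_eq`), and shape
regularity makes all Jacobians comparable to powers of `h_T` (`Mesh.IsScaled`), so the condition
transfers to every element with a constant that does not see the mesh. Hence `‖A^{1/2} ∇_h u‖` and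
the scaled `u - û` are bounded by `‖A^{-1/2} q‖` (`Mesh.exists_energy_le_flux`).

Energy identity. Testing the first equation with the solution itself and the second with `δ`, the
two `ℬ_h` terms cancel and `α ‖A^{-1/2} q‖² + ‖m^{1/2} δ‖² = (f, u) - (φ + χ, δ)`.

The multiplier in the dual norm. For `w ∈ H¹(𝒯_h)` let `v` be its elementwise `L²` projection, and
let `μ` be the trace of `v` from one side of each interior facet and `0` on the boundary. Poincaré,
trace and inverse inequalities show that the local energies of `(v, μ)` sum to at most a multiple of
`‖w‖²_DG` (`Mesh.exists_energy_projection_le`). As `δ` is piecewise polynomial, `(δ, w) = (δ, v) =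
(f, v) + α ℬ_h(q, (v, μ))`, so `‖δ‖_* ≤ C (‖f‖_* + α ‖A^{-1/2} q‖)` (`Mesh.exists_abs_ip_delta_le`).

Conclusion. A function `φ ∈ H^1_0(Ω)` has no jumps, hence `|(φ, δ)| ≤ C ‖δ‖_* ‖∇φ‖`. Also `|(f, u)|
≤ C ‖f‖_* ‖A^{-1/2} q‖` by the first point, and `|(χ, δ)| ≤ ‖m^{-1/2} χ‖ ‖m^{1/2} δ‖`. Inserted in
the energy identity these give a quadratic inequality for `‖A^{-1/2} q‖` and `‖m^{1/2} δ‖`, which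
`exists_le_of_quadratic` solves (`Mesh.exists_stability`).

Solvability. The system is square, so uniqueness suffices. With zero data the identity yields `q =
0` and `δ = 0`, the second equation yields `u = 0`, and the local inf-sup condition yields `û = 0`.
-/

/-- Evaluation of a polynomial at a point of Euclidean space. -/
def pe {d : ℕ} (q : MvPolynomial (Fin d) ℝ) (x : Space d) : ℝ :=
  MvPolynomial.eval (fun i => x i) q

/-! ### Norm comparison on finite-dimensional spaces -/

/-- The kernel condition lets `f` factor through the range of `g`, and a linear map on a
finite-dimensional normed space is bounded. All inverse inequalities and the local inf-sup condition
are instances of this. -/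
theorem exists_bound_of_ker_le {V H₁ H₂ : Type*} [AddCommGroup V] [Module ℝ V]
    [FiniteDimensional ℝ V] [NormedAddCommGroup H₁] [NormedSpace ℝ H₁] [NormedAddCommGroup H₂]
    [NormedSpace ℝ H₂] (f : V →ₗ[ℝ] H₁) (g : V →ₗ[ℝ] H₂) (h : ∀ x, g x = 0 → f x = 0) :
    ∃ C : ℝ, 0 < C ∧ ∀ x, ‖f x‖ ≤ C * ‖g x‖ := by
  have hk : LinearMap.ker g ≤ LinearMap.ker f := fun x hx => by
    simpa using h x (by simpa using hx)
  let ψ : LinearMap.range g →ₗ[ℝ] H₁ :=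
    ((LinearMap.ker g).liftQ f hk).comp g.quotKerEquivRange.symm.toLinearMap
  have hψ : ∀ x, ψ ⟨g x, x, rfl⟩ = f x := by
    intro x
    have : g.quotKerEquivRange.symm ⟨g x, x, rfl⟩ = (LinearMap.ker g).mkQ x := by
      rw [LinearEquiv.symm_apply_eq]; rfl
    simp [ψ, this]
  refine ⟨‖LinearMap.toContinuousLinearMap ψ‖ + 1, by positivity, fun x => ?_⟩
  have := (LinearMap.toContinuousLinearMap ψ).le_opNorm ⟨g x, x, rfl⟩
  have h2 : (LinearMap.toContinuousLinearMap ψ) ⟨g x, x, rfl⟩ = f x := hψ x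
  rw [h2] at this
  refine this.trans ?_
  have h3 : ‖(⟨g x, x, rfl⟩ : LinearMap.range g)‖ = ‖g x‖ := rfl
  rw [h3]
  nlinarith [norm_nonneg (g x)]

/-- A linear family of square integrable functions, as a linear map into `L²`. -/
def toL2 {V X E : Type*} [AddCommGroup V] [Module ℝ V] [MeasurableSpace X]
    [NormedAddCommGroup E] [InnerProductSpace ℝ E] (μ : Measure X) (ev : V →ₗ[ℝ] X → E)
    (h : ∀ v, MemLp (ev v) 2 μ) : V →ₗ[ℝ] Lp E 2 μ where
  toFun v := (h v).toLp
  map_add' v w := by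
    rw [← MemLp.toLp_add]; congr 1; simp
  map_smul' c v := by
    rw [RingHom.id_apply, ← MemLp.toLp_const_smul]; congr 1; simp

theorem norm_toL2_sq {V X E : Type*} [AddCommGroup V] [Module ℝ V] [MeasurableSpace X]
    [NormedAddCommGroup E] [InnerProductSpace ℝ E] (μ : Measure X) (ev : V →ₗ[ℝ] X → E)
    (h : ∀ v, MemLp (ev v) 2 μ) (v : V) : ‖toL2 μ ev h v‖ ^ 2 = ∫ x, ‖ev v x‖ ^ 2 ∂μ := by
  rw [← real_inner_self_eq_norm_sq, L2.inner_def]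
  refine integral_congr_ae ?_
  filter_upwards [(h v).coeFn_toLp] with x hx
  simp only [toL2, LinearMap.coe_mk, AddHom.coe_mk, hx, real_inner_self_eq_norm_sq]

/-- Comparison of two square integrals on a finite-dimensional space. -/
theorem exists_integral_sq_le {V X Y E F : Type*} [AddCommGroup V] [Module ℝ V]
    [FiniteDimensional ℝ V] [MeasurableSpace X] [MeasurableSpace Y]
    [NormedAddCommGroup E] [InnerProductSpace ℝ E] [NormedAddCommGroup F] [InnerProductSpace ℝ F]
    (μ : Measure X) (ν : Measure Y) (ev : V →ₗ[ℝ] X → E) (ev' : V →ₗ[ℝ] Y → F)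
    (h : ∀ v, MemLp (ev v) 2 μ) (h' : ∀ v, MemLp (ev' v) 2 ν)
    (hk : ∀ v, ∫ y, ‖ev' v y‖ ^ 2 ∂ν = 0 → v = 0) :
    ∃ C : ℝ, 0 < C ∧ ∀ v, ∫ x, ‖ev v x‖ ^ 2 ∂μ ≤ C * ∫ y, ‖ev' v y‖ ^ 2 ∂ν := by
  obtain ⟨C, hC, H⟩ := exists_bound_of_ker_le (toL2 μ ev h) (toL2 ν ev' h') (fun v hv => by
    have : v = 0 := hk v (by rw [← norm_toL2_sq ν ev' h', hv]; simp)
    rw [this, map_zero])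
  refine ⟨C ^ 2, by positivity, fun v => ?_⟩
  rw [← norm_toL2_sq μ ev h, ← norm_toL2_sq ν ev' h', ← mul_pow]
  exact pow_le_pow_left₀ (norm_nonneg _) (H v) 2

/-- Control of a square integral by finitely many linear functionals out of a family. -/
theorem exists_integral_sq_le_sum {V X E R : Type*} [AddCommGroup V] [Module ℝ V]
    [FiniteDimensional ℝ V] [MeasurableSpace X] [NormedAddCommGroup E] [InnerProductSpace ℝ E]
    [AddCommGroup R] [Module ℝ R] [FiniteDimensional ℝ R]
    (μ : Measure X) (ev : V →ₗ[ℝ] X → E) (h : ∀ v, MemLp (ev v) 2 μ) (b : R →ₗ[ℝ] V →ₗ[ℝ] ℝ)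
    (hk : ∀ v, (∀ r, b r v = 0) → ∫ x, ‖ev v x‖ ^ 2 ∂μ = 0) :
    ∃ C : ℝ, 0 < C ∧ ∀ v, ∫ x, ‖ev v x‖ ^ 2 ∂μ ≤
      C * ∑ j, b (Module.finBasis ℝ R j) v ^ 2 := by
  -- The values on a basis of `R` form one Euclidean vector; by linearity in `R` it vanishes only if
  -- every functional `b r` kills `v`.
  let g : V →ₗ[ℝ] EuclideanSpace ℝ (Fin (Module.finrank ℝ R)) :=
    (WithLp.linearEquiv 2 ℝ _).symm.toLinearMap.comp
      (LinearMap.pi fun j => b (Module.finBasis ℝ R j))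
  have hg : ∀ v, ‖g v‖ ^ 2 = ∑ j, b (Module.finBasis ℝ R j) v ^ 2 := by
    intro v
    rw [EuclideanSpace.norm_sq_eq]
    simp [g]
  obtain ⟨C, hC, H⟩ := exists_bound_of_ker_le (toL2 μ ev h) g (fun v hv => by
    have h0 : ∀ r, b r v = 0 := by
      have : b.flip v = 0 := by
        refine (Module.finBasis ℝ R).ext fun j => ?_
        have := congrArg (fun z => z j) hv
        simpa [g] using this
      intro r
      simpa using congrArg (fun l => l r) this
    have := hk v h0
    rw [← norm_toL2_sq μ ev h] at this
    simpa using this)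
  refine ⟨C ^ 2, by positivity, fun v => ?_⟩
  rw [← norm_toL2_sq μ ev h, ← hg, ← mul_pow]
  exact pow_le_pow_left₀ (norm_nonneg _) (H v) 2

/-! ### Polynomial functions -/

theorem pe_C {d : ℕ} (a : ℝ) : (pe (MvPolynomial.C a) : Space d → ℝ) = fun _ => a := by
  funext x; simp [pe]

theorem pe_add {d : ℕ} (p q : MvPolynomial (Fin d) ℝ) : pe (p + q) = pe p + pe q := by
  funext x; simp [pe]

theorem pe_mul_X {d : ℕ} (p : MvPolynomial (Fin d) ℝ) (i : Fin d) :
    pe (p * MvPolynomial.X i) = pe p * fun y : Space d => y i := by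
  funext x; simp [pe]

theorem hasFDerivAt_pe {d : ℕ} (q : MvPolynomial (Fin d) ℝ) (x : Space d) :
    HasFDerivAt (pe q)
      (∑ k, pe (MvPolynomial.pderiv k q) x • (EuclideanSpace.proj k : Space d →L[ℝ] ℝ)) x := by
  induction q using MvPolynomial.induction_on with
  | C a =>
    rw [pe_C]
    refine (hasFDerivAt_const a x).congr_fderiv ?_
    simp [pe]
  | add p q hp hq =>
    rw [pe_add]
    refine (hp.add hq).congr_fderiv ?_
    simp [pe, add_smul, Finset.sum_add_distrib]
  | mul_X p i hp =>
    have h1 : HasFDerivAt (fun y : Space d => y i) (EuclideanSpace.proj i : Space d →L[ℝ] ℝ) x :=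
      (EuclideanSpace.proj i : Space d →L[ℝ] ℝ).hasFDerivAt
    rw [pe_mul_X]
    refine (hp.mul h1).congr_fderiv ?_
    ext z
    simp only [pe, Derivation.leibniz, MvPolynomial.pderiv_X, smul_eq_mul, map_add, map_mul,
        MvPolynomial.eval_X, add_smul, Finset.sum_add_distrib, Finset.smul_sum, mul_smul]
    congr 2
    rw [Finset.sum_eq_single i]
    · simp
    · intro b _ hb; simp [hb]
    · simp

theorem contDiff_pe {d : ℕ} (q : MvPolynomial (Fin d) ℝ) : ContDiff ℝ ∞ (pe q) := by
  induction q using MvPolynomial.induction_on with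
  | C a => rw [pe_C]; exact contDiff_const
  | add p q hp hq => rw [pe_add]; exact hp.add hq
  | mul_X p i hp =>
    have h1 : ContDiff ℝ ∞ (fun y : Space d => y i) :=
      (EuclideanSpace.proj i : Space d →L[ℝ] ℝ).contDiff
    rw [pe_mul_X]; exact hp.mul h1

@[fun_prop]
theorem continuous_pe {d : ℕ} (q : MvPolynomial (Fin d) ℝ) : Continuous (pe q) :=
  (contDiff_pe q).continuous

theorem fderiv_pe {d : ℕ} (q : MvPolynomial (Fin d) ℝ) (x z : Space d) :
    fderiv ℝ (pe q) x z = ∑ k, pe (MvPolynomial.pderiv k q) x * z k := by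
  rw [(hasFDerivAt_pe q x).fderiv]
  simp

theorem gradient_pe {d : ℕ} (q : MvPolynomial (Fin d) ℝ) (x : Space d) (k : Fin d) :
    gradient (pe q) x k = pe (MvPolynomial.pderiv k q) x := by
  have h : inner ℝ (gradient (pe q) x) (EuclideanSpace.single k (1 : ℝ))
      = fderiv ℝ (pe q) x (EuclideanSpace.single k 1) := by
    rw [gradient, InnerProductSpace.toDual_symm_apply]
  rw [fderiv_pe, EuclideanSpace.inner_single_right] at h
  simpa [Pi.single_apply] using h

/-- A nonempty open set contains a product of intervals, and a polynomial vanishing on a product of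
infinite sets is zero. -/
theorem eq_zero_of_pe_eq_zero {d : ℕ} (q : MvPolynomial (Fin d) ℝ) (U : Set (Space d))
    (hU : (interior U).Nonempty) (h : ∀ x ∈ interior U, pe q x = 0) : q = 0 := by
  obtain ⟨x, hx⟩ := hU
  have h1 : IsOpen ((fun y : Fin d → ℝ => (WithLp.toLp 2 y : Space d)) ⁻¹' interior U) :=
    isOpen_interior.preimage (PiLp.continuous_toLp 2 _)
  obtain ⟨ε, hε, hb⟩ := Metric.isOpen_iff.1 h1 (fun i => x i) (by simpa using hx)
  refine MvPolynomial.funext_set (s := fun i => Metric.ball (x i) ε) (fun i => ?_) (fun y hy => ?_)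
  · rw [Real.ball_eq_Ioo]; exact Ioo_infinite (by linarith)
  · have hy' : y ∈ Metric.ball (fun i => x i) ε := by
      rw [ball_pi _ hε]; exact hy
    simpa [pe] using h _ (hb hy')

/-- A continuous function with vanishing square integral vanishes in the interior. -/
theorem eq_zero_of_integral_sq_eq_zero {d : ℕ} {E : Type*} [NormedAddCommGroup E]
    {f : Space d → E} (hf : Continuous f) {K : Set (Space d)}
    (hK : IsCompact K) (h : ∫ x in K, ‖f x‖ ^ 2 = 0) : ∀ x ∈ interior K, f x = 0 := by
  have hc : Continuous fun x => ‖f x‖ ^ 2 := by fun_prop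
  have hi : IntegrableOn (fun x => ‖f x‖ ^ 2) K := hc.continuousOn.integrableOn_compact hK
  have h1 := (setIntegral_eq_zero_iff_of_nonneg_ae (ae_of_all _ fun x => sq_nonneg _) hi).1 h
  have h2 : (fun x => ‖f x‖ ^ 2) =ᵐ[volume.restrict (interior K)] 0 :=
    ae_mono (Measure.restrict_mono interior_subset le_rfl) h1
  have h3 := Measure.eqOn_open_of_ae_eq h2 isOpen_interior hc.continuousOn continuousOn_const
  intro x hx
  simpa using h3 hx

theorem eq_zero_of_integral_pe_sq {d : ℕ} (q : MvPolynomial (Fin d) ℝ) {K : Set (Space d)}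
    (hK : IsCompact K) (hU : (interior K).Nonempty) (h : ∫ x in K, pe q x ^ 2 = 0) : q = 0 :=
  eq_zero_of_pe_eq_zero q K hU
    (eq_zero_of_integral_sq_eq_zero (continuous_pe q) hK (by simpa using h))

/-! ### Geometry of the reference elements -/

theorem refElem_subset_cube (s : Shape) (d : ℕ) : refElem s d ⊆ refElem .cube d := by
  intro x hx
  cases s with
  | cube => exact hx
  | simplex =>
    exact fun i => ⟨hx.1 i, (Finset.single_le_sum (fun j _ => hx.1 j) (Finset.mem_univ i)).trans hx.2⟩

theorem convex_refElem (s : Shape) (d : ℕ) : Convex ℝ (refElem s d) := by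
  intro x hx y hy a b ha hb hab
  cases s with
  | cube =>
    intro i
    have := hx i; have := hy i
    simp only [PiLp.add_apply, PiLp.smul_apply, smul_eq_mul]
    constructor <;> nlinarith
  | simplex =>
    refine ⟨fun i => ?_, ?_⟩
    · have := hx.1 i; have := hy.1 i
      simp only [PiLp.add_apply, PiLp.smul_apply, smul_eq_mul]
      positivity
    · have := hx.2; have := hy.2
      simp only [PiLp.add_apply, PiLp.smul_apply, smul_eq_mul, Finset.sum_add_distrib,
        ← Finset.mul_sum]
      nlinarith

theorem continuous_coord {d : ℕ} (i : Fin d) : Continuous fun x : Space d => x i :=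
  (EuclideanSpace.proj i : Space d →L[ℝ] ℝ).continuous

theorem isCompact_refElem (s : Shape) (d : ℕ) : IsCompact (refElem s d) := by
  have hcl : IsClosed (refElem s d) := by
    cases s with
    | cube =>
      have : refElem .cube d = ⋂ i, {x : Space d | 0 ≤ x i ∧ x i ≤ 1} := by
        ext x; simp [refElem]
      rw [this]
      exact isClosed_iInter fun i => (isClosed_le continuous_const (continuous_coord i)).inter
        (isClosed_le (continuous_coord i) continuous_const)
    | simplex =>
      have : refElem .simplex d = (⋂ i, {x : Space d | 0 ≤ x i}) ∩ {x | ∑ i, x i ≤ 1} := by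
        ext x; simp [refElem]
      rw [this]
      exact (isClosed_iInter fun i => isClosed_le continuous_const (continuous_coord i)).inter
        (isClosed_le (continuous_finsetSum _ fun i _ => continuous_coord i) continuous_const)
  have h1 : IsCompact ((WithLp.toLp 2 : (Fin d → ℝ) → Space d) '' (Set.pi univ fun _ => Icc 0 1)) :=
    (isCompact_univ_pi fun _ => isCompact_Icc).image (PiLp.continuous_toLp 2 _)
  refine h1.of_isClosed_subset hcl fun x hx => ⟨fun i => x i, ?_, rfl⟩
  intro i _
  exact refElem_subset_cube s d hx i

theorem measurableSet_refElem (s : Shape) (d : ℕ) : MeasurableSet (refElem s d) :=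
  (isCompact_refElem s d).isClosed.measurableSet

theorem interior_refElem_nonempty (s : Shape) (d : ℕ) : (interior (refElem s d)).Nonempty := by
  have hsub : {x : Space d | (∀ i, 0 < x i) ∧ ∑ i, x i < 1} ⊆ interior (refElem s d) := by
    refine interior_maximal (fun x hx => ?_) ?_
    · have : x ∈ refElem .simplex d := ⟨fun i => (hx.1 i).le, hx.2.le⟩
      cases s with
      | cube => exact refElem_subset_cube _ _ this
      | simplex => exact this
    · have : {x : Space d | (∀ i, 0 < x i) ∧ ∑ i, x i < 1}
          = (⋂ i, {x : Space d | 0 < x i}) ∩ {x | ∑ i, x i < 1} := by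
        ext x; simp
      rw [this]
      exact (isOpen_iInter_of_finite fun i => isOpen_lt continuous_const (continuous_coord i)).inter
        (isOpen_lt (continuous_finsetSum _ fun i _ => continuous_coord i) continuous_const)
  -- All coordinates equal to `1 / (d + 1)`: their sum `d / (d + 1)` stays below `1`, also for `d =
  -- 0`.
  refine ⟨_, hsub (?_ : WithLp.toLp 2 (fun _ => 1 / (d + 1 : ℝ)) ∈ _)⟩
  refine ⟨fun i => ?_, ?_⟩
  · simp only; positivity
  · simp only [Finset.sum_const, Finset.card_univ, Fintype.card_fin, nsmul_eq_mul]
    rw [mul_one_div, div_lt_one (by positivity)]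
    linarith

theorem zero_mem_refElem (s : Shape) (d : ℕ) : (0 : Space d) ∈ refElem s d := by
  cases s <;> simp [refElem]

theorem single_mem_refElem (s : Shape) (d : ℕ) (i : Fin d) :
    (EuclideanSpace.single i 1 : Space d) ∈ refElem s d := by
  have : (EuclideanSpace.single i 1 : Space d) ∈ refElem .simplex d := by
    refine ⟨fun j => ?_, ?_⟩
    · by_cases h : j = i <;> simp [h]
    · simp
  cases s with
  | cube => exact refElem_subset_cube _ _ this
  | simplex => exact this

theorem volume_refElem_ne_zero (s : Shape) (d : ℕ) : volume (refElem s d) ≠ 0 :=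
  ((isOpen_interior.measure_pos _ (interior_refElem_nonempty s d)).trans_le
    (measure_mono interior_subset)).ne'

theorem volume_refElem_ne_top (s : Shape) (d : ℕ) : volume (refElem s d) ≠ ⊤ :=
  (isCompact_refElem s d).measure_lt_top.ne

/-! ### Facets of the reference elements -/

/-- Labels for the facets of the reference element of dimension `n + 1`. -/
def FIdx : Shape → ℕ → Type
  | .simplex, n => Option (Fin (n + 1))
  | .cube, n => Fin (n + 1) × Bool

instance (s : Shape) (n : ℕ) : Fintype (FIdx s n) :=
  match s with
  | .simplex => inferInstanceAs (Fintype (Option (Fin (n + 1))))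
  | .cube => inferInstanceAs (Fintype (Fin (n + 1) × Bool))

/-- The facet `F` is the graph `x_i = c + m ∑_{j ≠ i} x_j` over the reference facet, with
`i = F.dir`, `c = F.cst` and `m = F.slope`. -/
def FIdx.dir : {s : Shape} → {n : ℕ} → FIdx s n → Fin (n + 1)
  | .simplex, _, some i => i
  | .simplex, _, none => 0
  | .cube, _, F => F.1

/-- See `FIdx.dir`. -/
def FIdx.cst : {s : Shape} → {n : ℕ} → FIdx s n → ℝ
  | .simplex, _, some _ => 0
  | .simplex, _, none => 1
  | .cube, _, F => if F.2 then 1 else 0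

/-- See `FIdx.dir`. -/
def FIdx.slope : {s : Shape} → {n : ℕ} → FIdx s n → ℝ
  | .simplex, _, some _ => 0
  | .simplex, _, none => -1
  | .cube, _, _ => 0

/-- The sign of the outward direction on the facet `F`, in the coordinate `F.dir`. -/
def FIdx.orient : {s : Shape} → {n : ℕ} → FIdx s n → ℝ
  | .simplex, _, some _ => -1
  | .simplex, _, none => 1
  | .cube, _, F => if F.2 then 1 else -1

/-- Insertion of a coordinate. -/
def ins {n : ℕ} (i : Fin (n + 1)) (t : ℝ) (y : Space n) : Space (n + 1) :=
  WithLp.toLp 2 (i.insertNth (α := fun _ => ℝ) t (fun j => y j))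

/-- Omission of a coordinate. -/
def drop {n : ℕ} (i : Fin (n + 1)) (x : Space (n + 1)) : Space n :=
  WithLp.toLp 2 fun j => x (i.succAbove j)

section ins
variable {n : ℕ} (i : Fin (n + 1))

@[simp] theorem ins_same (t : ℝ) (y : Space n) : ins i t y i = t := by simp [ins]

@[simp] theorem ins_succAbove (t : ℝ) (y : Space n) (j : Fin n) :
    ins i t y (i.succAbove j) = y j := by simp [ins]

@[simp] theorem drop_apply (x : Space (n + 1)) (j : Fin n) : drop i x j = x (i.succAbove j) := rfl

@[simp] theorem drop_ins (t : ℝ) (y : Space n) : drop i (ins i t y) = y := by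
  ext j; simp

@[simp] theorem ins_drop (x : Space (n + 1)) : ins i (x i) (drop i x) = x := by
  ext k
  rcases Fin.eq_self_or_eq_succAbove i k with rfl | ⟨j, rfl⟩ <;> simp

theorem sum_ins (t : ℝ) (y : Space n) : ∑ k, ins i t y k = t + ∑ j, y j := by
  rw [Fin.sum_univ_succAbove _ i]; simp

theorem ins_add (t u : ℝ) (y z : Space n) : ins i (t + u) (y + z) = ins i t y + ins i u z := by
  ext k
  rcases Fin.eq_self_or_eq_succAbove i k with rfl | ⟨j, rfl⟩ <;> simp

theorem ins_smul (c t : ℝ) (y : Space n) : ins i (c * t) (c • y) = c • ins i t y := by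
  ext k
  rcases Fin.eq_self_or_eq_succAbove i k with rfl | ⟨j, rfl⟩ <;> simp

theorem contDiff_ins {k : ℕ∞ω} {X : Type*} [NormedAddCommGroup X] [NormedSpace ℝ X]
    {f : X → ℝ} {g : X → Space n} (hf : ContDiff ℝ k f) (hg : ContDiff ℝ k g) :
    ContDiff ℝ k fun x => ins i (f x) (g x) := by
  rw [contDiff_euclidean]
  intro l
  rcases Fin.eq_self_or_eq_succAbove i l with rfl | ⟨j, rfl⟩
  · simpa using hf
  · simpa using (contDiff_euclidean.1 hg j)

theorem continuous_ins : Continuous fun q : ℝ × Space n => ins i q.1 q.2 :=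
  (contDiff_ins (k := 0) i contDiff_fst contDiff_snd).continuous

theorem ins_mem_simplex (t : ℝ) (y : Space n) :
    ins i t y ∈ refElem .simplex (n + 1) ↔ 0 ≤ t ∧ (∀ j, 0 ≤ y j) ∧ t + ∑ j, y j ≤ 1 := by
  simp only [refElem, mem_ofPred_eq, sum_ins, i.forall_iff_succAbove, ins_same, ins_succAbove,
    and_assoc]

theorem ins_mem_cube (t : ℝ) (y : Space n) :
    ins i t y ∈ refElem .cube (n + 1) ↔ (0 ≤ t ∧ t ≤ 1) ∧ y ∈ refElem .cube n := by
  simp only [refElem, mem_ofPred_eq, i.forall_iff_succAbove, ins_same, ins_succAbove]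

/-- Insertion of a coordinate, as a measurable equivalence. -/
def insEquiv : ℝ × Space n ≃ᵐ Space (n + 1) :=
  ((MeasurableEquiv.refl ℝ).prodCongr (MeasurableEquiv.toLp 2 (Fin n → ℝ)).symm).trans
    ((MeasurableEquiv.piFinSuccAbove (fun _ => ℝ) i).symm.trans
      (MeasurableEquiv.toLp 2 (Fin (n + 1) → ℝ)))

theorem insEquiv_apply (q : ℝ × Space n) : insEquiv i q = ins i q.1 q.2 := rfl

theorem measurePreserving_insEquiv :
    MeasurePreserving (insEquiv i) ((volume : Measure ℝ).prod (volume : Measure (Space n)))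
      volume := by
  have h1 := (MeasurePreserving.id (volume : Measure ℝ)).prod
    (EuclideanSpace.volume_preserving_symm_measurableEquiv_toLp (Fin n))
  have h2 := (volume_preserving_piFinSuccAbove (fun _ : Fin (n + 1) => ℝ) i).symm
  have h3 := (EuclideanSpace.volume_preserving_symm_measurableEquiv_toLp (Fin (n + 1))).symm
  exact h3.comp (h2.comp h1)

theorem lintegral_ins (f : Space (n + 1) → ℝ≥0∞) (hf : Measurable f) :
    ∫⁻ x, f x = ∫⁻ y : Space n, ∫⁻ t : ℝ, f (ins i t y) := by
  rw [(measurePreserving_insEquiv i).lintegral_map_equiv f,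
    lintegral_prod_symm' (fun q => f (insEquiv i q)) (hf.comp (insEquiv i).measurable)]
  rfl

end ins

/-- The parametrization of the facet `F` over the reference facet. -/
def facetMap {s : Shape} {n : ℕ} (F : FIdx s n) (y : Space n) : Space (n + 1) :=
  ins F.dir (F.cst + F.slope * ∑ j, y j) y

/-- The linear part of `facetMap F`. -/
def facetLin {s : Shape} {n : ℕ} (F : FIdx s n) : Space n →ₗ[ℝ] Space (n + 1) where
  toFun y := ins F.dir (F.slope * ∑ j, y j) y
  map_add' y z := by
    rw [← ins_add]; simp [Finset.sum_add_distrib, mul_add]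
  map_smul' c y := by
    simp only [RingHom.id_apply]
    rw [← ins_smul]; simp [Finset.mul_sum, mul_left_comm]

theorem facetMap_add {s : Shape} {n : ℕ} (F : FIdx s n) (y z : Space n) :
    facetMap F (y + z) = facetMap F y + facetLin F z := by
  simp only [facetMap, facetLin, LinearMap.coe_mk, AddHom.coe_mk, ← ins_add]
  congr 1
  simp [Finset.sum_add_distrib]; ring

theorem contDiff_facetMap {s : Shape} {n : ℕ} (F : FIdx s n) : ContDiff ℝ ∞ (facetMap F) := by
  refine contDiff_ins _ ?_ contDiff_id
  refine contDiff_const.add (contDiff_const.mul (ContDiff.sum fun j _ => ?_))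
  exact (EuclideanSpace.proj j : Space n →L[ℝ] ℝ).contDiff

theorem facetMap_mem {s : Shape} {n : ℕ} (F : FIdx s n) {y : Space n} (hy : y ∈ refElem s n) :
    facetMap F y ∈ refElem s (n + 1) := by
  match s, F with
  | .simplex, some i =>
    refine (ins_mem_simplex _ _ _).2 ⟨by simp [FIdx.cst, FIdx.slope], hy.1, ?_⟩
    simpa [FIdx.cst, FIdx.slope] using hy.2
  | .simplex, none =>
    have := hy.2
    refine (ins_mem_simplex _ _ _).2 ⟨?_, hy.1, ?_⟩ <;> simp only [FIdx.cst, FIdx.slope] <;>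
      linarith
  | .cube, (i, b) =>
    refine (ins_mem_cube _ _ _).2 ⟨?_, hy⟩
    cases b <;> simp [FIdx.cst, FIdx.slope]

theorem mem_image_facetMap {s : Shape} {n : ℕ} (F : FIdx s n) (x : Space (n + 1)) :
    x ∈ facetMap F '' refElem s n ↔
      x ∈ refElem s (n + 1) ∧ x F.dir = F.cst + F.slope * ∑ j, x (F.dir.succAbove j) := by
  constructor
  · rintro ⟨y, hy, rfl⟩
    exact ⟨facetMap_mem F hy, by simp [facetMap]⟩
  · rintro ⟨hx, h⟩
    refine ⟨drop F.dir x, ?_, ?_⟩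
    · match s, F with
      | .simplex, some i =>
        rw [← ins_drop i x, ins_mem_simplex] at hx
        have h2 : ∑ j, drop i x j ≤ 1 := by linarith [hx.1, hx.2.2]
        exact ⟨hx.2.1, h2⟩
      | .simplex, none =>
        rw [← ins_drop 0 x, ins_mem_simplex] at hx
        have h2 : ∑ j, drop 0 x j ≤ 1 := by linarith [hx.1, hx.2.2]
        exact ⟨hx.2.1, h2⟩
      | .cube, (i, b) =>
        rw [← ins_drop i x, ins_mem_cube] at hx
        exact hx.2
    · rw [facetMap]
      simp only [drop_apply, ← h, ins_drop]

theorem mem_refFacets_iff {s : Shape} {n : ℕ} (S : Set (Space (n + 1))) :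
    S ∈ refFacets s (n + 1) ↔ ∃ F : FIdx s n, S = facetMap F '' refElem s n := by
  have key : ∀ F : FIdx s n, facetMap F '' refElem s n = {x ∈ refElem s (n + 1) |
      x F.dir = F.cst + F.slope * ∑ j, x (F.dir.succAbove j)} := fun F =>
    Set.ext fun x => mem_image_facetMap F x
  simp only [key]
  match s with
  | .simplex =>
    -- The slanted facet is solved for the coordinate `0`, the direction assigned to `none`.
    have h0 : {x : Space (n + 1) | x ∈ refElem .simplex (n + 1) ∧ ∑ i, x i = 1} =
        {x | x ∈ refElem .simplex (n + 1) ∧ x 0 = 1 + -1 * ∑ j, x (Fin.succAbove 0 j)} := by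
      ext x
      simp only [mem_ofPred_eq, Fin.sum_univ_succAbove (fun k => x k) 0]
      refine and_congr_right fun _ => ⟨fun h => by linarith, fun h => by linarith⟩
    constructor
    · rintro (⟨i, rfl⟩ | rfl)
      · exact ⟨some i, by simp [FIdx.dir, FIdx.cst, FIdx.slope]⟩
      · exact ⟨none, h0⟩
    · rintro ⟨F | i, rfl⟩
      · exact Or.inr h0.symm
      · exact Or.inl ⟨i, by simp [FIdx.dir, FIdx.cst, FIdx.slope]⟩
  | .cube =>
    constructor
    · rintro ⟨i, rfl | rfl⟩
      · exact ⟨(i, false), by simp [FIdx.dir, FIdx.cst, FIdx.slope]⟩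
      · exact ⟨(i, true), by simp [FIdx.dir, FIdx.cst, FIdx.slope]⟩
    · rintro ⟨⟨i, b⟩, rfl⟩
      refine ⟨i, ?_⟩
      cases b
      · exact Or.inl (by simp [FIdx.dir, FIdx.cst, FIdx.slope])
      · exact Or.inr (by simp [FIdx.dir, FIdx.cst, FIdx.slope])

/-- Two different facets are told apart by testing their equations at the vertices `0` and `e_i` of
the reference element. -/
theorem image_facetMap_injective {s : Shape} {n : ℕ} :
    Function.Injective fun F : FIdx s n => facetMap F '' refElem s n := by
  intro F F' h
  have h' : ∀ x : Space (n + 1), x ∈ refElem s (n + 1) →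
      (x F.dir = F.cst + F.slope * ∑ j, x (F.dir.succAbove j) ↔
        x F'.dir = F'.cst + F'.slope * ∑ j, x (F'.dir.succAbove j)) := by
    intro x hx
    have := Set.ext_iff.1 h x
    simp only [mem_image_facetMap] at this
    simpa [hx] using this
  match s, F, F' with
  | .simplex, none, none => rfl
  | .simplex, some i, none =>
    have := h' 0 (zero_mem_refElem _ _)
    simp [FIdx.cst, FIdx.slope] at this
  | .simplex, none, some i =>
    have := h' 0 (zero_mem_refElem _ _)
    simp [FIdx.cst, FIdx.slope] at this
  | .simplex, some i, some j =>
    have := h' (EuclideanSpace.single j 1) (single_mem_refElem _ _ _)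
    simp only [FIdx.cst, FIdx.slope, FIdx.dir, zero_mul, add_zero] at this
    by_contra hne
    have hij : i ≠ j := fun e => hne (by rw [e])
    simp [hij] at this
  | .cube, (i, b), (j, b') =>
    have hz := h' 0 (zero_mem_refElem _ _)
    have hi := h' (EuclideanSpace.single i 1) (single_mem_refElem _ _ _)
    have hj := h' (EuclideanSpace.single j 1) (single_mem_refElem _ _ _)
    simp only [FIdx.cst, FIdx.slope, FIdx.dir, zero_mul, add_zero] at hz hi hj
    by_cases hij : i = j
    · subst hij
      cases b <;> cases b' <;> first | rfl | simp_all
    · cases b <;> cases b' <;> simp_all [Ne.symm hij]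

/-! ### Poincaré and trace inequalities for smooth functions on the reference elements -/

theorem ofReal_integral_Icc {f : ℝ → ℝ} (hf : Continuous f) (h0 : ∀ t ∈ Icc (0 : ℝ) 1, 0 ≤ f t) :
    ENNReal.ofReal (∫ t in (0 : ℝ)..1, f t) = ∫⁻ t in Icc (0 : ℝ) 1, ENNReal.ofReal (f t) := by
  rw [intervalIntegral.integral_of_le zero_le_one, ← integral_Icc_eq_integral_Ioc,
    ofReal_integral_eq_lintegral_ofReal (hf.continuousOn.integrableOn_compact isCompact_Icc)]
  exact (ae_restrict_iff' measurableSet_Icc).2 (ae_of_all _ h0)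

/-- Cauchy--Schwarz on the unit interval, read off from the nonnegativity of the variance of `ψ`
about its mean `φ 1 - φ 0`. -/
theorem ofReal_sub_sq_le {φ ψ : ℝ → ℝ} (h : ∀ t, HasDerivAt φ (ψ t) t) (hψ : Continuous ψ) :
    ENNReal.ofReal ((φ 1 - φ 0) ^ 2) ≤ ∫⁻ t in Icc (0 : ℝ) 1, ENNReal.ofReal (ψ t ^ 2) := by
  have h1 : ∫ t in (0 : ℝ)..1, ψ t = φ 1 - φ 0 :=
    intervalIntegral.integral_eq_sub_of_hasDerivAt (fun t _ => h t) (hψ.intervalIntegrable _ _)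
  rw [← ofReal_integral_Icc (by fun_prop) (fun t _ => sq_nonneg _)]
  refine ENNReal.ofReal_le_ofReal ?_
  set m := φ 1 - φ 0
  have h2 : 0 ≤ ∫ t in (0 : ℝ)..1, (ψ t - m) ^ 2 :=
    intervalIntegral.integral_nonneg zero_le_one fun t _ => sq_nonneg _
  have h3 : ∫ t in (0 : ℝ)..1, (ψ t - m) ^ 2 =
      (∫ t in (0 : ℝ)..1, ψ t ^ 2) - (∫ t in (0 : ℝ)..1, 2 * m * ψ t) +
        ∫ t in (0 : ℝ)..1, m ^ 2 := by
    rw [← intervalIntegral.integral_sub (Continuous.intervalIntegrable (by fun_prop) _ _)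
      (Continuous.intervalIntegrable (by fun_prop) _ _), ← intervalIntegral.integral_add
      (Continuous.intervalIntegrable (by fun_prop) _ _)
      (Continuous.intervalIntegrable (by fun_prop) _ _)]
    congr 1; funext t; ring
  rw [intervalIntegral.integral_const_mul, h1] at h3
  simp only [intervalIntegral.integral_const, sub_zero, smul_eq_mul, one_mul] at h3
  nlinarith

/-- The fundamental theorem of calculus with `φ 1 = 0`. It serves the trace inequality, where a
cut-off factor makes `φ` vanish at the far end of the curve. -/
theorem ofReal_le_lintegral_of_neg_deriv_le {φ ψ M : ℝ → ℝ} (h : ∀ t, HasDerivAt φ (ψ t) t)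
    (hψ : Continuous ψ) (hM : Continuous M) (h1 : φ 1 = 0)
    (h0 : ∀ t ∈ Icc (0 : ℝ) 1, 0 ≤ M t) (hle : ∀ t ∈ Icc (0 : ℝ) 1, -ψ t ≤ M t) :
    ENNReal.ofReal (φ 0) ≤ ∫⁻ t in Icc (0 : ℝ) 1, ENNReal.ofReal (M t) := by
  have h2 : ∫ t in (0 : ℝ)..1, ψ t = φ 1 - φ 0 :=
    intervalIntegral.integral_eq_sub_of_hasDerivAt (fun t _ => h t) (hψ.intervalIntegrable _ _)
  rw [← ofReal_integral_Icc hM h0]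
  refine ENNReal.ofReal_le_ofReal ?_
  have h3 : φ 0 = ∫ t in (0 : ℝ)..1, -ψ t := by
    rw [intervalIntegral.integral_neg, h2, h1]; ring
  rw [h3]
  exact intervalIntegral.integral_mono_on zero_le_one (hψ.neg.intervalIntegrable _ _)
    (hM.intervalIntegrable _ _) hle

theorem lintegral_comp_smul_space {d : ℕ} (f : Space d → ℝ≥0∞) (hf : Measurable f) {r : ℝ}
    (hr : 0 < r) : ENNReal.ofReal (r ^ d) * ∫⁻ x, f (r • x) = ∫⁻ x, f x := by
  have h1 : ∫⁻ x, f (r • x) = ∫⁻ x, f x ∂(Measure.map (r • ·) volume) :=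
    (lintegral_map hf (measurable_const_smul r)).symm
  rw [h1, Measure.map_addHaar_smul _ hr.ne', lintegral_smul_measure, smul_eq_mul, ← mul_assoc,
    ← ENNReal.ofReal_mul (by positivity)]
  have : r ^ d * |(r ^ Module.finrank ℝ (Space d))⁻¹| = 1 := by
    rw [finrank_euclideanSpace_fin, abs_of_pos (by positivity), mul_inv_cancel₀ (by positivity)]
  rw [this]; simp

/-- The contraction towards `c` maps the convex set `K` into itself and has Jacobian `t ^ d ≥ 2 ^
(-d)`. -/
theorem lintegral_convex_comb_le {d : ℕ} {K : Set (Space d)} (hK : Convex ℝ K)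
    (hKm : MeasurableSet K) {G : Space d → ℝ≥0∞} (hG : Measurable G) {c : Space d} (hc : c ∈ K)
    {t : ℝ} (ht : 1 / 2 ≤ t) (ht1 : t ≤ 1) :
    ∫⁻ x in K, G (t • x + (1 - t) • c) ≤ 2 ^ d * ∫⁻ x in K, G x := by
  have htp : 0 < t := by linarith
  have hm : Measurable (K.indicator G) := hG.indicator hKm
  have h1 : ∫⁻ x in K, G (t • x + (1 - t) • c) ≤
      ∫⁻ x, K.indicator G (t • x + (1 - t) • c) := by
    rw [← lintegral_indicator hKm]
    refine lintegral_mono fun x => ?_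
    by_cases hx : x ∈ K
    · have : t • x + (1 - t) • c ∈ K := hK hx hc htp.le (by linarith) (by ring)
      simp [hx, this]
    · simp [hx]
  refine h1.trans ?_
  have h2 := lintegral_comp_smul_space (fun x => K.indicator G (x + (1 - t) • c))
    (hm.comp (measurable_add_const _)) htp
  rw [lintegral_add_right_eq_self (fun x => K.indicator G x), lintegral_indicator hKm] at h2
  rw [← h2, ← mul_assoc]
  refine le_mul_of_one_le_left (by positivity) ?_
  have : (2 : ℝ≥0∞) ^ d = ENNReal.ofReal (2 ^ d) := by
    rw [ENNReal.ofReal_pow (by norm_num)]; simp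
  rw [this, ← ENNReal.ofReal_mul (by positivity), ← mul_pow]
  refine ENNReal.one_le_ofReal.2 (one_le_pow₀ (by linarith))

theorem fderiv_apply_sq_le {d : ℕ} (a : Space d → ℝ) (x z : Space d) :
    (fderiv ℝ a x z) ^ 2 ≤ ‖gradient a x‖ ^ 2 * ‖z‖ ^ 2 := by
  have h1 : ‖gradient a x‖ = ‖fderiv ℝ a x‖ := by simp [gradient]
  have := (fderiv ℝ a x).le_opNorm z
  rw [h1, ← mul_pow, ← sq_abs]
  exact pow_le_pow_left₀ (abs_nonneg _) this 2

theorem continuous_gradient {d : ℕ} {a : Space d → ℝ} (ha : ContDiff ℝ ∞ a) :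
    Continuous (gradient a) := by
  unfold gradient
  exact (LinearIsometryEquiv.continuous _).comp (ha.continuous_fderiv (by simp))

/-- Poincaré inequality on a compact convex set: integrate `|a x - a y|²` over `K × K`, bound it by
the gradient along the segment from `y` to `x`, and choose for the constant a value `a y` that is no
worse than the average. -/
theorem exists_sub_const_sq_le {d : ℕ} {K : Set (Space d)} (hK : Convex ℝ K) (hKc : IsCompact K)
    (hK0 : volume K ≠ 0) : ∃ C : ℝ, 0 < C ∧ ∀ a : Space d → ℝ, ContDiff ℝ ∞ a →
      ∃ c, ∫ x in K, (a x - c) ^ 2 ≤ C * ∫ x in K, ‖gradient a x‖ ^ 2 := by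
  obtain ⟨D, hD, hDK⟩ : ∃ D : ℝ, 0 < D ∧ ∀ x ∈ K, ∀ y ∈ K, ‖x - y‖ ^ 2 ≤ D := by
    obtain ⟨R, hR⟩ := hKc.isBounded.exists_norm_le
    refine ⟨(2 * |R|) ^ 2 + 1, by positivity, fun x hx y hy => ?_⟩
    have : ‖x - y‖ ≤ 2 * |R| := by
      have := norm_sub_le x y; have := hR x hx; have := hR y hy; have := le_abs_self R; linarith
    nlinarith [norm_nonneg (x - y)]
  have hKm := hKc.isClosed.measurableSet
  have hKt : volume K ≠ ⊤ := hKc.measure_lt_top.ne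
  refine ⟨2 ^ d * D, by positivity, fun a ha => ?_⟩
  have hgc := continuous_gradient ha
  have hac := ha.continuous
  let G : Space d → ℝ≥0∞ := fun x => ENNReal.ofReal (‖gradient a x‖ ^ 2)
  have hGc : Continuous G := ENNReal.continuous_ofReal.comp (by fun_prop)
  have hG : Measurable G := hGc.measurable
  -- pointwise bound along segments
  have hpt : ∀ x ∈ K, ∀ y ∈ K, ENNReal.ofReal ((a x - a y) ^ 2) ≤
      ENNReal.ofReal D * ∫⁻ t in Icc (0 : ℝ) 1, G (t • x + (1 - t) • y) := by
    intro x hx y hy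
    have hline : ∀ t : ℝ, HasDerivAt (fun t : ℝ => t • x + (1 - t) • y) (x - y) t := by
      intro t
      have h1 := (hasDerivAt_id t).smul_const x
      have h2 := ((hasDerivAt_id t).const_sub 1).smul_const y
      convert! h1.add h2 using 1
      simp [sub_eq_add_neg]
    have hd : ∀ t : ℝ, HasDerivAt (fun t : ℝ => a (t • x + (1 - t) • y))
        (fderiv ℝ a (t • x + (1 - t) • y) (x - y)) t := fun t =>
      ((ha.differentiable (by simp)) _).hasFDerivAt.comp_hasDerivAt t (hline t)
    have hcont : Continuous fun t : ℝ => fderiv ℝ a (t • x + (1 - t) • y) (x - y) := by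
      have := ha.continuous_fderiv (by simp)
      fun_prop
    have := ofReal_sub_sq_le hd hcont
    simp only [one_smul, sub_self, zero_smul, add_zero, sub_zero, zero_add] at this
    refine this.trans ?_
    rw [← lintegral_const_mul _ (by fun_prop)]
    refine lintegral_mono fun t => ?_
    simp only [G]
    rw [← ENNReal.ofReal_mul hD.le]
    refine ENNReal.ofReal_le_ofReal ((fderiv_apply_sq_le _ _ _).trans ?_)
    rw [mul_comm]
    exact mul_le_mul_of_nonneg_right (hDK x hx y hy) (sq_nonneg _)
  -- The point `t x + (1 - t) y` is substituted for `x` if `t ≥ 1/2` and for `y` if `t ≤ 1/2`, so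
  -- that the Jacobian never drops below `2 ^ (-d)`.
  have hslice : ∀ t ∈ Icc (0 : ℝ) 1, ∫⁻ y in K, ∫⁻ x in K, G (t • x + (1 - t) • y) ≤
      volume K * (2 ^ d * ∫⁻ x in K, G x) := by
    intro t ht
    have hbound : ∀ f : Space d → ℝ≥0∞, (∀ y ∈ K, f y ≤ 2 ^ d * ∫⁻ x in K, G x) →
        ∫⁻ y in K, f y ≤ volume K * (2 ^ d * ∫⁻ x in K, G x) := by
      intro f hf
      refine (setLIntegral_mono' hKm hf).trans ?_
      rw [setLIntegral_const, mul_comm]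
    rcases le_total (1 / 2) t with h | h
    · exact hbound _ fun y hy => lintegral_convex_comb_le hK hKm hG hy h ht.2
    · rw [lintegral_lintegral_swap (by
        refine Measurable.aemeasurable ?_
        exact (hGc.comp (by fun_prop)).measurable)]
      refine hbound _ fun x hx => ?_
      have := lintegral_convex_comb_le hK hKm hG hx (t := 1 - t) (by linarith) (by linarith [ht.1])
      simpa [add_comm] using this
  have hdouble : ∫⁻ y in K, ∫⁻ x in K, ENNReal.ofReal ((a x - a y) ^ 2) ≤
      ENNReal.ofReal D * (volume K * (2 ^ d * ∫⁻ x in K, G x)) := by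
    have hm3 : Measurable fun q : (Space d × Space d) × ℝ => G (q.2 • q.1.2 + (1 - q.2) • q.1.1) :=
      (hGc.comp (by fun_prop)).measurable
    calc ∫⁻ y in K, ∫⁻ x in K, ENNReal.ofReal ((a x - a y) ^ 2)
        ≤ ∫⁻ y in K, ∫⁻ x in K, ENNReal.ofReal D *
            ∫⁻ t in Icc (0 : ℝ) 1, G (t • x + (1 - t) • y) :=
          setLIntegral_mono' hKm fun y hy => setLIntegral_mono' hKm fun x hx => hpt x hx y hy
      _ = ENNReal.ofReal D * ∫⁻ y in K, ∫⁻ x in K,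
            ∫⁻ t in Icc (0 : ℝ) 1, G (t • x + (1 - t) • y) := by
          simp_rw [lintegral_const_mul' _ _ ENNReal.ofReal_ne_top]
      _ = ENNReal.ofReal D * ∫⁻ t in Icc (0 : ℝ) 1, ∫⁻ y in K, ∫⁻ x in K,
            G (t • x + (1 - t) • y) := by
          congr 1
          have : ∀ y, ∫⁻ x in K, ∫⁻ t in Icc (0 : ℝ) 1, G (t • x + (1 - t) • y) =
              ∫⁻ t in Icc (0 : ℝ) 1, ∫⁻ x in K, G (t • x + (1 - t) • y) := fun y =>
            lintegral_lintegral_swap ((hGc.comp (by fun_prop)).measurable.aemeasurable)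
          simp_rw [this]
          refine lintegral_lintegral_swap (Measurable.aemeasurable ?_)
          exact Measurable.lintegral_prod_right' (f := fun q : (Space d × ℝ) × Space d =>
            G (q.1.2 • q.2 + (1 - q.1.2) • q.1.1)) ((hGc.comp (by fun_prop)).measurable)
      _ ≤ ENNReal.ofReal D * ∫⁻ _ in Icc (0 : ℝ) 1, volume K * (2 ^ d * ∫⁻ x in K, G x) := by
          exact mul_le_mul' le_rfl (setLIntegral_mono' measurableSet_Icc hslice)
      _ = _ := by simp
  -- Some `y ∈ K` has an inner integral at most equal to the average of the double integral; the
  -- factor `volume K` in `hdouble` then cancels.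
  obtain ⟨y, hy, hav⟩ := exists_le_setLAverage hK0 hKt
    (f := fun y => ∫⁻ x in K, ENNReal.ofReal ((a x - a y) ^ 2)) (by
      refine Measurable.aemeasurable ?_
      exact Measurable.lintegral_prod_right' (f := fun q : Space d × Space d =>
        ENNReal.ofReal ((a q.2 - a q.1) ^ 2))
        ((ENNReal.continuous_ofReal.comp (by fun_prop)).measurable))
  refine ⟨a y, ?_⟩
  rw [setLAverage_eq] at hav
  have hav2 : ∫⁻ x in K, ENNReal.ofReal ((a x - a y) ^ 2) ≤
      ENNReal.ofReal (2 ^ d * D) * ∫⁻ x in K, G x := by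
    refine hav.trans (ENNReal.div_le_of_le_mul ?_)
    refine hdouble.trans (le_of_eq ?_)
    rw [ENNReal.ofReal_mul (by positivity), ENNReal.ofReal_pow (by norm_num)]
    simp only [ENNReal.ofReal_ofNat]
    ring
  have hi : Integrable (fun x => ‖gradient a x‖ ^ 2) (volume.restrict K) :=
    (Continuous.continuousOn (by fun_prop)).integrableOn_compact hKc
  have hi2 : Integrable (fun x => (a x - a y) ^ 2) (volume.restrict K) :=
    (Continuous.continuousOn (by fun_prop)).integrableOn_compact hKc
  rw [← ofReal_integral_eq_lintegral_ofReal hi2 (ae_of_all _ fun x => sq_nonneg _),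
    ← ofReal_integral_eq_lintegral_ofReal hi (ae_of_all _ fun x => sq_nonneg _),
    ← ENNReal.ofReal_mul (by positivity)] at hav2
  exact (ENNReal.ofReal_le_ofReal_iff (mul_nonneg (by positivity)
    (integral_nonneg fun x => sq_nonneg _))).1 hav2

theorem FIdx.orient_eq {s : Shape} {n : ℕ} (F : FIdx s n) : F.orient = 1 ∨ F.orient = -1 := by
  match s, F with
  | .simplex, some _ => exact Or.inr rfl
  | .simplex, none => exact Or.inl rfl
  | .cube, (_, b) => cases b <;> simp [FIdx.orient]

/-- The reference element is swept out by shrunk copies of the facet `F`; the shrinking rate is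
`1` on the simplex and `0` on the cube. -/
def shrinkRate : Shape → ℝ
  | .simplex => 1
  | .cube => 0

theorem shrinkRate_eq (s : Shape) : shrinkRate s = 1 ∨ shrinkRate s = 0 := by
  cases s <;> simp [shrinkRate]

/-- The sweeping curve through `y`. -/
def sweep {s : Shape} {n : ℕ} (F : FIdx s n) (y : Space n) (t : ℝ) : Space (n + 1) :=
  facetMap F y - (F.orient * t) • EuclideanSpace.single F.dir 1

theorem sweep_eq_ins {s : Shape} {n : ℕ} (F : FIdx s n) (y : Space n) (t : ℝ) :
    sweep F y t = ins F.dir (F.cst + F.slope * ∑ j, y j - F.orient * t) y := by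
  ext k
  rcases Fin.eq_self_or_eq_succAbove F.dir k with rfl | ⟨j, rfl⟩ <;>
    simp [sweep, facetMap]

theorem sweep_mem {s : Shape} {n : ℕ} (F : FIdx s n) {y : Space n} (hy : y ∈ refElem s n) {t : ℝ}
    (ht : t ∈ Icc (0 : ℝ) 1) : sweep F ((1 - shrinkRate s * t) • y) t ∈ refElem s (n + 1) := by
  rw [sweep_eq_ins]
  obtain ⟨h0, h1⟩ := ht
  match s, F with
  | .simplex, some i =>
    have := hy.2
    have h3 : 0 ≤ (1 - t) * (1 - ∑ j, y j) := mul_nonneg (by linarith) (by linarith)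
    refine (ins_mem_simplex _ _ _).2 ⟨?_, fun j => ?_, ?_⟩
    · simpa [FIdx.cst, FIdx.slope, FIdx.orient] using h0
    · simpa [shrinkRate] using mul_nonneg (sub_nonneg.2 h1) (hy.1 j)
    · simp only [FIdx.cst, FIdx.slope, FIdx.orient, shrinkRate, PiLp.smul_apply, smul_eq_mul,
        ← Finset.mul_sum]
      linarith
  | .simplex, none =>
    have := hy.2
    have h3 : 0 ≤ (1 - t) * (1 - ∑ j, y j) := mul_nonneg (by linarith) (by linarith)
    refine (ins_mem_simplex _ _ _).2 ⟨?_, fun j => ?_, ?_⟩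
    · simp only [FIdx.cst, FIdx.slope, FIdx.orient, shrinkRate, PiLp.smul_apply, smul_eq_mul,
        ← Finset.mul_sum]
      linarith
    · simpa [shrinkRate] using mul_nonneg (sub_nonneg.2 h1) (hy.1 j)
    · simp only [FIdx.cst, FIdx.slope, FIdx.orient, shrinkRate, PiLp.smul_apply, smul_eq_mul,
        ← Finset.mul_sum]
      linarith
  | .cube, (i, b) =>
    refine (ins_mem_cube _ _ _).2 ⟨?_, by simpa [shrinkRate] using hy⟩
    cases b <;> simp [FIdx.cst, FIdx.slope, FIdx.orient] <;> constructor <;> linarith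

/-- For fixed `y` the parameter `t` only translates, and possibly reflects, the coordinate `F.dir`;
hence the Jacobian is one. -/
theorem lintegral_sweep {s : Shape} {n : ℕ} (F : FIdx s n) {f : Space (n + 1) → ℝ≥0∞}
    (hf : Measurable f) : ∫⁻ t : ℝ, ∫⁻ y : Space n, f (sweep F y t) = ∫⁻ x, f x := by
  have hc : Continuous fun q : ℝ × Space n => sweep F q.2 q.1 := by
    have := (contDiff_facetMap F).continuous
    unfold sweep; fun_prop
  rw [lintegral_lintegral_swap (f := fun t y => f (sweep F y t))
    (hf.comp hc.measurable).aemeasurable, lintegral_ins F.dir f hf]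
  congr 1; funext y
  simp_rw [sweep_eq_ins]
  rcases F.orient_eq with h | h <;> rw [h]
  · simp only [one_mul]
    exact lintegral_sub_left_eq_self (fun u => f (ins F.dir u y)) _
  · simp only [neg_mul, one_mul, sub_neg_eq_add]
    exact lintegral_add_left_eq_self (fun u => f (ins F.dir u y)) _

/-- One-dimensional trace estimate, applied to `φ t = (1 - t) (1 - κ t)^n g²`. The factor `1 - t`
makes `φ 1 = 0`, and `(1 - κ t)^n` is the Jacobian of the shrinking facet. In the bound of `-φ'` the
weight contributes `n + 1` and Young's inequality for `2 g g'` contributes `1 + B²`. -/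
theorem ofReal_sq_le_lintegral_shrink {g g' N : ℝ → ℝ} (hg : ∀ t, HasDerivAt g (g' t) t)
    (hg' : Continuous g') (hN : Continuous N) {B : ℝ}
    (hB : ∀ t, g' t ^ 2 ≤ B ^ 2 * N t ^ 2) {κ : ℝ} (hκ : κ = 1 ∨ κ = 0) (n : ℕ) :
    ENNReal.ofReal (g 0 ^ 2) ≤ ENNReal.ofReal (n + 2 + B ^ 2) *
      ∫⁻ t in Icc (0 : ℝ) 1, ENNReal.ofReal ((1 - κ * t) ^ n * (g t ^ 2 + N t ^ 2)) := by
  have hgc : Continuous g := continuous_iff_continuousAt.2 fun t => (hg t).continuousAt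
  have hw : ∀ t, HasDerivAt (fun t : ℝ => (1 - t) * (1 - κ * t) ^ n)
      (-(1 - κ * t) ^ n + (1 - t) * (n * (1 - κ * t) ^ (n - 1) * -κ)) t := by
    intro t
    have h1 := (hasDerivAt_id t).const_sub 1
    have h2 := (((hasDerivAt_id t).const_mul κ).const_sub 1).pow n
    convert! h1.mul h2 using 1
    simp
  have hφ : ∀ t, HasDerivAt (fun t => (1 - t) * (1 - κ * t) ^ n * g t ^ 2)
      ((-(1 - κ * t) ^ n + (1 - t) * (n * (1 - κ * t) ^ (n - 1) * -κ)) * g t ^ 2 +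
        (1 - t) * (1 - κ * t) ^ n * (2 * g t * g' t)) t := by
    intro t
    convert! (hw t).mul ((hg t).pow 2) using 1
    simp
  have hρ : ∀ t ∈ Icc (0 : ℝ) 1, 0 ≤ 1 - κ * t := by
    intro t ht
    rcases hκ with e | e <;> rw [e] <;> linarith [ht.2]
  have := ofReal_le_lintegral_of_neg_deriv_le hφ (by fun_prop)
    (M := fun t => (n + 2 + B ^ 2) * ((1 - κ * t) ^ n * (g t ^ 2 + N t ^ 2))) (by fun_prop)
    (by simp) (fun t ht => ?_) (fun t ht => ?_)
  · simp only [sub_zero, mul_zero, one_pow, one_mul] at this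
    refine this.trans (le_of_eq ?_)
    rw [← lintegral_const_mul' _ _ ENNReal.ofReal_ne_top]
    refine setLIntegral_congr_fun measurableSet_Icc fun t ht => ?_
    rw [← ENNReal.ofReal_mul (by positivity)]
  · have := hρ t ht
    positivity
  · have hρn : 0 ≤ (1 - κ * t) ^ n := pow_nonneg (hρ t ht) n
    -- For `κ = 1` the lost power of `1 - t` is restored by the cut-off. If `n = 0`, the truncated
    -- exponent `n - 1` is harmless because of the factor `n`.
    have h1 : (1 - t) * (n * (1 - κ * t) ^ (n - 1) * κ) ≤ n * (1 - κ * t) ^ n := by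
      rcases hκ with rfl | rfl
      · rcases Nat.eq_zero_or_pos n with rfl | hn
        · simp
        · obtain ⟨m, rfl⟩ := Nat.exists_eq_succ_of_ne_zero hn.ne'
          simp only [Nat.succ_eq_add_one, Nat.add_sub_cancel, one_mul]
          exact le_of_eq (by ring)
      · simp
    have h2 : -(2 * g t * g' t) ≤ g t ^ 2 + B ^ 2 * N t ^ 2 := by
      nlinarith [sq_nonneg (g t + g' t), hB t]
    have h6 : 0 ≤ g t ^ 2 := sq_nonneg _
    have h7 : 0 ≤ N t ^ 2 := sq_nonneg _
    have h8 : (1 - t) * (1 - κ * t) ^ n * -(2 * g t * g' t) ≤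
        (1 - κ * t) ^ n * (g t ^ 2 + B ^ 2 * N t ^ 2) := by
      calc _ ≤ (1 - t) * (1 - κ * t) ^ n * (g t ^ 2 + B ^ 2 * N t ^ 2) :=
            mul_le_mul_of_nonneg_left h2 (mul_nonneg (by linarith [ht.2]) hρn)
        _ ≤ _ := by
            refine mul_le_mul_of_nonneg_right ?_ (by positivity)
            exact mul_le_of_le_one_left hρn (by linarith [ht.1])
    have h9 := mul_le_mul_of_nonneg_right h1 h6
    have h10 : 0 ≤ (n + 2 : ℝ) * ((1 - κ * t) ^ n * N t ^ 2) := by positivity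
    have h11 : 0 ≤ B ^ 2 * ((1 - κ * t) ^ n * g t ^ 2) := by positivity
    linarith

theorem hasDerivAt_sweep {s : Shape} {n : ℕ} (F : FIdx s n) (y : Space n) (κ t : ℝ) :
    HasDerivAt (fun t : ℝ => sweep F ((1 - κ * t) • y) t)
      (-(κ • facetLin F y) - F.orient • (EuclideanSpace.single F.dir 1 : Space (n + 1))) t := by
  have he : (fun t : ℝ => sweep F ((1 - κ * t) • y) t) = fun t : ℝ =>
      facetMap F 0 + (1 - κ * t) • facetLin F y -
        (F.orient * t) • (EuclideanSpace.single F.dir 1 : Space (n + 1)) := by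
    funext t
    rw [sweep, ← map_smul, ← facetMap_add, zero_add]
  rw [he]
  have h1 := ((((hasDerivAt_id t).const_mul κ).const_sub 1).smul_const (facetLin F y)).const_add
    (facetMap F 0)
  have h2 := (((hasDerivAt_id t).const_mul F.orient).smul_const
    (EuclideanSpace.single F.dir 1 : Space (n + 1)))
  convert! h1.sub h2 using 1
  simp

theorem continuous_facetLin {s : Shape} {n : ℕ} (F : FIdx s n) : Continuous (facetLin F) :=
  (LinearMap.toContinuousLinearMap (facetLin F)).continuous

theorem continuous_facetMap {s : Shape} {n : ℕ} (F : FIdx s n) : Continuous (facetMap F) :=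
  (contDiff_facetMap F).continuous

theorem continuous_sweep {s : Shape} {n : ℕ} (F : FIdx s n) {X : Type*} [TopologicalSpace X]
    {f : X → ℝ} {g : X → Space n} (hf : Continuous f) (hg : Continuous g) :
    Continuous fun q => sweep F (g q) (f q) := by
  have := (continuous_facetMap F).comp hg
  exact this.sub ((continuous_const.mul hf).smul continuous_const)

theorem exists_sweep_deriv_bound {s : Shape} {n : ℕ} (F : FIdx s n) : ∃ B : ℝ, 0 < B ∧
    ∀ y ∈ refElem s n, ‖-(shrinkRate s • facetLin F y) -
      F.orient • (EuclideanSpace.single F.dir 1 : Space (n + 1))‖ ≤ B := by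
  have hcont : Continuous fun y : Space n => -(shrinkRate s • facetLin F y) -
      F.orient • (EuclideanSpace.single F.dir 1 : Space (n + 1)) := by
    have := continuous_facetLin F
    fun_prop
  obtain ⟨R, hR⟩ := ((isCompact_refElem s n).image hcont).isBounded.exists_norm_le
  exact ⟨|R| + 1, by positivity, fun y hy =>
    (hR _ (mem_image_of_mem _ hy)).trans (by linarith [le_abs_self R])⟩

/-- The weight turns the integral over the facet into one over its shrunk copy, which the sweep
keeps inside the element. At `t = 1` the section of a simplex degenerates to a point and the
substitution fails. -/
theorem lintegral_shrink_sweep_le {s : Shape} {n : ℕ} (F : FIdx s n) {H : Space (n + 1) → ℝ≥0∞}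
    (hH : Measurable H) {t : ℝ} (ht : t ∈ Icc (0 : ℝ) 1) (ht1 : t ≠ 1) :
    ∫⁻ y in refElem s n, ENNReal.ofReal ((1 - shrinkRate s * t) ^ n) *
        H (sweep F ((1 - shrinkRate s * t) • y) t) ≤
      ∫⁻ y : Space n, (refElem s (n + 1)).indicator H (sweep F y t) := by
  have hρ : 0 < 1 - shrinkRate s * t := by
    have := lt_of_le_of_ne ht.2 ht1
    rcases shrinkRate_eq s with e | e <;> rw [e] <;> linarith
  have hm : Measurable fun y : Space n => (refElem s (n + 1)).indicator H (sweep F y t) :=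
    (hH.indicator (measurableSet_refElem s _)).comp
      (continuous_sweep F continuous_const continuous_id).measurable
  rw [← lintegral_comp_smul_space _ hm hρ, lintegral_const_mul' _ _ ENNReal.ofReal_ne_top]
  refine mul_le_mul' le_rfl ?_
  rw [← lintegral_indicator (measurableSet_refElem s n)]
  refine lintegral_mono fun y => ?_
  by_cases hy : y ∈ refElem s n
  · have := sweep_mem F hy ht
    simp [hy, this]
  · simp [hy]

/-- The sweeping curve through a facet point is a straight line whose velocity is bounded by `B`;
the one-dimensional estimate applies to `a` along it. -/
theorem ofReal_trace_sq_le {s : Shape} {n : ℕ} (F : FIdx s n) {a : Space (n + 1) → ℝ}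
    (ha : ContDiff ℝ ∞ a) {B : ℝ} {y : Space n} (hy : ‖-(shrinkRate s • facetLin F y) -
      F.orient • (EuclideanSpace.single F.dir 1 : Space (n + 1))‖ ≤ B) :
    ENNReal.ofReal (a (facetMap F y) ^ 2) ≤
      ENNReal.ofReal (n + 2 + B ^ 2) * ∫⁻ t in Icc (0 : ℝ) 1,
        ENNReal.ofReal ((1 - shrinkRate s * t) ^ n) *
          ENNReal.ofReal (a (sweep F ((1 - shrinkRate s * t) • y) t) ^ 2 +
            ‖gradient a (sweep F ((1 - shrinkRate s * t) • y) t)‖ ^ 2) := by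
  obtain ⟨z, hz⟩ : ∃ z, z = -(shrinkRate s • facetLin F y) -
      F.orient • (EuclideanSpace.single F.dir 1 : Space (n + 1)) := ⟨_, rfl⟩
  obtain ⟨γ, hγ⟩ : ∃ γ : ℝ → Space (n + 1), γ = fun t => sweep F ((1 - shrinkRate s * t) • y) t :=
    ⟨_, rfl⟩
  have hd : ∀ t, HasDerivAt γ z t := by
    rw [hγ, hz]
    exact hasDerivAt_sweep F y (shrinkRate s)
  have hγc : Continuous γ := continuous_iff_continuousAt.2 fun t => (hd t).continuousAt
  have h0 : γ 0 = facetMap F y := by rw [hγ]; simp [sweep]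
  have hgc := continuous_gradient ha
  have hfd := ha.continuous_fderiv (by simp)
  rw [← hz] at hy
  have hda : ∀ t, HasDerivAt (fun t => a (γ t)) (fderiv ℝ a (γ t) z) t := fun t =>
    ((ha.differentiable (by simp)) (γ t)).hasFDerivAt.comp_hasDerivAt t (hd t)
  have := ofReal_sq_le_lintegral_shrink hda (N := fun t => ‖gradient a (γ t)‖) (B := B)
    (by fun_prop) (by fun_prop) (fun t => by
      refine (fderiv_apply_sq_le _ _ _).trans ?_
      rw [mul_comm]
      exact mul_le_mul_of_nonneg_right (pow_le_pow_left₀ (norm_nonneg _) hy 2)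
        (sq_nonneg _)) (shrinkRate_eq s) n
  rw [h0] at this
  refine this.trans (le_of_eq ?_)
  congr 1
  refine setLIntegral_congr_fun measurableSet_Icc fun t ht => ?_
  have hρ : 0 ≤ 1 - shrinkRate s * t := by
    rcases shrinkRate_eq s with e | e <;> rw [e] <;> linarith [ht.2]
  simp only [hγ]
  rw [ENNReal.ofReal_mul (pow_nonneg hρ n)]

/-- Trace inequality: the pointwise bounds along the curves are integrated over the facet, and
Fubini with the change of variables `(y, t) ↦ sweep` recovers the volume integral. -/
theorem exists_trace_le {s : Shape} {n : ℕ} (F : FIdx s n) :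
    ∃ C : ℝ, 0 < C ∧ ∀ a : Space (n + 1) → ℝ, ContDiff ℝ ∞ a →
      ∫ y in refElem s n, a (facetMap F y) ^ 2 ≤
        C * ∫ x in refElem s (n + 1), (a x ^ 2 + ‖gradient a x‖ ^ 2) := by
  obtain ⟨B, hB, hBy⟩ := exists_sweep_deriv_bound F
  refine ⟨n + 2 + B ^ 2, by positivity, fun a ha => ?_⟩
  have hgc := continuous_gradient ha
  have hac := ha.continuous
  have hfc := continuous_facetMap F
  let h : Space (n + 1) → ℝ := fun x => a x ^ 2 + ‖gradient a x‖ ^ 2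
  have hhc : Continuous h := by fun_prop
  have hh0 : ∀ x, 0 ≤ h x := fun x => by positivity
  obtain ⟨H, hHeq⟩ : ∃ H : Space (n + 1) → ℝ≥0∞, H = fun x => ENNReal.ofReal (h x) := ⟨_, rfl⟩
  have hH : Measurable H := hHeq ▸ (ENNReal.continuous_ofReal.comp hhc).measurable
  have hpt : ∀ y ∈ refElem s n, ENNReal.ofReal (a (facetMap F y) ^ 2) ≤
      ENNReal.ofReal (n + 2 + B ^ 2) * ∫⁻ t in Icc (0 : ℝ) 1,
        ENNReal.ofReal ((1 - shrinkRate s * t) ^ n) * H (sweep F ((1 - shrinkRate s * t) • y) t) := by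
    intro y hy
    rw [hHeq]
    exact ofReal_trace_sq_le F ha (hBy y hy)
  have htot : ∫⁻ y in refElem s n, ENNReal.ofReal (a (facetMap F y) ^ 2) ≤
      ENNReal.ofReal (n + 2 + B ^ 2) * ∫⁻ x in refElem s (n + 1), H x := by
    calc _ ≤ ∫⁻ y in refElem s n, ENNReal.ofReal (n + 2 + B ^ 2) * ∫⁻ t in Icc (0 : ℝ) 1,
            ENNReal.ofReal ((1 - shrinkRate s * t) ^ n) * H (sweep F ((1 - shrinkRate s * t) • y) t) :=
          setLIntegral_mono' (measurableSet_refElem s n) hpt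
      _ = ENNReal.ofReal (n + 2 + B ^ 2) * ∫⁻ t in Icc (0 : ℝ) 1, ∫⁻ y in refElem s n,
            ENNReal.ofReal ((1 - shrinkRate s * t) ^ n) * H (sweep F ((1 - shrinkRate s * t) • y) t) := by
          rw [lintegral_const_mul' _ _ ENNReal.ofReal_ne_top]
          congr 1
          refine lintegral_lintegral_swap (f := fun y t => ENNReal.ofReal ((1 - shrinkRate s * t) ^ n) *
            H (sweep F ((1 - shrinkRate s * t) • y) t)) (Measurable.aemeasurable ?_)
          have hm1 : Continuous fun q : Space n × ℝ => ENNReal.ofReal ((1 - shrinkRate s * q.2) ^ n) :=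
            ENNReal.continuous_ofReal.comp (by fun_prop)
          have hm3 : Continuous fun q : Space n × ℝ => (1 - shrinkRate s * q.2) • q.1 :=
            (continuous_const.sub (continuous_const.mul continuous_snd)).smul continuous_fst
          have hm2 : Continuous fun q : Space n × ℝ =>
              sweep F ((1 - shrinkRate s * q.2) • q.1) q.2 := continuous_sweep F continuous_snd hm3
          exact hm1.measurable.mul (hH.comp hm2.measurable)
      _ ≤ ENNReal.ofReal (n + 2 + B ^ 2) * ∫⁻ t in Icc (0 : ℝ) 1,
            ∫⁻ y : Space n, (refElem s (n + 1)).indicator H (sweep F y t) := by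
          refine mul_le_mul' le_rfl (lintegral_mono_ae ?_)
          filter_upwards [ae_restrict_mem measurableSet_Icc,
            ae_restrict_of_ae (Measure.ae_ne volume (1 : ℝ))] with t ht ht1
          exact lintegral_shrink_sweep_le F hH ht ht1
      _ ≤ ENNReal.ofReal (n + 2 + B ^ 2) * ∫⁻ t : ℝ,
            ∫⁻ y : Space n, (refElem s (n + 1)).indicator H (sweep F y t) :=
          mul_le_mul' le_rfl (setLIntegral_le_lintegral _ _)
      _ = _ := by
          rw [lintegral_sweep F (hH.indicator (measurableSet_refElem s _)),
            lintegral_indicator (measurableSet_refElem s _)]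
  have hi : Integrable h (volume.restrict (refElem s (n + 1))) :=
    hhc.continuousOn.integrableOn_compact (isCompact_refElem _ _)
  have hi2 : Integrable (fun y => a (facetMap F y) ^ 2) (volume.restrict (refElem s n)) :=
    (Continuous.continuousOn (by fun_prop)).integrableOn_compact (isCompact_refElem _ _)
  rw [hHeq, ← ofReal_integral_eq_lintegral_ofReal hi2 (ae_of_all _ fun x => sq_nonneg _),
    ← ofReal_integral_eq_lintegral_ofReal hi (ae_of_all _ hh0),
    ← ENNReal.ofReal_mul (by positivity)] at htot
  exact (ENNReal.ofReal_le_ofReal_iff (mul_nonneg (by positivity)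
    (integral_nonneg hh0))).1 htot

/-! ### Substitutions in the reference polynomial spaces -/

theorem mem_polySpace_simplex {d p : ℕ} (q : MvPolynomial (Fin d) ℝ) :
    q ∈ polySpace .simplex d p ↔ q.totalDegree ≤ p :=
  MvPolynomial.mem_restrictTotalDegree _ _ q

theorem mem_polySpace_cube {d p : ℕ} (q : MvPolynomial (Fin d) ℝ) :
    q ∈ polySpace .cube d p ↔ ∀ i, q.degreeOf i ≤ p := by
  refine (MvPolynomial.mem_restrictDegree _ _ _).trans ?_
  simp only [MvPolynomial.degreeOf_le_iff]
  exact ⟨fun h i m hm => h m hm i, fun h m hm i => h i m hm⟩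

instance (s : Shape) (d p : ℕ) : FiniteDimensional ℝ (polySpace s d p) := by
  cases s
  · exact inferInstanceAs (Module.Finite ℝ (MvPolynomial.restrictTotalDegree (Fin d) ℝ p))
  · exact inferInstanceAs (Module.Finite ℝ (MvPolynomial.restrictDegree (Fin d) ℝ p))

theorem C_mem_polySpace (s : Shape) (d p : ℕ) (c : ℝ) : MvPolynomial.C c ∈ polySpace s d p := by
  cases s
  · simp [mem_polySpace_simplex]
  · simp [mem_polySpace_cube]

/-- Substitutions preserving the reference polynomial spaces. -/
def AdmSub {d e : ℕ} : Shape → (Fin d → MvPolynomial (Fin e) ℝ) → Prop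
  | .simplex, f => ∀ j, (f j).totalDegree ≤ 1
  | .cube, f => ∀ k, ∃ j₀ : Option (Fin d), ∀ j, (f j).degreeOf k ≤ if some j = j₀ then 1 else 0

/-- Checked on monomials. In the cube case each new variable occurs in at most one substituted
component, and there linearly, so its degree is at most the exponent of that component. -/
theorem AdmSub.aeval_mem {d e p : ℕ} {s : Shape} {f : Fin d → MvPolynomial (Fin e) ℝ}
    (hf : AdmSub s f) {q : MvPolynomial (Fin d) ℝ} (hq : q ∈ polySpace s d p) :
    MvPolynomial.aeval f q ∈ polySpace s e p := by
  rw [MvPolynomial.aeval_def, MvPolynomial.eval₂_eq']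
  refine Submodule.sum_mem _ fun m hm => ?_
  cases s with
  | simplex =>
    rw [mem_polySpace_simplex] at hq ⊢
    have h1 : (∏ i, f i ^ m i).totalDegree ≤ ∑ i, m i := by
      refine (MvPolynomial.totalDegree_finsetProd _ _).trans (Finset.sum_le_sum fun i _ => ?_)
      exact (MvPolynomial.totalDegree_pow _ _).trans (by have := hf i; nlinarith)
    have h2 : ∑ i, m i ≤ p := by
      have := (MvPolynomial.le_totalDegree hm).trans hq
      rwa [Finsupp.sum_fintype _ _ (fun _ => rfl)] at this
    refine (MvPolynomial.totalDegree_mul _ _).trans ?_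
    rw [MvPolynomial.algebraMap_eq, MvPolynomial.totalDegree_C]
    omega
  | cube =>
    rw [mem_polySpace_cube] at hq ⊢
    intro k
    obtain ⟨j₀, hj⟩ := hf k
    have h1 : (∏ i, f i ^ m i).degreeOf k ≤ ∑ i, m i * if some i = j₀ then 1 else 0 := by
      refine (MvPolynomial.degreeOf_prod_le _ _ _).trans (Finset.sum_le_sum fun i _ => ?_)
      exact (MvPolynomial.degreeOf_pow_le _ _ _).trans (Nat.mul_le_mul_left _ (hj i))
    have h2 : ∑ i, m i * (if some i = j₀ then 1 else 0) ≤ p := by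
      cases j₀ with
      | none => simp
      | some j =>
        simp only [Option.some_inj, mul_ite, mul_one, mul_zero, Finset.sum_ite_eq',
          Finset.mem_univ, if_true]
        exact (MvPolynomial.degreeOf_le_iff.1 (hq j)) m hm
    refine (MvPolynomial.degreeOf_mul_le _ _ _).trans ?_
    rw [MvPolynomial.algebraMap_eq, MvPolynomial.degreeOf_C]
    omega

theorem pe_aeval {d e : ℕ} (f : Fin d → MvPolynomial (Fin e) ℝ) (q : MvPolynomial (Fin d) ℝ)
    (y : Space e) : pe (MvPolynomial.aeval f q) y = pe q (WithLp.toLp 2 fun i => pe (f i) y) := by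
  induction q using MvPolynomial.induction_on with
  | C a => simp [pe]
  | add p q hp hq => simp_all [pe]
  | mul_X p i hp => simp_all [pe]

/-- Restriction to the facet `F`, as a substitution. -/
def facetSub {s : Shape} {n : ℕ} (F : FIdx s n) : Fin (n + 1) → MvPolynomial (Fin n) ℝ :=
  F.dir.insertNth (α := fun _ => MvPolynomial (Fin n) ℝ)
    (MvPolynomial.C F.cst + MvPolynomial.C F.slope * ∑ j, MvPolynomial.X j) MvPolynomial.X

theorem pe_facetSub {s : Shape} {n : ℕ} (F : FIdx s n) (q : MvPolynomial (Fin (n + 1)) ℝ)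
    (y : Space n) : pe (MvPolynomial.aeval (facetSub F) q) y = pe q (facetMap F y) := by
  rw [pe_aeval]
  congr 1
  ext k
  rcases Fin.eq_self_or_eq_succAbove F.dir k with rfl | ⟨j, rfl⟩ <;>
    simp [facetSub, facetMap, pe]

theorem totalDegree_C_add_le {e : ℕ} (c : ℝ) {q : MvPolynomial (Fin e) ℝ}
    (hq : q.totalDegree ≤ 1) : (MvPolynomial.C c + q).totalDegree ≤ 1 :=
  (MvPolynomial.totalDegree_add _ _).trans (by simpa using hq)

theorem totalDegree_C_mul_le {e : ℕ} (c : ℝ) {q : MvPolynomial (Fin e) ℝ}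
    (hq : q.totalDegree ≤ 1) : (MvPolynomial.C c * q).totalDegree ≤ 1 :=
  (MvPolynomial.totalDegree_mul _ _).trans (by simpa using hq)

theorem admSub_facetSub {s : Shape} {n : ℕ} (F : FIdx s n) : AdmSub s (facetSub F) := by
  match s, F with
  | .simplex, F =>
    intro j
    rcases Fin.eq_self_or_eq_succAbove F.dir j with h | ⟨j, rfl⟩
    · rw [h]
      simp only [facetSub, Fin.insertNth_apply_same]
      refine totalDegree_C_add_le _ (totalDegree_C_mul_le _ ?_)
      exact MvPolynomial.totalDegree_finsetSum_le fun i _ => by simp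
    · simp [facetSub]
  | .cube, (i, b) =>
    intro k
    -- On the cube, the facet variable `k` occurs only in the component `i.succAbove k`; the
    -- component `i` is constant.
    refine ⟨some (i.succAbove k), fun j => ?_⟩
    rcases Fin.eq_self_or_eq_succAbove i j with rfl | ⟨j, rfl⟩
    · have : facetSub (s := .cube) (j, b) j = MvPolynomial.C (FIdx.cst (s := .cube) (j, b)) := by
        simp [facetSub, FIdx.dir, FIdx.slope]
      rw [this, MvPolynomial.degreeOf_C]
      exact Nat.zero_le _
    · have : facetSub (s := .cube) (i, b) (i.succAbove j) = MvPolynomial.X j := by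
        simp [facetSub, FIdx.dir]
      rw [this, MvPolynomial.degreeOf_X]
      simp only [Option.some_inj, Fin.succAbove_right_inj]
      by_cases h : k = j
      · simp [h]
      · rw [if_neg h]; exact Nat.zero_le _

/-- Extension from a coordinate hyperplane, as a substitution. -/
def liftSub {n : ℕ} (i : Fin (n + 1)) (j : Fin n) : MvPolynomial (Fin (n + 1)) ℝ :=
  MvPolynomial.X (i.succAbove j)

theorem pe_liftSub {n : ℕ} (i : Fin (n + 1)) (q : MvPolynomial (Fin n) ℝ) (x : Space (n + 1)) :
    pe (MvPolynomial.aeval (liftSub i) q) x = pe q (drop i x) := by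
  rw [pe_aeval]
  congr 1
  ext k
  simp [liftSub, pe]

theorem degreeOf_liftSub {n : ℕ} (i : Fin (n + 1)) (q : MvPolynomial (Fin n) ℝ) :
    (MvPolynomial.aeval (liftSub i) q).degreeOf i = 0 := by
  classical
  have h : MvPolynomial.aeval (liftSub i) q = MvPolynomial.rename i.succAbove q :=
    DFunLike.congr_fun (MvPolynomial.algHom_ext fun j => by simp [liftSub]) q
  by_contra hne
  have h1 := MvPolynomial.vars_rename i.succAbove q
    (h ▸ (MvPolynomial.mem_vars_iff_degreeOf_ne_zero.2 hne))
  obtain ⟨j, -, hj⟩ := Finset.mem_image.1 h1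
  exact Fin.succAbove_ne i j hj

theorem admSub_liftSub {s : Shape} {n : ℕ} (i : Fin (n + 1)) : AdmSub s (liftSub i) := by
  cases s with
  | simplex => intro j; simp [liftSub]
  | cube =>
    intro k
    rcases Fin.eq_self_or_eq_succAbove i k with rfl | ⟨l, rfl⟩
    · refine ⟨none, fun j => ?_⟩
      rw [liftSub, MvPolynomial.degreeOf_X, if_neg (Fin.succAbove_ne _ _).symm]
      exact Nat.zero_le _
    · refine ⟨some l, fun j => ?_⟩
      rw [liftSub, MvPolynomial.degreeOf_X]
      simp only [Option.some_inj, Fin.succAbove_right_inj]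
      by_cases h : l = j
      · simp [h]
      · rw [if_neg h]; exact Nat.zero_le _

/-- An affine map, as a substitution. -/
def affineSub {d e : ℕ} (b : Space d) (A : Matrix (Fin d) (Fin e) ℝ) (j : Fin d) :
    MvPolynomial (Fin e) ℝ :=
  MvPolynomial.C (b j) + ∑ k, MvPolynomial.C (A j k) * MvPolynomial.X k

theorem pe_affineSub {d e : ℕ} (b : Space d) (A : Matrix (Fin d) (Fin e) ℝ)
    (q : MvPolynomial (Fin d) ℝ) (y : Space e) :
    pe (MvPolynomial.aeval (affineSub b A) q) y =
      pe q (WithLp.toLp 2 fun j => b j + ∑ k, A j k * y k) := by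
  rw [pe_aeval]
  congr 1
  ext k
  simp [affineSub, pe]

theorem admSub_affineSub_simplex {d e : ℕ} (b : Space d) (A : Matrix (Fin d) (Fin e) ℝ) :
    AdmSub .simplex (affineSub b A) := fun j =>
  totalDegree_C_add_le _ (MvPolynomial.totalDegree_finsetSum_le fun i _ =>
    totalDegree_C_mul_le _ (by simp))

/-- Degrees in each variable survive an affine substitution when every column of the matrix has at
most one nonzero entry, since no product then mixes two occurrences of the same variable. -/
theorem admSub_affineSub_cube {d e : ℕ} (b : Space d) (A : Matrix (Fin d) (Fin e) ℝ)
    (hA : ∀ i j k, A i k ≠ 0 → A j k ≠ 0 → i = j) : AdmSub .cube (affineSub b A) := by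
  classical
  intro k
  have hdeg : ∀ j, (affineSub b A j).degreeOf k ≤ if A j k ≠ 0 then 1 else 0 := by
    intro j
    refine (MvPolynomial.degreeOf_add_le _ _ _).trans (max_le (by simp) ?_)
    refine (MvPolynomial.degreeOf_sum_le _ _ _).trans (Finset.sup_le fun l _ => ?_)
    by_cases hl : A j l = 0
    · simp [hl]
    · refine (MvPolynomial.degreeOf_C_mul_le _ _ _).trans ?_
      rw [MvPolynomial.degreeOf_X]
      by_cases h : k = l
      · subst h; simp [hl]
      · rw [if_neg h]; exact Nat.zero_le _
  by_cases h : ∃ j, A j k ≠ 0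
  · obtain ⟨j₀, hj₀⟩ := h
    refine ⟨some j₀, fun j => (hdeg j).trans ?_⟩
    by_cases hj : A j k = 0
    · simp [hj]
    · simp [hA j j₀ k hj hj₀, hj₀]
  · push Not at h
    exact ⟨none, fun j => by simpa [h j] using hdeg j⟩

/-- An invertible matrix such that the absolute row sums of the matrix and of its inverse are at
most `1` has at most one nonzero entry in each column. -/
theorem eq_of_rowSum_le_one {n : ℕ} {A B : Matrix (Fin n) (Fin n) ℝ} (hAB : A * B = 1)
    (hA : ∀ i, ∑ j, |A i j| ≤ 1) (hB : ∀ i, ∑ j, |B i j| ≤ 1) (i j k : Fin n)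
    (hi : A i k ≠ 0) (hj : A j k ≠ 0) : i = j := by
  have hBle : ∀ k i, |B k i| ≤ 1 := fun k i =>
    (Finset.single_le_sum (fun l _ => abs_nonneg (B k l)) (Finset.mem_univ i)).trans (hB k)
  -- The chain `1 = ∑ A_il B_li ≤ ∑ |A_il| |B_li| ≤ ∑ |A_il| ≤ 1` is an equality, which forces
  -- `|B_li| = 1` wherever `A_il ≠ 0`. Two such rows would give row `k` of `B` an absolute sum of at
  -- least `2`.
  have key : ∀ i, A i k ≠ 0 → |B k i| = 1 := by
    intro i hi
    have h1 : (1 : ℝ) = ∑ l, A i l * B l i := by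
      have := congrFun (congrFun hAB i) i
      rw [Matrix.mul_apply, Matrix.one_apply_eq] at this
      exact this.symm
    have h2 : (1 : ℝ) ≤ ∑ l, |A i l| * |B l i| := by
      calc (1 : ℝ) = ∑ l, A i l * B l i := h1
        _ ≤ ∑ l, |A i l * B l i| := Finset.sum_le_sum fun l _ => le_abs_self _
        _ = _ := by simp_rw [abs_mul]
    have h3 : ∑ l, |A i l| * (1 - |B l i|) ≤ 0 := by
      simp only [mul_sub, mul_one, Finset.sum_sub_distrib]
      linarith [hA i]
    have h4 : |A i k| * (1 - |B k i|) ≤ 0 :=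
      (Finset.single_le_sum (f := fun l => |A i l| * (1 - |B l i|))
        (fun l _ => mul_nonneg (abs_nonneg _) (by linarith [hBle l i]))
        (Finset.mem_univ k)).trans h3
    have h5 : 0 < |A i k| := abs_pos.2 hi
    have h6 : 1 - |B k i| ≤ 0 := by
      by_contra h
      push Not at h
      nlinarith
    linarith [hBle k i]
  by_contra hne
  have h1 : |B k i| + |B k j| ≤ ∑ l, |B k l| := by
    rw [← Finset.sum_pair (f := fun l => |B k l|) hne]
    exact Finset.sum_le_sum_of_subset_of_nonneg (Finset.subset_univ _) fun l _ _ => abs_nonneg _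
  linarith [key i hi, key j hj, hB k]

/-- An affine self-map of the unit cube has absolute row sums at most `1`. -/
theorem rowSum_le_one {n : ℕ} {b : Space n} {A : Matrix (Fin n) (Fin n) ℝ}
    (h : ∀ y ∈ refElem .cube n, (WithLp.toLp 2 fun j => b j + ∑ k, A j k * y k : Space n) ∈
      refElem .cube n) (i : Fin n) : ∑ j, |A i j| ≤ 1 := by
  -- These two vertices maximize and minimize the `i`-th component over the cube. Both values lie in
  -- `[0, 1]`, and their difference is the absolute row sum.
  have h1 := h (WithLp.toLp 2 fun k => if 0 < A i k then 1 else 0)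
    (fun k => by dsimp only; split_ifs <;> simp) i
  have h2 := h (WithLp.toLp 2 fun k => if 0 < A i k then 0 else 1)
    (fun k => by dsimp only; split_ifs <;> simp) i
  simp only at h1 h2
  have h3 : ∑ j, |A i j| = (∑ k, A i k * if 0 < A i k then 1 else 0) -
      ∑ k, A i k * if 0 < A i k then 0 else 1 := by
    rw [← Finset.sum_sub_distrib]
    refine Finset.sum_congr rfl fun k _ => ?_
    split_ifs with hk
    · simp [abs_of_pos hk]
    · simp [abs_of_nonpos (not_lt.1 hk)]
  linarith [h1.2, h2.1]

/-- The operator `x_k ∂_k` multiplies each monomial by its exponent in `x_k`, hence preserves every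
space spanned by monomials. This keeps the test fields of the kernel proofs in the Raviart--Thomas
space. -/
theorem X_mul_pderiv_mem {s : Shape} {d p : ℕ} {q : MvPolynomial (Fin d) ℝ}
    (hq : q ∈ polySpace s d p) (k : Fin d) :
    MvPolynomial.X k * MvPolynomial.pderiv k q ∈ polySpace s d p := by
  have key : ∀ (S : Set (Fin d →₀ ℕ)) (q : MvPolynomial (Fin d) ℝ),
      q ∈ MvPolynomial.restrictSupport ℝ S →
      MvPolynomial.X k * MvPolynomial.pderiv k q ∈ MvPolynomial.restrictSupport ℝ S := by
    intro S q hS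
    rw [MvPolynomial.restrictSupport_eq_span] at hS
    induction hS using Submodule.span_induction with
    | mem x hx =>
      obtain ⟨m, hm, rfl⟩ := hx
      rw [MvPolynomial.pderiv_monomial, MvPolynomial.X, MvPolynomial.monomial_mul]
      rcases Nat.eq_zero_or_pos (m k) with h0 | h0
      · simp [h0]
      · have : Finsupp.single k 1 + (m - Finsupp.single k 1) = m := by
          rw [add_comm]
          refine tsub_add_cancel_of_le ?_
          rw [Finsupp.single_le_iff]; exact h0
        rw [this, MvPolynomial.monomial_mem_restrictSupport]
        exact Or.inl hm
    | zero => simp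
    | add x y _ _ hx hy => rw [map_add, mul_add]; exact Submodule.add_mem _ hx hy
    | smul a x _ hx => rw [Derivation.map_smul, mul_smul_comm]; exact Submodule.smul_mem _ _ hx
  cases s
  · exact key _ q hq
  · exact key _ q hq

/-! ### Inverse inequalities and projections on the reference elements -/

/-- Evaluation of polynomials, as a linear map. -/
def peL (d : ℕ) : MvPolynomial (Fin d) ℝ →ₗ[ℝ] Space d → ℝ where
  toFun q := pe q
  map_add' p q := pe_add p q
  map_smul' c q := by funext x; simp [pe]

/-- The gradient of polynomials, as a linear map. -/
def gradL (d : ℕ) : MvPolynomial (Fin d) ℝ →ₗ[ℝ] Space d → Space d where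
  toFun q x := gradient (pe q) x
  map_add' p q := by
    funext x; ext k
    rw [Pi.add_apply, PiLp.add_apply, gradient_pe, gradient_pe, gradient_pe, map_add, pe_add]
    rfl
  map_smul' c q := by
    funext x; ext k
    rw [Pi.smul_apply, PiLp.smul_apply, gradient_pe, gradient_pe, Derivation.map_smul]
    simp [pe]

theorem memLp_two_of_continuous {d : ℕ} {E : Type*} [NormedAddCommGroup E] {f : Space d → E}
    (hf : Continuous f) {K : Set (Space d)} (hK : IsCompact K) :
    MemLp f 2 (volume.restrict K) := by
  have : Fact (volume K < ⊤) := ⟨hK.measure_lt_top⟩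
  obtain ⟨R, hR⟩ := (hK.image hf).isBounded.exists_norm_le
  refine MemLp.of_bound (hf.continuousOn.aestronglyMeasurable_of_isCompact hK
    hK.isClosed.measurableSet) R ?_
  filter_upwards [ae_restrict_mem hK.isClosed.measurableSet] with x hx
  exact hR _ (mem_image_of_mem _ hx)

theorem integrable_of_continuous {d : ℕ} {E : Type*} [NormedAddCommGroup E] {f : Space d → E}
    (hf : Continuous f) {K : Set (Space d)} (hK : IsCompact K) :
    Integrable f (volume.restrict K) :=
  hf.continuousOn.integrableOn_compact hK

/-- Finite dimension suffices: a polynomial with vanishing `L²` norm on the reference element is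
zero. -/
theorem exists_gradient_inverse (s : Shape) (d p : ℕ) : ∃ C : ℝ, 0 < C ∧
    ∀ v ∈ polySpace s d p, ∫ x in refElem s d, ‖gradient (pe v) x‖ ^ 2 ≤
      C * ∫ x in refElem s d, pe v x ^ 2 := by
  obtain ⟨C, hC, H⟩ := exists_integral_sq_le (volume.restrict (refElem s d))
    (volume.restrict (refElem s d)) ((gradL d).comp (polySpace s d p).subtype)
    ((peL d).comp (polySpace s d p).subtype)
    (fun v => memLp_two_of_continuous (continuous_gradient (contDiff_pe _)) (isCompact_refElem _ _))
    (fun v => memLp_two_of_continuous (continuous_pe _) (isCompact_refElem _ _))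
    (fun v hv => Subtype.ext (eq_zero_of_integral_pe_sq _ (isCompact_refElem _ _)
      (interior_refElem_nonempty s d) (by simpa [peL] using! hv)))
  refine ⟨C, hC, fun v hv => ?_⟩
  simpa [gradL, peL] using! H ⟨v, hv⟩

theorem exists_trace_inverse {s : Shape} {n : ℕ} (F : FIdx s n) (p : ℕ) : ∃ C : ℝ, 0 < C ∧
    ∀ v ∈ polySpace s (n + 1) p, ∫ y in refElem s n, pe v (facetMap F y) ^ 2 ≤
      C * ∫ x in refElem s (n + 1), pe v x ^ 2 := by
  obtain ⟨C₁, hC₁, H₁⟩ := exists_trace_le F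
  obtain ⟨C₂, hC₂, H₂⟩ := exists_gradient_inverse s (n + 1) p
  refine ⟨C₁ * (1 + C₂), by positivity, fun v hv => (H₁ _ (contDiff_pe v)).trans ?_⟩
  have hc := continuous_pe v
  have hg := continuous_gradient (contDiff_pe v)
  rw [integral_add (integrable_of_continuous (by fun_prop) (isCompact_refElem _ _))
    (integrable_of_continuous (by fun_prop) (isCompact_refElem _ _)), mul_assoc]
  exact mul_le_mul_of_nonneg_left (by linarith [H₂ v hv]) hC₁.le

/-- Stability and approximation of the `L²` projection onto the reference polynomial space. -/
theorem exists_projection_le (s : Shape) (n p : ℕ) : ∃ C : ℝ, 0 < C ∧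
    ∀ (a : Space (n + 1) → ℝ) (w : Space (n + 1) → ℝ), ContDiff ℝ ∞ a →
      MemLp w 2 (volume.restrict (refElem s (n + 1))) → ∀ v ∈ polySpace s (n + 1) p,
      (∀ z ∈ polySpace s (n + 1) p, ∫ x in refElem s (n + 1), (pe v x - w x) * pe z x = 0) →
      (∫ x in refElem s (n + 1), ‖gradient (pe v) x‖ ^ 2) +
        ∑ F : FIdx s n, ∫ y in refElem s n, (a (facetMap F y) - pe v (facetMap F y)) ^ 2 ≤
      C * ((∫ x in refElem s (n + 1), ‖gradient a x‖ ^ 2) +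
        ∫ x in refElem s (n + 1), (w x - a x) ^ 2) := by
  obtain ⟨C₀, hC₀, H₀⟩ := exists_sub_const_sq_le (convex_refElem s (n + 1))
    (isCompact_refElem s (n + 1)) (volume_refElem_ne_zero s (n + 1))
  obtain ⟨C₁, hC₁, H₁⟩ := exists_gradient_inverse s (n + 1) p
  choose C₂ hC₂ H₂ using fun F : FIdx s n => exists_trace_inverse F p
  choose C₃ hC₃ H₃ using fun F : FIdx s n => exists_trace_le F
  have hS2 : 0 ≤ ∑ F, C₂ F := Finset.sum_nonneg fun F _ => (hC₂ F).le
  have hS3 : 0 ≤ ∑ F, C₃ F := Finset.sum_nonneg fun F _ => (hC₃ F).le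
  refine ⟨(C₁ + 2 * ∑ F, C₂ F) * (2 + 2 * C₀) + 2 * (∑ F, C₃ F) * (C₀ + 1), by positivity,
    fun a w ha hw v hv hproj => ?_⟩
  set K := refElem s (n + 1) with hK
  have hKc : IsCompact K := isCompact_refElem s (n + 1)
  obtain ⟨c, hc⟩ := H₀ a ha
  have hac := ha.continuous
  have hgc := continuous_gradient ha
  set A := ∫ x in K, ‖gradient a x‖ ^ 2 with hA
  set W := ∫ x in K, (w x - a x) ^ 2 with hW
  set Dl := ∫ x in K, (a x - c) ^ 2 with hDl
  have hA0 : 0 ≤ A := integral_nonneg fun x => sq_nonneg _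
  have hW0 : 0 ≤ W := integral_nonneg fun x => sq_nonneg _
  have hDl0 : 0 ≤ Dl := integral_nonneg fun x => sq_nonneg _
  -- the projection error
  obtain ⟨z, hz⟩ : ∃ z, z = v - MvPolynomial.C c := ⟨_, rfl⟩
  have hzm : z ∈ polySpace s (n + 1) p := hz ▸ Submodule.sub_mem _ hv (C_mem_polySpace s _ _ c)
  have hze : ∀ x, pe z x = pe v x - c := fun x => by rw [hz]; simp [pe]
  have hzc := continuous_pe z
  have hvc := continuous_pe v
  set Z := ∫ x in K, pe z x ^ 2 with hZ
  have hzL : MemLp (pe z) 2 (volume.restrict K) := memLp_two_of_continuous hzc hKc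
  have hwc : MemLp (fun x => w x - c) 2 (volume.restrict K) :=
    hw.sub (memLp_two_of_continuous continuous_const hKc)
  have hwa : MemLp (fun x => w x - a x) 2 (volume.restrict K) :=
    hw.sub (memLp_two_of_continuous hac hKc)
  have hwz : Integrable (fun x => (w x - c) * pe z x) (volume.restrict K) :=
    hwc.integrable_mul hzL
  -- The polynomial `z = v - c` is an admissible test, so orthogonality gives `‖z‖² = (w - c, z)`.
  -- Then `w - c` is split into `w - a` and the Poincaré remainder `a - c`.
  have hZle : Z ≤ 2 * W + 2 * Dl := by
    have h1 : Z = ∫ x in K, (w x - c) * pe z x := by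
      have h2 := hproj z hzm
      have h3 : ∀ x, (pe v x - w x) * pe z x = pe z x ^ 2 - (w x - c) * pe z x := fun x => by
        rw [hze]; ring
      simp_rw [h3] at h2
      rw [integral_sub hzL.integrable_sq hwz] at h2
      linarith
    have h4 : ∫ x in K, (w x - c) * pe z x ≤ ∫ x in K, (pe z x ^ 2 / 2 + (w x - c) ^ 2 / 2) := by
      refine integral_mono hwz
        ((hzL.integrable_sq.div_const 2).add (hwc.integrable_sq.div_const 2)) fun x => ?_
      dsimp only
      nlinarith [sq_nonneg (w x - c - pe z x)]
    rw [integral_add (hzL.integrable_sq.div_const 2) (hwc.integrable_sq.div_const 2),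
      integral_div, integral_div] at h4
    have h5 : ∫ x in K, (w x - c) ^ 2 ≤ ∫ x in K, (2 * (w x - a x) ^ 2 + 2 * (a x - c) ^ 2) := by
      refine integral_mono hwc.integrable_sq ((hwa.integrable_sq.const_mul 2).add
        (integrable_of_continuous (by fun_prop) hKc)) fun x => ?_
      dsimp only
      nlinarith [sq_nonneg (w x - a x - (a x - c))]
    rw [integral_add (hwa.integrable_sq.const_mul 2)
      (integrable_of_continuous (by fun_prop) hKc), integral_const_mul, integral_const_mul] at h5
    linarith
  -- Subtracting the constant does not change the gradient, so the inverse inequality may be applied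
  -- to `z` in place of `v`.
  have hgrad : ∫ x in K, ‖gradient (pe v) x‖ ^ 2 ≤ C₁ * Z := by
    have h1 : ∀ x, gradient (pe v) x = gradient (pe z) x := fun x => by
      ext k; rw [gradient_pe, gradient_pe, hz]; simp
    simp_rw [h1]
    exact H₁ z hzm
  have hgac : ∀ x, gradient (fun y => a y - c) x = gradient a x := fun x => by
    simp [gradient, fderiv_sub_const]
  -- On a facet `a - v = (a - c) - z`: the trace inequality handles the first term, the polynomial
  -- trace inequality the second.
  have hface : ∀ F : FIdx s n, ∫ y in refElem s n, (a (facetMap F y) - pe v (facetMap F y)) ^ 2 ≤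
      2 * (C₃ F * (Dl + A)) + 2 * (C₂ F * Z) := by
    intro F
    have hfc := continuous_facetMap F
    have h1 := H₃ F (fun x => a x - c) (ha.sub contDiff_const)
    simp_rw [hgac] at h1
    rw [integral_add (integrable_of_continuous (by fun_prop) hKc)
      (integrable_of_continuous (by fun_prop) hKc)] at h1
    have h2 := H₂ F z hzm
    have hi1 : Integrable (fun y => (a (facetMap F y) - c) ^ 2) (volume.restrict (refElem s n)) :=
      integrable_of_continuous (by fun_prop) (isCompact_refElem s n)
    have hi2 : Integrable (fun y => pe z (facetMap F y) ^ 2) (volume.restrict (refElem s n)) :=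
      integrable_of_continuous (by fun_prop) (isCompact_refElem s n)
    have h3 : ∫ y in refElem s n, (a (facetMap F y) - pe v (facetMap F y)) ^ 2 ≤
        ∫ y in refElem s n, (2 * (a (facetMap F y) - c) ^ 2 + 2 * pe z (facetMap F y) ^ 2) := by
      refine integral_mono (integrable_of_continuous (by fun_prop) (isCompact_refElem s n))
        ((hi1.const_mul 2).add (hi2.const_mul 2)) fun y => ?_
      have hvz : pe v (facetMap F y) = pe z (facetMap F y) + c := by rw [hze]; ring
      dsimp only
      rw [hvz]
      nlinarith [sq_nonneg (a (facetMap F y) - c + pe z (facetMap F y))]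
    rw [integral_add (hi1.const_mul 2) (hi2.const_mul 2), integral_const_mul,
      integral_const_mul] at h3
    linarith
  have hsum := Finset.sum_le_sum fun F (_ : F ∈ Finset.univ) => hface F
  rw [Finset.sum_add_distrib, ← Finset.mul_sum, ← Finset.mul_sum, ← Finset.sum_mul,
    ← Finset.sum_mul] at hsum
  have hZ2 : Z ≤ (2 + 2 * C₀) * (A + W) := by nlinarith
  have hDA : Dl + A ≤ (C₀ + 1) * (A + W) := by nlinarith
  have h1 : (C₁ + 2 * ∑ F, C₂ F) * Z ≤ (C₁ + 2 * ∑ F, C₂ F) * ((2 + 2 * C₀) * (A + W)) :=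
    mul_le_mul_of_nonneg_left hZ2 (by positivity)
  have h2 : 2 * (∑ F, C₃ F) * (Dl + A) ≤ 2 * (∑ F, C₃ F) * ((C₀ + 1) * (A + W)) :=
    mul_le_mul_of_nonneg_left hDA (by positivity)
  linarith

/-! ### The hybrid mixed form on the reference elements -/

/-- The integral of a polynomial over the reference element. -/
def refInt (s : Shape) (d : ℕ) : MvPolynomial (Fin d) ℝ →ₗ[ℝ] ℝ where
  toFun q := ∫ x in refElem s d, pe q x
  map_add' p q := by
    rw [pe_add]
    exact integral_add (integrable_of_continuous (continuous_pe p) (isCompact_refElem _ _))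
      (integrable_of_continuous (continuous_pe q) (isCompact_refElem _ _))
  map_smul' c q := by
    have : ∀ x : Space d, pe (c • q) x = c * pe q x := fun x => by simp [pe]
    simp_rw [this, integral_const_mul]
    rfl

theorem refInt_apply (s : Shape) (d : ℕ) (q : MvPolynomial (Fin d) ℝ) :
    refInt s d q = ∫ x in refElem s d, pe q x := rfl

theorem pe_mul {d : ℕ} (p q : MvPolynomial (Fin d) ℝ) (x : Space d) :
    pe (p * q) x = pe p x * pe q x := by simp [pe]

theorem pe_sub {d : ℕ} (p q : MvPolynomial (Fin d) ℝ) (x : Space d) :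
    pe (p - q) x = pe p x - pe q x := by simp [pe]

theorem eq_zero_of_refInt_sq {s : Shape} {d : ℕ} {q : MvPolynomial (Fin d) ℝ}
    (h : refInt s d (q ^ 2) = 0) : q = 0 := by
  refine eq_zero_of_integral_pe_sq q (isCompact_refElem s d) (interior_refElem_nonempty s d) ?_
  rw [refInt_apply] at h
  rw [← h]
  congr 1; funext x; simp [pe]

theorem refInt_sq_nonneg (s : Shape) {d : ℕ} (q : MvPolynomial (Fin d) ℝ) :
    0 ≤ refInt s d (q ^ 2) := by
  rw [refInt_apply]
  exact integral_nonneg fun x => by simp [pe, sq_nonneg]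

/-- The outward normal component on the facet `F`, scaled by the surface element. -/
def normalRef {s : Shape} {n : ℕ} (F : FIdx s n) (z : Fin (n + 1) → ℝ) : ℝ :=
  F.orient * (z F.dir - F.slope * ∑ j, z (F.dir.succAbove j))

/-- The trace of the normal component of a polynomial field on the facet `F`. -/
def normalPoly {s : Shape} {n : ℕ} (F : FIdx s n) :
    (Fin (n + 1) → MvPolynomial (Fin (n + 1)) ℝ) →ₗ[ℝ] MvPolynomial (Fin n) ℝ :=
  (MvPolynomial.aeval (facetSub F)).toLinearMap.comp
      (F.orient • (LinearMap.proj F.dir - F.slope • ∑ j, LinearMap.proj (F.dir.succAbove j)))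

theorem pe_normalPoly {s : Shape} {n : ℕ} (F : FIdx s n)
    (r : Fin (n + 1) → MvPolynomial (Fin (n + 1)) ℝ) (y : Space n) :
    pe (normalPoly F r) y = normalRef F fun k => pe (r k) (facetMap F y) := by
  simp only [normalPoly, LinearMap.comp_apply, AlgHom.toLinearMap_apply, pe_facetSub, normalRef]
  simp [pe]

/-- The local form `(r, ∇u) - (u - μ, r ⬝ n)` on the reference element. -/
def bRef {s : Shape} {n : ℕ} (r : Fin (n + 1) → MvPolynomial (Fin (n + 1)) ℝ)
    (u : MvPolynomial (Fin (n + 1)) ℝ) (μ : FIdx s n → MvPolynomial (Fin n) ℝ) : ℝ :=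
  refInt s (n + 1) (∑ k, r k * MvPolynomial.pderiv k u) -
    ∑ F, refInt s n ((MvPolynomial.aeval (facetSub F) u - μ F) * normalPoly F r)

theorem bRef_eq {s : Shape} {n : ℕ} (r : Fin (n + 1) → MvPolynomial (Fin (n + 1)) ℝ)
    (u : MvPolynomial (Fin (n + 1)) ℝ) (μ : FIdx s n → MvPolynomial (Fin n) ℝ) :
    bRef r u μ = (∫ x in refElem s (n + 1), ∑ k, pe (r k) x * pe (MvPolynomial.pderiv k u) x) -
      ∑ F, ∫ y in refElem s n, (pe u (facetMap F y) - pe (μ F) y) *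
        normalRef F fun k => pe (r k) (facetMap F y) := by
  simp only [bRef, refInt_apply, pe_mul, pe_sub, pe_normalPoly, pe_facetSub]
  congr 3; funext x; simp [pe]

/-- `bRef` as a bilinear form. -/
def bRefL (s : Shape) (n : ℕ) : (Fin (n + 1) → MvPolynomial (Fin (n + 1)) ℝ) →ₗ[ℝ]
    (MvPolynomial (Fin (n + 1)) ℝ × (FIdx s n → MvPolynomial (Fin n) ℝ)) →ₗ[ℝ] ℝ :=
  LinearMap.mk₂ ℝ (fun r x => bRef r x.1 x.2)
    (fun r r' x => by
      simp only [bRef, Pi.add_apply, add_mul, Finset.sum_add_distrib, map_add, mul_add]; ring)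
    (fun c r x => by
      simp only [bRef, Pi.smul_apply, smul_mul_assoc, mul_smul_comm, ← Finset.smul_sum, map_smul,
        smul_sub])
    (fun r x x' => by
      simp only [bRef, Prod.fst_add, Prod.snd_add, Pi.add_apply, map_add, mul_add, sub_mul, add_mul,
        Finset.sum_add_distrib, map_sub, Finset.sum_sub_distrib]; ring)
    (fun c r x => by
      simp only [bRef, Prod.smul_fst, Prod.smul_snd, Pi.smul_apply, map_smul, Derivation.map_smul,
        ← smul_sub, smul_mul_assoc, mul_smul_comm, ← Finset.smul_sum])

theorem bRefL_apply (s : Shape) (n : ℕ) (r : Fin (n + 1) → MvPolynomial (Fin (n + 1)) ℝ) (x) :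
    bRefL s n r x = bRef r x.1 x.2 := rfl

/-- The trace of `u` minus `μ`, on the facet `F`. -/
def gapRef {s : Shape} {n : ℕ} (u : MvPolynomial (Fin (n + 1)) ℝ)
    (μ : FIdx s n → MvPolynomial (Fin n) ℝ) (F : FIdx s n) : MvPolynomial (Fin n) ℝ :=
  MvPolynomial.aeval (facetSub F) u - μ F

theorem gapRef_mem {s : Shape} {n p : ℕ} {u : MvPolynomial (Fin (n + 1)) ℝ}
    (hu : u ∈ polySpace s (n + 1) p) {μ : FIdx s n → MvPolynomial (Fin n) ℝ}
    (hμ : ∀ F, μ F ∈ polySpace s n p) (F : FIdx s n) : gapRef u μ F ∈ polySpace s n p :=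
  Submodule.sub_mem _ ((admSub_facetSub F).aeval_mem hu) (hμ F)

theorem facetSub_liftSub {s : Shape} {n : ℕ} (F : FIdx s n) (q : MvPolynomial (Fin n) ℝ) :
    MvPolynomial.aeval (facetSub F) (MvPolynomial.aeval (liftSub F.dir) q) = q := by
  have : (MvPolynomial.aeval (facetSub F)).comp (MvPolynomial.aeval (liftSub F.dir)) =
      AlgHom.id ℝ _ := MvPolynomial.algHom_ext fun j => by simp [liftSub, facetSub]
  exact DFunLike.congr_fun this q

/-- The interior of the unit simplex, as a subset of the interior of the reference element. -/
theorem openSimplex_subset_interior (s : Shape) (d : ℕ) :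
    {x : Space d | (∀ i, 0 < x i) ∧ ∑ i, x i < 1} ⊆ interior (refElem s d) := by
  refine interior_maximal (fun x hx => ?_) ?_
  · have : x ∈ refElem .simplex d := ⟨fun i => (hx.1 i).le, hx.2.le⟩
    cases s with
    | cube => exact refElem_subset_cube _ _ this
    | simplex => exact this
  · have : {x : Space d | (∀ i, 0 < x i) ∧ ∑ i, x i < 1}
        = (⋂ i, {x : Space d | 0 < x i}) ∩ {x | ∑ i, x i < 1} := by
      ext x; simp
    rw [this]
    exact (isOpen_iInter_of_finite fun i => isOpen_lt continuous_const (continuous_coord i)).inter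
      (isOpen_lt (continuous_finsetSum _ fun i _ => continuous_coord i) continuous_const)

theorem eq_zero_of_openSimplex {d : ℕ} (q : MvPolynomial (Fin d) ℝ)
    (h : ∀ x : Space d, (∀ i, 0 < x i) → ∑ i, x i < 1 → pe q x = 0) : q = 0 := by
  set U := {x : Space d | (∀ i, 0 < x i) ∧ ∑ i, x i < 1}
  refine eq_zero_of_pe_eq_zero q U ?_ fun x hx => h x (interior_subset hx).1 (interior_subset hx).2
  have hU : IsOpen U := by
    have : U = (⋂ i, {x : Space d | 0 < x i}) ∩ {x | ∑ i, x i < 1} := by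
      ext x; simp [U]
    rw [this]
    exact (isOpen_iInter_of_finite fun i => isOpen_lt continuous_const (continuous_coord i)).inter
      (isOpen_lt (continuous_finsetSum _ fun i _ => continuous_coord i) continuous_const)
  rw [hU.interior_eq]
  refine ⟨WithLp.toLp 2 (fun _ => 1 / (d + 1 : ℝ)), fun i => ?_, ?_⟩
  · simp only; positivity
  · simp only [Finset.sum_const, Finset.card_univ, Fintype.card_fin, nsmul_eq_mul]
    rw [mul_one_div, div_lt_one (by positivity)]
    linarith

/-- A polynomial which is nonnegative on the reference element and has integral zero vanishes. -/
theorem pe_eq_zero_of_refInt_eq_zero {s : Shape} {d : ℕ} {q : MvPolynomial (Fin d) ℝ}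
    (h0 : ∀ x ∈ refElem s d, 0 ≤ pe q x) (h : refInt s d q = 0) :
    ∀ x ∈ interior (refElem s d), pe q x = 0 := by
  have h1 : ∫ x in refElem s d, ‖Real.sqrt (pe q x)‖ ^ 2 = 0 := by
    rw [← h, refInt_apply]
    refine setIntegral_congr_fun (measurableSet_refElem s d) fun x hx => ?_
    rw [Real.norm_eq_abs, sq_abs, Real.sq_sqrt (h0 x hx)]
  intro x hx
  have := eq_zero_of_integral_sq_eq_zero (Real.continuous_sqrt.comp (continuous_pe q))
    (isCompact_refElem s d) h1 x hx
  exact (Real.sqrt_eq_zero (h0 x (interior_subset hx))).1 this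

/-- A field isolating the facet `F` shows that `u = μ` on `F`. -/
theorem gapRef_eq_zero_of_isolating {s : Shape} {n : ℕ} {u : MvPolynomial (Fin (n + 1)) ℝ}
    {μ : FIdx s n → MvPolynomial (Fin n) ℝ} (hu : ∀ k, MvPolynomial.pderiv k u = 0) (F : FIdx s n)
    (r : Fin (n + 1) → MvPolynomial (Fin (n + 1)) ℝ) (hb : bRef r u μ = 0)
    (h1 : ∀ y, (normalRef F fun k => pe (r k) (facetMap F y)) = pe (gapRef u μ F) y)
    (h2 : ∀ F', F' ≠ F → ∀ y, (normalRef F' fun k => pe (r k) (facetMap F' y)) = 0) :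
    gapRef u μ F = 0 := by
  refine eq_zero_of_refInt_sq (s := s) ?_
  rw [bRef_eq, Finset.sum_eq_single F (fun F' _ hF' => by simp [h2 F' hF']) (by simp)] at hb
  simp only [hu, h1] at hb
  rw [refInt_apply]
  have h3 : ∀ y, pe (gapRef u μ F ^ 2) y = (pe u (facetMap F y) - pe (μ F) y) *
      pe (gapRef u μ F) y := fun y => by
    rw [sq, pe_mul]; congr 1
    rw [gapRef, pe_sub, pe_facetSub]
  simp_rw [h3]
  simpa [pe] using hb

theorem mem_rtSpace_scalar {s : Shape} {d p : ℕ} {r : Fin d → MvPolynomial (Fin d) ℝ}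
    (g : Fin d → MvPolynomial (Fin d) ℝ) (t : MvPolynomial (Fin d) ℝ)
    (hg : ∀ k, g k ∈ polySpace s d p) (ht : t ∈ polySpace s d p)
    (hr : ∀ k, r k = g k + MvPolynomial.X k * t) : r ∈ rtSpace s d p .scalar := by
  have : r = g + LinearMap.pi (fun i => LinearMap.mulLeft ℝ (MvPolynomial.X i)) t := by
    funext k; simp [hr]
  rw [this]
  exact Submodule.add_mem_sup (fun k _ => hg k) (Submodule.mem_map_of_mem ht)

theorem mem_rtSpace_componentwise {s : Shape} {d p : ℕ} {r : Fin d → MvPolynomial (Fin d) ℝ}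
    (g t : Fin d → MvPolynomial (Fin d) ℝ)
    (hg : ∀ k, g k ∈ polySpace s d p) (ht : ∀ k, t k ∈ polySpace s d p)
    (hr : ∀ k, r k = g k + MvPolynomial.X k * t k) : r ∈ rtSpace s d p .componentwise := by
  intro k _
  have : r k = g k + LinearMap.mulLeft ℝ (MvPolynomial.X k) (t k) := by simp [hr]
  simp only
  rw [this]
  exact Submodule.add_mem_sup (hg k) (Submodule.mem_map_of_mem (ht k))

theorem normalRef_facet_simplex_none {n : ℕ} (y : Space n) :
    ∑ k, facetMap (s := .simplex) (none : Option (Fin (n + 1))) y k = 1 := by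
  simp only [facetMap, sum_ins]
  simp [FIdx.cst, FIdx.slope]

theorem normalRef_simplex_none {n : ℕ} (z : Fin (n + 1) → ℝ) :
    normalRef (s := .simplex) (none : Option (Fin (n + 1))) z = ∑ k, z k := by
  rw [Fin.sum_univ_succAbove z 0]
  simp [normalRef, FIdx.orient, FIdx.slope, FIdx.dir]

theorem normalRef_simplex_some {n : ℕ} (i : Fin (n + 1)) (z : Fin (n + 1) → ℝ) :
    normalRef (s := .simplex) (some i : Option (Fin (n + 1))) z = -z i := by
  simp [normalRef, FIdx.orient, FIdx.slope, FIdx.dir]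

theorem facetMap_simplex_some {n : ℕ} (i : Fin (n + 1)) (y : Space n) :
    facetMap (s := .simplex) (some i : Option (Fin (n + 1))) y i = 0 := by
  simp [facetMap, FIdx.cst, FIdx.slope, FIdx.dir]

/-- The field `r_k = x_k (∂_k u - t)` with `t = ∑ x_j ∂_j u` has zero normal component on every
facet and tests the gradient against a nonnegative quantity. Once `∇u = 0`, fields with normal
component on a single facet test the gap there against itself. -/
theorem bRef_kernel_simplex {n p : ℕ} {u : MvPolynomial (Fin (n + 1)) ℝ}
    {μ : FIdx .simplex n → MvPolynomial (Fin n) ℝ} (hu : u ∈ polySpace .simplex (n + 1) p)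
    (hμ : ∀ F, μ F ∈ polySpace .simplex n p)
    (hb : ∀ r ∈ rtSpace .simplex (n + 1) p .scalar, bRef r u μ = 0) :
    (∀ k, MvPolynomial.pderiv k u = 0) ∧ ∀ F, gapRef u μ F = 0 := by
  have hgrad : ∀ k, MvPolynomial.pderiv k u = 0 := by
    obtain ⟨t, ht⟩ : ∃ t, t = ∑ j, MvPolynomial.X j * MvPolynomial.pderiv j u := ⟨_, rfl⟩
    have htm : t ∈ polySpace .simplex (n + 1) p :=
      ht ▸ Submodule.sum_mem _ fun j _ => X_mul_pderiv_mem hu j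
    have hpt : ∀ x, pe t x = ∑ j, x j * pe (MvPolynomial.pderiv j u) x := fun x => by
      rw [ht]; simp [pe]
    -- Since `x_k ∂_k u` and `t` both lie in `𝒫_p`, this field has the form `[𝒫_p]^d + x 𝒫_p`.
    have h0 := hb (fun k => MvPolynomial.X k * MvPolynomial.pderiv k u + MvPolynomial.X k * -t)
      (mem_rtSpace_scalar _ (-t) (fun k => X_mul_pderiv_mem hu k) (Submodule.neg_mem _ htm)
        fun k => rfl)
    have hr : ∀ k x, pe (MvPolynomial.X k * MvPolynomial.pderiv k u + MvPolynomial.X k * -t) x =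
        x k * (pe (MvPolynomial.pderiv k u) x - pe t x) := fun k x => by
      simp [pe]; ring
    have hn : ∀ (F : FIdx .simplex n) (y : Space n), normalRef F (fun k =>
        pe (MvPolynomial.X k * MvPolynomial.pderiv k u + MvPolynomial.X k * -t) (facetMap F y)) =
          0 := by
      intro F y
      simp_rw [hr]
      match F with
      | some i => rw [normalRef_simplex_some, facetMap_simplex_some]; simp
      | none =>
        rw [normalRef_simplex_none]
        simp only [mul_sub, Finset.sum_sub_distrib, ← Finset.sum_mul]
        rw [normalRef_facet_simplex_none, hpt]; ring
    have h1 : refInt .simplex (n + 1) (∑ k, (MvPolynomial.X k * MvPolynomial.pderiv k u +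
        MvPolynomial.X k * -t) * MvPolynomial.pderiv k u) = 0 := by
      rw [bRef_eq] at h0
      simp only [hn, mul_zero, integral_zero, Finset.sum_const_zero, sub_zero] at h0
      rw [refInt_apply, ← h0]
      congr 1; funext x; simp [pe]
    have hval : ∀ x, pe (∑ k, (MvPolynomial.X k * MvPolynomial.pderiv k u +
        MvPolynomial.X k * -t) * MvPolynomial.pderiv k u) x =
        ∑ k, x k * pe (MvPolynomial.pderiv k u) x ^ 2 - pe t x ^ 2 := by
      intro x
      have : pe (∑ k, (MvPolynomial.X k * MvPolynomial.pderiv k u +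
        MvPolynomial.X k * -t) * MvPolynomial.pderiv k u) x = ∑ k, x k *
          (pe (MvPolynomial.pderiv k u) x - pe t x) * pe (MvPolynomial.pderiv k u) x := by
        simp only [← hr]; simp [pe]
      rw [this, sq (pe t x)]
      nth_rewrite 2 [hpt]
      rw [Finset.sum_mul, ← Finset.sum_sub_distrib]
      exact Finset.sum_congr rfl fun k _ => by ring
    -- Cauchy--Schwarz with weights `x_k`. As `∑ x_k ≤ 1`, it makes the integrand `∑ x_k (∂_k u)² -
    -- t²` nonnegative on the simplex.
    have hcs : ∀ x : Space (n + 1), (∀ k, 0 ≤ x k) → pe t x ^ 2 ≤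
        (∑ k, x k) * ∑ k, x k * pe (MvPolynomial.pderiv k u) x ^ 2 := by
      intro x hx
      rw [hpt]
      exact Finset.sum_sq_le_sum_mul_sum_of_sq_le_mul _ (fun k _ => hx k)
        (fun k _ => mul_nonneg (hx k) (sq_nonneg _)) fun k _ => le_of_eq (by ring)
    have hS : ∀ x : Space (n + 1), (∀ k, 0 ≤ x k) →
        0 ≤ ∑ k, x k * pe (MvPolynomial.pderiv k u) x ^ 2 := fun x hx =>
      Finset.sum_nonneg fun k _ => mul_nonneg (hx k) (sq_nonneg _)
    have h2 := pe_eq_zero_of_refInt_eq_zero (fun x hx => by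
      rw [hval]
      have := hcs x hx.1; have := hS x hx.1; have := hx.2
      nlinarith) h1
    intro k
    refine eq_zero_of_openSimplex _ fun x hx hx1 => ?_
    have h3 := h2 x (openSimplex_subset_interior _ _ ⟨hx, hx1⟩)
    rw [hval] at h3
    have h4 := hcs x (fun k => (hx k).le)
    have h5 := hS x (fun k => (hx k).le)
    -- In the open simplex `∑ x_k < 1`, so equality in the previous bound leaves no room for a
    -- positive sum.
    have h6 : ∑ k, x k * pe (MvPolynomial.pderiv k u) x ^ 2 = 0 := by
      by_contra hne
      have : 0 < ∑ k, x k * pe (MvPolynomial.pderiv k u) x ^ 2 := lt_of_le_of_ne h5 (Ne.symm hne)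
      nlinarith
    have h7 := (Finset.sum_eq_zero_iff_of_nonneg
      (fun k _ => mul_nonneg (hx k).le (sq_nonneg _))).1 h6 k (Finset.mem_univ k)
    simpa [(hx k).ne'] using h7
  refine ⟨hgrad, fun F => ?_⟩
  obtain ⟨t, ht⟩ : ∃ t, t = MvPolynomial.aeval (liftSub F.dir) (gapRef u μ F) := ⟨_, rfl⟩
  have htm : t ∈ polySpace .simplex (n + 1) p :=
    ht ▸ (admSub_liftSub _).aeval_mem (gapRef_mem hu hμ F)
  have htF : ∀ y, pe t (facetMap F y) = pe (gapRef u μ F) y := fun y => by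
    rw [ht, ← pe_facetSub, facetSub_liftSub]
  match F with
  | some i =>
    -- The field `(x - e_i) t`, where `e_i` is the vertex opposite to the facet `x_i = 0`: it is
    -- tangential on all facets through that vertex.
    have hrm := mem_rtSpace_scalar (p := p) (s := .simplex)
      (r := fun k => -(Pi.single i t : Fin (n + 1) → _) k + MvPolynomial.X k * t)
      _ t (fun k => Submodule.neg_mem _ (by
        by_cases h : k = i
        · subst h; simpa using htm
        · simp [h])) htm fun k => rfl
    have hr : ∀ k x, pe (-(Pi.single i t : Fin (n + 1) → _) k + MvPolynomial.X k * t) x =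
        (x k - if k = i then 1 else 0) * pe t x := fun k x => by
      by_cases h : k = i
      · subst h; simp [pe]; ring
      · simp [pe, h]
    refine gapRef_eq_zero_of_isolating hgrad _ _ (hb _ hrm) (fun y => ?_) (fun F' hF' y => ?_)
    · simp_rw [hr]
      rw [normalRef_simplex_some, facetMap_simplex_some, htF]; simp
    · simp_rw [hr]
      match F' with
      | some j =>
        have hji : j ≠ i := fun e => hF' (by rw [e])
        rw [normalRef_simplex_some, facetMap_simplex_some]; simp [hji]
      | none =>
        rw [normalRef_simplex_none, ← Finset.sum_mul, Finset.sum_sub_distrib,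
          normalRef_facet_simplex_none]
        simp
  | none =>
    -- The field `x t`: the origin is the vertex opposite to the slanted facet.
    have hrm := mem_rtSpace_scalar (p := p) (s := .simplex)
      (r := fun k => (0 : Fin (n + 1) → MvPolynomial (Fin (n + 1)) ℝ) k + MvPolynomial.X k * t)
      _ t (fun k => Submodule.zero_mem _) htm fun k => rfl
    have hr : ∀ k x, pe ((0 : Fin (n + 1) → MvPolynomial (Fin (n + 1)) ℝ) k +
        MvPolynomial.X k * t) x = x k * pe t x := fun k x => by simp [pe]
    refine gapRef_eq_zero_of_isolating hgrad _ _ (hb _ hrm) (fun y => ?_) (fun F' hF' y => ?_)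
    · simp_rw [hr]
      rw [normalRef_simplex_none, ← Finset.sum_mul, normalRef_facet_simplex_none, htF, one_mul]
    · simp_rw [hr]
      match F' with
      | some j => rw [normalRef_simplex_some, facetMap_simplex_some]; simp
      | none => exact absurd rfl hF'

/-! ### The kernel of the hybrid form on the cube -/

theorem facetMap_cube {n : ℕ} (i : Fin (n + 1)) (b : Bool) (y : Space n) :
    facetMap (s := .cube) (i, b) y = ins i (if b then 1 else 0) y := by
  simp [facetMap, FIdx.dir, FIdx.cst, FIdx.slope]

theorem facetSub_cube_dir {n : ℕ} (i : Fin (n + 1)) (b : Bool) :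
    MvPolynomial.aeval (facetSub (s := .cube) (i, b)) (MvPolynomial.X i : MvPolynomial _ ℝ) =
      if b then 1 else 0 := by
  refine MvPolynomial.funext fun y => ?_
  have := pe_facetSub (s := .cube) (i, b) (MvPolynomial.X i) (WithLp.toLp 2 y)
  rw [facetMap_cube] at this
  simp only [pe] at this
  rw [this]
  cases b <;> simp

theorem normalPoly_cube {n : ℕ} (i : Fin (n + 1)) (b : Bool)
    (r : Fin (n + 1) → MvPolynomial (Fin (n + 1)) ℝ) :
    normalPoly (s := .cube) (i, b) r =
      (if b then 1 else -1 : ℝ) • MvPolynomial.aeval (facetSub (s := .cube) (i, b)) (r i) := by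
  cases b <;> simp [normalPoly, FIdx.dir, FIdx.slope, FIdx.orient]

theorem setIntegral_cube {n : ℕ} (i : Fin (n + 1)) {f : Space (n + 1) → ℝ} (hf : Continuous f) :
    ∫ x in refElem .cube (n + 1), f x =
      ∫ y in refElem .cube n, ∫ t in (0 : ℝ)..1, f (ins i t y) := by
  have hpre : insEquiv i ⁻¹' refElem .cube (n + 1) = Icc (0 : ℝ) 1 ×ˢ refElem .cube n := by
    ext q
    simp only [mem_preimage, insEquiv_apply, ins_mem_cube, mem_prod, mem_Icc]
  rw [← (measurePreserving_insEquiv i).setIntegral_preimage_emb (insEquiv i).measurableEmbedding,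
    hpre, ← Measure.prod_restrict, integral_prod_symm]
  · refine integral_congr_ae (Eventually.of_forall fun y => ?_)
    simp only [insEquiv_apply]
    rw [intervalIntegral.integral_of_le zero_le_one, integral_Icc_eq_integral_Ioc]
  · rw [Measure.prod_restrict]
    have : Continuous fun q : ℝ × Space n => f (insEquiv i q) := hf.comp (continuous_ins i)
    exact this.continuousOn.integrableOn_compact (isCompact_Icc.prod (isCompact_refElem _ _))

theorem hasDerivAt_pe_ins {n : ℕ} (i : Fin (n + 1)) (q : MvPolynomial (Fin (n + 1)) ℝ)
    (y : Space n) (t : ℝ) : HasDerivAt (fun t => pe q (ins i t y))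
      (pe (MvPolynomial.pderiv i q) (ins i t y)) t := by
  have hd : HasDerivAt (fun t : ℝ => ins i t y) (EuclideanSpace.single i 1) t := by
    have : (fun t : ℝ => ins i t y) = fun t => ins i 0 y +
        t • (EuclideanSpace.single i 1 : Space (n + 1)) := by
      funext t; ext k
      refine Fin.succAboveCases i ?_ (fun j => ?_) k <;> simp [Fin.succAbove_ne]
    rw [this]
    simpa using ((hasDerivAt_id t).smul_const (EuclideanSpace.single i 1 : Space (n + 1))).const_add
      (ins i 0 y)
  have := (hasFDerivAt_pe q (ins i t y)).comp_hasDerivAt t hd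
  have hs : (∑ k, pe (MvPolynomial.pderiv k q) (ins i t y) •
      (EuclideanSpace.proj k : Space (n + 1) →L[ℝ] ℝ)) (EuclideanSpace.single i 1) =
        pe (MvPolynomial.pderiv i q) (ins i t y) := by
    simp
  rw [hs] at this
  exact this

/-- The divergence theorem on the cube, in one direction. -/
theorem refInt_pderiv_cube {n : ℕ} (i : Fin (n + 1)) (q : MvPolynomial (Fin (n + 1)) ℝ) :
    refInt .cube (n + 1) (MvPolynomial.pderiv i q) =
      refInt .cube n (MvPolynomial.aeval (facetSub (s := .cube) (i, true)) q) -
        refInt .cube n (MvPolynomial.aeval (facetSub (s := .cube) (i, false)) q) := by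
  rw [refInt_apply, setIntegral_cube i (continuous_pe _), ← map_sub, refInt_apply]
  refine integral_congr_ae (Eventually.of_forall fun y => ?_)
  simp only
  rw [intervalIntegral.integral_eq_sub_of_hasDerivAt (fun t _ => hasDerivAt_pe_ins i q y t)
    (((continuous_pe _).comp ((continuous_ins i).comp
      (continuous_id.prodMk continuous_const))).intervalIntegrable _ _), pe_sub]
  have h := fun b => (pe_facetSub (s := .cube) (i, b) q y).trans
    (congrArg (pe q) (facetMap_cube i b y))
  refine Eq.trans ?_ (congrArg₂ (· - ·) (h true) (h false)).symm
  simp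

theorem pderiv_liftSub {n : ℕ} (i : Fin (n + 1)) (q : MvPolynomial (Fin n) ℝ) :
    MvPolynomial.pderiv i (MvPolynomial.aeval (liftSub i) q) = 0 := by
  refine MvPolynomial.funext fun x => ?_
  have h1 := hasDerivAt_pe_ins i (MvPolynomial.aeval (liftSub i) q) (drop i (WithLp.toLp 2 x)) (x i)
  simp only [pe_liftSub, drop_ins] at h1
  have h2 := h1.unique (hasDerivAt_const (x i) _)
  have h3 : ins i (x i) (drop i (WithLp.toLp 2 x)) = WithLp.toLp 2 x :=
    ins_drop i (WithLp.toLp 2 x)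
  rw [h3] at h2
  simpa [pe] using h2

/-- The divergence theorem for `x_i c u` with `c` independent of `x_i`. The factor `x_i` removes the
contribution of the face `x_i = 0`. -/
theorem refInt_cube_by_parts {n : ℕ} (i : Fin (n + 1)) (c : MvPolynomial (Fin n) ℝ)
    (u : MvPolynomial (Fin (n + 1)) ℝ) :
    refInt .cube (n + 1) (MvPolynomial.X i * MvPolynomial.aeval (liftSub i) c *
        MvPolynomial.pderiv i u) =
      refInt .cube n (c * MvPolynomial.aeval (facetSub (s := .cube) (i, true)) u) -
        refInt .cube (n + 1) (MvPolynomial.aeval (liftSub i) c * u) := by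
  have h := refInt_pderiv_cube i (MvPolynomial.X i * MvPolynomial.aeval (liftSub i) c * u)
  have hl : MvPolynomial.aeval (facetSub (s := .cube) (i, true))
      (MvPolynomial.aeval (liftSub i) c) = c := facetSub_liftSub (s := .cube) (i, true) c
  simp only [map_mul, facetSub_cube_dir, hl, Derivation.leibniz, pderiv_liftSub,
    MvPolynomial.pderiv_X_self, smul_eq_mul, mul_zero, zero_add, mul_one, map_add, if_true, one_mul,
    zero_mul, map_zero, sub_zero, Bool.false_eq_true, if_false] at h
  rw [mul_comm u, ] at h
  linarith

theorem refInt_liftSub {n : ℕ} (i : Fin (n + 1)) (c : MvPolynomial (Fin n) ℝ) :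
    refInt .cube (n + 1) (MvPolynomial.aeval (liftSub i) c) = refInt .cube n c := by
  have h := refInt_cube_by_parts i c 1
  simp only [map_one, mul_one, MvPolynomial.pderiv_one, mul_zero, map_zero] at h
  linarith

/-- The part of the hybrid form on the cube which involves the `i`-th component. -/
def cubePart {n : ℕ} (u : MvPolynomial (Fin (n + 1)) ℝ)
    (μ : FIdx .cube n → MvPolynomial (Fin n) ℝ) (i : Fin (n + 1))
    (w : MvPolynomial (Fin (n + 1)) ℝ) : ℝ :=
  refInt .cube (n + 1) (w * MvPolynomial.pderiv i u) -
    refInt .cube n (gapRef u μ (i, true) * MvPolynomial.aeval (facetSub (s := .cube) (i, true)) w) +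
    refInt .cube n (gapRef u μ (i, false) * MvPolynomial.aeval (facetSub (s := .cube) (i, false)) w)

theorem bRef_cube {n : ℕ} (r : Fin (n + 1) → MvPolynomial (Fin (n + 1)) ℝ)
    (u : MvPolynomial (Fin (n + 1)) ℝ) (μ : FIdx .cube n → MvPolynomial (Fin n) ℝ) :
    bRef r u μ = ∑ i, cubePart u μ i (r i) := by
  have : (∑ F : FIdx .cube n, refInt .cube n
      ((MvPolynomial.aeval (facetSub F) u - μ F) * normalPoly F r)) =
      ∑ i : Fin (n + 1), ∑ b : Bool, refInt .cube n (gapRef u μ (i, b) * normalPoly (s := .cube)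
        (i, b) r) := by
    rw [← Fintype.sum_prod_type']; rfl
  rw [bRef, this, map_sum, ← Finset.sum_sub_distrib]
  refine Finset.sum_congr rfl fun i _ => ?_
  simp only [Fintype.sum_bool, normalPoly_cube, if_true, Bool.false_eq_true, if_false, one_smul,
    neg_smul, mul_neg, map_neg, cubePart]
  ring

theorem bRef_cube_single {n : ℕ} (i : Fin (n + 1)) (w : MvPolynomial (Fin (n + 1)) ℝ)
    (u : MvPolynomial (Fin (n + 1)) ℝ) (μ : FIdx .cube n → MvPolynomial (Fin n) ℝ) :
    bRef (Pi.single i w) u μ = cubePart u μ i w := by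
  rw [bRef_cube, Finset.sum_eq_single i (fun j _ hj => by simp [Pi.single_eq_of_ne hj, cubePart])
    (by simp), Pi.single_eq_same]

/-- The components can be tested separately. The component `x_i (1 - x_i) ∂_i u` vanishes on both
faces and forces `∂_i u = 0`; afterwards `1 - x_i` and `x_i` times the lifted gap isolate the faces
`x_i = 0` and `x_i = 1`. -/
theorem bRef_kernel_cube_componentwise {n p : ℕ} {u : MvPolynomial (Fin (n + 1)) ℝ}
    {μ : FIdx .cube n → MvPolynomial (Fin n) ℝ} (hu : u ∈ polySpace .cube (n + 1) p)
    (hμ : ∀ F, μ F ∈ polySpace .cube n p)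
    (hb : ∀ r ∈ rtSpace .cube (n + 1) p .componentwise, bRef r u μ = 0) :
    (∀ k, MvPolynomial.pderiv k u = 0) ∧ ∀ F, gapRef u μ F = 0 := by
  have hpart : ∀ i, ∀ g ∈ polySpace .cube (n + 1) p, ∀ t ∈ polySpace .cube (n + 1) p,
      cubePart u μ i (g + MvPolynomial.X i * t) = 0 := by
    intro i g hg t ht
    rw [← bRef_cube_single]
    refine hb _ (mem_rtSpace_componentwise (Pi.single i g) (Pi.single i t) ?_ ?_ ?_) <;> intro k <;>
      by_cases h : k = i <;> first | (subst h; simp [hg, ht]) | simp [Pi.single_eq_of_ne h]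
  have hgrad : ∀ i, MvPolynomial.pderiv i u = 0 := by
    intro i
    -- Here `x_i (1 - x_i) ∂_i u = g - x_i g` with `g = x_i ∂_i u ∈ 𝒫_p`.
    have h := hpart i _ (X_mul_pderiv_mem hu i) _ (Submodule.neg_mem _ (X_mul_pderiv_mem hu i))
    simp only [cubePart, map_add, map_mul, map_neg, facetSub_cube_dir, if_true, one_mul,
      Bool.false_eq_true, if_false, zero_mul, add_neg_cancel, mul_zero, map_zero, sub_zero,
      add_zero] at h
    have hv : ∀ x : Space (n + 1), pe ((MvPolynomial.X i * MvPolynomial.pderiv i u +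
        MvPolynomial.X i * -(MvPolynomial.X i * MvPolynomial.pderiv i u)) *
          MvPolynomial.pderiv i u) x = x i * (1 - x i) * pe (MvPolynomial.pderiv i u) x ^ 2 := by
      intro x; simp [pe]; ring
    have h2 := pe_eq_zero_of_refInt_eq_zero (fun x hx => by
      rw [hv]
      exact mul_nonneg (mul_nonneg (hx i).1 (sub_nonneg.2 (hx i).2)) (sq_nonneg _)) h
    refine eq_zero_of_openSimplex _ fun x hx hx1 => ?_
    have h3 := h2 x (openSimplex_subset_interior _ _ ⟨hx, hx1⟩)
    rw [hv] at h3
    have h4 : x i < 1 := lt_of_le_of_lt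
      (Finset.single_le_sum (fun k _ => (hx k).le) (Finset.mem_univ i)) hx1
    have h5 : x i * (1 - x i) ≠ 0 := (mul_pos (hx i) (sub_pos.2 h4)).ne'
    simpa [h5] using h3
  have hl : ∀ i b c, MvPolynomial.aeval (facetSub (s := .cube) (n := n) (i, b))
      (MvPolynomial.aeval (liftSub i) c) = c := fun i b c =>
    facetSub_liftSub (s := .cube) (i, b) c
  refine ⟨hgrad, fun F => ?_⟩
  obtain ⟨i, b⟩ := F
  have hm : MvPolynomial.aeval (liftSub i) (gapRef u μ (i, b)) ∈ polySpace .cube (n + 1) p :=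
    (admSub_liftSub _).aeval_mem (gapRef_mem hu hμ (i, b))
  cases b
  · have h := hpart i _ hm _ (Submodule.neg_mem _ hm)
    simp only [cubePart, hgrad, map_add, map_mul, map_neg, facetSub_cube_dir, hl, if_true, one_mul,
      Bool.false_eq_true, if_false, zero_mul, add_neg_cancel, mul_zero, map_zero, sub_zero,
      add_zero, zero_add, ← sq] at h
    exact eq_zero_of_refInt_sq h
  · have h := hpart i 0 (Submodule.zero_mem _) _ hm
    simp only [cubePart, hgrad, map_mul, facetSub_cube_dir, hl, if_true, one_mul,
      Bool.false_eq_true, if_false, zero_mul, mul_zero, map_zero,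
      add_zero, zero_add, zero_sub, neg_eq_zero, ← sq] at h
    exact eq_zero_of_refInt_sq h

/-- The lift has degree zero in `x_i`, so the product has degree one there. This is where the scalar
form on cubes needs `p ≥ 1`. -/
theorem X_mul_liftSub_mem {n p : ℕ} (hp : 1 ≤ p) (i : Fin (n + 1)) {c : MvPolynomial (Fin n) ℝ}
    (hc : c ∈ polySpace .cube n p) :
    MvPolynomial.X i * MvPolynomial.aeval (liftSub i) c ∈ polySpace .cube (n + 1) p := by
  rw [mem_polySpace_cube]
  intro j
  by_cases h : j = i
  · subst h
    refine (MvPolynomial.degreeOf_mul_le _ _ _).trans ?_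
    rw [degreeOf_liftSub, MvPolynomial.degreeOf_X_self]
    omega
  · refine (MvPolynomial.degreeOf_mul_le _ _ _).trans ?_
    rw [MvPolynomial.degreeOf_X_of_ne h, zero_add]
    exact (mem_polySpace_cube _).1 ((admSub_liftSub i).aeval_mem hc) j

/-- Testing with `x_i u`, when `cubePart` vanishes on `x_i c` for `c` independent of `x_i`. -/
theorem cubePart_X_mul_self {n p : ℕ} {u : MvPolynomial (Fin (n + 1)) ℝ}
    {μ : FIdx .cube n → MvPolynomial (Fin n) ℝ}
    (hμ : ∀ F, μ F ∈ polySpace .cube n p) (i : Fin (n + 1))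
    (h : ∀ c ∈ polySpace .cube n p,
      cubePart u μ i (MvPolynomial.X i * MvPolynomial.aeval (liftSub i) c) = 0) :
    -2 * cubePart u μ i (MvPolynomial.X i * u) =
      refInt .cube (n + 1) ((u - MvPolynomial.aeval (liftSub i) (μ (i, true))) ^ 2) +
        refInt .cube n (gapRef u μ (i, true) ^ 2) := by
  have hl : ∀ b c, MvPolynomial.aeval (facetSub (s := .cube) (n := n) (i, b))
      (MvPolynomial.aeval (liftSub i) c) = c := fun b c =>
    facetSub_liftSub (s := .cube) (i, b) c
  -- Choosing `c = μ` on the face `x_i = 1` and integrating by parts gives `(μ, u) = ‖μ‖²`, with `μ`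
  -- lifted to the cube on the left.
  have h1 := h _ (hμ (i, true))
  simp only [cubePart, refInt_cube_by_parts, map_mul, facetSub_cube_dir, hl, if_true, one_mul,
    Bool.false_eq_true, if_false, zero_mul, mul_zero, map_zero, add_zero] at h1 ⊢
  -- This evaluates `2 (x_i u, ∂_i u) = ‖u‖²_{x_i = 1} - ‖u‖²`. The rest completes the squares of `u
  -- - μ` in the cube and on the face.
  have h2 := refInt_pderiv_cube i (MvPolynomial.X i * (u * u))
  simp only [map_mul, facetSub_cube_dir, Derivation.leibniz, smul_eq_mul,
    MvPolynomial.pderiv_X_self, map_add, if_true, one_mul, mul_one,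
    zero_mul, map_zero, sub_zero, Bool.false_eq_true, if_false] at h2
  obtain ⟨v, hv⟩ : ∃ v, v = MvPolynomial.aeval (facetSub (s := .cube) (i, true)) u := ⟨_, rfl⟩
  have hg : gapRef u μ (i, true) = v - μ (i, true) := by subst hv; rfl
  rw [← hv, hg] at h1
  rw [← hv] at h2
  rw [hg, ← hv]
  have e1 : refInt .cube (n + 1) ((u - MvPolynomial.aeval (liftSub i) (μ (i, true))) ^ 2) =
      refInt .cube (n + 1) (u * u) - 2 * refInt .cube (n + 1)
        (MvPolynomial.aeval (liftSub i) (μ (i, true)) * u) +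
        refInt .cube n (μ (i, true) * μ (i, true)) := by
    rw [← refInt_liftSub i (μ (i, true) * μ (i, true))]
    have : (2 : ℝ) * refInt .cube (n + 1) (MvPolynomial.aeval (liftSub i) (μ (i, true)) * u) =
      refInt .cube (n + 1) ((2 : ℝ) • (MvPolynomial.aeval (liftSub i) (μ (i, true)) * u)) := by
      simp
    rw [this, ← map_sub, ← map_add]
    congr 1
    rw [map_mul, ofNat_smul_eq_nsmul ℝ]
    simp only [nsmul_eq_mul, Nat.cast_ofNat]
    ring
  have e2 : refInt .cube n ((v - μ (i, true)) ^ 2) = refInt .cube n (v * v) -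
      2 * refInt .cube n (μ (i, true) * v) + refInt .cube n (μ (i, true) * μ (i, true)) := by
    have : (2 : ℝ) * refInt .cube n (μ (i, true) * v) =
      refInt .cube n ((2 : ℝ) • (μ (i, true) * v)) := by
      simp
    rw [this, ← map_sub, ← map_add]
    congr 1
    rw [ofNat_smul_eq_nsmul ℝ]
    simp only [nsmul_eq_mul, Nat.cast_ofNat]
    ring
  have e3 : refInt .cube n ((v - μ (i, true)) * v) = refInt .cube n (v * v) -
      refInt .cube n (μ (i, true) * v) := by rw [sub_mul, map_sub]
  have e4 : refInt .cube n ((v - μ (i, true)) * μ (i, true)) = refInt .cube n (μ (i, true) * v) -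
      refInt .cube n (μ (i, true) * μ (i, true)) := by
    rw [sub_mul, map_sub, mul_comm v]
  have e5 : refInt .cube (n + 1) (MvPolynomial.X i * (u * MvPolynomial.pderiv i u)) =
      refInt .cube (n + 1) (MvPolynomial.X i * u * MvPolynomial.pderiv i u) := by rw [mul_assoc]
  rw [mul_add, map_add, e5] at h2
  rw [e1, e2, e3]
  rw [e4] at h1
  linarith

/-- Only fields in `[𝒫_p]^d` can be tested component by component; the part `x 𝒫_p` couples them.
Testing with `x u` yields a sum over `i` of squares, so each vanishes: `u` equals the lift of its
facet value on `x_i = 1`, hence does not depend on `x_i`. -/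
theorem bRef_kernel_cube_scalar {n p : ℕ} (hp : 1 ≤ p) {u : MvPolynomial (Fin (n + 1)) ℝ}
    {μ : FIdx .cube n → MvPolynomial (Fin n) ℝ} (hu : u ∈ polySpace .cube (n + 1) p)
    (hμ : ∀ F, μ F ∈ polySpace .cube n p)
    (hb : ∀ r ∈ rtSpace .cube (n + 1) p .scalar, bRef r u μ = 0) :
    (∀ k, MvPolynomial.pderiv k u = 0) ∧ ∀ F, gapRef u μ F = 0 := by
  have hpart : ∀ i, ∀ g ∈ polySpace .cube (n + 1) p, cubePart u μ i g = 0 := by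
    intro i g hg
    rw [← bRef_cube_single]
    refine hb _ (mem_rtSpace_scalar (Pi.single i g) 0 ?_ (Submodule.zero_mem _) (by simp))
    intro k
    by_cases h : k = i
    · subst h; simpa
    · simp [Pi.single_eq_of_ne h]
  have hX := hb (fun k => MvPolynomial.X k * u)
    (mem_rtSpace_scalar 0 u (fun _ => Submodule.zero_mem _) hu (by simp))
  rw [bRef_cube] at hX
  have hsum : ∑ i : Fin (n + 1), (refInt .cube (n + 1)
      ((u - MvPolynomial.aeval (liftSub i) (μ (i, true))) ^ 2) +
        refInt .cube n (gapRef u μ (i, true) ^ 2)) = 0 := by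
    have : ∑ i : Fin (n + 1), -2 * cubePart u μ i (MvPolynomial.X i * u) = 0 := by
      rw [← Finset.mul_sum, hX, mul_zero]
    rw [← this]
    exact Finset.sum_congr rfl fun i _ => (cubePart_X_mul_self hμ i fun c hc =>
      hpart i _ (X_mul_liftSub_mem hp i hc)).symm
  have hz : ∀ i : Fin (n + 1), MvPolynomial.pderiv i u = 0 ∧ gapRef u μ (i, true) = 0 := by
    intro i
    have h1 := (Finset.sum_eq_zero_iff_of_nonneg (fun i _ => add_nonneg (refInt_sq_nonneg _ _)
      (refInt_sq_nonneg _ _))).1 hsum i (Finset.mem_univ i)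
    obtain ⟨h2, h3⟩ := (add_eq_zero_iff_of_nonneg (refInt_sq_nonneg _ _)
      (refInt_sq_nonneg _ _)).1 h1
    refine ⟨?_, eq_zero_of_refInt_sq h3⟩
    rw [sub_eq_zero.1 (eq_zero_of_refInt_sq h2), pderiv_liftSub]
  refine ⟨fun k => (hz k).1, fun F => ?_⟩
  obtain ⟨i, b⟩ := F
  cases b
  · have hl : MvPolynomial.aeval (facetSub (s := .cube) (n := n) (i, false))
        (MvPolynomial.aeval (liftSub i) (gapRef u μ (i, false))) = gapRef u μ (i, false) :=
      facetSub_liftSub (s := .cube) (i, false) _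
    -- With `∇u = 0` and no gap on `x_i = 1`, the lifted gap of the face `x_i = 0` is tested against
    -- itself.
    have h := hpart i _ ((admSub_liftSub i).aeval_mem (gapRef_mem hu hμ (i, false)))
    simp only [cubePart, (hz i).1, (hz i).2, hl, mul_zero, zero_mul, map_zero, sub_zero, zero_add,
      ← sq] at h
    exact eq_zero_of_refInt_sq h
  · exact (hz i).2

theorem bRef_kernel {s : Shape} {rt : RTForm} {n p : ℕ} (hrt : rt.Admissible s p)
    {u : MvPolynomial (Fin (n + 1)) ℝ}
    {μ : FIdx s n → MvPolynomial (Fin n) ℝ} (hu : u ∈ polySpace s (n + 1) p)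
    (hμ : ∀ F, μ F ∈ polySpace s n p)
    (hb : ∀ r ∈ rtSpace s (n + 1) p rt, bRef r u μ = 0) :
    (∀ k, MvPolynomial.pderiv k u = 0) ∧ ∀ F, gapRef u μ F = 0 := by
  match s, rt with
  | .simplex, .scalar => exact bRef_kernel_simplex hu hμ hb
  | .cube, .scalar => exact bRef_kernel_cube_scalar hrt hu hμ hb
  | .cube, .componentwise => exact bRef_kernel_cube_componentwise hu hμ hb
  | .simplex, .componentwise => exact hrt.elim

/-! ### Stability and boundedness of the hybrid form on the reference elements -/

theorem sq_integral_inner_le {X E : Type*} [MeasurableSpace X] {μ : Measure X}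
    [NormedAddCommGroup E] [InnerProductSpace ℝ E] {f g : X → E} (hf : MemLp f 2 μ)
    (hg : MemLp g 2 μ) :
    (∫ x, inner ℝ (f x) (g x) ∂μ) ^ 2 ≤ (∫ x, ‖f x‖ ^ 2 ∂μ) * ∫ x, ‖g x‖ ^ 2 ∂μ := by
  have h1 : |∫ x, inner ℝ (f x) (g x) ∂μ| ≤ ∫ x, ‖f x‖ * ‖g x‖ ∂μ := by
    refine (abs_integral_le_integral_abs).trans ?_
    exact integral_mono_of_nonneg (Eventually.of_forall fun x => abs_nonneg _)
      (hf.norm.integrable_mul hg.norm) (Eventually.of_forall fun x => abs_real_inner_le_norm _ _)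
  have h2 := integral_mul_norm_le_Lp_mul_Lq (μ := μ) (f := f) (g := g) Real.HolderConjugate.two_two
    (by simpa using hf) (by simpa using hg)
  have hF : 0 ≤ ∫ x, ‖f x‖ ^ 2 ∂μ := integral_nonneg fun x => by positivity
  have hG : 0 ≤ ∫ x, ‖g x‖ ^ 2 ∂μ := integral_nonneg fun x => by positivity
  simp only [Real.rpow_two, ← Real.sqrt_eq_rpow] at h2
  have h3 := abs_le_abs_of_nonneg (abs_nonneg _) (h1.trans h2)
  rw [← sq_abs, ← Real.sq_sqrt hF, ← Real.sq_sqrt hG, ← mul_pow]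
  exact pow_le_pow_left₀ (abs_nonneg _) (h1.trans h2) 2

theorem sq_integral_mul_le {X : Type*} [MeasurableSpace X] {μ : Measure X}
    {f g : X → ℝ} (hf : MemLp f 2 μ) (hg : MemLp g 2 μ) :
    (∫ x, f x * g x ∂μ) ^ 2 ≤ (∫ x, f x ^ 2 ∂μ) * ∫ x, g x ^ 2 ∂μ := by
  have := sq_integral_inner_le hf hg
  simpa [mul_comm] using this

instance (s : Shape) (d p : ℕ) (rt : RTForm) : FiniteDimensional ℝ (rtSpace s d p rt) := by
  have hpi : ∀ W : Fin d → Submodule ℝ (MvPolynomial (Fin d) ℝ), (∀ k, FiniteDimensional ℝ (W k)) →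
      FiniteDimensional ℝ (Submodule.pi univ W) := by
    intro W hW
    let f : Submodule.pi univ W →ₗ[ℝ] (k : Fin d) → W k :=
      LinearMap.pi fun k => ((LinearMap.proj k).comp (Submodule.subtype _)).codRestrict (W k)
        fun r => r.2 k (mem_univ k)
    refine FiniteDimensional.of_injective f fun a b h => ?_
    ext k : 2
    exact congrArg Subtype.val (congrFun h k)
  cases rt with
  | scalar =>
    have := hpi (fun _ => polySpace s d p) fun _ => inferInstance
    unfold rtSpace
    infer_instance
  | componentwise =>
    exact hpi _ fun k => inferInstance

/-- The values of a polynomial field. -/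
def fieldL (d : ℕ) : (Fin d → MvPolynomial (Fin d) ℝ) →ₗ[ℝ] Space d → Space d where
  toFun r x := WithLp.toLp 2 fun k => pe (r k) x
  map_add' r r' := by funext x; ext k; simp [pe]
  map_smul' c r := by funext x; ext k; simp [pe]

theorem fieldL_apply {d : ℕ} (r : Fin d → MvPolynomial (Fin d) ℝ) (x : Space d) (k : Fin d) :
    fieldL d r x k = pe (r k) x := rfl

theorem gradL_apply {d : ℕ} (q : MvPolynomial (Fin d) ℝ) : gradL d q = gradient (pe q) := rfl

theorem continuous_fieldL {d : ℕ} (r : Fin d → MvPolynomial (Fin d) ℝ) :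
    Continuous (fieldL d r) :=
  (PiLp.continuous_toLp 2 _).comp (continuous_pi fun k => continuous_pe (r k))

theorem continuous_gradL {d : ℕ} (q : MvPolynomial (Fin d) ℝ) : Continuous (gradL d q) :=
  continuous_gradient (contDiff_pe q)

theorem bRef_eq_inner {s : Shape} {n : ℕ} (r : Fin (n + 1) → MvPolynomial (Fin (n + 1)) ℝ)
    (u : MvPolynomial (Fin (n + 1)) ℝ) (μ : FIdx s n → MvPolynomial (Fin n) ℝ) :
    bRef r u μ = (∫ x in refElem s (n + 1), inner ℝ (fieldL _ r x) (gradient (pe u) x)) -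
      ∑ F, ∫ y in refElem s n, pe (gapRef u μ F) y * pe (normalPoly F r) y := by
  rw [bRef_eq]
  congr 1
  · refine integral_congr_ae (Eventually.of_forall fun x => ?_)
    simp only [PiLp.inner_apply, fieldL_apply, gradient_pe]
    exact Finset.sum_congr rfl fun k _ => by simp [mul_comm]
  · refine Finset.sum_congr rfl fun F _ => ?_
    simp only [gapRef, pe_sub, pe_facetSub, pe_normalPoly]

/-- The squared energy norm of `(u, μ)` on the reference element. -/
def energyRef {s : Shape} {n : ℕ} (u : MvPolynomial (Fin (n + 1)) ℝ)
    (μ : FIdx s n → MvPolynomial (Fin n) ℝ) : ℝ :=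
  (∫ x in refElem s (n + 1), ‖gradient (pe u) x‖ ^ 2) +
    ∑ F, ∫ y in refElem s n, pe (gapRef u μ F) y ^ 2

theorem exists_normal_inverse {s : Shape} {n : ℕ} (F : FIdx s n) (p : ℕ) (rt : RTForm) :
    ∃ C : ℝ, 0 < C ∧ ∀ r ∈ rtSpace s (n + 1) p rt,
      ∫ y in refElem s n, pe (normalPoly F r) y ^ 2 ≤
        C * ∫ x in refElem s (n + 1), ‖fieldL _ r x‖ ^ 2 := by
  obtain ⟨C, hC, h⟩ := exists_integral_sq_le (volume.restrict (refElem s n))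
    (volume.restrict (refElem s (n + 1)))
    ((peL n).comp ((normalPoly F).comp (rtSpace s (n + 1) p rt).subtype))
    ((fieldL (n + 1)).comp (rtSpace s (n + 1) p rt).subtype)
    (fun v => memLp_two_of_continuous (continuous_pe _) (isCompact_refElem _ _))
    (fun v => memLp_two_of_continuous (continuous_fieldL _) (isCompact_refElem _ _)) (by
      rintro ⟨r, hr⟩ hv
      have h0 := eq_zero_of_integral_sq_eq_zero (continuous_fieldL r) (isCompact_refElem _ _) hv
      ext k : 2
      refine eq_zero_of_pe_eq_zero _ _ (interior_refElem_nonempty s (n + 1)) fun x hx => ?_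
      exact congrArg (fun z : Space (n + 1) => z k) (h0 x hx))
  refine ⟨C, hC, fun r hr => ?_⟩
  have := h ⟨r, hr⟩
  simpa [peL] using this

/-- Cauchy--Schwarz on the element and on each facet, where the normal trace of a Raviart--Thomas
field is bounded by its `L²` norm through `exists_normal_inverse`. -/
theorem exists_bRef_le (s : Shape) (n p : ℕ) (rt : RTForm) : ∃ C : ℝ, 0 < C ∧
    ∀ r ∈ rtSpace s (n + 1) p rt, ∀ (u : MvPolynomial (Fin (n + 1)) ℝ)
      (μ : FIdx s n → MvPolynomial (Fin n) ℝ),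
      bRef r u μ ^ 2 ≤ C * (∫ x in refElem s (n + 1), ‖fieldL _ r x‖ ^ 2) * energyRef u μ := by
  choose B hB0 hB using fun F : FIdx s n => exists_normal_inverse F p rt
  refine ⟨2 + 2 * Fintype.card (FIdx s n) * ∑ F, B F, ?_, fun r hr u μ => ?_⟩
  · have := Finset.sum_nonneg fun F (_ : F ∈ Finset.univ) => (hB0 F).le
    positivity
  obtain ⟨R, hR⟩ : ∃ R, R = ∫ x in refElem s (n + 1), ‖fieldL _ r x‖ ^ 2 := ⟨_, rfl⟩
  obtain ⟨N, hN⟩ : ∃ N, N = ∫ x in refElem s (n + 1), ‖gradient (pe u) x‖ ^ 2 := ⟨_, rfl⟩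
  obtain ⟨g, hg⟩ : ∃ g : FIdx s n → ℝ, g = fun F => ∫ y in refElem s n, pe (gapRef u μ F) y ^ 2 :=
    ⟨_, rfl⟩
  have hR0 : 0 ≤ R := hR ▸ integral_nonneg fun x => by positivity
  have hN0 : 0 ≤ N := hN ▸ integral_nonneg fun x => by positivity
  have hg0 : ∀ F, 0 ≤ g F := fun F => hg ▸ integral_nonneg fun x => by positivity
  have hgF : ∀ F, g F = ∫ y in refElem s n, pe (gapRef u μ F) y ^ 2 := fun F => by rw [hg]
  have hen : energyRef u μ = N + ∑ F, g F := by rw [energyRef, hN, hg]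
  have h1 := sq_integral_inner_le (memLp_two_of_continuous (continuous_fieldL r)
    (isCompact_refElem s (n + 1))) (memLp_two_of_continuous (continuous_gradL u)
    (isCompact_refElem s (n + 1)))
  rw [gradL_apply, ← hR, ← hN] at h1
  have h2 : ∀ F : FIdx s n, (∫ y in refElem s n, pe (gapRef u μ F) y * pe (normalPoly F r) y) ^ 2 ≤
      g F * (B F * R) := by
    intro F
    refine (sq_integral_mul_le (memLp_two_of_continuous (continuous_pe _) (isCompact_refElem _ _))
      (memLp_two_of_continuous (continuous_pe _) (isCompact_refElem _ _))).trans ?_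
    rw [← hgF, hR]
    exact mul_le_mul_of_nonneg_left (hB F r hr) (hg0 F)
  have h3 := sq_sum_le_card_mul_sum_sq (s := Finset.univ)
    (f := fun F : FIdx s n => ∫ y in refElem s n, pe (gapRef u μ F) y * pe (normalPoly F r) y)
  have h4 : ∑ F : FIdx s n, g F * (B F * R) ≤ (∑ F, g F) * (∑ F, B F) * R := by
    rw [Finset.sum_mul, Finset.sum_mul]
    refine Finset.sum_le_sum fun F _ => ?_
    rw [mul_assoc]
    refine mul_le_mul_of_nonneg_left (mul_le_mul_of_nonneg_right ?_ hR0) (hg0 F)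
    exact Finset.single_le_sum (fun F _ => (hB0 F).le) (Finset.mem_univ F)
  have h5 := h3.trans (mul_le_mul_of_nonneg_left ((Finset.sum_le_sum fun F _ => h2 F).trans h4)
    (Nat.cast_nonneg _))
  rw [bRef_eq_inner, ← hR, hen]
  have hBs := Finset.sum_nonneg fun F (_ : F ∈ Finset.univ) => (hB0 F).le
  have hgs := Finset.sum_nonneg fun F (_ : F ∈ Finset.univ) => hg0 F
  rw [Finset.card_univ] at h5
  generalize (∫ x in refElem s (n + 1), inner ℝ (fieldL _ r x) (gradient (pe u) x)) = I at *
  generalize (∑ F, ∫ y in refElem s n, pe (gapRef u μ F) y * pe (normalPoly F r) y) = J at *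
  have h6 : (I - J) ^ 2 ≤ 2 * I ^ 2 + 2 * J ^ 2 := by nlinarith [sq_nonneg (I + J)]
  have hc : (0 : ℝ) ≤ Fintype.card (FIdx s n) := Nat.cast_nonneg _
  generalize (Fintype.card (FIdx s n) : ℝ) = c at *
  generalize ∑ F, B F = b at *
  generalize ∑ F, g F = G at *
  have h7 : 0 ≤ R * G := by positivity
  have h8 : 0 ≤ c * b * R * N := by positivity
  nlinarith

/-- The local inf-sup condition on the reference element. -/
theorem exists_energyRef_le {s : Shape} {p : ℕ} {rt : RTForm} (hrt : rt.Admissible s p) (n : ℕ) :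
    ∃ C : ℝ, 0 < C ∧ ∀ u ∈ polySpace s (n + 1) p, ∀ μ : FIdx s n → MvPolynomial (Fin n) ℝ,
      (∀ F, μ F ∈ polySpace s n p) → ∀ K : ℝ,
      (∀ r ∈ rtSpace s (n + 1) p rt,
        bRef r u μ ^ 2 ≤ K * ∫ x in refElem s (n + 1), ‖fieldL _ r x‖ ^ 2) →
      energyRef u μ ≤ C * K := by
  let V := polySpace s (n + 1) p × (FIdx s n → polySpace s n p)
  let emb : V →ₗ[ℝ] MvPolynomial (Fin (n + 1)) ℝ × (FIdx s n → MvPolynomial (Fin n) ℝ) :=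
    LinearMap.prodMap (Submodule.subtype _) ((Submodule.subtype _).compLeft (FIdx s n))
  have hemb : ∀ v : V, emb v = (v.1.1, fun F => (v.2 F).1) := fun v => rfl
  let b : rtSpace s (n + 1) p rt →ₗ[ℝ] V →ₗ[ℝ] ℝ :=
    (bRefL s n).compl₁₂ (Submodule.subtype _) emb
  have hb : ∀ r v, b r v = bRef r.1 v.1.1 fun F => (v.2 F).1 := fun r v => rfl
  -- The kernel result is what turns the finitely many functionals given by a basis of fields into a
  -- bound of both parts of the energy.
  have hker : ∀ v : V, (∀ r, b r v = 0) → (∀ k, MvPolynomial.pderiv k v.1.1 = 0) ∧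
      ∀ F, gapRef v.1.1 (fun F => (v.2 F).1) F = 0 := fun v h =>
    bRef_kernel hrt v.1.2 (fun F => (v.2 F).2) fun r hr => h ⟨r, hr⟩
  obtain ⟨C₀, hC₀, h₀⟩ := exists_integral_sq_le_sum (volume.restrict (refElem s (n + 1)))
    ((gradL (n + 1)).comp ((Submodule.subtype _).comp (LinearMap.fst ℝ _ _)))
    (fun v : V => memLp_two_of_continuous (continuous_gradL _) (isCompact_refElem _ _)) b (by
      intro v hv
      have : gradL (n + 1) v.1.1 = 0 := by
        funext x; ext k
        rw [gradL_apply, gradient_pe, (hker v hv).1 k]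
        simp [pe]
      have h2 : ∀ x, gradL (n + 1) v.1.1 x = 0 := fun x => by rw [this]; rfl
      refine (integral_congr_ae (Eventually.of_forall fun x => ?_)).trans (integral_zero _ _)
      exact (congrArg (fun z : Space (n + 1) => ‖z‖ ^ 2) (h2 x)).trans (by simp))
  let gapL : FIdx s n → V →ₗ[ℝ] MvPolynomial (Fin n) ℝ := fun F =>
    (MvPolynomial.aeval (facetSub F)).toLinearMap.comp
      ((Submodule.subtype _).comp (LinearMap.fst ℝ _ _)) -
      (Submodule.subtype _).comp ((LinearMap.proj F).comp (LinearMap.snd ℝ _ _))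
  have hgap : ∀ F (v : V), gapL F v = gapRef v.1.1 (fun F => (v.2 F).1) F := fun F v => rfl
  have hF := fun F : FIdx s n => exists_integral_sq_le_sum (volume.restrict (refElem s n))
    ((peL n).comp (gapL F))
    (fun v : V => memLp_two_of_continuous (continuous_pe _) (isCompact_refElem _ _)) b (by
      intro v hv
      have : gapL F v = 0 := by rw [hgap, (hker v hv).2 F]
      simp [this])
  choose B hB0 hB using hF
  let S := ∑ j, ∫ x in refElem s (n + 1),
    ‖fieldL _ (Module.finBasis ℝ (rtSpace s (n + 1) p rt) j).1 x‖ ^ 2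
  have hS : 0 ≤ S := Finset.sum_nonneg fun j _ => integral_nonneg fun x => by positivity
  have hBs := Finset.sum_nonneg fun F (_ : F ∈ Finset.univ) => (hB0 F).le
  refine ⟨(C₀ + ∑ F, B F) * S + 1, by positivity, fun u hu μ hμ K hK => ?_⟩
  -- A nonzero constant field belongs to the space and has positive norm, so no negative `K` can
  -- satisfy the hypothesis. The sign is used to absorb the summand `1` in the constant.
  have hK0 : 0 ≤ K := by
    have h1 := hK (fun _ => MvPolynomial.C 1) (by
      cases rt
      · exact mem_rtSpace_scalar (fun _ => MvPolynomial.C 1) 0 (fun _ => C_mem_polySpace _ _ _ _)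
          (Submodule.zero_mem _) (by simp)
      · exact mem_rtSpace_componentwise (fun _ => MvPolynomial.C 1) 0
          (fun _ => C_mem_polySpace _ _ _ _) (fun _ => Submodule.zero_mem _) (by simp))
    have h2 : 0 < ∫ x in refElem s (n + 1), ‖fieldL (n + 1) (fun _ => MvPolynomial.C 1) x‖ ^ 2 := by
      refine lt_of_le_of_ne (integral_nonneg fun x => by positivity) fun h => ?_
      obtain ⟨x, hx⟩ := interior_refElem_nonempty s (n + 1)
      have := eq_zero_of_integral_sq_eq_zero (continuous_fieldL _) (isCompact_refElem _ _)
        h.symm x hx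
      have := congrArg (fun z : Space (n + 1) => z 0) this
      simp [fieldL_apply, pe] at this
    by_contra hneg
    have := mul_neg_of_neg_of_pos (not_le.1 hneg) h2
    linarith [sq_nonneg (bRef (s := s) (fun _ => MvPolynomial.C 1) u μ)]
  let v : V := (⟨u, hu⟩, fun F => ⟨μ F, hμ F⟩)
  have hsum : ∑ j, b (Module.finBasis ℝ _ j) v ^ 2 ≤ K * S := by
    rw [Finset.mul_sum]
    exact Finset.sum_le_sum fun j _ => hK _ (Module.finBasis ℝ (rtSpace s (n + 1) p rt) j).2
  have e0 := (h₀ v).trans (mul_le_mul_of_nonneg_left hsum hC₀.le)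
  have eF := fun F => (hB F v).trans (mul_le_mul_of_nonneg_left hsum (hB0 F).le)
  have e1 := Finset.sum_le_sum fun F (_ : F ∈ (Finset.univ : Finset (FIdx s n))) => eF F
  rw [← Finset.sum_mul] at e1
  have e2 : energyRef u μ = (∫ x in refElem s (n + 1), ‖gradL (n + 1) u x‖ ^ 2) +
    ∑ F, ∫ y in refElem s n, ‖peL n (gapL F v) y‖ ^ 2 := by
    simp only [energyRef, gradL_apply, Real.norm_eq_abs, sq_abs]
    rfl
  rw [e2]
  refine (add_le_add e0 e1).trans ?_
  nlinarith

/-! ### Affine changes of variables -/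

theorem affineEquiv_eq {d : ℕ} (Θ : Space d ≃ᵃ[ℝ] Space d) (x : Space d) :
    Θ x = Θ.linear x + Θ 0 := by
  have := Θ.map_vadd 0 x
  simpa using this

theorem det_linear_ne_zero {d : ℕ} (Θ : Space d ≃ᵃ[ℝ] Space d) :
    LinearMap.det (Θ.linear : Space d →ₗ[ℝ] Space d) ≠ 0 :=
  (LinearEquiv.isUnit_det' Θ.linear).ne_zero

theorem map_affineEquiv_volume {d : ℕ} (Θ : Space d ≃ᵃ[ℝ] Space d) :
    (volume : Measure (Space d)).map Θ =
      ENNReal.ofReal |(LinearMap.det (Θ.linear : Space d →ₗ[ℝ] Space d))⁻¹| • volume := by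
  have h1 : (Θ : Space d → Space d) =
      (fun x => x + Θ 0) ∘ (Θ.linear : Space d →ₗ[ℝ] Space d) := by
    funext x; simpa using affineEquiv_eq Θ x
  rw [h1, ← Measure.map_map (measurable_add_const _)
    (LinearMap.continuous_of_finiteDimensional _).measurable,
    Measure.map_linearMap_addHaar_eq_smul_addHaar _ (det_linear_ne_zero Θ), Measure.map_smul,
    (measurePreserving_add_right volume (Θ 0)).map_eq]

theorem measurableEmbedding_affineEquiv {d : ℕ} (Θ : Space d ≃ᵃ[ℝ] Space d) :
    MeasurableEmbedding Θ :=
  Θ.toContinuousAffineEquiv.toHomeomorph.measurableEmbedding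

/-- The volume change of an affine equivalence. -/
def volChange {d : ℕ} (Θ : Space d ≃ᵃ[ℝ] Space d) : ℝ :=
  |LinearMap.det (Θ.linear : Space d →ₗ[ℝ] Space d)|

theorem volChange_pos {d : ℕ} (Θ : Space d ≃ᵃ[ℝ] Space d) : 0 < volChange Θ :=
  abs_pos.2 (det_linear_ne_zero Θ)

theorem restrict_image_affineEquiv {d : ℕ} (Θ : Space d ≃ᵃ[ℝ] Space d) (K : Set (Space d)) :
    volume.restrict (Θ '' K) = ENNReal.ofReal (volChange Θ) • (volume.restrict K).map Θ := by
  have h := (measurableEmbedding_affineEquiv Θ).restrict_map volume (Θ '' K)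
  rw [map_affineEquiv_volume, Θ.injective.preimage_image, Measure.restrict_smul] at h
  rw [← h, smul_smul, abs_inv, ← ENNReal.ofReal_mul (volChange_pos Θ).le, volChange,
    mul_inv_cancel₀ (abs_pos.2 (det_linear_ne_zero Θ)).ne', ENNReal.ofReal_one, one_smul]

theorem setIntegral_image_affineEquiv {d : ℕ} (Θ : Space d ≃ᵃ[ℝ] Space d) (K : Set (Space d))
    (f : Space d → ℝ) : ∫ x in Θ '' K, f x = volChange Θ * ∫ x in K, f (Θ x) := by
  rw [restrict_image_affineEquiv, integral_smul_measure,
    (measurableEmbedding_affineEquiv Θ).integral_map, ENNReal.toReal_ofReal (volChange_pos Θ).le,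
    smul_eq_mul]

theorem memLp_image_affineEquiv {d : ℕ} {E : Type*} [NormedAddCommGroup E]
    (Θ : Space d ≃ᵃ[ℝ] Space d) (K : Set (Space d)) (f : Space d → E) :
    MemLp f 2 (volume.restrict (Θ '' K)) ↔ MemLp (f ∘ Θ) 2 (volume.restrict K) := by
  have hc : ENNReal.ofReal (volChange Θ) ≠ 0 := by simpa using volChange_pos Θ
  have hct : ENNReal.ofReal (volChange Θ) ≠ ⊤ := ENNReal.ofReal_ne_top
  rw [restrict_image_affineEquiv, ← (measurableEmbedding_affineEquiv Θ).memLp_map_measure_iff]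
  refine ⟨fun h => ?_, fun h => h.smul_measure hct⟩
  have := h.smul_measure (c := (ENNReal.ofReal (volChange Θ))⁻¹) (by simpa using volChange_pos Θ)
  rwa [smul_smul, ENNReal.inv_mul_cancel hc hct, one_smul] at this

/-- The substitution of an affine map into polynomials. -/
def affSub {d e : ℕ} (f : Space d →ᵃ[ℝ] Space e) : Fin e → MvPolynomial (Fin d) ℝ :=
  affineSub (f 0) (Matrix.of fun j k => f.linear (EuclideanSpace.single k 1) j)

theorem affineMap_apply {d e : ℕ} (f : Space d →ᵃ[ℝ] Space e) (y : Space d) :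
    f y = WithLp.toLp 2 fun j =>
      f 0 j + ∑ k, f.linear (EuclideanSpace.single k 1) j * y k := by
  have h1 : f y = f.linear y + f 0 := by simpa using f.map_vadd 0 y
  have h2 : y = ∑ k, y k • (EuclideanSpace.single k 1 : Space d) := by
    ext j; simp [Finset.sum_apply, Pi.single_apply]
  ext j
  rw [h1]
  conv_lhs => rw [h2]
  simp [map_sum, add_comm, mul_comm]

theorem pe_affSub {d e : ℕ} (f : Space d →ᵃ[ℝ] Space e) (q : MvPolynomial (Fin e) ℝ)
    (y : Space d) : pe (MvPolynomial.aeval (affSub f) q) y = pe q (f y) := by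
  rw [affSub, pe_affineSub, affineMap_apply f y]; rfl

/-- Total degree is invariant under all affine maps. On the cube, `Θ` and its inverse both have
absolute row sums at most one, so every column of the linear part has at most one nonzero entry. -/
theorem admSub_affSub {s : Shape} {n : ℕ} (Θ : Space n ≃ᵃ[ℝ] Space n)
    (h : Θ '' refElem s n = refElem s n) : AdmSub s (affSub (Θ : Space n →ᵃ[ℝ] Space n)) := by
  have hto : ∀ y ∈ refElem s n, Θ y ∈ refElem s n := fun y hy => h ▸ mem_image_of_mem _ hy
  have hfrom : ∀ y ∈ refElem s n, Θ.symm y ∈ refElem s n := fun y hy => by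
    rw [← h] at hy
    obtain ⟨z, hz, rfl⟩ := hy
    simpa using hz
  cases s with
  | simplex => exact admSub_affineSub_simplex _ _
  | cube =>
    refine admSub_affineSub_cube _ _ fun i j k =>
      eq_of_rowSum_le_one (B := Matrix.of fun j k =>
        Θ.symm.linear (EuclideanSpace.single k 1) j) ?_ ?_ ?_ i j k
    · ext i j
      have h1 : Θ.linear (Θ.symm.linear (EuclideanSpace.single j 1)) i =
          (EuclideanSpace.single j 1 : Space n) i := by
        simp
      have h2 : (Θ.symm.linear (EuclideanSpace.single j 1) : Space n) =
          ∑ k, (Θ.symm.linear (EuclideanSpace.single j 1)) k •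
            (EuclideanSpace.single k 1 : Space n) := by
        ext j; simp [Finset.sum_apply, Pi.single_apply]
      rw [h2] at h1
      simp only [map_sum, map_smul] at h1
      rw [Matrix.mul_apply, Matrix.one_apply]
      simp only [Matrix.of_apply]
      have h3 : ∀ k, ((Θ : Space n →ᵃ[ℝ] Space n).linear (EuclideanSpace.single k 1)) =
        Θ.linear (EuclideanSpace.single k 1) := fun k => rfl
      simp only [h3]
      simpa [mul_comm, Pi.single_apply] using h1
    · refine rowSum_le_one (b := Θ 0) fun y hy => ?_
      have := hto y hy
      rwa [show Θ y = (Θ : Space n →ᵃ[ℝ] Space n) y from rfl, affineMap_apply] at this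
    · refine rowSum_le_one (b := Θ.symm 0) fun y hy => ?_
      have := hfrom y hy
      rwa [show Θ.symm y = (Θ.symm : Space n →ᵃ[ℝ] Space n) y from rfl, affineMap_apply] at this

/-- A map that preserves a set of finite positive volume has Jacobian one. -/
theorem volChange_eq_one {s : Shape} {n : ℕ} (Θ : Space n ≃ᵃ[ℝ] Space n)
    (h : Θ '' refElem s n = refElem s n) : volChange Θ = 1 := by
  have h1 := setIntegral_image_affineEquiv Θ (refElem s n) fun _ => 1
  rw [h] at h1
  simp only [integral_const, smul_eq_mul, mul_one, measureReal_restrict_apply_univ] at h1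
  have h2 : volume.real (refElem s n) ≠ 0 :=
    (ENNReal.toReal_pos (volume_refElem_ne_zero s n) (volume_refElem_ne_top s n)).ne'
  field_simp at h1
  exact h1.symm

theorem setIntegral_comp_affineEquiv {s : Shape} {n : ℕ} (Θ : Space n ≃ᵃ[ℝ] Space n)
    (h : Θ '' refElem s n = refElem s n) (f : Space n → ℝ) :
    ∫ y in refElem s n, f (Θ y) = ∫ y in refElem s n, f y := by
  have := setIntegral_image_affineEquiv Θ (refElem s n) f
  rw [h, volChange_eq_one Θ h, one_mul] at this
  exact this.symm

theorem symm_image_refElem {s : Shape} {n : ℕ} {Θ : Space n ≃ᵃ[ℝ] Space n}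
    (h : Θ '' refElem s n = refElem s n) : Θ.symm '' refElem s n = refElem s n := by
  conv_lhs => rw [← h]
  rw [image_image]
  simp

/-! ### Facets of an element -/

theorem dropLin_exists {n : ℕ} (i : Fin (n + 1)) : ∃ f : Space (n + 1) →ₗ[ℝ] Space n,
    ∀ x, f x = drop i x :=
  ⟨{ toFun := drop i, map_add' := fun x y => by ext; simp, map_smul' := fun c x => by ext; simp },
    fun x => rfl⟩

theorem facetMap_eq_iff {s : Shape} {n : ℕ} (F : FIdx s n) (x : Space (n + 1)) :
    facetMap F (drop F.dir x) = x ↔ x F.dir = F.cst + F.slope * ∑ j, x (F.dir.succAbove j) := by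
  constructor
  · intro h
    conv_lhs => rw [← h]
    simp [facetMap]
  · intro h
    rw [facetMap]
    simp only [drop_apply]
    rw [← h, ins_drop]

/-- Two parametrizations of the same facet differ by an affine symmetry of the reference facet. -/
theorem exists_affineEquiv_facetMap {s : Shape} {n : ℕ} (F : FIdx s n)
    (g : Space n →ᵃ[ℝ] Space (n + 1)) (hg : Function.Injective g)
    (h : g '' refElem s n = facetMap F '' refElem s n) :
    ∃ Θ : Space n ≃ᵃ[ℝ] Space n, (∀ y, g y = facetMap F (Θ y)) ∧
      Θ '' refElem s n = refElem s n := by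
  obtain ⟨dl, hdl⟩ := dropLin_exists (n := n) F.dir
  let θ : Space n →ᵃ[ℝ] Space n := dl.toAffineMap.comp g
  have hθ : ∀ y, θ y = drop F.dir (g y) := fun y => hdl _
  -- The hyperplane of the facet is `c = F.cst`. Along `g` this equation holds at `0` and at the
  -- unit vectors, hence everywhere by affinity; so dropping the coordinate `F.dir` loses nothing.
  let c : Space (n + 1) →ₗ[ℝ] ℝ :=
    (EuclideanSpace.proj F.dir : Space (n + 1) →L[ℝ] ℝ).toLinearMap -
      F.slope • ∑ j, (EuclideanSpace.proj (F.dir.succAbove j) : Space (n + 1) →L[ℝ] ℝ).toLinearMap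
  have hc : ∀ x, c x = x F.dir - F.slope * ∑ j, x (F.dir.succAbove j) := fun x => by
    simp [c]
  have h1 : ∀ y ∈ refElem s n, c (g y) = F.cst := fun y hy => by
    have := ((mem_image_facetMap F _).1 (h ▸ mem_image_of_mem g hy)).2
    rw [hc, this]; ring
  have h2 : ∀ k, c (g.linear (EuclideanSpace.single k 1)) = 0 := fun k => by
    have e1 := h1 _ (single_mem_refElem s n k)
    have e0 := h1 _ (zero_mem_refElem s n)
    have : g (EuclideanSpace.single k 1) = g.linear (EuclideanSpace.single k 1) + g 0 := by
      simpa using g.map_vadd 0 (EuclideanSpace.single k 1)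
    rw [this, map_add, e0] at e1
    linarith
  have h3 : ∀ y, c (g y) = F.cst := fun y => by
    have e0 := h1 _ (zero_mem_refElem s n)
    have e1 : g y = g.linear y + g 0 := by simpa using g.map_vadd 0 y
    have e2 : y = ∑ k, y k • (EuclideanSpace.single k 1 : Space n) := by
      ext j; simp [Finset.sum_apply, Pi.single_apply]
    have e3 : c (g.linear y) = 0 := by
      rw [e2]; simp only [map_sum, map_smul, h2, smul_zero, Finset.sum_const_zero]
    rw [e1, map_add, e3, e0, zero_add]
  have h4 : ∀ y, g y = facetMap F (θ y) := fun y => by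
    rw [hθ]
    refine ((facetMap_eq_iff F _).2 ?_).symm
    have := h3 y
    rw [hc] at this
    linarith
  have hinj : Function.Injective θ := fun y z hyz => hg (by rw [h4 y, h4 z, hyz])
  have hlin : Function.Injective θ.linear := (AffineMap.linear_injective_iff θ).2 hinj
  have hbij : Function.Bijective θ.linear :=
    ⟨hlin, LinearMap.injective_iff_surjective.1 hlin⟩
  refine ⟨AffineEquiv.ofBijective (φ := θ) ((AffineMap.linear_bijective_iff θ).1 hbij), h4, ?_⟩
  have hfi : Function.Injective (facetMap F) := fun y z hyz => by
    have := congrArg (drop F.dir) hyz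
    simpa [facetMap] using this
  refine hfi.image_injective ?_
  rw [← h, image_image]
  exact image_congr fun y _ => (h4 y).symm

/-! ### Determinants of families of vectors -/

/-- The determinant of the matrix whose rows are the given vectors. -/
def detRows {d : ℕ} (v : Fin d → Space d) : ℝ := Matrix.det (Matrix.of fun i j => v i j)

theorem detRows_mul {d : ℕ} (v w : Fin d → Space d) :
    detRows v * detRows w = Matrix.det (Matrix.of fun i j => inner ℝ (v i) (w j)) := by
  rw [detRows, detRows, ← Matrix.det_transpose (Matrix.of fun i j => w i j), ← Matrix.det_mul]
  congr 1
  ext i j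
  simp [Matrix.mul_apply, PiLp.inner_apply, mul_comm]

theorem toMatrix_basisFun {d : ℕ} (L : Space d →ₗ[ℝ] Space d) :
    LinearMap.toMatrix (EuclideanSpace.basisFun (Fin d) ℝ).toBasis
      (EuclideanSpace.basisFun (Fin d) ℝ).toBasis L =
      Matrix.of fun i j => L (EuclideanSpace.single j 1) i := by
  ext i j
  simp [LinearMap.toMatrix_apply]

theorem detRows_single {d : ℕ} (L : Space d →ₗ[ℝ] Space d) :
    detRows (fun i => L (EuclideanSpace.single i 1)) = LinearMap.det L := by
  rw [← LinearMap.det_toMatrix (EuclideanSpace.basisFun (Fin d) ℝ).toBasis, toMatrix_basisFun,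
    ← Matrix.det_transpose, detRows]
  rfl

theorem detRows_map {d : ℕ} (L : Space d →ₗ[ℝ] Space d) (v : Fin d → Space d) :
    detRows (fun i => L (v i)) = LinearMap.det L * detRows v := by
  rw [← detRows_single L, mul_comm, detRows, detRows, detRows, ← Matrix.det_mul]
  congr 1
  ext i j
  have h2 : v i = ∑ k, v i k • (EuclideanSpace.single k 1 : Space d) := by
    ext j; simp [Finset.sum_apply, Pi.single_apply]
  simp only [Matrix.of_apply, Matrix.mul_apply]
  conv_lhs => rw [h2]
  simp [map_sum]

/-- The product is the determinant of the matrix of inner products, whose first column is zero below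
its first entry because each `u i` is orthogonal to `y`. -/
theorem detRows_cons_mul {d : ℕ} (x y : Space (d + 1)) (u w : Fin d → Space (d + 1))
    (h : ∀ i, inner ℝ (u i) y = 0) :
    detRows (Fin.cons x u : Fin (d + 1) → Space (d + 1)) *
        detRows (Fin.cons y w : Fin (d + 1) → Space (d + 1)) =
      inner ℝ x y * Matrix.det (Matrix.of fun i j => inner ℝ (u i) (w j)) := by
  rw [detRows_mul, Matrix.det_succ_column_zero, Fin.sum_univ_succ]
  have : ∀ i : Fin d, Matrix.of (fun i j : Fin (d + 1) =>
      inner ℝ ((Fin.cons x u : Fin (d + 1) → Space (d + 1)) i)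
        ((Fin.cons y w : Fin (d + 1) → Space (d + 1)) j)) i.succ 0 = 0 := fun i => by
    simp [h i]
  simp only [this, mul_zero, zero_mul, Finset.sum_const_zero, add_zero]
  simp only [Fin.val_zero, pow_zero, one_mul, Matrix.of_apply, Fin.cons_zero, Fin.succAbove_zero]
  congr 2

theorem abs_det_le {d : ℕ} (L : Space d →ₗ[ℝ] Space d) {x : ℝ}
    (h : ∀ i, ‖L (EuclideanSpace.single i 1)‖ ≤ x) :
    |LinearMap.det L| ≤ (d.factorial : ℝ) * x ^ d := by
  rw [← detRows_single L, detRows]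
  have := Matrix.det_le (A := Matrix.of fun i j => L (EuclideanSpace.single i 1) j)
    (abv := AbsoluteValue.abs) (x := x) fun i j =>
      (PiLp.norm_apply_le (L (EuclideanSpace.single i 1)) j).trans (h i)
  simpa using this

/-! ### Facets and normals of a mesh -/

namespace Mesh

section Geometry

variable {s : Shape} {n : ℕ} {Ω : Set (Space (n + 1))} {ι κ : Type} (M : Mesh s n Ω ι κ)

/-- The facet of the element `T` which corresponds to the facet `F` of the reference element. -/
def facetAt (T : ι) (F : FIdx s n) : κ :=
  (M.exists_facet T (facetMap F '' refElem s n) ((mem_refFacets_iff _).2 ⟨F, rfl⟩)).choose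

theorem image_facetAt (T : ι) (F : FIdx s n) :
    M.Ψ (M.facetAt T F) '' refElem s n = M.Φ T '' (facetMap F '' refElem s n) :=
  (M.exists_facet T (facetMap F '' refElem s n) ((mem_refFacets_iff _).2 ⟨F, rfl⟩)).choose_spec

theorem facetAt_injective (T : ι) : Function.Injective (M.facetAt T) := fun F F' h => by
  refine image_facetMap_injective ((M.Φ T).injective.image_injective ?_)
  simp only
  rw [← image_facetAt, ← image_facetAt, h]

theorem incident_iff (E : κ) (T : ι) :
    (T = M.side₁ E ∨ T = M.side₂ E) ↔ ∃ F, M.facetAt T F = E := by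
  rw [← M.incident]
  constructor
  · rintro ⟨S, hS, h⟩
    obtain ⟨F, rfl⟩ := (mem_refFacets_iff S).1 hS
    exact ⟨F, M.facet_injective ((M.image_facetAt T F).trans h.symm)⟩
  · rintro ⟨F, rfl⟩
    exact ⟨_, (mem_refFacets_iff _).2 ⟨F, rfl⟩, M.image_facetAt T F⟩

theorem incident_facetAt (T : ι) (F : FIdx s n) :
    T = M.side₁ (M.facetAt T F) ∨ T = M.side₂ (M.facetAt T F) :=
  (M.incident_iff _ _).2 ⟨F, rfl⟩

theorem mem_facetsOf [Fintype κ] (E : κ) (T : ι) :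
    E ∈ M.facetsOf T ↔ ∃ F, M.facetAt T F = E := by
  classical
  rw [← M.incident_iff]
  simp [facetsOf]

theorem sum_facetsOf [Fintype κ] (T : ι) (f : κ → ℝ) :
    ∑ E ∈ M.facetsOf T, f E = ∑ F, f (M.facetAt T F) := by
  classical
  have : M.facetsOf T = Finset.univ.map ⟨M.facetAt T, M.facetAt_injective T⟩ := by
    ext E
    rw [mem_facetsOf]
    simp
  rw [this, Finset.sum_map]
  rfl

theorem exists_facetChange (T : ι) (F : FIdx s n) : ∃ Θ : Space n ≃ᵃ[ℝ] Space n,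
    (∀ y, M.Ψ (M.facetAt T F) y = M.Φ T (facetMap F (Θ y))) ∧
      Θ '' refElem s n = refElem s n := by
  obtain ⟨Θ, h1, h2⟩ := exists_affineEquiv_facetMap F
    (((M.Φ T).symm : Space (n + 1) →ᵃ[ℝ] Space (n + 1)).comp (M.Ψ (M.facetAt T F)))
    ((M.Φ T).symm.injective.comp (M.Ψ_injective _)) (by
      rw [AffineMap.coe_comp, image_comp, image_facetAt, image_image]
      simp)
  refine ⟨Θ, fun y => ?_, h2⟩
  rw [← h1]
  simp

/-- The change of coordinates between the parametrizations of a facet by `M.Ψ` and from inside the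
element `T`. -/
def facetChange (T : ι) (F : FIdx s n) : Space n ≃ᵃ[ℝ] Space n := (M.exists_facetChange T F).choose

theorem Ψ_facetAt (T : ι) (F : FIdx s n) (y : Space n) :
    M.Ψ (M.facetAt T F) y = M.Φ T (facetMap F (M.facetChange T F y)) :=
  (M.exists_facetChange T F).choose_spec.1 y

theorem image_facetChange (T : ι) (F : FIdx s n) :
    M.facetChange T F '' refElem s n = refElem s n :=
  (M.exists_facetChange T F).choose_spec.2

theorem Ψ_linear (T : ι) (F : FIdx s n) (z : Space n) :
    (M.Ψ (M.facetAt T F)).linear z =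
      (M.Φ T).linear (facetLin F ((M.facetChange T F).linear z)) := by
  have h1 : (M.Ψ (M.facetAt T F)).linear z =
      M.Ψ (M.facetAt T F) z - M.Ψ (M.facetAt T F) 0 := by
    have := (M.Ψ (M.facetAt T F)).linearMap_vsub z 0
    simpa using this
  rw [h1, Ψ_facetAt, Ψ_facetAt, affineEquiv_eq (M.facetChange T F) z, add_comm (_ : Space n), facetMap_add,
    affineEquiv_eq (M.Φ T), affineEquiv_eq (M.Φ T) (facetMap F _), map_add]
  abel

/-- Points of the facet are also points of the element, so the outwardness inequality holds in both
directions along each edge at the base vertex of the facet. -/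
theorem inner_normal_linear (T : ι) (F : FIdx s n) (z : Space n) :
    inner ℝ (M.normal T (M.facetAt T F)) ((M.Ψ (M.facetAt T F)).linear z) = 0 := by
  have hsub : ∀ y ∈ refElem s n, M.Ψ (M.facetAt T F) y ∈ M.Φ T '' refElem s (n + 1) := by
    intro y hy
    have : M.Ψ (M.facetAt T F) y ∈ M.Φ T '' (facetMap F '' refElem s n) :=
      M.image_facetAt T F ▸ mem_image_of_mem _ hy
    refine image_mono ?_ this
    rintro _ ⟨y, hy, rfl⟩
    exact facetMap_mem F hy
  have h := (M.normal_spec T _ (M.incident_facetAt T F)).2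
  have hk : ∀ k, inner ℝ (M.normal T (M.facetAt T F))
      ((M.Ψ (M.facetAt T F)).linear (EuclideanSpace.single k 1)) = 0 := by
    intro k
    have e : (M.Ψ (M.facetAt T F)).linear (EuclideanSpace.single k 1) =
        M.Ψ (M.facetAt T F) (EuclideanSpace.single k 1) - M.Ψ (M.facetAt T F) 0 := by
      have := (M.Ψ (M.facetAt T F)).linearMap_vsub (EuclideanSpace.single k 1) 0
      simpa using this
    rw [e]
    refine le_antisymm (h _ (hsub _ (single_mem_refElem s n k)) _
      (mem_image_of_mem _ (zero_mem_refElem s n))) ?_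
    have := h _ (hsub _ (zero_mem_refElem s n)) _
      (mem_image_of_mem _ (single_mem_refElem s n k))
    rw [← neg_sub, inner_neg_right] at this
    linarith
  have e2 : z = ∑ k, z k • (EuclideanSpace.single k 1 : Space n) := by
    ext j; simp [Finset.sum_apply, Pi.single_apply]
  rw [e2]
  simp only [map_sum, map_smul, inner_sum, inner_smul_right, hk, mul_zero, Finset.sum_const_zero]

theorem det_gram_pos (E : κ) : 0 < (Matrix.of fun i j : Fin n =>
    inner ℝ ((M.Ψ E).linear (EuclideanSpace.single i 1))
      ((M.Ψ E).linear (EuclideanSpace.single j 1))).det := by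
  refine Matrix.PosDef.det_pos ?_
  refine Matrix.posDef_gram_of_linearIndependent (𝕜 := ℝ)
    (v := fun i => (M.Ψ E).linear (EuclideanSpace.single i 1)) ?_
  have h1 : LinearIndependent ℝ fun i : Fin n => (EuclideanSpace.single i 1 : Space n) := by
    have := (EuclideanSpace.basisFun (Fin n) ℝ).toBasis.linearIndependent
    convert! this with i
    simp
  exact h1.map' _ (LinearMap.ker_eq_bot.2
    ((AffineMap.linear_injective_iff (M.Ψ E)).2 (M.Ψ_injective E)))

theorem facetJac_pos (E : κ) : 0 < M.facetJac E := Real.sqrt_pos.2 (M.det_gram_pos E)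

theorem facetJac_sq (E : κ) : M.facetJac E ^ 2 = (Matrix.of fun i j : Fin n =>
    inner ℝ ((M.Ψ E).linear (EuclideanSpace.single i 1))
      ((M.Ψ E).linear (EuclideanSpace.single j 1))).det :=
  Real.sq_sqrt (M.det_gram_pos E).le

end Geometry

end Mesh

/-- The vector `ν` with `⟨z, ν⟩ = z_i - m ∑_{j ≠ i} z_j`, normal to the facet `F`. -/
def conormal {s : Shape} {n : ℕ} (F : FIdx s n) : Space (n + 1) := ins F.dir 1
  (WithLp.toLp 2 fun _ => -F.slope)

theorem inner_conormal {s : Shape} {n : ℕ} (F : FIdx s n) (z : Space (n + 1)) :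
    inner ℝ z (conormal F) = z F.dir - F.slope * ∑ j, z (F.dir.succAbove j) := by
  rw [PiLp.inner_apply, Fin.sum_univ_succAbove _ F.dir]
  simp [conormal, Finset.mul_sum]
  ring

theorem normalRef_eq {s : Shape} {n : ℕ} (F : FIdx s n) (z : Space (n + 1)) :
    normalRef F (fun k => z k) = F.orient * inner ℝ z (conormal F) := by
  rw [inner_conormal, normalRef]

theorem inner_facetLin_conormal {s : Shape} {n : ℕ} (F : FIdx s n) (z : Space n) :
    inner ℝ (facetLin F z) (conormal F) = 0 := by
  rw [inner_conormal]
  simp [facetLin]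

theorem facetLin_succAbove {s : Shape} {n : ℕ} (F : FIdx s n) (z : Space n) (j : Fin n) :
    facetLin F z (F.dir.succAbove j) = z j := by
  simp [facetLin]

/-- The determinant of the facet frame of the reference element. -/
theorem exists_detRows_facetLin {s : Shape} {n : ℕ} (F : FIdx s n) (Θ : Space n ≃ᵃ[ℝ] Space n)
    (h : Θ '' refElem s n = refElem s n) : ∃ c : ℝ, |c| = 1 ∧ ∀ z : Space (n + 1),
      detRows (Fin.cons z (fun j => facetLin F (Θ.linear (EuclideanSpace.single j 1))) :
        Fin (n + 1) → Space (n + 1)) = c * inner ℝ z (conormal F) := by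
  -- An orthonormal coordinate frame of the base hyperplane. Together with the conormal it has
  -- determinant `P = ±1`, since the conormal has component one in the direction `F.dir`.
  let a : Fin n → Space (n + 1) := fun j => EuclideanSpace.single (F.dir.succAbove j) 1
  let P := detRows (Fin.cons (conormal F) a : Fin (n + 1) → Space (n + 1))
  let e : Space (n + 1) := EuclideanSpace.single F.dir 1
  have haa : (Matrix.of fun i j => inner ℝ (a i) (a j)).det = 1 := by
    rw [← Matrix.det_one (n := Fin n)]
    congr 1
    ext i j
    simp only [a, Matrix.of_apply, Matrix.one_apply, EuclideanSpace.inner_single_left, map_one,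
      one_mul, PiLp.single_apply, Fin.succAbove_right_inj]
  have hae : ∀ i, inner ℝ (a i) e = 0 := fun i => by
    simp only [a, e, EuclideanSpace.inner_single_left, map_one, one_mul, PiLp.single_apply,
      Fin.succAbove_ne, if_false]
  have hee : inner ℝ e e = (1 : ℝ) := by simp [e]
  have hce : inner ℝ (conormal F) e = (1 : ℝ) := by
    rw [real_inner_comm, inner_conormal]
    simp [e, Fin.succAbove_ne]
  have h1 := detRows_cons_mul (conormal F) e a a hae
  have h2 := detRows_cons_mul e e a a hae
  rw [haa, mul_one] at h1 h2
  have hP : |P| = 1 := by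
    have h3 : P ^ 2 = 1 := by
      rw [hce] at h1
      rw [hee] at h2
      have : P * detRows (Fin.cons e a : Fin (n + 1) → Space (n + 1)) = 1 := h1
      calc P ^ 2 = P ^ 2 * (detRows (Fin.cons e a : Fin (n + 1) → Space (n + 1)) *
            detRows (Fin.cons e a : Fin (n + 1) → Space (n + 1))) := by rw [h2, mul_one]
        _ = (P * detRows (Fin.cons e a : Fin (n + 1) → Space (n + 1))) ^ 2 := by ring
        _ = 1 := by rw [this, one_pow]
    rw [← sq_abs] at h3
    exact (pow_eq_one_iff_of_nonneg (abs_nonneg P) two_ne_zero).1 h3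
  refine ⟨LinearMap.det (Θ.linear : Space n →ₗ[ℝ] Space n) * P, ?_, fun z => ?_⟩
  · rw [abs_mul, hP, mul_one]
    exact volChange_eq_one Θ h
  -- The facet vectors are orthogonal to the conormal, so multiplying by `P` splits off the inner
  -- product of `z` with the conormal; the remaining minor is the determinant of `Θ`.
  have h4 := detRows_cons_mul z (conormal F)
    (fun j => facetLin F (Θ.linear (EuclideanSpace.single j 1))) a
    fun i => inner_facetLin_conormal F _
  have h5 : (Matrix.of fun i j => inner ℝ (facetLin F (Θ.linear (EuclideanSpace.single i 1)))
      (a j)).det = LinearMap.det (Θ.linear : Space n →ₗ[ℝ] Space n) := by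
    rw [← detRows_single, detRows]
    congr 1
    ext i j
    simp only [a, Matrix.of_apply, EuclideanSpace.inner_single_right, one_mul,
      facetLin_succAbove]
    simp
  rw [h5] at h4
  have h6 : P * P = 1 := by rw [← abs_mul_abs_self, hP, mul_one]
  calc _ = detRows (Fin.cons z fun j => facetLin F (Θ.linear (EuclideanSpace.single j 1))) *
        P * P := by rw [mul_assoc, h6, mul_one]
    _ = _ := by rw [h4]; ring

theorem abs_eq_of_sq {x y : ℝ} (hy : 0 ≤ y) (h : x ^ 2 = y ^ 2) : |x| = y := by
  rw [← abs_of_nonneg hy]; exact (sq_eq_sq_iff_abs_eq_abs _ _).1 h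

namespace Mesh

section Geometry

variable {s : Shape} {n : ℕ} {Ω : Set (Space (n + 1))} {ι κ : Type} (M : Mesh s n Ω ι κ)

/-- The normal component, scaled by the surface element, in reference coordinates. -/
theorem facetJac_mul_inner_normal (T : ι) (F : FIdx s n) (z : Space (n + 1)) :
    M.facetJac (M.facetAt T F) * inner ℝ (M.normal T (M.facetAt T F)) ((M.Φ T).linear z) =
      volChange (M.Φ T) * normalRef F fun k => z k := by
  obtain ⟨J, hJ⟩ : ∃ J, J = M.facetJac (M.facetAt T F) := ⟨_, rfl⟩
  obtain ⟨ν, hν⟩ : ∃ ν, ν = M.normal T (M.facetAt T F) := ⟨_, rfl⟩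
  have hJ0 : 0 < J := hJ ▸ M.facetJac_pos _
  let w : Fin n → Space (n + 1) :=
    fun j => (M.Ψ (M.facetAt T F)).linear (EuclideanSpace.single j 1)
  have hνw : ∀ i, inner ℝ (w i) ν = 0 := fun i => by
    rw [real_inner_comm, hν]; exact M.inner_normal_linear T F _
  have hνν : inner ℝ ν ν = (1 : ℝ) := by
    rw [real_inner_self_eq_norm_sq, hν, (M.normal_spec T _ (M.incident_facetAt T F)).1, one_pow]
  have hG : J ^ 2 = (Matrix.of fun i j => inner ℝ (w i) (w j)).det := by
    rw [hJ, M.facetJac_sq]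
  let D := detRows (Fin.cons ν w : Fin (n + 1) → Space (n + 1))
  -- The unit normal is orthogonal to the facet frame `w`, so the square of the determinant of `(ν,
  -- w)` is the Gram determinant of `w`.
  have hD : |D| = J := by
    have h := detRows_cons_mul ν ν w w hνw
    rw [hνν, one_mul, ← hG] at h
    exact abs_eq_of_sq hJ0.le (by rw [sq]; exact h)
  obtain ⟨c, hc, hcz⟩ := exists_detRows_facetLin F (M.facetChange T F) (M.image_facetChange T F)
  -- The determinants of `(Φ' z, w)` and `(ν, w)` are multiplied. The first one pulls back to the
  -- reference facet frame, which produces the conormal.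
  have hz : ∀ z, J ^ 2 * inner ℝ ν ((M.Φ T).linear z) =
      LinearMap.det ((M.Φ T).linear : Space (n + 1) →ₗ[ℝ] Space (n + 1)) * c * D *
        inner ℝ z (conormal F) := by
    intro z
    have h := detRows_cons_mul ((M.Φ T).linear z) ν w w hνw
    have h2 : (Fin.cons ((M.Φ T).linear z) w : Fin (n + 1) → Space (n + 1)) = fun i =>
        ((M.Φ T).linear : Space (n + 1) →ₗ[ℝ] Space (n + 1)) ((Fin.cons z fun j => facetLin F
          ((M.facetChange T F).linear (EuclideanSpace.single j 1)) :
            Fin (n + 1) → Space (n + 1)) i) := by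
      funext i
      refine Fin.cases ?_ (fun j => ?_) i
      · rfl
      · simp only [Fin.cons_succ, w]
        exact M.Ψ_linear T F _
    rw [h2, detRows_map, hcz, ← hG] at h
    rw [real_inner_comm]
    linarith
  obtain ⟨η, hη⟩ : ∃ η, η = LinearMap.det ((M.Φ T).linear : Space (n + 1) →ₗ[ℝ] Space (n + 1)) *
    c * D / J * F.orient := ⟨_, rfl⟩
  have ho : F.orient * F.orient = 1 := by rcases F.orient_eq with h | h <;> rw [h] <;> norm_num
  have hz2 : ∀ z : Space (n + 1), J * inner ℝ ν ((M.Φ T).linear z) =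
      η * normalRef F fun k => z k := by
    intro z
    rw [normalRef_eq, hη]
    have := hz z
    field_simp
    linear_combination this - LinearMap.det ((M.Φ T).linear : Space (n + 1) →ₗ[ℝ] Space (n + 1)) *
      c * D * inner ℝ z (conormal F) * ho
  have hηa : |η| = volChange (M.Φ T) := by
    have hoa : |F.orient| = 1 := by rcases F.orient_eq with h | h <;> rw [h] <;> norm_num
    rw [hη, abs_mul, abs_div, abs_mul, abs_mul, hc, hD, abs_of_pos hJ0, hoa, volChange]
    field_simp
  -- The sign is fixed by an inward displacement from the facet point with parameter `0`: there the
  -- reference normal component is `-1`, and outwardness makes the left-hand side nonpositive.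
  have hη0 : 0 ≤ η := by
    have h1 := (M.normal_spec T _ (M.incident_facetAt T F)).2 (M.Φ T (sweep F 0 1))
      (mem_image_of_mem _ (by
        have := sweep_mem F (zero_mem_refElem s n) (t := 1) ⟨zero_le_one, le_rfl⟩
        rwa [smul_zero] at this)) (M.Φ T (facetMap F 0)) (by
        rw [M.image_facetAt]
        exact mem_image_of_mem _ (mem_image_of_mem _ (zero_mem_refElem s n)))
    have h2 : M.Φ T (sweep F 0 1) - M.Φ T (facetMap F 0) =
        (M.Φ T).linear (-(F.orient • (EuclideanSpace.single F.dir 1 : Space (n + 1)))) := by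
      rw [affineEquiv_eq, affineEquiv_eq (M.Φ T) (facetMap F 0), add_sub_add_right_eq_sub,
        ← map_sub]
      congr 1
      simp [sweep]
    rw [h2, ← hν] at h1
    have h3 := hz2 (-(F.orient • (EuclideanSpace.single F.dir 1 : Space (n + 1))))
    have h4 : (normalRef F fun k =>
        (-(F.orient • (EuclideanSpace.single F.dir 1 : Space (n + 1)))) k) = -1 := by
      rw [normalRef_eq, inner_conormal]
      simp [Fin.succAbove_ne]
      linarith
    rw [h4] at h3
    nlinarith
  rw [← hJ, ← hν, hz2, ← hηa, abs_of_nonneg hη0]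

end Geometry

end Mesh

/-! ### Shape regular meshes -/

namespace Mesh

section Scaling

variable {s : Shape} {n : ℕ} {Ω : Set (Space (n + 1))} {ι κ : Type} (M : Mesh s n Ω ι κ)

/-- The geometric quantities of the mesh scale like powers of the element diameters. -/
structure IsScaled (K : ℝ) : Prop where
  pos : 0 < K
  hElem_pos : ∀ T, 0 < M.hElem T
  linear_le : ∀ T z, ‖(M.Φ T).linear z‖ ≤ K * M.hElem T * ‖z‖
  le_linear : ∀ T z, M.hElem T * ‖z‖ ≤ K * ‖(M.Φ T).linear z‖
  vol_le : ∀ T, volChange (M.Φ T) ≤ K * M.hElem T ^ (n + 1)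
  le_vol : ∀ T, M.hElem T ^ (n + 1) ≤ K * volChange (M.Φ T)
  jac_le : ∀ T F, M.facetJac (M.facetAt T F) ≤ K * M.hElem T ^ n
  le_jac : ∀ T F, M.hElem T ^ n ≤ K * M.facetJac (M.facetAt T F)
  hFacet_pos : ∀ T F, 0 < M.hFacet (M.facetAt T F)
  hFacet_le : ∀ T F, M.hFacet (M.facetAt T F) ≤ M.hElem T
  le_hFacet : ∀ T F, M.hElem T ≤ K * M.hFacet (M.facetAt T F)

theorem isCompact_elem (T : ι) : IsCompact (M.elem T) :=
  (isCompact_refElem s (n + 1)).image (M.Φ T).continuous_of_finiteDimensional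

theorem linear_eq_sub (T : ι) (x y : Space (n + 1)) :
    (M.Φ T).linear (x - y) = M.Φ T x - M.Φ T y := by
  rw [affineEquiv_eq, affineEquiv_eq (M.Φ T) y, map_sub, add_sub_add_right_eq_sub]

theorem facet_subset_elem (T : ι) (F : FIdx s n) : M.facet (M.facetAt T F) ⊆ M.elem T := by
  rw [facet, image_facetAt]
  refine image_mono ?_
  rintro _ ⟨y, hy, rfl⟩
  exact facetMap_mem F hy

theorem norm_linear_single_le (T : ι) (i : Fin (n + 1)) :
    ‖(M.Φ T).linear (EuclideanSpace.single i 1)‖ ≤ M.hElem T := by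
  have := M.linear_eq_sub T (EuclideanSpace.single i 1) 0
  rw [sub_zero] at this
  rw [this, ← dist_eq_norm]
  exact Metric.dist_le_diam_of_mem (M.isCompact_elem T).isBounded
    (mem_image_of_mem _ (single_mem_refElem _ _ _)) (mem_image_of_mem _ (zero_mem_refElem _ _))

theorem hElem_pos (T : ι) : 0 < M.hElem T := by
  refine lt_of_lt_of_le (norm_pos_iff.2 fun h => ?_) (M.norm_linear_single_le T 0)
  have h1 := (M.Φ T).linear.injective (h.trans (map_zero _).symm)
  have := congrArg (fun z : Space (n + 1) => z 0) h1
  simp at this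

theorem norm_linear_le (T : ι) (z : Space (n + 1)) :
    ‖(M.Φ T).linear z‖ ≤ (n + 1) * M.hElem T * ‖z‖ := by
  have e2 : z = ∑ k, z k • (EuclideanSpace.single k 1 : Space (n + 1)) := by
    ext j; simp [Finset.sum_apply, Pi.single_apply]
  have h1 : (M.Φ T).linear z = ∑ k, z k • (M.Φ T).linear (EuclideanSpace.single k 1) := by
    conv_lhs => rw [e2]
    simp [map_sum]
  rw [h1]
  refine (norm_sum_le _ _).trans ?_
  have : ∀ k ∈ (Finset.univ : Finset (Fin (n + 1))),
      ‖z k • (M.Φ T).linear (EuclideanSpace.single k 1)‖ ≤ ‖z‖ * M.hElem T := fun k _ => by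
    rw [norm_smul]
    exact mul_le_mul (PiLp.norm_apply_le z k) (M.norm_linear_single_le T k) (norm_nonneg _)
      (norm_nonneg _)
  refine (Finset.sum_le_sum this).trans (le_of_eq ?_)
  simp
  ring

/-- A vector of length `h_T / (2 σ)` in any direction fits into the element from the centre of the
inscribed ball, and its preimage is a difference of two points of the reference element. -/
theorem norm_linear_symm_le {σ : ℝ} (hσ : 0 < σ) (hM : M.ShapeRegular σ) (T : ι)
    (w : Space (n + 1)) : M.hElem T * ‖(M.Φ T).linear.symm w‖ ≤ 2 * σ * (n + 1) * ‖w‖ := by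
  obtain ⟨x, hx⟩ := hM T
  have hh := M.hElem_pos T
  by_cases hw : w = 0
  · simp [hw]
  have hw0 : 0 < ‖w‖ := norm_pos_iff.2 hw
  obtain ⟨ρ, hρ⟩ : ∃ ρ, ρ = M.hElem T / (2 * σ) := ⟨_, rfl⟩
  have hρ0 : 0 < ρ := by rw [hρ]; positivity
  have hx0 := hx (Metric.mem_closedBall_self (by positivity))
  have hx1 : x + (ρ / ‖w‖) • w ∈ M.elem T := hx (by
    rw [Metric.mem_closedBall, dist_eq_norm, add_sub_cancel_left, norm_smul, Real.norm_eq_abs,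
      abs_of_pos (by positivity), div_mul_cancel₀ _ hw0.ne', hρ])
  obtain ⟨a, ha, hxa⟩ := hx0
  obtain ⟨b, hb, hxb⟩ := hx1
  have h1 : (M.Φ T).linear (b - a) = (ρ / ‖w‖) • w := by
    rw [linear_eq_sub, hxb, hxa, add_sub_cancel_left]
  have h2 : (ρ / ‖w‖) • (M.Φ T).linear.symm w = b - a := by
    rw [← map_smul, ← h1, LinearEquiv.symm_apply_apply]
  have h3 : ‖b - a‖ ≤ n + 1 := by
    have ha' := refElem_subset_cube _ _ ha
    have hb' := refElem_subset_cube _ _ hb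
    refine (EuclideanSpace.norm_eq _).trans_le (Real.sqrt_le_left (by positivity) |>.2 ?_)
    refine (Finset.sum_le_sum (g := fun _ => (1 : ℝ)) fun i _ => ?_).trans ?_
    · rw [Real.norm_eq_abs, sq_abs, PiLp.sub_apply]
      have := ha' i; have := hb' i
      nlinarith
    · simp
      nlinarith [(Nat.cast_nonneg n : (0 : ℝ) ≤ n)]
  rw [← h2, norm_smul, Real.norm_eq_abs, abs_of_pos (by positivity)] at h3
  have h4 : ρ * ‖(M.Φ T).linear.symm w‖ ≤ (n + 1) * ‖w‖ := by
    rw [div_mul_eq_mul_div, div_le_iff₀ hw0] at h3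
    exact h3
  have h5 : M.hElem T = 2 * σ * ρ := by rw [hρ]; field_simp
  rw [h5]
  nlinarith

theorem le_norm_linear {σ : ℝ} (hσ : 0 < σ) (hM : M.ShapeRegular σ) (T : ι)
    (z : Space (n + 1)) : M.hElem T * ‖z‖ ≤ 2 * σ * (n + 1) * ‖(M.Φ T).linear z‖ := by
  simpa using M.norm_linear_symm_le hσ hM T ((M.Φ T).linear z)

theorem volChange_le (T : ι) :
    volChange (M.Φ T) ≤ ((n + 1).factorial : ℝ) * M.hElem T ^ (n + 1) :=
  abs_det_le _ fun i => M.norm_linear_single_le T i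

/-- The Leibniz bound of the determinant, applied to the inverse linear part. -/
theorem le_volChange {σ : ℝ} (hσ : 0 < σ) (hM : M.ShapeRegular σ) (T : ι) :
    M.hElem T ^ (n + 1) ≤
      ((n + 1).factorial : ℝ) * (2 * σ * (n + 1)) ^ (n + 1) * volChange (M.Φ T) := by
  have hh := M.hElem_pos T
  have h1 := abs_det_le ((M.Φ T).linear.symm : Space (n + 1) →ₗ[ℝ] Space (n + 1))
    (x := 2 * σ * (n + 1) / M.hElem T) fun i => by
      rw [le_div_iff₀ hh, mul_comm]
      simpa using M.norm_linear_symm_le hσ hM T (EuclideanSpace.single i 1)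
  have h2 : volChange (M.Φ T) *
      |LinearMap.det ((M.Φ T).linear.symm : Space (n + 1) →ₗ[ℝ] Space (n + 1))| = 1 := by
    rw [volChange, ← abs_mul, LinearEquiv.det_mul_det_symm, abs_one]
  rw [div_pow, mul_div_assoc', le_div_iff₀ (pow_pos hh _)] at h1
  have h3 := mul_le_mul_of_nonneg_left h1 (volChange_pos (M.Φ T)).le
  rw [← mul_assoc, h2, one_mul] at h3
  linarith

theorem hFacet_le (T : ι) (F : FIdx s n) : M.hFacet (M.facetAt T F) ≤ M.hElem T :=
  Metric.diam_mono (M.facet_subset_elem T F) (M.isCompact_elem T).isBounded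

theorem facetJac_le (T : ι) (F : FIdx s n) :
    M.facetJac (M.facetAt T F) ≤ (n.factorial : ℝ) * M.hElem T ^ n := by
  have hh := (M.hElem_pos T).le
  refine Real.sqrt_le_iff.2 ⟨by positivity, ?_⟩
  have hw : ∀ i, ‖(M.Ψ (M.facetAt T F)).linear (EuclideanSpace.single i 1)‖ ≤ M.hElem T := by
    intro i
    have e : (M.Ψ (M.facetAt T F)).linear (EuclideanSpace.single i 1) =
        M.Ψ (M.facetAt T F) (EuclideanSpace.single i 1) - M.Ψ (M.facetAt T F) 0 := by
      have := (M.Ψ (M.facetAt T F)).linearMap_vsub (EuclideanSpace.single i 1) 0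
      simpa using this
    rw [e, ← dist_eq_norm]
    exact Metric.dist_le_diam_of_mem (M.isCompact_elem T).isBounded
      (M.facet_subset_elem T F (mem_image_of_mem _ (single_mem_refElem _ _ _)))
      (M.facet_subset_elem T F (mem_image_of_mem _ (zero_mem_refElem _ _)))
  have h1 := Matrix.det_le (abv := AbsoluteValue.abs) (x := M.hElem T ^ 2)
    (A := Matrix.of fun i j : Fin n =>
      inner ℝ ((M.Ψ (M.facetAt T F)).linear (EuclideanSpace.single i 1))
      ((M.Ψ (M.facetAt T F)).linear (EuclideanSpace.single j 1))) fun i j => by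
      refine (abs_real_inner_le_norm
        ((M.Ψ (M.facetAt T F)).linear (EuclideanSpace.single i 1))
        ((M.Ψ (M.facetAt T F)).linear (EuclideanSpace.single j 1))).trans ?_
      rw [sq]
      exact mul_le_mul (hw i) (hw j) (norm_nonneg _) hh
  have h2 := (le_abs_self _).trans h1
  simp only [Fintype.card_fin, nsmul_eq_mul] at h2
  have hf : (1 : ℝ) ≤ n.factorial := by exact_mod_cast n.factorial_pos
  calc _ ≤ (n.factorial : ℝ) * (M.hElem T ^ 2) ^ n := h2
    _ ≤ (n.factorial : ℝ) * n.factorial * (M.hElem T ^ 2) ^ n := by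
        refine mul_le_mul_of_nonneg_right ?_ (by positivity)
        nlinarith
    _ = _ := by rw [mul_pow, ← pow_mul, ← pow_mul, mul_comm 2 n]; ring

/-- Volume is at most facet area times height: `facetJac_mul_inner_normal` with the direction
`F.dir`, whose reference normal component is `±1` and whose image has length at most `h_T`. -/
theorem volChange_le_facetJac (T : ι) (F : FIdx s n) :
    volChange (M.Φ T) ≤ M.facetJac (M.facetAt T F) * M.hElem T := by
  have h := M.facetJac_mul_inner_normal T F (EuclideanSpace.single F.dir 1)
  have h1 : |normalRef F fun k => (EuclideanSpace.single F.dir 1 : Space (n + 1)) k| = 1 := by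
    rw [normalRef_eq, inner_conormal]
    rcases F.orient_eq with h | h <;> simp [h, Fin.succAbove_ne]
  have h2 := congrArg abs h
  rw [abs_mul, abs_mul, h1, mul_one, abs_of_pos (volChange_pos _),
    abs_of_pos (M.facetJac_pos _)] at h2
  rw [← h2]
  refine mul_le_mul_of_nonneg_left ?_ (M.facetJac_pos _).le
  refine (abs_real_inner_le_norm _ _).trans ?_
  rw [(M.normal_spec T _ (M.incident_facetAt T F)).1, one_mul]
  exact M.norm_linear_single_le T _

/-- An edge of the facet has length comparable to `h_T`. A facet of dimension zero has no edge and
zero diameter, hence `1 ≤ n`. -/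
theorem le_hFacet (hn : 1 ≤ n) {σ : ℝ} (hσ : 0 < σ) (hM : M.ShapeRegular σ) (T : ι)
    (F : FIdx s n) : M.hElem T ≤ 2 * σ * (n + 1) * M.hFacet (M.facetAt T F) := by
  obtain ⟨m, rfl⟩ : ∃ m, n = m + 1 := ⟨n - 1, by omega⟩
  let z := facetLin F (EuclideanSpace.single 0 1)
  have hz : 1 ≤ ‖z‖ := by
    have h1 := PiLp.norm_apply_le z (F.dir.succAbove 0)
    rw [facetLin_succAbove] at h1
    simpa using h1
  have h2 : ‖(M.Φ T).linear z‖ ≤ M.hFacet (M.facetAt T F) := by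
    have hz2 : z = facetMap F (EuclideanSpace.single 0 1) - facetMap F 0 := by
      have := facetMap_add F 0 (EuclideanSpace.single 0 1)
      rw [zero_add] at this
      rw [this, add_sub_cancel_left]
    rw [hz2, linear_eq_sub, ← dist_eq_norm]
    have hmem : ∀ y ∈ refElem s (m + 1), M.Φ T (facetMap F y) ∈ M.facet (M.facetAt T F) :=
      fun y hy => by
        rw [facet, image_facetAt]; exact mem_image_of_mem _ (mem_image_of_mem _ hy)
    exact Metric.dist_le_diam_of_mem
      ((M.isCompact_elem T).isBounded.subset (M.facet_subset_elem T F))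
      (hmem _ (single_mem_refElem _ _ _)) (hmem _ (zero_mem_refElem _ _))
  have hh := M.hElem_pos T
  calc M.hElem T ≤ M.hElem T * ‖z‖ := le_mul_of_one_le_right hh.le hz
    _ ≤ _ := M.le_norm_linear hσ hM T z
    _ ≤ _ := mul_le_mul_of_nonneg_left h2 (by positivity)

theorem isScaled_of_shapeRegular (hn : 1 ≤ n) {σ : ℝ} (hσ : 0 < σ) :
    ∃ K : ℝ, ∀ (Ω : Set (Space (n + 1))) (ι κ : Type) (M : Mesh s n Ω ι κ), M.ShapeRegular σ →
      M.IsScaled K := by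
  let A : ℝ := ((n + 1).factorial : ℝ) * (2 * σ * (n + 1)) ^ (n + 1)
  let B : ℝ := 2 * σ * (n + 1)
  have hA : 0 < A := by positivity
  have hB : 0 < B := by positivity
  have hf : (0 : ℝ) < (n + 1).factorial := by positivity
  have hf' : (0 : ℝ) < n.factorial := by positivity
  -- The sum of the positive constants in the individual bounds dominates each of them.
  refine ⟨A + B + (n + 1 : ℝ) + (n + 1).factorial + n.factorial, fun Ω ι κ M hM => ?_⟩
  have mono : ∀ {x y c d : ℝ}, x ≤ c * y → 0 ≤ y → c ≤ d → x ≤ d * y := fun h hy hcd =>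
    h.trans (mul_le_mul_of_nonneg_right hcd hy)
  have hh := M.hElem_pos
  have hlf := M.le_hFacet hn hσ hM
  constructor
  · positivity
  · exact hh
  · intro T z
    have := M.norm_linear_le T z
    rw [mul_assoc] at this ⊢
    exact mono this (by have := hh T; positivity) (by linarith)
  · exact fun T z => mono (M.le_norm_linear hσ hM T z) (norm_nonneg _) (by linarith)
  · exact fun T => mono (M.volChange_le T) (by have := hh T; positivity) (by linarith)
  · exact fun T => mono (M.le_volChange hσ hM T) (volChange_pos _).le (by linarith)
  · exact fun T F => mono (M.facetJac_le T F) (by have := hh T; positivity) (by linarith)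
  · intro T F
    -- Combining `h_T^(n+1) ≤ A vol` with `vol ≤ J h_T`, one power of `h_T` cancels and bounds the
    -- facet Jacobian from below.
    have h1 := (M.le_volChange hσ hM T).trans
      (mul_le_mul_of_nonneg_left (M.volChange_le_facetJac T F) hA.le)
    rw [pow_succ, ← mul_assoc] at h1
    exact mono (le_of_mul_le_mul_right h1 (hh T)) (M.facetJac_pos _).le (by linarith)
  · intro T F
    by_contra hneg
    have h1 := hlf T F
    have h2 := hh T
    nlinarith [mul_nonneg hB.le (neg_nonneg.2 (not_lt.1 hneg))]
  · exact M.hFacet_le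
  · exact fun T F => mono (hlf T F) Metric.diam_nonneg (by linarith)

end Scaling

end Mesh

/-! ### The discrete forms in reference coordinates -/

theorem inner_gradient {d : ℕ} (a : Space d → ℝ) (x z : Space d) :
    inner ℝ (gradient a x) z = fderiv ℝ a x z := by
  rw [gradient, InnerProductSpace.toDual_symm_apply]

theorem hasFDerivAt_affineEquiv {d : ℕ} (Θ : Space d ≃ᵃ[ℝ] Space d) (x : Space d) :
    HasFDerivAt Θ (LinearMap.toContinuousLinearMap (Θ.linear : Space d →ₗ[ℝ] Space d)) x := by
  have h : (Θ : Space d → Space d) =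
      fun x => LinearMap.toContinuousLinearMap (Θ.linear : Space d →ₗ[ℝ] Space d) x + Θ 0 := by
    funext x; simpa using affineEquiv_eq Θ x
  rw [h]
  exact (ContinuousLinearMap.hasFDerivAt _).add_const _

theorem contDiff_affineEquiv {d : ℕ} (Θ : Space d ≃ᵃ[ℝ] Space d) : ContDiff ℝ ∞ Θ := by
  have h : (Θ : Space d → Space d) =
      fun x => LinearMap.toContinuousLinearMap (Θ.linear : Space d →ₗ[ℝ] Space d) x + Θ 0 := by
    funext x; simpa using affineEquiv_eq Θ x
  rw [h]
  exact (ContinuousLinearMap.contDiff _).add contDiff_const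

theorem inner_gradient_comp {d : ℕ} (Θ : Space d ≃ᵃ[ℝ] Space d) {a : Space d → ℝ}
    (ha : ContDiff ℝ ∞ a) (x z : Space d) :
    inner ℝ (gradient (a ∘ Θ) x) z = inner ℝ (gradient a (Θ x)) (Θ.linear z) := by
  rw [inner_gradient, inner_gradient]
  have := (((ha.differentiable (by simp)) (Θ x)).hasFDerivAt.comp x
    (hasFDerivAt_affineEquiv Θ x)).fderiv
  rw [this]
  rfl

namespace Mesh

section Forms

variable {s : Shape} {n : ℕ} {Ω : Set (Space (n + 1))} {ι κ : Type} (M : Mesh s n Ω ι κ)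

theorem fn_Φ (v : ι → MvPolynomial (Fin (n + 1)) ℝ) (T : ι) (x : Space (n + 1)) :
    M.fn v T (M.Φ T x) = pe (v T) x := by
  simp [fn, pe]

theorem fn_comp_Φ (v : ι → MvPolynomial (Fin (n + 1)) ℝ) (T : ι) :
    M.fn v T ∘ M.Φ T = pe (v T) := funext fun x => M.fn_Φ v T x

theorem fn_eq_pe (v : ι → MvPolynomial (Fin (n + 1)) ℝ) (T : ι) :
    M.fn v T = pe (MvPolynomial.aeval
      (affSub ((M.Φ T).symm : Space (n + 1) →ᵃ[ℝ] Space (n + 1))) (v T)) := by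
  funext x
  rw [pe_affSub]
  rfl

theorem contDiff_fn (v : ι → MvPolynomial (Fin (n + 1)) ℝ) (T : ι) :
    ContDiff ℝ ∞ (M.fn v T) := by
  rw [fn_eq_pe]; exact contDiff_pe _

theorem field_Φ (r : ι → Fin (n + 1) → MvPolynomial (Fin (n + 1)) ℝ) (T : ι)
    (x : Space (n + 1)) : M.field r T (M.Φ T x) =
      (LinearMap.det ((M.Φ T).linear : Space (n + 1) →ₗ[ℝ] Space (n + 1)))⁻¹ •
        (M.Φ T).linear (fieldL _ (r T) x) := by
  simp only [field, AffineEquiv.symm_apply_apply]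
  rfl

theorem continuous_field (r : ι → Fin (n + 1) → MvPolynomial (Fin (n + 1)) ℝ) (T : ι) :
    Continuous (M.field r T) := by
  have h1 : Continuous ((M.Φ T).linear) :=
    (LinearMap.toContinuousLinearMap
      ((M.Φ T).linear : Space (n + 1) →ₗ[ℝ] Space (n + 1))).continuous
  have h2 : M.field r T = fun x =>
      (LinearMap.det ((M.Φ T).linear : Space (n + 1) →ₗ[ℝ] Space (n + 1)))⁻¹ •
        (M.Φ T).linear (fieldL _ (r T) ((M.Φ T).symm x)) := rfl
  have h3 : Continuous fun x => (M.Φ T).linear (fieldL _ (r T) ((M.Φ T).symm x)) :=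
    h1.comp ((continuous_fieldL _).comp (M.Φ T).symm.continuous_of_finiteDimensional)
  rw [h2]
  exact h3.const_smul (LinearMap.det ((M.Φ T).linear : Space (n + 1) →ₗ[ℝ] Space (n + 1)))⁻¹

/-- The facet function `μ` on the facets of `T`, in the coordinates of the reference element. -/
def traceAt (μ : κ → MvPolynomial (Fin n) ℝ) (T : ι) (F : FIdx s n) : MvPolynomial (Fin n) ℝ :=
  MvPolynomial.aeval (affSub ((M.facetChange T F).symm : Space n →ᵃ[ℝ] Space n))
    (μ (M.facetAt T F))

theorem pe_traceAt (μ : κ → MvPolynomial (Fin n) ℝ) (T : ι) (F : FIdx s n) (y : Space n) :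
    pe (M.traceAt μ T F) (M.facetChange T F y) = facetFn μ (M.facetAt T F) y := by
  rw [traceAt, pe_affSub]
  simp [facetFn, pe]

theorem traceAt_mem {p : ℕ} {μ : κ → MvPolynomial (Fin n) ℝ} {T : ι} {F : FIdx s n}
    (h : μ (M.facetAt T F) ∈ polySpace s n p) : M.traceAt μ T F ∈ polySpace s n p :=
  (admSub_affSub _ (symm_image_refElem (M.image_facetChange T F))).aeval_mem h

/-- The sign of the determinant of `Φ_T'`. -/
def orientation (T : ι) : ℝ :=
  (LinearMap.det ((M.Φ T).linear : Space (n + 1) →ₗ[ℝ] Space (n + 1)))⁻¹ * volChange (M.Φ T)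

theorem orientation_sq (T : ι) : M.orientation T ^ 2 = 1 := by
  have := det_linear_ne_zero (M.Φ T)
  rw [orientation, mul_pow, volChange, sq_abs]
  field_simp

theorem facetIntegral_eq (T : ι) (F : FIdx s n) (f : Space n → ℝ) :
    M.facetIntegral (M.facetAt T F) (fun y => f (M.facetChange T F y)) =
      M.facetJac (M.facetAt T F) * ∫ y in refElem s n, f y := by
  rw [facetIntegral, setIntegral_comp_affineEquiv _ (M.image_facetChange T F)]

theorem fn_sub_facetFn (v : ι → MvPolynomial (Fin (n + 1)) ℝ) (μ : κ → MvPolynomial (Fin n) ℝ)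
    (T : ι) (F : FIdx s n) (y : Space n) :
    M.fn v T (M.Ψ (M.facetAt T F) y) - facetFn μ (M.facetAt T F) y =
      pe (gapRef (v T) (M.traceAt μ T) F) (M.facetChange T F y) := by
  rw [Ψ_facetAt, fn_Φ, gapRef, pe_sub, pe_facetSub, pe_traceAt]

theorem sum_facetIntegral_gap [Fintype κ] (v : ι → MvPolynomial (Fin (n + 1)) ℝ)
    (μ : κ → MvPolynomial (Fin n) ℝ) (T : ι) :
    ∑ E ∈ M.facetsOf T, M.facetIntegral E (fun y =>
      (M.fn v T (M.Ψ E y) - facetFn μ E y) ^ 2) = ∑ F, M.facetJac (M.facetAt T F) *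
        ∫ y in refElem s n, pe (gapRef (v T) (M.traceAt μ T) F) y ^ 2 := by
  rw [sum_facetsOf]
  refine Finset.sum_congr rfl fun F _ => ?_
  simp_rw [fn_sub_facetFn]
  exact M.facetIntegral_eq T F fun y => pe (gapRef (v T) (M.traceAt μ T) F) y ^ 2

variable [Fintype ι] [Fintype κ]

/-- The Piola transform is dual to the chain rule for gradients and, by `facetJac_mul_inner_normal`,
to the change of surface measure. All Jacobians cancel and only the sign of the determinant is left,
which later disappears on squaring. -/
theorem formB_eq (r : ι → Fin (n + 1) → MvPolynomial (Fin (n + 1)) ℝ)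
    (v : ι → MvPolynomial (Fin (n + 1)) ℝ) (μ : κ → MvPolynomial (Fin n) ℝ) :
    M.formB r v μ = ∑ T, M.orientation T * bRef (r T) (v T) (M.traceAt μ T) := by
  rw [formB, ← Finset.sum_sub_distrib]
  refine Finset.sum_congr rfl fun T _ => ?_
  rw [bRef_eq_inner, mul_sub, Finset.mul_sum, sum_facetsOf]
  congr 1
  · rw [elem, setIntegral_image_affineEquiv, orientation, mul_comm _ (volChange _), mul_assoc,
      ← integral_const_mul (LinearMap.det _)⁻¹]
    refine congrArg (volChange (M.Φ T) * ·)
      (integral_congr_ae (Eventually.of_forall fun x => ?_))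
    simp only
    rw [field_Φ, real_inner_smul_left, real_inner_comm, ← inner_gradient_comp _ (M.contDiff_fn v T),
      fn_comp_Φ, real_inner_comm]
  · refine Finset.sum_congr rfl fun F _ => ?_
    have h : ∀ y, (M.fn v T (M.Ψ (M.facetAt T F) y) - facetFn μ (M.facetAt T F) y) *
        inner ℝ (M.field r T (M.Ψ (M.facetAt T F) y)) (M.normal T (M.facetAt T F)) =
        (fun y => pe (gapRef (v T) (M.traceAt μ T) F) y *
          ((M.facetJac (M.facetAt T F))⁻¹ * (M.orientation T * pe (normalPoly F (r T)) y)))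
          (M.facetChange T F y) := by
      intro y
      simp only
      rw [fn_sub_facetFn]
      congr 1
      have h1 := M.facetJac_mul_inner_normal T F
        (fieldL _ (r T) (facetMap F (M.facetChange T F y)))
      have h2 : (normalRef F fun k => fieldL _ (r T) (facetMap F (M.facetChange T F y)) k) =
          pe (normalPoly F (r T)) (M.facetChange T F y) := by
        rw [pe_normalPoly]; rfl
      rw [h2] at h1
      rw [Ψ_facetAt, field_Φ, real_inner_smul_left, real_inner_comm, orientation, mul_assoc, ← h1]
      have := (M.facetJac_pos (M.facetAt T F)).ne'
      field_simp
    have hJ := (M.facetJac_pos (M.facetAt T F)).ne'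
    simp_rw [h]
    rw [M.facetIntegral_eq T F fun y => pe (gapRef (v T) (M.traceAt μ T) F) y *
          ((M.facetJac (M.facetAt T F))⁻¹ * (M.orientation T * pe (normalPoly F (r T)) y)),
      ← integral_const_mul, ← integral_const_mul]
    refine integral_congr_ae (Eventually.of_forall fun y => ?_)
    simp only
    field_simp

end Forms

end Mesh

theorem tendsto_integral_norm_sq {X E : Type*} [MeasurableSpace X] {μ : Measure X}
    [NormedAddCommGroup E] [InnerProductSpace ℝ E] {f : ℕ → X → E} {g : X → E}
    (hf : ∀ k, MemLp (f k) 2 μ) (hg : MemLp g 2 μ)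
    (h : Tendsto (fun k => eLpNorm (f k - g) 2 μ) atTop (𝓝 0)) :
    Tendsto (fun k => ∫ x, ‖f k x‖ ^ 2 ∂μ) atTop (𝓝 (∫ x, ‖g x‖ ^ 2 ∂μ)) := by
  have key : ∀ {u : X → E} (hu : MemLp u 2 μ), ‖hu.toLp u‖ ^ 2 = ∫ x, ‖u x‖ ^ 2 ∂μ := by
    intro u hu
    rw [← real_inner_self_eq_norm_sq, L2.inner_def]
    refine integral_congr_ae ?_
    filter_upwards [hu.coeFn_toLp] with x hx
    rw [hx, real_inner_self_eq_norm_sq]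
  have h1 := (Lp.tendsto_Lp_iff_tendsto_eLpNorm'' f hf g hg).2 h
  have h2 := (h1.norm).pow 2
  simp_rw [key] at h2
  exact h2

namespace Mesh

/-! ### Scaling of local norms between an element and the reference element -/

section Local

variable {s : Shape} {n : ℕ} {Ω : Set (Space (n + 1))} {ι κ : Type} {M : Mesh s n Ω ι κ} {K : ℝ}

theorem setIntegral_elem (T : ι) (f : Space (n + 1) → ℝ) :
    ∫ x in M.elem T, f x = volChange (M.Φ T) * ∫ x in refElem s (n + 1), f (M.Φ T x) :=
  setIntegral_image_affineEquiv _ _ _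

/-- The chain rule is tested with the pulled-back gradient itself and then divided by its norm,
which accounts for the separate case of a vanishing gradient. -/
theorem IsScaled.gradient_le (hM : M.IsScaled K) (T : ι) {a : Space (n + 1) → ℝ}
    (ha : ContDiff ℝ ∞ a) (x : Space (n + 1)) :
    ‖gradient (a ∘ M.Φ T) x‖ ^ 2 ≤ K ^ 2 * M.hElem T ^ 2 * ‖gradient a (M.Φ T x)‖ ^ 2 := by
  have h1 := inner_gradient_comp (M.Φ T) ha x (gradient (a ∘ M.Φ T) x)
  rw [real_inner_self_eq_norm_sq] at h1
  have h2 := (real_inner_le_norm (gradient a (M.Φ T x))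
    ((M.Φ T).linear (gradient (a ∘ M.Φ T) x))).trans
    (mul_le_mul_of_nonneg_left (hM.linear_le T _) (norm_nonneg _))
  rw [← h1] at h2
  have hh := hM.hElem_pos T
  have hK := hM.pos
  rw [← mul_pow, ← mul_pow]
  refine pow_le_pow_left₀ (norm_nonneg _) ?_ 2
  by_cases h0 : ‖gradient (a ∘ M.Φ T) x‖ = 0
  · rw [h0]; positivity
  · have h3 : 0 < ‖gradient (a ∘ M.Φ T) x‖ := lt_of_le_of_ne (norm_nonneg _) (Ne.symm h0)
    refine le_of_mul_le_mul_right ?_ h3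
    calc _ = ‖gradient (a ∘ M.Φ T) x‖ ^ 2 := (sq _).symm
      _ ≤ _ := h2
      _ = _ := by ring

theorem IsScaled.le_gradient (hM : M.IsScaled K) (T : ι) {a : Space (n + 1) → ℝ}
    (ha : ContDiff ℝ ∞ a) (x : Space (n + 1)) :
    M.hElem T ^ 2 * ‖gradient a (M.Φ T x)‖ ^ 2 ≤ K ^ 2 * ‖gradient (a ∘ M.Φ T) x‖ ^ 2 := by
  obtain ⟨z, hz⟩ := (M.Φ T).linear.surjective (gradient a (M.Φ T x))
  have h1 := inner_gradient_comp (M.Φ T) ha x z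
  rw [hz, real_inner_self_eq_norm_sq] at h1
  have h2 := real_inner_le_norm (gradient (a ∘ M.Φ T) x) z
  rw [h1] at h2
  have h3 := hM.le_linear T z
  rw [hz] at h3
  have hh := hM.hElem_pos T
  have hK := hM.pos
  rw [← mul_pow, ← mul_pow]
  refine pow_le_pow_left₀ (by positivity) ?_ 2
  by_cases h0 : ‖gradient a (M.Φ T x)‖ = 0
  · rw [h0]; simp; positivity
  · have h4 : 0 < ‖gradient a (M.Φ T x)‖ := lt_of_le_of_ne (norm_nonneg _) (Ne.symm h0)
    refine le_of_mul_le_mul_right ?_ h4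
    calc _ = M.hElem T * ‖gradient a (M.Φ T x)‖ ^ 2 := by ring
      _ ≤ M.hElem T * (‖gradient (a ∘ M.Φ T) x‖ * ‖z‖) := mul_le_mul_of_nonneg_left h2 hh.le
      _ = ‖gradient (a ∘ M.Φ T) x‖ * (M.hElem T * ‖z‖) := by ring
      _ ≤ ‖gradient (a ∘ M.Φ T) x‖ * (K * ‖gradient a (M.Φ T x)‖) :=
          mul_le_mul_of_nonneg_left h3 (norm_nonneg _)
      _ = _ := by ring

/-- The scaling factor of the Dirichlet energy, `h_T^{d-2}`. -/
def scale (M : Mesh s n Ω ι κ) (T : ι) : ℝ := M.hElem T ^ (n + 1) / M.hElem T ^ 2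

theorem scale_pos (T : ι) : 0 < M.scale T := by
  have := M.hElem_pos T
  unfold scale; positivity

theorem integrable_ref {d : ℕ} {E : Type*} [NormedAddCommGroup E] {f : Space d → E}
    (hf : Continuous f) : Integrable f (volume.restrict (refElem s d)) :=
  integrable_of_continuous hf (isCompact_refElem s d)

theorem continuous_Φ (T : ι) : Continuous (M.Φ T) := (M.Φ T).continuous_of_finiteDimensional

theorem contDiff_comp_Φ (T : ι) {a : Space (n + 1) → ℝ} (ha : ContDiff ℝ ∞ a) :
    ContDiff ℝ ∞ (a ∘ M.Φ T) := ha.comp (contDiff_affineEquiv _)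

theorem IsScaled.integral_gradient_le (hM : M.IsScaled K) (T : ι) {a : Space (n + 1) → ℝ}
    (ha : ContDiff ℝ ∞ a) : ∫ x in M.elem T, ‖gradient a x‖ ^ 2 ≤
      K ^ 3 * M.scale T * ∫ x in refElem s (n + 1), ‖gradient (a ∘ M.Φ T) x‖ ^ 2 := by
  have hh := hM.hElem_pos T
  have hK := hM.pos
  have hc := continuous_gradient (contDiff_comp_Φ (M := M) T ha)
  have h1 : M.hElem T ^ 2 * ∫ x in refElem s (n + 1), ‖gradient a (M.Φ T x)‖ ^ 2 ≤
      K ^ 2 * ∫ x in refElem s (n + 1), ‖gradient (a ∘ M.Φ T) x‖ ^ 2 := by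
    rw [← integral_const_mul, ← integral_const_mul]
    refine integral_mono (integrable_ref ?_) (integrable_ref (by fun_prop)) (hM.le_gradient T ha)
    have := (continuous_gradient ha).comp (continuous_Φ (M := M) T)
    fun_prop
  rw [setIntegral_elem, scale]
  generalize (∫ x in refElem s (n + 1), ‖gradient a (M.Φ T x)‖ ^ 2) = I at *
  have hJ : 0 ≤ ∫ x in refElem s (n + 1), ‖gradient (a ∘ M.Φ T) x‖ ^ 2 :=
    integral_nonneg fun x => by positivity
  generalize (∫ x in refElem s (n + 1), ‖gradient (a ∘ M.Φ T) x‖ ^ 2) = J at *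
  have h2 : I ≤ K ^ 2 * J / M.hElem T ^ 2 := by rw [le_div_iff₀ (by positivity)]; linarith
  calc _ ≤ volChange (M.Φ T) * (K ^ 2 * J / M.hElem T ^ 2) :=
        mul_le_mul_of_nonneg_left h2 (volChange_pos _).le
    _ ≤ K * M.hElem T ^ (n + 1) * (K ^ 2 * J / M.hElem T ^ 2) :=
        mul_le_mul_of_nonneg_right (hM.vol_le T) (by positivity)
    _ = _ := by ring

theorem IsScaled.le_integral_gradient (hM : M.IsScaled K) (T : ι) {a : Space (n + 1) → ℝ}
    (ha : ContDiff ℝ ∞ a) :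
    M.scale T * ∫ x in refElem s (n + 1), ‖gradient (a ∘ M.Φ T) x‖ ^ 2 ≤
      K ^ 3 * ∫ x in M.elem T, ‖gradient a x‖ ^ 2 := by
  have hh := hM.hElem_pos T
  have hK := hM.pos
  have hc := continuous_gradient (contDiff_comp_Φ (M := M) T ha)
  have h1 : ∫ x in refElem s (n + 1), ‖gradient (a ∘ M.Φ T) x‖ ^ 2 ≤
      K ^ 2 * M.hElem T ^ 2 * ∫ x in refElem s (n + 1), ‖gradient a (M.Φ T x)‖ ^ 2 := by
    rw [← integral_const_mul]
    refine integral_mono (integrable_ref (by fun_prop)) (integrable_ref ?_) (hM.gradient_le T ha)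
    have := (continuous_gradient ha).comp (continuous_Φ (M := M) T)
    fun_prop
  rw [setIntegral_elem, scale]
  have hI : 0 ≤ ∫ x in refElem s (n + 1), ‖gradient a (M.Φ T x)‖ ^ 2 :=
    integral_nonneg fun x => by positivity
  generalize (∫ x in refElem s (n + 1), ‖gradient a (M.Φ T x)‖ ^ 2) = I at *
  generalize (∫ x in refElem s (n + 1), ‖gradient (a ∘ M.Φ T) x‖ ^ 2) = J at *
  calc _ ≤ M.hElem T ^ (n + 1) / M.hElem T ^ 2 * (K ^ 2 * M.hElem T ^ 2 * I) :=
        mul_le_mul_of_nonneg_left h1 (by positivity)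
    _ = M.hElem T ^ (n + 1) * (K ^ 2 * I) := by field_simp
    _ ≤ K * volChange (M.Φ T) * (K ^ 2 * I) :=
        mul_le_mul_of_nonneg_right (hM.le_vol T) (by positivity)
    _ = _ := by ring

/-- The facet term `h_T⁻¹ · h_T^(d-1)` scales like the Dirichlet energy `h_T^(d-2)`; this is why the
energy carries the weight `h_T⁻¹`. -/
theorem IsScaled.jac_div_le (hM : M.IsScaled K) (T : ι) (F : FIdx s n) :
    (M.hElem T)⁻¹ * M.facetJac (M.facetAt T F) ≤ K * M.scale T := by
  have hh := hM.hElem_pos T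
  calc _ ≤ (M.hElem T)⁻¹ * (K * M.hElem T ^ n) :=
        mul_le_mul_of_nonneg_left (hM.jac_le T F) (by positivity)
    _ = _ := by rw [scale, pow_succ]; field_simp

theorem IsScaled.le_jac_div (hM : M.IsScaled K) (T : ι) (F : FIdx s n) :
    M.scale T ≤ K * ((M.hElem T)⁻¹ * M.facetJac (M.facetAt T F)) := by
  have hh := hM.hElem_pos T
  calc M.scale T = (M.hElem T)⁻¹ * M.hElem T ^ n := by rw [scale, pow_succ]; field_simp
    _ ≤ (M.hElem T)⁻¹ * (K * M.facetJac (M.facetAt T F)) :=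
        mul_le_mul_of_nonneg_left (hM.le_jac T F) (by positivity)
    _ = _ := by ring

/-- The Piola map scales squared `L²` norms by `h_T^(2-d)`, the reciprocal of the factor for the
Dirichlet energy. The powers of `h_T` therefore cancel in the inf-sup quotient. -/
theorem IsScaled.field_ref_le (hM : M.IsScaled K) (T : ι)
    (r : ι → Fin (n + 1) → MvPolynomial (Fin (n + 1)) ℝ) :
    ∫ x in refElem s (n + 1), ‖fieldL _ (r T) x‖ ^ 2 ≤
      K ^ 3 * M.scale T * ∫ x in M.elem T, ‖M.field r T x‖ ^ 2 ∧
    M.scale T * ∫ x in M.elem T, ‖M.field r T x‖ ^ 2 ≤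
      K ^ 3 * ∫ x in refElem s (n + 1), ‖fieldL _ (r T) x‖ ^ 2 := by
  have hh := hM.hElem_pos T
  have hK := hM.pos
  have hd := volChange_pos (M.Φ T)
  have hLc : Continuous fun x => (M.Φ T).linear (fieldL _ (r T) x) :=
    (LinearMap.toContinuousLinearMap
      ((M.Φ T).linear : Space (n + 1) →ₗ[ℝ] Space (n + 1))).continuous.comp (continuous_fieldL _)
  have hfc := continuous_fieldL (r T)
  have h0 : volChange (M.Φ T) * ∫ x in M.elem T, ‖M.field r T x‖ ^ 2 =
      ∫ x in refElem s (n + 1), ‖(M.Φ T).linear (fieldL _ (r T) x)‖ ^ 2 := by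
    rw [setIntegral_elem, ← integral_const_mul, ← integral_const_mul]
    refine integral_congr_ae (Eventually.of_forall fun x => ?_)
    simp only
    rw [field_Φ, norm_smul, norm_inv, Real.norm_eq_abs, ← volChange]
    field_simp
  have h1 : M.hElem T ^ 2 * ∫ x in refElem s (n + 1), ‖fieldL _ (r T) x‖ ^ 2 ≤
      K ^ 2 * ∫ x in refElem s (n + 1), ‖(M.Φ T).linear (fieldL _ (r T) x)‖ ^ 2 := by
    rw [← integral_const_mul, ← integral_const_mul]
    refine integral_mono (integrable_ref (by fun_prop)) (integrable_ref (by fun_prop)) fun x => ?_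
    simp only
    rw [← mul_pow, ← mul_pow]
    exact pow_le_pow_left₀ (by positivity) (hM.le_linear T _) 2
  have h2 : ∫ x in refElem s (n + 1), ‖(M.Φ T).linear (fieldL _ (r T) x)‖ ^ 2 ≤
      K ^ 2 * M.hElem T ^ 2 * ∫ x in refElem s (n + 1), ‖fieldL _ (r T) x‖ ^ 2 := by
    rw [← integral_const_mul]
    refine integral_mono (integrable_ref (by fun_prop)) (integrable_ref (by fun_prop)) fun x => ?_
    simp only
    rw [← mul_pow, ← mul_pow]
    exact pow_le_pow_left₀ (by positivity) (hM.linear_le T _) 2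
  rw [← h0] at h1 h2
  have hE : 0 ≤ ∫ x in M.elem T, ‖M.field r T x‖ ^ 2 := integral_nonneg fun x => by positivity
  generalize (∫ x in M.elem T, ‖M.field r T x‖ ^ 2) = E at *
  generalize (∫ x in refElem s (n + 1), ‖fieldL _ (r T) x‖ ^ 2) = R at *
  rw [scale]
  constructor
  · have h3 : R ≤ K ^ 2 * (volChange (M.Φ T) * E) / M.hElem T ^ 2 := by
      rw [le_div_iff₀ (by positivity)]; linarith
    refine h3.trans ?_
    rw [mul_div_assoc', div_mul_eq_mul_div]
    refine div_le_div_of_nonneg_right ?_ (by positivity)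
    calc _ = K ^ 2 * E * volChange (M.Φ T) := by ring
      _ ≤ K ^ 2 * E * (K * M.hElem T ^ (n + 1)) :=
          mul_le_mul_of_nonneg_left (hM.vol_le T) (by positivity)
      _ = _ := by ring
  · rw [div_mul_eq_mul_div, div_le_iff₀ (by positivity)]
    calc _ ≤ K * volChange (M.Φ T) * E := mul_le_mul_of_nonneg_right (hM.le_vol T) hE
      _ = K * (volChange (M.Φ T) * E) := by ring
      _ ≤ K * (K ^ 2 * M.hElem T ^ 2 * R) := mul_le_mul_of_nonneg_left h2 hK.le
      _ = _ := by ring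

/-- The local energy of `(v, μ)` on the element `T`, without the coefficient. -/
def energyAt [Fintype κ] (M : Mesh s n Ω ι κ) (v : ι → MvPolynomial (Fin (n + 1)) ℝ)
    (μ : κ → MvPolynomial (Fin n) ℝ) (T : ι) : ℝ :=
  (∫ x in M.elem T, ‖gradient (M.fn v T) x‖ ^ 2) +
    (M.hElem T)⁻¹ * ∑ E ∈ M.facetsOf T, M.facetIntegral E fun y =>
      (M.fn v T (M.Ψ E y) - facetFn μ E y) ^ 2

theorem IsScaled.energyAt_le [Fintype κ] (hM : M.IsScaled K)
    (v : ι → MvPolynomial (Fin (n + 1)) ℝ) (μ : κ → MvPolynomial (Fin n) ℝ) (T : ι) :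
    M.energyAt v μ T ≤ (K ^ 3 + K) * M.scale T * energyRef (v T) (M.traceAt μ T) := by
  have hK := hM.pos
  have hs := scale_pos (M := M) T
  have h1 := hM.integral_gradient_le T (M.contDiff_fn v T)
  rw [fn_comp_Φ] at h1
  rw [energyAt, energyRef, sum_facetIntegral_gap, mul_add]
  have hg : ∀ F, 0 ≤ ∫ y in refElem s n, pe (gapRef (v T) (M.traceAt μ T) F) y ^ 2 := fun F =>
    integral_nonneg fun y => by positivity
  have hJ : 0 ≤ ∫ x in refElem s (n + 1), ‖gradient (pe (v T)) x‖ ^ 2 :=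
    integral_nonneg fun x => by positivity
  refine add_le_add (h1.trans ?_) ?_
  · refine mul_le_mul_of_nonneg_right (mul_le_mul_of_nonneg_right ?_ hs.le) hJ
    linarith
  · rw [Finset.mul_sum, Finset.mul_sum]
    refine Finset.sum_le_sum fun F _ => ?_
    rw [← mul_assoc]
    refine mul_le_mul_of_nonneg_right ((hM.jac_div_le T F).trans ?_) (hg F)
    refine mul_le_mul_of_nonneg_right ?_ hs.le
    have : 0 < K ^ 3 := by positivity
    linarith

theorem IsScaled.le_energyAt [Fintype κ] (hM : M.IsScaled K)
    (v : ι → MvPolynomial (Fin (n + 1)) ℝ) (μ : κ → MvPolynomial (Fin n) ℝ) (T : ι) :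
    M.scale T * energyRef (v T) (M.traceAt μ T) ≤ (K ^ 3 + K) * M.energyAt v μ T := by
  have hK := hM.pos
  have hs := scale_pos (M := M) T
  have h1 := hM.le_integral_gradient T (M.contDiff_fn v T)
  rw [fn_comp_Φ] at h1
  rw [energyAt, energyRef, sum_facetIntegral_gap, mul_add, mul_add]
  have hg : ∀ F, 0 ≤ ∫ y in refElem s n, pe (gapRef (v T) (M.traceAt μ T) F) y ^ 2 := fun F =>
    integral_nonneg fun y => by positivity
  have hJ : 0 ≤ ∫ x in M.elem T, ‖gradient (M.fn v T) x‖ ^ 2 :=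
    integral_nonneg fun x => by positivity
  refine add_le_add (h1.trans ?_) ?_
  · refine mul_le_mul_of_nonneg_right ?_ hJ
    linarith
  · rw [Finset.mul_sum, Finset.mul_sum, Finset.mul_sum]
    refine Finset.sum_le_sum fun F _ => ?_
    have h2 := mul_le_mul_of_nonneg_right (hM.le_jac_div T F) (hg F)
    refine h2.trans ?_
    have h3 : 0 ≤ (M.hElem T)⁻¹ * M.facetJac (M.facetAt T F) *
        ∫ y in refElem s n, pe (gapRef (v T) (M.traceAt μ T) F) y ^ 2 :=
      mul_nonneg (mul_nonneg (inv_nonneg.2 (hM.hElem_pos T).le) (M.facetJac_pos _).le) (hg F)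
    have : 0 < K ^ 3 := by positivity
    nlinarith

end Local

/-! ### Local inf-sup condition and local boundedness on the elements of a mesh -/

section LocalEstimates

variable {s : Shape} {n p : ℕ} {rt : RTForm} {K : ℝ}

/-- Local inf-sup condition. -/
theorem exists_energyAt_le (hrt : rt.Admissible s p) (n : ℕ) (hK : 0 < K) : ∃ C : ℝ, 0 < C ∧
    ∀ {Ω : Set (Space (n + 1))} {ι κ : Type} [Fintype κ] {M : Mesh s n Ω ι κ}, M.IsScaled K →
      ∀ (T : ι) (v : ι → MvPolynomial (Fin (n + 1)) ℝ) (μ : κ → MvPolynomial (Fin n) ℝ),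
      v T ∈ polySpace s (n + 1) p → (∀ F, M.traceAt μ T F ∈ polySpace s n p) →
      ∀ Q : ℝ, (∀ r : ι → Fin (n + 1) → MvPolynomial (Fin (n + 1)) ℝ,
          r T ∈ rtSpace s (n + 1) p rt → bRef (r T) (v T) (M.traceAt μ T) ^ 2 ≤
            Q * ∫ x in M.elem T, ‖M.field r T x‖ ^ 2) →
        M.energyAt v μ T ≤ C * Q := by
  obtain ⟨C, hC, h⟩ := exists_energyRef_le hrt n
  refine ⟨(K ^ 3 + K) * (C * K ^ 3), by positivity, ?_⟩
  intro Ω ι κ _ M hM T v μ hv hμ Q hQ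
  have hs := scale_pos (M := M) T
  have hQ0 : 0 ≤ Q ∨ Q < 0 := le_or_gt 0 Q
  have h1 := h (v T) hv (M.traceAt μ T) hμ (Q * K ^ 3 / M.scale T) fun r hr => by
    have h2 := hQ (fun _ => r) hr
    have h3 := (hM.field_ref_le T fun _ => r)
    rcases hQ0 with hQ0 | hQ0
    · refine h2.trans ?_
      rw [div_mul_eq_mul_div, le_div_iff₀ hs]
      have := mul_le_mul_of_nonneg_left h3.2 hQ0
      linarith
    -- A negative `Q` is compatible only with a field of norm zero, and then both right-hand sides
    -- vanish.
    · have hE : 0 ≤ ∫ x in M.elem T, ‖M.field (fun _ => r) T x‖ ^ 2 :=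
        integral_nonneg fun x => by positivity
      have hE0 : ∫ x in M.elem T, ‖M.field (fun _ => r) T x‖ ^ 2 = 0 := by
        by_contra hne
        have : 0 < ∫ x in M.elem T, ‖M.field (fun _ => r) T x‖ ^ 2 :=
          lt_of_le_of_ne hE (Ne.symm hne)
        nlinarith [sq_nonneg (bRef r (v T) (M.traceAt μ T))]
      have hR : 0 ≤ ∫ x in refElem s (n + 1), ‖fieldL _ r x‖ ^ 2 :=
        integral_nonneg fun x => by positivity
      rw [hE0, mul_zero] at h2 h3
      have h4 : ∫ x in refElem s (n + 1), ‖fieldL _ r x‖ ^ 2 = 0 := le_antisymm h3.1 hR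
      rw [h4, mul_zero]
      exact h2
  have h5 := (hM.energyAt_le v μ T).trans (mul_le_mul_of_nonneg_left h1 (by positivity))
  refine h5.trans (le_of_eq ?_)
  field_simp

/-- Local boundedness of the hybrid form. -/
theorem exists_bRef_at_le (s : Shape) (n p : ℕ) (rt : RTForm) (hK : 0 < K) : ∃ C : ℝ, 0 < C ∧
    ∀ {Ω : Set (Space (n + 1))} {ι κ : Type} [Fintype κ] {M : Mesh s n Ω ι κ}, M.IsScaled K →
      ∀ (T : ι) (r : ι → Fin (n + 1) → MvPolynomial (Fin (n + 1)) ℝ)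
        (v : ι → MvPolynomial (Fin (n + 1)) ℝ) (μ : κ → MvPolynomial (Fin n) ℝ),
      r T ∈ rtSpace s (n + 1) p rt → bRef (r T) (v T) (M.traceAt μ T) ^ 2 ≤
        C * (∫ x in M.elem T, ‖M.field r T x‖ ^ 2) * M.energyAt v μ T := by
  obtain ⟨C, hC, h⟩ := exists_bRef_le s n p rt
  refine ⟨C * K ^ 3 * (K ^ 3 + K), by positivity, ?_⟩
  intro Ω ι κ _ M hM T r v μ hr
  have hs := scale_pos (M := M) T
  refine (h (r T) hr (v T) (M.traceAt μ T)).trans ?_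
  have h1 := (hM.field_ref_le T r).1
  have h2 := hM.le_energyAt v μ T
  have hE : 0 ≤ ∫ x in M.elem T, ‖M.field r T x‖ ^ 2 := integral_nonneg fun x => by positivity
  have hN : 0 ≤ energyRef (v T) (M.traceAt μ T) :=
    add_nonneg (integral_nonneg fun x => by positivity)
      (Finset.sum_nonneg fun F _ => integral_nonneg fun x => by positivity)
  generalize (∫ x in M.elem T, ‖M.field r T x‖ ^ 2) = E at *
  generalize (∫ x in refElem s (n + 1), ‖fieldL _ (r T) x‖ ^ 2) = R at *
  generalize energyRef (v T) (M.traceAt μ T) = N at *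
  calc C * R * N ≤ C * (K ^ 3 * M.scale T * E) * N := by gcongr
    _ = C * K ^ 3 * E * (M.scale T * N) := by ring
    _ ≤ C * K ^ 3 * E * ((K ^ 3 + K) * M.energyAt v μ T) := by gcongr
    _ = _ := by ring

end LocalEstimates

end Mesh

theorem tendsto_integral_sq {X : Type*} [MeasurableSpace X] {μ : Measure X}
    {f : ℕ → X → ℝ} {g : X → ℝ} (hf : ∀ k, MemLp (f k) 2 μ) (hg : MemLp g 2 μ)
    (h : Tendsto (fun k => eLpNorm (f k - g) 2 μ) atTop (𝓝 0)) :
    Tendsto (fun k => ∫ x, f k x ^ 2 ∂μ) atTop (𝓝 (∫ x, g x ^ 2 ∂μ)) := by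
  simpa using tendsto_integral_norm_sq hf hg h

namespace Mesh

/-! ### The elementwise `L²` projection of an `H¹` function -/

section Projection

variable {s : Shape} {n p : ℕ} {K : ℝ}

/-- Here `w` is projected while gradient and trace are those of a smooth approximation `a`. The
mismatch `w - a` carries a factor depending on the element, which is harmless because the mismatch
tends to zero in the next result. -/
theorem exists_projection_smooth_le (s : Shape) (n p : ℕ) (hK : 0 < K) : ∃ C : ℝ, 0 < C ∧
    ∀ {Ω : Set (Space (n + 1))} {ι κ : Type} [Fintype κ] {M : Mesh s n Ω ι κ}, M.IsScaled K →
      ∀ (T : ι) (w a : Space (n + 1) → ℝ), ContDiff ℝ ∞ a →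
      MemLp w 2 (volume.restrict (M.elem T)) → ∀ v : ι → MvPolynomial (Fin (n + 1)) ℝ,
      v T ∈ polySpace s (n + 1) p →
      (∀ z : ι → MvPolynomial (Fin (n + 1)) ℝ, z T ∈ polySpace s (n + 1) p →
        ∫ x in M.elem T, (M.fn v T x - w x) * M.fn z T x = 0) →
      (∫ x in M.elem T, ‖gradient (M.fn v T) x‖ ^ 2) +
        (M.hElem T)⁻¹ * ∑ E ∈ M.facetsOf T, M.facetIntegral E
          (fun y => (a (M.Ψ E y) - M.fn v T (M.Ψ E y)) ^ 2) ≤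
        C * ((∫ x in M.elem T, ‖gradient a x‖ ^ 2) +
          M.scale T / volChange (M.Φ T) * ∫ x in M.elem T, (w x - a x) ^ 2) := by
  obtain ⟨C, hC, h⟩ := exists_projection_le s n p
  refine ⟨(K ^ 3 + K) * C * (K ^ 3 + 1), by positivity, ?_⟩
  intro Ω ι κ _ M hM T w a ha hw v hv hproj
  have hs := scale_pos (M := M) T
  have hd := volChange_pos (M.Φ T)
  have h1 := h (a ∘ M.Φ T) (w ∘ M.Φ T) (contDiff_comp_Φ T ha)
    ((memLp_image_affineEquiv _ _ _).1 hw) (v T) hv fun z hz => by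
      have h2 := hproj (fun _ => z) hz
      rw [setIntegral_elem] at h2
      simp only [fn_Φ] at h2
      exact (mul_eq_zero.1 h2).resolve_left hd.ne'
  have h3 := hM.integral_gradient_le T (M.contDiff_fn v T)
  rw [fn_comp_Φ] at h3
  have h4 := hM.le_integral_gradient T ha
  have h5 : ∀ F : FIdx s n, M.facetIntegral (M.facetAt T F) (fun y =>
      (a (M.Ψ (M.facetAt T F) y) - M.fn v T (M.Ψ (M.facetAt T F) y)) ^ 2) =
      M.facetJac (M.facetAt T F) * ∫ y in refElem s n,
        ((a ∘ M.Φ T) (facetMap F y) - pe (v T) (facetMap F y)) ^ 2 := fun F => by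
    rw [← M.facetIntegral_eq T F fun y =>
      ((a ∘ M.Φ T) (facetMap F y) - pe (v T) (facetMap F y)) ^ 2]
    simp only [Ψ_facetAt, fn_Φ, Function.comp_apply]
  have h6 : ∫ x in M.elem T, (w x - a x) ^ 2 = volChange (M.Φ T) *
      ∫ x in refElem s (n + 1), ((w ∘ M.Φ T) x - (a ∘ M.Φ T) x) ^ 2 := by
    rw [setIntegral_elem]; rfl
  have hg : ∀ F : FIdx s n, 0 ≤ ∫ y in refElem s n,
      ((a ∘ M.Φ T) (facetMap F y) - pe (v T) (facetMap F y)) ^ 2 := fun F =>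
    integral_nonneg fun y => by positivity
  have h7 : (M.hElem T)⁻¹ * ∑ F : FIdx s n, M.facetJac (M.facetAt T F) * (∫ y in refElem s n,
        ((a ∘ M.Φ T) (facetMap F y) - pe (v T) (facetMap F y)) ^ 2) ≤ K * M.scale T *
      ∑ F : FIdx s n, ∫ y in refElem s n,
        ((a ∘ M.Φ T) (facetMap F y) - pe (v T) (facetMap F y)) ^ 2 := by
    rw [Finset.mul_sum, Finset.mul_sum]
    refine Finset.sum_le_sum fun F _ => ?_
    rw [← mul_assoc]
    exact mul_le_mul_of_nonneg_right (hM.jac_div_le T F) (hg F)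
  rw [sum_facetsOf]
  simp only [h5]
  rw [h6]
  have hgs := Finset.sum_nonneg fun F (_ : F ∈ (Finset.univ : Finset (FIdx s n))) => hg F
  have hN : 0 ≤ ∫ x in refElem s (n + 1), ‖gradient (pe (v T)) x‖ ^ 2 :=
    integral_nonneg fun x => by positivity
  have hW : 0 ≤ ∫ x in refElem s (n + 1), ((w ∘ M.Φ T) x - (a ∘ M.Φ T) x) ^ 2 :=
    integral_nonneg fun x => by positivity
  have hA : 0 ≤ ∫ x in M.elem T, ‖gradient a x‖ ^ 2 := integral_nonneg fun x => by positivity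
  generalize (∫ x in M.elem T, ‖gradient a x‖ ^ 2) = A at *
  generalize (∫ x in refElem s (n + 1), ((w ∘ M.Φ T) x - (a ∘ M.Φ T) x) ^ 2) = W at *
  generalize (∫ x in refElem s (n + 1), ‖gradient (pe (v T)) x‖ ^ 2) = N at *
  generalize (∫ x in refElem s (n + 1), ‖gradient (a ∘ M.Φ T) x‖ ^ 2) = A' at *
  generalize (∑ F : FIdx s n, ∫ y in refElem s n,
    ((a ∘ M.Φ T) (facetMap F y) - pe (v T) (facetMap F y)) ^ 2) = S at *
  have hK3 : 0 < K ^ 3 := by positivity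
  have e1 : M.scale T / volChange (M.Φ T) * (volChange (M.Φ T) * W) = M.scale T * W := by
    field_simp
  rw [e1]
  calc _ ≤ K ^ 3 * M.scale T * N + K * M.scale T * S := add_le_add h3 h7
    _ ≤ (K ^ 3 + K) * M.scale T * (N + S) := by
        have : 0 ≤ M.scale T * S := by positivity
        have : 0 ≤ M.scale T * N := by positivity
        nlinarith
    _ ≤ (K ^ 3 + K) * M.scale T * (C * (A' + W)) :=
        mul_le_mul_of_nonneg_left h1 (by positivity)
    _ = (K ^ 3 + K) * C * (M.scale T * A' + M.scale T * W) := by ring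
    _ ≤ (K ^ 3 + K) * C * (K ^ 3 * A + M.scale T * W) := by gcongr
    _ ≤ (K ^ 3 + K) * C * ((K ^ 3 + 1) * (A + M.scale T * W)) := by
        refine mul_le_mul_of_nonneg_left ?_ (by positivity)
        have : 0 ≤ M.scale T * W := by positivity
        nlinarith
    _ = _ := by ring

/-- The smooth estimate passes to the limit along approximations that converge in `L²` together with
their gradients and traces. The polynomial `v` is the projection of `w` and stays fixed throughout.
-/
theorem exists_projection_at_le (s : Shape) (n p : ℕ) (hK : 0 < K) : ∃ C : ℝ, 0 < C ∧
    ∀ {Ω : Set (Space (n + 1))} {ι κ : Type} [Fintype κ] {M : Mesh s n Ω ι κ}, M.IsScaled K →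
      ∀ (T : ι) (w : Space (n + 1) → ℝ) (G : Space (n + 1) → Space (n + 1)) (t : κ → Space n → ℝ)
        (a : ℕ → Space (n + 1) → ℝ),
      MemLp w 2 (volume.restrict (M.elem T)) → MemLp G 2 (volume.restrict (M.elem T)) →
      (∀ E ∈ M.facetsOf T, MemLp (t E) 2 (volume.restrict (refElem s n))) →
      (∀ k, ContDiff ℝ ∞ (a k)) →
      Tendsto (fun k => eLpNorm (a k - w) 2 (volume.restrict (M.elem T))) atTop (𝓝 0) →
      Tendsto (fun k => eLpNorm (gradient (a k) - G) 2 (volume.restrict (M.elem T)))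
        atTop (𝓝 0) →
      (∀ E ∈ M.facetsOf T, Tendsto (fun k => eLpNorm (fun y => a k (M.Ψ E y) - t E y) 2
          (volume.restrict (refElem s n))) atTop (𝓝 0)) →
      ∀ v : ι → MvPolynomial (Fin (n + 1)) ℝ, v T ∈ polySpace s (n + 1) p →
      (∀ z : ι → MvPolynomial (Fin (n + 1)) ℝ, z T ∈ polySpace s (n + 1) p →
        ∫ x in M.elem T, (M.fn v T x - w x) * M.fn z T x = 0) →
      (∫ x in M.elem T, ‖gradient (M.fn v T) x‖ ^ 2) +
        (M.hElem T)⁻¹ * ∑ E ∈ M.facetsOf T, M.facetIntegral E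
          (fun y => (t E y - M.fn v T (M.Ψ E y)) ^ 2) ≤ C * ∫ x in M.elem T, ‖G x‖ ^ 2 := by
  obtain ⟨C, hC, h⟩ := exists_projection_smooth_le s n p hK
  refine ⟨C, hC, ?_⟩
  intro Ω ι κ _ M hM T w G t a hw hG ht ha haw haG hat v hv hproj
  have hle := fun k => h hM T w (a k) (ha k) hw v hv hproj
  have hcT := M.isCompact_elem T
  have h1 := tendsto_integral_norm_sq
    (fun k => memLp_two_of_continuous (continuous_gradient (ha k)) hcT) hG haG
  have h2 : Tendsto (fun k => ∫ x in M.elem T, (w x - a k x) ^ 2) atTop (𝓝 0) := by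
    have h3 := tendsto_integral_sq (f := fun k => a k - w) (g := 0)
      (fun k => (memLp_two_of_continuous (ha k).continuous hcT).sub hw) MemLp.zero
      (by simpa using haw)
    simp only [Pi.sub_apply, Pi.zero_apply, ne_eq, OfNat.ofNat_ne_zero, not_false_eq_true, zero_pow,
      integral_zero] at h3
    refine h3.congr fun k => ?_
    exact integral_congr_ae (Eventually.of_forall fun x => by simp only; ring)
  have hΨ : ∀ E, Continuous (M.Ψ E) := fun E => (M.Ψ E).continuous_of_finiteDimensional
  have h3 : ∀ E ∈ M.facetsOf T, Tendsto (fun k => M.facetIntegral E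
      (fun y => (a k (M.Ψ E y) - M.fn v T (M.Ψ E y)) ^ 2)) atTop
      (𝓝 (M.facetIntegral E (fun y => (t E y - M.fn v T (M.Ψ E y)) ^ 2))) := by
    intro E hE
    have hfn := memLp_two_of_continuous ((M.contDiff_fn v T).continuous.comp (hΨ E))
      (isCompact_refElem s n)
    refine (tendsto_integral_sq
      (f := fun k y => a k (M.Ψ E y) - M.fn v T (M.Ψ E y))
      (g := fun y => t E y - M.fn v T (M.Ψ E y))
      (fun k => (memLp_two_of_continuous ((ha k).continuous.comp (hΨ E))
        (isCompact_refElem s n)).sub hfn) ((ht E hE).sub hfn) ?_).const_mul _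
    refine (hat E hE).congr fun k => ?_
    congr 1
    funext y
    simp
  have hL := (tendsto_finsetSum (M.facetsOf T) h3).const_mul (M.hElem T)⁻¹
  have hL2 := hL.const_add (∫ x in M.elem T, ‖gradient (M.fn v T) x‖ ^ 2)
  have hR := (h1.add (h2.const_mul (M.scale T / volChange (M.Φ T)))).const_mul C
  rw [mul_zero, add_zero] at hR
  exact le_of_tendsto_of_tendsto' hL2 hR hle

end Projection

end Mesh

/-! ### The diffusion tensor -/

/-- The matrix `B` applied to a vector. -/
def mulE {d : ℕ} (B : Matrix (Fin d) (Fin d) ℝ) (ξ : Space d) : Space d :=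
  WithLp.toLp 2 (B.mulVec fun i => ξ i)

theorem matForm_eq_inner {d : ℕ} (B : Matrix (Fin d) (Fin d) ℝ) (ξ η : Space d) :
    matForm B ξ η = inner ℝ ξ (mulE B η) := by
  simp only [matForm, mulE, PiLp.inner_apply, Matrix.mulVec, dotProduct]
  refine Finset.sum_congr rfl fun i _ => ?_
  simp only [RCLike.inner_apply, conj_trivial, Finset.sum_mul]
  exact Finset.sum_congr rfl fun j _ => by ring

theorem mulE_add {d : ℕ} (B : Matrix (Fin d) (Fin d) ℝ) (ξ η : Space d) :
    mulE B (ξ + η) = mulE B ξ + mulE B η := by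
  ext i
  simp [mulE, Matrix.mulVec, dotProduct, mul_add, Finset.sum_add_distrib]

theorem mulE_smul {d : ℕ} (B : Matrix (Fin d) (Fin d) ℝ) (c : ℝ) (ξ : Space d) :
    mulE B (c • ξ) = c • mulE B ξ := by
  ext i
  simp only [mulE, Matrix.mulVec, dotProduct, PiLp.smul_apply, smul_eq_mul, Finset.mul_sum]
  exact Finset.sum_congr rfl fun j _ => by ring

theorem mulE_mul {d : ℕ} (B C : Matrix (Fin d) (Fin d) ℝ) (ξ : Space d) :
    mulE (B * C) ξ = mulE B (mulE C ξ) := by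
  simp only [mulE, ← Matrix.mulVec_mulVec]

theorem mulE_one {d : ℕ} (ξ : Space d) : mulE 1 ξ = ξ := by
  simp [mulE]

theorem matForm_comm {d : ℕ} {B : Matrix (Fin d) (Fin d) ℝ} (hB : B.IsSymm) (ξ η : Space d) :
    matForm B ξ η = matForm B η ξ := by
  simp only [matForm]
  rw [Finset.sum_comm]
  refine Finset.sum_congr rfl fun i _ => Finset.sum_congr rfl fun j _ => ?_
  rw [hB.apply]; ring

/-- The coefficient at one point. -/
structure TensorBounds {d : ℕ} (lo hi : ℝ) (B : Matrix (Fin d) (Fin d) ℝ) : Prop where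
  symm : B.IsSymm
  le : ∀ ξ : Space d, lo * ‖ξ‖ ^ 2 ≤ matForm B ξ ξ
  ge : ∀ ξ : Space d, matForm B ξ ξ ≤ hi * ‖ξ‖ ^ 2

section Tensor

variable {d : ℕ} {lo hi : ℝ} {B : Matrix (Fin d) (Fin d) ℝ}

theorem TensorBounds.nonneg (h : TensorBounds lo hi B) (hlo : 0 < lo) (ξ : Space d) :
    0 ≤ matForm B ξ ξ := le_trans (by positivity) (h.le ξ)

/-- The quadratic `t ↦ B(ξ + t η, ξ + t η)` is nonnegative, so its discriminant is nonpositive. -/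
theorem TensorBounds.cauchy_schwarz (h : TensorBounds lo hi B) (hlo : 0 < lo) (ξ η : Space d) :
    matForm B ξ η ^ 2 ≤ matForm B ξ ξ * matForm B η η := by
  have hq : ∀ t : ℝ, 0 ≤ matForm B η η * (t * t) + 2 * matForm B ξ η * t + matForm B ξ ξ := by
    intro t
    have h1 := h.nonneg hlo (ξ + t • η)
    have h2 : matForm B (ξ + t • η) (ξ + t • η) =
        matForm B η η * (t * t) + 2 * matForm B ξ η * t + matForm B ξ ξ := by
      have h3 := matForm_comm h.symm η ξ
      simp only [matForm_eq_inner, mulE_add, mulE_smul, inner_add_left, inner_add_right,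
        inner_smul_left, inner_smul_right] at h3 ⊢
      rw [h3]
      simp
      ring
    rwa [h2] at h1
  have := discrim_le_zero hq
  rw [discrim] at this
  linarith

/-- Cauchy--Schwarz for the form `B` with the pair `(B ξ, ξ)` avoids square roots of matrices and
spectral theory. -/
theorem TensorBounds.norm_mulE_le (h : TensorBounds lo hi B) (hlo : 0 < lo) (hhi : 0 < hi)
    (ξ : Space d) : ‖mulE B ξ‖ ≤ hi * ‖ξ‖ := by
  have h1 := h.cauchy_schwarz hlo (mulE B ξ) ξ
  rw [matForm_eq_inner B (mulE B ξ) ξ, real_inner_self_eq_norm_sq] at h1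
  have h2 := h1.trans (mul_le_mul (h.ge _) (h.ge _) (h.nonneg hlo _) (by positivity))
  by_cases h0 : ‖mulE B ξ‖ = 0
  · rw [h0]; positivity
  · have h3 : 0 < ‖mulE B ξ‖ := lt_of_le_of_ne (norm_nonneg _) (Ne.symm h0)
    refine abs_le_of_sq_le_sq' ?_ (by positivity) |>.2
    refine le_of_mul_le_mul_right ?_ (pow_pos h3 2)
    nlinarith

theorem TensorBounds.mul_inv (h : TensorBounds lo hi B) (hlo : 0 < lo) : B * B⁻¹ = 1 := by
  refine Matrix.mul_nonsing_inv B ?_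
  rw [isUnit_iff_ne_zero]
  intro hdet
  obtain ⟨v, hv, hBv⟩ := Matrix.exists_mulVec_eq_zero_iff.2 hdet
  have h1 := h.le (WithLp.toLp 2 v)
  have h2 : mulE B (WithLp.toLp 2 v) = 0 := by
    simp only [mulE]
    rw [show (fun i => (WithLp.toLp 2 v : Space d) i) = v from rfl, hBv]
    rfl
  rw [matForm_eq_inner, h2, inner_zero_right] at h1
  have h3 : (WithLp.toLp 2 v : Space d) ≠ 0 := fun h => hv (by
    have := congrArg (fun z : Space d => fun i => z i) h
    exact this)
  have := norm_pos_iff.2 h3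
  have : 0 < lo * ‖(WithLp.toLp 2 v : Space d)‖ ^ 2 := by positivity
  linarith

theorem TensorBounds.matForm_inv (h : TensorBounds lo hi B) (hlo : 0 < lo) (η : Space d) :
    matForm B⁻¹ η η = matForm B (mulE B⁻¹ η) (mulE B⁻¹ η) := by
  rw [matForm_eq_inner, matForm_eq_inner, ← mulE_mul, h.mul_inv hlo, mulE_one, real_inner_comm]

theorem TensorBounds.inv_nonneg (h : TensorBounds lo hi B) (hlo : 0 < lo) (η : Space d) :
    0 ≤ matForm B⁻¹ η η := by
  rw [h.matForm_inv hlo]; exact h.nonneg hlo _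

theorem TensorBounds.norm_inv_sq_le (h : TensorBounds lo hi B) (hlo : 0 < lo) (η : Space d) :
    lo * ‖mulE B⁻¹ η‖ ^ 2 ≤ matForm B⁻¹ η η := by
  rw [h.matForm_inv hlo]; exact h.le _

theorem TensorBounds.norm_inv_le (h : TensorBounds lo hi B) (hlo : 0 < lo) (η : Space d) :
    ‖mulE B⁻¹ η‖ ≤ lo⁻¹ * ‖η‖ := by
  have h1 := h.norm_inv_sq_le hlo η
  rw [matForm_eq_inner] at h1
  have h2 := h1.trans (real_inner_le_norm _ _)
  rw [inv_mul_eq_div, le_div_iff₀ hlo]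
  by_cases h0 : ‖mulE B⁻¹ η‖ = 0
  · rw [h0]; simp
  · have h3 : 0 < ‖mulE B⁻¹ η‖ := lt_of_le_of_ne (norm_nonneg _) (Ne.symm h0)
    refine le_of_mul_le_mul_right ?_ h3
    nlinarith

/-- Here `‖η‖² = B(η, B⁻¹ η)`, and Cauchy--Schwarz for the form `B` applies. -/
theorem TensorBounds.norm_sq_le (h : TensorBounds lo hi B) (hlo : 0 < lo) (η : Space d) :
    ‖η‖ ^ 2 ≤ hi * matForm B⁻¹ η η := by
  have h1 := h.cauchy_schwarz hlo η (mulE B⁻¹ η)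
  rw [← h.matForm_inv hlo, matForm_eq_inner B, ← mulE_mul, h.mul_inv hlo, mulE_one,
    real_inner_self_eq_norm_sq] at h1
  have h2 := h1.trans (mul_le_mul_of_nonneg_right (h.ge η) (h.inv_nonneg hlo η))
  by_cases h0 : ‖η‖ = 0
  · have : η = 0 := norm_eq_zero.1 h0
    subst this
    simp [matForm]
  · have h3 : 0 < ‖η‖ := lt_of_le_of_ne (norm_nonneg _) (Ne.symm h0)
    refine le_of_mul_le_mul_right ?_ (pow_pos h3 2)
    nlinarith

end Tensor

theorem aestronglyMeasurable_mulE {d : ℕ} {X : Type*} [MeasurableSpace X] {μ : Measure X}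
    {B : X → Matrix (Fin d) (Fin d) ℝ} (hB : ∀ i j, AEStronglyMeasurable (fun x => B x i j) μ)
    {f : X → Space d} (hf : AEStronglyMeasurable f μ) :
    AEStronglyMeasurable (fun x => mulE (B x) (f x)) μ := by
  have h1 : ∀ j, AEStronglyMeasurable (fun x => f x j) μ := fun j =>
    (continuous_coord j).comp_aestronglyMeasurable hf
  have h2 : AEStronglyMeasurable (fun x => (B x).mulVec fun i => f x i) μ := by
    refine (aemeasurable_pi_iff.2 fun i => ?_).aestronglyMeasurable
    have : (fun x => (B x).mulVec (fun i => f x i) i) = fun x => ∑ j, B x i j * f x j := rfl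
    rw [this]
    exact (Finset.aestronglyMeasurable_fun_sum _ fun j _ => (hB i j).mul (h1 j)).aemeasurable
  exact (PiLp.continuous_toLp 2 _).comp_aestronglyMeasurable h2

theorem memLp_mulE {d : ℕ} {X : Type*} [MeasurableSpace X] {μ : Measure X}
    {B : X → Matrix (Fin d) (Fin d) ℝ} (hB : ∀ i j, AEStronglyMeasurable (fun x => B x i j) μ)
    {c : ℝ} (hc : ∀ᵐ x ∂μ, ∀ ξ, ‖mulE (B x) ξ‖ ≤ c * ‖ξ‖)
    {f : X → Space d} (hf : MemLp f 2 μ) : MemLp (fun x => mulE (B x) (f x)) 2 μ :=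
  hf.of_le_mul (c := c) (aestronglyMeasurable_mulE hB hf.1) (hc.mono fun _ hx => hx _)

/-- Cramer's rule: determinant and adjugate depend continuously on the entries, and scalar inversion
is measurable. -/
theorem aestronglyMeasurable_inv {d : ℕ} {X : Type*} [MeasurableSpace X] {μ : Measure X}
    {B : X → Matrix (Fin d) (Fin d) ℝ} (hB : ∀ i j, AEStronglyMeasurable (fun x => B x i j) μ)
    (i j : Fin d) : AEStronglyMeasurable (fun x => (B x)⁻¹ i j) μ := by
  have h1 : AEStronglyMeasurable (fun x => (B x : Fin d → Fin d → ℝ)) μ := by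
    exact (aemeasurable_pi_iff.2 fun i => aemeasurable_pi_iff.2 fun j =>
      (hB i j).aemeasurable).aestronglyMeasurable
  have h2 : AEStronglyMeasurable (fun x => (B x).det) μ :=
    (show Continuous fun C : Fin d → Fin d → ℝ => Matrix.det (C : Matrix (Fin d) (Fin d) ℝ) from
      Continuous.matrix_det continuous_id).comp_aestronglyMeasurable h1
  have h3 : AEStronglyMeasurable (fun x => (B x).adjugate i j) μ :=
    (show Continuous fun C : Fin d → Fin d → ℝ =>
      Matrix.adjugate (C : Matrix (Fin d) (Fin d) ℝ) i j from
      (Continuous.matrix_adjugate continuous_id).matrix_elem i j).comp_aestronglyMeasurable h1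
  have h4 : (fun x => (B x)⁻¹ i j) = fun x => (B x).det⁻¹ * (B x).adjugate i j := by
    funext x
    rw [Matrix.inv_def, Ring.inverse_eq_inv', Matrix.smul_apply, smul_eq_mul]
  rw [h4]
  exact (h2.aemeasurable.inv.aestronglyMeasurable).mul h3

/-! ### Elements and the domain -/

namespace Mesh

section Domain

variable {s : Shape} {n : ℕ} {Ω : Set (Space (n + 1))} {ι κ : Type} (M : Mesh s n Ω ι κ)

theorem convex_elem (T : ι) : Convex ℝ (M.elem T) :=
  (convex_refElem s (n + 1)).affine_image ((M.Φ T) : Space (n + 1) →ᵃ[ℝ] Space (n + 1))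

theorem interior_elem_ae (T : ι) : interior (M.elem T) =ᵐ[volume] M.elem T :=
  interior_ae_eq_of_null_frontier ((M.convex_elem T).addHaar_frontier volume)

theorem restrict_interior_elem (T : ι) :
    volume.restrict (interior (M.elem T)) = volume.restrict (M.elem T) :=
  Measure.restrict_congr_set (M.interior_elem_ae T)

/-- Elements cover only the closure of `Ω`; that `Ω` is the interior of its closure brings their
interiors back into `Ω`. -/
theorem interior_elem_subset (hΩ : IsPolyhedralDomain Ω) (T : ι) : interior (M.elem T) ⊆ Ω := by
  refine (interior_mono ?_).trans hΩ.interior_closure.subset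
  refine Subset.trans ?_ M.cover.subset
  exact subset_iUnion (fun T => M.Φ T '' refElem s (n + 1)) T

/-- An element may touch `∂Ω` and so is not contained in `Ω`, but it is convex, hence its frontier
is a null set. -/
theorem restrict_elem_le (hΩ : IsPolyhedralDomain Ω) (T : ι) :
    volume.restrict (M.elem T) ≤ volume.restrict Ω := by
  rw [← restrict_interior_elem]
  exact Measure.restrict_mono (M.interior_elem_subset hΩ T) le_rfl

theorem ae_elem (hΩ : IsPolyhedralDomain Ω) (T : ι) {P : Space (n + 1) → Prop}
    (h : ∀ᵐ x ∂volume.restrict Ω, P x) : ∀ᵐ x ∂volume.restrict (M.elem T), P x :=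
  ae_mono (M.restrict_elem_le hΩ T) h

theorem memLp_elem (hΩ : IsPolyhedralDomain Ω) (T : ι) {E : Type*} [NormedAddCommGroup E]
    {p : ℝ≥0∞} {f : Space (n + 1) → E} (h : MemLp f p (volume.restrict Ω)) :
    MemLp f p (volume.restrict (M.elem T)) := h.mono_measure (M.restrict_elem_le hΩ T)

theorem sum_setIntegral_le [Fintype ι] (hΩ : IsPolyhedralDomain Ω) {f : Space (n + 1) → ℝ}
    (hf : Integrable f (volume.restrict Ω)) (h0 : ∀ x, 0 ≤ f x) :
    ∑ T, ∫ x in M.elem T, f x ≤ ∫ x in Ω, f x := by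
  have h1 : ∀ T, ∫ x in M.elem T, f x = ∫ x in interior (M.elem T), f x := fun T => by
    rw [restrict_interior_elem]
  simp_rw [h1]
  rw [← integral_iUnion_fintype (s := fun T => interior (M.elem T)) (fun T => isOpen_interior.measurableSet)
    (fun T T' h => M.disjoint_interiors T T' h)
    (fun T => hf.mono_measure (Measure.restrict_mono (M.interior_elem_subset hΩ T) le_rfl))]
  exact setIntegral_mono_set hf (Eventually.of_forall h0)
    (LE.le.eventuallyLE (iUnion_subset fun T => M.interior_elem_subset hΩ T))

end Domain

end Mesh

/-! ### Broken Sobolev functions -/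

theorem tendsto_integral_mul {X : Type*} [MeasurableSpace X] {μ : Measure X}
    {f : ℕ → X → ℝ} {g u : X → ℝ} (hf : ∀ k, MemLp (f k) 2 μ) (hg : MemLp g 2 μ)
    (hu : MemLp u 2 μ) (h : Tendsto (fun k => eLpNorm (f k - g) 2 μ) atTop (𝓝 0)) :
    Tendsto (fun k => ∫ x, f k x * u x ∂μ) atTop (𝓝 (∫ x, g x * u x ∂μ)) := by
  have h1 := tendsto_integral_sq (f := fun k => f k - g) (g := 0) (fun k => (hf k).sub hg)
    MemLp.zero (by simpa using h)
  simp only [Pi.zero_apply, ne_eq, OfNat.ofNat_ne_zero, not_false_eq_true, zero_pow,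
    integral_zero] at h1
  have h2 : Tendsto (fun k => (∫ x, (f k - g) x * u x ∂μ) ^ 2) atTop (𝓝 0) := by
    refine squeeze_zero (fun k => sq_nonneg _)
      (fun k => sq_integral_mul_le ((hf k).sub hg) hu) ?_
    simpa using h1.mul_const (∫ x, u x ^ 2 ∂μ)
  have h3 : Tendsto (fun k => ∫ x, (f k - g) x * u x ∂μ) atTop (𝓝 0) := by
    have := (Real.continuous_sqrt.tendsto 0).comp h2
    rw [Real.sqrt_zero] at this
    refine (tendsto_zero_iff_abs_tendsto_zero _).2 (this.congr fun k => ?_)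
    simp [Real.sqrt_sq_eq_abs]
  have h4 := h3.add_const (∫ x, g x * u x ∂μ)
  rw [zero_add] at h4
  refine h4.congr fun k => ?_
  refine (integral_add (((hf k).sub hg).integrable_mul hu) (hg.integrable_mul hu)).symm.trans ?_
  exact integral_congr_ae (Eventually.of_forall fun x => by simp only [Pi.mul_apply, Pi.sub_apply]; ring)

theorem gradient_apply {d : ℕ} (a : Space d → ℝ) (x : Space d) (i : Fin d) :
    gradient a x i = fderiv ℝ a x (EuclideanSpace.single i 1) := by
  rw [← inner_gradient, EuclideanSpace.inner_single_right]
  simp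

theorem gradient_eq_zero_of_notMem {d : ℕ} {a : Space d → ℝ} {x : Space d} (hx : x ∉ tsupport a) :
    gradient a x = 0 := by
  have : fderiv ℝ a x = 0 := by
    by_contra h
    exact hx (support_fderiv_subset ℝ h)
  rw [gradient, this, map_zero]

theorem integral_mul_gradient {d : ℕ} {U : Set (Space d)} {a η : Space d → ℝ}
    (ha : ContDiff ℝ ∞ a) (hη : ContDiff ℝ ∞ η) (hc : HasCompactSupport η) (hs : tsupport η ⊆ U)
    (i : Fin d) : ∫ x in U, a x * gradient η x i = - ∫ x in U, gradient a x i * η x := by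
  have h0 : ∀ x ∉ U, η x = 0 := fun x hx => image_eq_zero_of_notMem_tsupport fun h => hx (hs h)
  rw [setIntegral_eq_integral_of_forall_compl_eq_zero fun x hx => by
      rw [gradient_eq_zero_of_notMem fun h => hx (hs h)]; simp,
    setIntegral_eq_integral_of_forall_compl_eq_zero fun x hx => by rw [h0 x hx, mul_zero]]
  simp_rw [gradient_apply]
  have hac := ha.continuous_fderiv (by simp)
  have hηc := hη.continuous_fderiv (by simp)
  have hcd : HasCompactSupport fun x => fderiv ℝ η x (EuclideanSpace.single i 1) :=
    hc.fderiv_apply (𝕜 := ℝ) _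
  refine integral_mul_fderiv_eq_neg_fderiv_mul_of_integrable ?_ ?_ ?_
    (fun x _ => ha.differentiable (by simp) x) (fun x _ => hη.differentiable (by simp) x)
  · exact ((hac.clm_apply continuous_const).mul hη.continuous).integrable_of_hasCompactSupport
      hc.mul_left
  · exact (ha.continuous.mul (hηc.clm_apply continuous_const)).integrable_of_hasCompactSupport
      hcd.mul_left
  · exact (ha.continuous.mul hη.continuous).integrable_of_hasCompactSupport hc.mul_left

theorem eLpNorm_coord_le {d : ℕ} {μ : Measure (Space d)} (f : Space d → Space d) (i : Fin d) :
    eLpNorm (fun x => f x i) 2 μ ≤ eLpNorm f 2 μ :=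
  eLpNorm_mono fun x => PiLp.norm_apply_le (f x) i

theorem memLp_coord {d : ℕ} {μ : Measure (Space d)} {f : Space d → Space d} (hf : MemLp f 2 μ)
    (i : Fin d) : MemLp (fun x => f x i) 2 μ :=
  ⟨(continuous_coord i).comp_aestronglyMeasurable hf.1,
    (eLpNorm_coord_le f i).trans_lt hf.2⟩

/-- An `L²` limit of smooth functions with convergent gradients has a weak gradient. -/
theorem hasWeakGradient_of_tendsto {d : ℕ} {U : Set (Space d)}
    {a : ℕ → Space d → ℝ} {w : Space d → ℝ} {G : Space d → Space d}
    (ha : ∀ k, ContDiff ℝ ∞ (a k)) (ha2 : ∀ k, MemLp (a k) 2 (volume.restrict U))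
    (hG2 : ∀ k, MemLp (gradient (a k)) 2 (volume.restrict U))
    (hw : MemLp w 2 (volume.restrict U)) (hG : MemLp G 2 (volume.restrict U))
    (h1 : Tendsto (fun k => eLpNorm (a k - w) 2 (volume.restrict U)) atTop (𝓝 0))
    (h2 : Tendsto (fun k => eLpNorm (gradient (a k) - G) 2 (volume.restrict U)) atTop (𝓝 0)) :
    HasWeakGradient U w G := by
  intro η hη hc hs
  have hηm : MemLp η 2 (volume.restrict U) := hη.continuous.memLp_of_hasCompactSupport hc
  have hgc : HasCompactSupport (gradient η) :=
    HasCompactSupport.intro hc fun x hx => gradient_eq_zero_of_notMem hx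
  have hgm : MemLp (gradient η) 2 (volume.restrict U) :=
    (continuous_gradient hη).memLp_of_hasCompactSupport hgc
  have hi1 : Integrable (fun x => w x • gradient η x) (volume.restrict U) :=
    memLp_one_iff_integrable.1 (hgm.smul hw)
  have hi2 : Integrable (fun x => η x • G x) (volume.restrict U) :=
    memLp_one_iff_integrable.1 (hG.smul hηm)
  ext i
  have e1 : (∫ x in U, w x • gradient η x) i = ∫ x in U, w x * gradient η x i :=
    ((EuclideanSpace.proj i : Space d →L[ℝ] ℝ).integral_comp_comm hi1).symm
  have e2 : (∫ x in U, η x • G x) i = ∫ x in U, G x i * η x := by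
    refine ((EuclideanSpace.proj i : Space d →L[ℝ] ℝ).integral_comp_comm hi2).symm.trans ?_
    exact integral_congr_ae (Eventually.of_forall fun x => by simp [mul_comm])
  rw [PiLp.neg_apply, e1, e2]
  have l1 := tendsto_integral_mul ha2 hw (memLp_coord hgm i) h1
  have l2 := (tendsto_integral_mul (f := fun k x => gradient (a k) x i) (g := fun x => G x i)
    (fun k => memLp_coord (hG2 k) i) (memLp_coord hG i) hηm
    (tendsto_of_tendsto_of_tendsto_of_le_of_le tendsto_const_nhds h2 (fun k => zero_le)
      fun k => eLpNorm_coord_le (gradient (a k) - G) i)).neg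
  refine tendsto_nhds_unique l1 (l2.congr fun k => ?_)
  rw [integral_mul_gradient (ha k) hη hc hs]

namespace Mesh

section Broken

variable {s : Shape} {n : ℕ} {Ω : Set (Space (n + 1))} {ι κ : Type} {M : Mesh s n Ω ι κ}

/-- The weak gradient need not be supplied, since it is inherited from the smooth approximations. -/
theorem isBrokenH1_of_tendsto [Fintype κ] (hΩ : IsPolyhedralDomain Ω) {w : Space (n + 1) → ℝ}
    {G : ι → Space (n + 1) → Space (n + 1)} {t : ι → κ → Space n → ℝ}
    (hw : MemLp w 2 (volume.restrict Ω)) (hG : ∀ T, MemLp (G T) 2 (volume.restrict (M.elem T)))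
    (ht : ∀ T, ∀ E ∈ M.facetsOf T, MemLp (t T E) 2 (volume.restrict (refElem s n)))
    (a : ι → ℕ → Space (n + 1) → ℝ) (ha : ∀ T k, ContDiff ℝ ∞ (a T k))
    (h1 : ∀ T, Tendsto (fun k => eLpNorm (a T k - w) 2 (volume.restrict (M.elem T))) atTop (𝓝 0))
    (h2 : ∀ T, Tendsto (fun k => eLpNorm (gradient (a T k) - G T) 2
      (volume.restrict (M.elem T))) atTop (𝓝 0))
    (h3 : ∀ T, ∀ E ∈ M.facetsOf T, Tendsto (fun k => eLpNorm (fun y => a T k (M.Ψ E y) - t T E y) 2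
          (volume.restrict (refElem s n))) atTop (𝓝 0)) : M.IsBrokenH1 w G t := by
  refine ⟨hw, fun T => ⟨hG T, ?_, ht T, a T, ha T, h1 T, h2 T, h3 T⟩⟩
  have hr := M.restrict_interior_elem T
  refine hasWeakGradient_of_tendsto (ha T) ?_ ?_ ?_ ?_ ?_ ?_ <;> rw [hr]
  · exact fun k => memLp_two_of_continuous (ha T k).continuous (M.isCompact_elem T)
  · exact fun k => memLp_two_of_continuous (continuous_gradient (ha T k)) (M.isCompact_elem T)
  · exact M.memLp_elem hΩ T hw
  · exact hG T
  · exact h1 T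
  · exact h2 T

/-- The function which equals `b T` on each element `T`. -/
def glue [Fintype ι] (M : Mesh s n Ω ι κ) (b : ι → Space (n + 1) → ℝ) (x : Space (n + 1)) : ℝ :=
  ∑ T, (interior (M.elem T)).indicator (b T) x

theorem glue_of_mem [Fintype ι] (b : ι → Space (n + 1) → ℝ) {T : ι} {x : Space (n + 1)}
    (hx : x ∈ interior (M.elem T)) : M.glue b x = b T x := by
  rw [glue, Finset.sum_eq_single T]
  · exact indicator_of_mem hx _
  · intro T' _ hT'
    exact indicator_of_notMem
      (fun h => (disjoint_left.1 (M.disjoint_interiors T' T hT') h hx)) _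
  · simp

theorem glue_ae [Fintype ι] (M : Mesh s n Ω ι κ) (b : ι → Space (n + 1) → ℝ) (T : ι) :
    M.glue b =ᵐ[volume.restrict (M.elem T)] b T := by
  rw [← restrict_interior_elem]
  filter_upwards [ae_restrict_mem isOpen_interior.measurableSet] with x hx
  exact glue_of_mem b hx

theorem isBrokenH1_glue [Fintype ι] [Fintype κ] (M : Mesh s n Ω ι κ) (hΩ : IsPolyhedralDomain Ω)
    {b : ι → Space (n + 1) → ℝ} (hb : ∀ T, ContDiff ℝ ∞ (b T)) :
    M.IsBrokenH1 (M.glue b) (fun T => gradient (b T)) (fun T E y => b T (M.Ψ E y)) := by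
  have hΨ : ∀ E, Continuous (M.Ψ E) := fun E => (M.Ψ E).continuous_of_finiteDimensional
  refine isBrokenH1_of_tendsto hΩ ?_ ?_ ?_ (fun T _ => b T) (fun T _ => hb T) ?_ ?_ ?_
  · refine memLp_finsetSum _ fun T _ => ?_
    refine (memLp_indicator_iff_restrict isOpen_interior.measurableSet).2 ?_
    rw [Measure.restrict_restrict isOpen_interior.measurableSet]
    refine (memLp_two_of_continuous (hb T).continuous (M.isCompact_elem T)).mono_measure ?_
    exact Measure.restrict_mono (inter_subset_left.trans interior_subset) le_rfl
  · exact fun T => memLp_two_of_continuous (continuous_gradient (hb T)) (M.isCompact_elem T)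
  · exact fun T E _ => memLp_two_of_continuous ((hb T).continuous.comp (hΨ E))
      (isCompact_refElem s n)
  · intro T
    have : eLpNorm (b T - M.glue b) 2 (volume.restrict (M.elem T)) = 0 := by
      rw [← eLpNorm_zero (p := 2) (μ := volume.restrict (M.elem T)) (α := Space (n + 1)) (ε := ℝ)]
      refine eLpNorm_congr_ae ?_
      filter_upwards [M.glue_ae b T] with x hx
      simp [hx]
    simp [this]
  · simp
  · simp

/-- A trace inequality on one facet of the mesh. -/
theorem exists_facet_trace_le {K : ℝ} (hM : M.IsScaled K) (E : κ) : ∃ C : ℝ, 0 < C ∧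
    ∀ a : Space (n + 1) → ℝ, ContDiff ℝ ∞ a → ∫ y in refElem s n, a (M.Ψ E y) ^ 2 ≤
      C * ((∫ x in M.elem (M.side₁ E), a x ^ 2) +
        ∫ x in M.elem (M.side₁ E), ‖gradient a x‖ ^ 2) := by
  obtain ⟨F, hF⟩ := (M.incident_iff E (M.side₁ E)).1 (Or.inl rfl)
  generalize M.side₁ E = T at *
  subst hF
  obtain ⟨C, hC, h⟩ := exists_trace_le F
  have hd := volChange_pos (M.Φ T)
  have hh := hM.hElem_pos T
  have hK := hM.pos
  refine ⟨C * (1 + K ^ 2 * M.hElem T ^ 2) * (volChange (M.Φ T))⁻¹, by positivity, fun a ha => ?_⟩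
  have hΦ := continuous_Φ (M := M) T
  have hac := ha.continuous
  have hgc := continuous_gradient ha
  have hgc' := continuous_gradient (contDiff_comp_Φ (M := M) T ha)
  have h1 := h (a ∘ M.Φ T) (contDiff_comp_Φ T ha)
  have h2 : ∫ y in refElem s n, a (M.Ψ (M.facetAt T F) y) ^ 2 =
      ∫ y in refElem s n, (a ∘ M.Φ T) (facetMap F y) ^ 2 := by
    simp_rw [Ψ_facetAt]
    exact setIntegral_comp_affineEquiv _ (M.image_facetChange T F) fun y =>
      (a ∘ M.Φ T) (facetMap F y) ^ 2
  rw [h2]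
  refine h1.trans ?_
  have h3 : ∫ x in refElem s (n + 1), ((a ∘ M.Φ T) x ^ 2 + ‖gradient (a ∘ M.Φ T) x‖ ^ 2) ≤
      (1 + K ^ 2 * M.hElem T ^ 2) * ((∫ x in refElem s (n + 1), a (M.Φ T x) ^ 2) +
        ∫ x in refElem s (n + 1), ‖gradient a (M.Φ T x)‖ ^ 2) := by
    have hi1 : Integrable (fun x => a (M.Φ T x) ^ 2) (volume.restrict (refElem s (n + 1))) :=
      integrable_ref (by fun_prop)
    have hi2 : Integrable (fun x => ‖gradient a (M.Φ T x)‖ ^ 2)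
      (volume.restrict (refElem s (n + 1))) := integrable_ref (by fun_prop)
    have hi3 : Integrable (fun x => (a ∘ M.Φ T) x ^ 2 + ‖gradient (a ∘ M.Φ T) x‖ ^ 2)
      (volume.restrict (refElem s (n + 1))) := integrable_ref (by
        have : Continuous (a ∘ M.Φ T) := hac.comp hΦ
        fun_prop)
    rw [← integral_add hi1 hi2, ← integral_const_mul]
    refine integral_mono hi3 ((hi1.add hi2).const_mul _) fun x => ?_
    have h4 := hM.gradient_le T ha x
    have h5 : 0 ≤ K ^ 2 * M.hElem T ^ 2 * a (M.Φ T x) ^ 2 := by positivity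
    simp only [Function.comp_apply]
    nlinarith [sq_nonneg ‖gradient a (M.Φ T x)‖]
  rw [setIntegral_elem, setIntegral_elem]
  refine (mul_le_mul_of_nonneg_left h3 hC.le).trans (le_of_eq ?_)
  field_simp

theorem norm_sub_sq_Lp {X E : Type*} [MeasurableSpace X] {μ : Measure X} [NormedAddCommGroup E]
    [InnerProductSpace ℝ E] {u v : X → E} (hu : MemLp u 2 μ) (hv : MemLp v 2 μ) :
    dist (hu.toLp u) (hv.toLp v) ^ 2 = ∫ x, ‖u x - v x‖ ^ 2 ∂μ := by
  rw [dist_eq_norm, ← MemLp.toLp_sub, ← real_inner_self_eq_norm_sq, L2.inner_def]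
  refine integral_congr_ae ?_
  filter_upwards [(hu.sub hv).coeFn_toLp] with x hx
  rw [hx, real_inner_self_eq_norm_sq]
  rfl

theorem gradient_sub {d : ℕ} {a b : Space d → ℝ} (ha : ContDiff ℝ ∞ a) (hb : ContDiff ℝ ∞ b)
    (x : Space d) : gradient (a - b) x = gradient a x - gradient b x := by
  rw [gradient, gradient, gradient, fderiv_sub (ha.differentiable (by simp) x)
    (hb.differentiable (by simp) x), map_sub]

/-- Smooth functions which converge in `H¹` have convergent traces. -/
theorem exists_trace_limit {K : ℝ} (hM : M.IsScaled K) (E : κ) {a : ℕ → Space (n + 1) → ℝ}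
    (ha : ∀ k, ContDiff ℝ ∞ (a k)) {w : Space (n + 1) → ℝ} {G : Space (n + 1) → Space (n + 1)}
    (hw : MemLp w 2 (volume.restrict (M.elem (M.side₁ E))))
    (hG : MemLp G 2 (volume.restrict (M.elem (M.side₁ E))))
    (h1 : Tendsto (fun k => eLpNorm (a k - w) 2 (volume.restrict (M.elem (M.side₁ E))))
      atTop (𝓝 0))
    (h2 : Tendsto (fun k => eLpNorm (gradient (a k) - G) 2
      (volume.restrict (M.elem (M.side₁ E)))) atTop (𝓝 0)) :
    ∃ t : Space n → ℝ, MemLp t 2 (volume.restrict (refElem s n)) ∧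
      Tendsto (fun k => eLpNorm (fun y => a k (M.Ψ E y) - t y) 2
          (volume.restrict (refElem s n))) atTop (𝓝 0) := by
  obtain ⟨C, hC, hC'⟩ := exists_facet_trace_le hM E
  have hΨ : Continuous (M.Ψ E) := (M.Ψ E).continuous_of_finiteDimensional
  have hcT := M.isCompact_elem (M.side₁ E)
  have hm1 : ∀ k, MemLp (a k) 2 (volume.restrict (M.elem (M.side₁ E))) := fun k =>
    memLp_two_of_continuous (ha k).continuous hcT
  have hm2 : ∀ k, MemLp (gradient (a k)) 2 (volume.restrict (M.elem (M.side₁ E))) := fun k =>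
    memLp_two_of_continuous (continuous_gradient (ha k)) hcT
  have hm3 : ∀ k, MemLp (fun y => a k (M.Ψ E y)) 2 (volume.restrict (refElem s n)) := fun k =>
    memLp_two_of_continuous ((ha k).continuous.comp hΨ) (isCompact_refElem s n)
  have c1 := ((Lp.tendsto_Lp_iff_tendsto_eLpNorm'' a hm1 w hw).2 h1).cauchySeq
  have c2 := ((Lp.tendsto_Lp_iff_tendsto_eLpNorm'' (fun k => gradient (a k)) hm2 G hG).2
    h2).cauchySeq
  -- The trace inequality for differences makes the traces a Cauchy sequence, and completeness of
  -- `L²` provides the limit.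
  have hd : ∀ k l, dist ((hm3 k).toLp _) ((hm3 l).toLp _) ^ 2 ≤
      C * (dist ((hm1 k).toLp _) ((hm1 l).toLp _) ^ 2 +
        dist ((hm2 k).toLp _) ((hm2 l).toLp _) ^ 2) := by
    intro k l
    rw [norm_sub_sq_Lp, norm_sub_sq_Lp, norm_sub_sq_Lp]
    have := hC' (a k - a l) ((ha k).sub (ha l))
    simpa [gradient_sub (ha k) (ha l)] using this
  have c3 : CauchySeq fun k => (hm3 k).toLp (fun y => a k (M.Ψ E y)) := by
    rw [Metric.cauchySeq_iff] at c1 c2 ⊢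
    intro ε hε
    -- The traces are then closer than `√(2 C) η ≤ 2 √C η < ε`; the summand `1` makes the last
    -- inequality strict.
    obtain ⟨η, hη⟩ : ∃ η, η = ε / (2 * Real.sqrt C + 1) := ⟨_, rfl⟩
    have hsC := Real.sqrt_nonneg C
    have hη0 : 0 < η := by rw [hη]; positivity
    obtain ⟨N1, hN1⟩ := c1 η hη0
    obtain ⟨N2, hN2⟩ := c2 η hη0
    refine ⟨max N1 N2, fun k hk l hl => ?_⟩
    have e1 := hN1 k (le_trans (le_max_left _ _) hk) l (le_trans (le_max_left _ _) hl)
    have e2 := hN2 k (le_trans (le_max_right _ _) hk) l (le_trans (le_max_right _ _) hl)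
    have e3 := hd k l
    have e4 : dist ((hm3 k).toLp (fun y => a k (M.Ψ E y)))
        ((hm3 l).toLp (fun y => a l (M.Ψ E y))) ≤ 2 * Real.sqrt C * η := by
      refine abs_le_of_sq_le_sq' ?_ (by positivity) |>.2
      have : dist ((hm1 k).toLp _) ((hm1 l).toLp _) ^ 2 ≤ η ^ 2 :=
        pow_le_pow_left₀ dist_nonneg e1.le 2
      have : dist ((hm2 k).toLp _) ((hm2 l).toLp _) ^ 2 ≤ η ^ 2 :=
        pow_le_pow_left₀ dist_nonneg e2.le 2
      rw [mul_pow, mul_pow, Real.sq_sqrt hC.le]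
      nlinarith [sq_nonneg η, mul_pos hC (pow_pos hη0 2)]
    refine e4.trans_lt ?_
    have h5 : ε = (2 * Real.sqrt C + 1) * η := by rw [hη]; field_simp
    rw [h5]
    linarith
  obtain ⟨f, hf⟩ := cauchySeq_tendsto_of_complete c3
  refine ⟨f, Lp.memLp f, ?_⟩
  refine (Lp.tendsto_Lp_iff_tendsto_eLpNorm'' (fun k y => a k (M.Ψ E y)) hm3 f (Lp.memLp f)).1 ?_
  rwa [Lp.toLp_coeFn]

/-- Functions in `H^1_0(Ω)` are broken `H¹` functions without jumps. -/
theorem isBrokenH1_of_isH10 [Fintype κ] (hΩ : IsPolyhedralDomain Ω) {K : ℝ} (hM : M.IsScaled K)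
    {φ : Space (n + 1) → ℝ} {G : Space (n + 1) → Space (n + 1)} (h : IsH10 Ω φ G) :
    ∃ t : ι → κ → Space n → ℝ, M.IsBrokenH1 φ (fun _ => G) t ∧
      ∀ E, M.facetIntegral E (fun y => M.jump t E y ^ 2) = 0 := by
  obtain ⟨hφ, hG, a, ha, h1, h2⟩ := h
  have hmono : ∀ (T : ι) {F : Type} [NormedAddCommGroup F] (f : ℕ → Space (n + 1) → F),
      Tendsto (fun k => eLpNorm (f k) 2 (volume.restrict Ω)) atTop (𝓝 0) →
      Tendsto (fun k => eLpNorm (f k) 2 (volume.restrict (M.elem T))) atTop (𝓝 0) :=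
    fun T F _ f hf => tendsto_of_tendsto_of_tendsto_of_le_of_le tendsto_const_nhds hf
      (fun k => zero_le) fun k => eLpNorm_mono_measure _ (M.restrict_elem_le hΩ T)
  have ht := fun E => exists_trace_limit hM E (fun k => (ha k).1) (M.memLp_elem hΩ _ hφ)
    (M.memLp_elem hΩ _ hG) (hmono _ _ h1) (hmono _ _ h2)
  choose t htm htl using ht
  -- One sequence approximates `φ` on all elements, so the trace can be chosen per facet,
  -- independently of the side; interior jumps are then identically zero.
  refine ⟨fun _ => t, isBrokenH1_of_tendsto hΩ hφ (fun T => M.memLp_elem hΩ T hG)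
    (fun T E _ => htm E) (fun _ => a) (fun _ k => (ha k).1) (fun T => hmono T _ h1)
    (fun T => hmono T _ h2) fun T E _ => htl E, fun E => ?_⟩
  by_cases hE : M.facet E ⊆ frontier Ω
  · have hΨ : Continuous (M.Ψ E) := (M.Ψ E).continuous_of_finiteDimensional
    -- The approximations have support inside the open set `Ω` and vanish on its frontier, hence so
    -- does the limit trace.
    have hz : ∀ k, ∫ y in refElem s n, a k (M.Ψ E y) ^ 2 = 0 := by
      intro k
      refine (setIntegral_congr_fun (measurableSet_refElem s n) fun y hy => ?_).trans
        (integral_zero _ _)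
      have h3 : a k (M.Ψ E y) = 0 := by
        refine image_eq_zero_of_notMem_tsupport fun h4 => ?_
        have h5 := hE (mem_image_of_mem _ hy)
        rw [hΩ.isOpen.frontier_eq] at h5
        exact h5.2 ((ha k).2.2 h4)
      simp [h3]
    have hl := tendsto_integral_sq (f := fun k y => a k (M.Ψ E y)) (g := t E)
      (fun k => memLp_two_of_continuous ((ha k).1.continuous.comp hΨ) (isCompact_refElem s n))
      (htm E) (htl E)
    simp only [hz] at hl
    have h6 := tendsto_nhds_unique hl tendsto_const_nhds
    simp only [facetIntegral, jump, if_pos hE, h6, mul_zero]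
  · simp [facetIntegral, jump, if_neg hE]

end Broken

end Mesh

theorem integrable_inner_of_memLp {X E : Type*} [MeasurableSpace X] {μ : Measure X}
    [NormedAddCommGroup E] [InnerProductSpace ℝ E] {f g : X → E} (hf : MemLp f 2 μ)
    (hg : MemLp g 2 μ) : Integrable (fun x => inner ℝ (f x) (g x)) μ :=
  (hf.norm.integrable_mul hg.norm).mono' (hf.1.inner hg.1)
    (Eventually.of_forall fun _ => norm_inner_le_norm _ _)

/-! ### The DG norm -/

namespace Mesh

section Sums

variable {s : Shape} {n : ℕ} {Ω : Set (Space (n + 1))} {ι κ : Type} (M : Mesh s n Ω ι κ)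
  [Fintype ι] [Fintype κ]

open Classical in
theorem sum_facetsOf_comm (g : κ → ι → ℝ) : ∑ T, ∑ E ∈ M.facetsOf T, g E T =
    ∑ E, ∑ T, if T = M.side₁ E ∨ T = M.side₂ E then g E T else 0 := by
  rw [Finset.sum_comm]
  refine Finset.sum_congr rfl fun T _ => ?_
  rw [facetsOf, Finset.sum_filter]

/-- The factor `2` accounts for boundary facets, whose two sides are the same element and which
appear only once on the right. -/
theorem sum_sides_le {g : κ → ι → ℝ} (hg : ∀ E T, 0 ≤ g E T) :
    ∑ E, (g E (M.side₁ E) + g E (M.side₂ E)) ≤ 2 * ∑ T, ∑ E ∈ M.facetsOf T, g E T := by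
  classical
  rw [sum_facetsOf_comm, Finset.mul_sum]
  refine Finset.sum_le_sum fun E _ => ?_
  have h : ∀ T₀, (T₀ = M.side₁ E ∨ T₀ = M.side₂ E) → g E T₀ ≤
      ∑ T, if T = M.side₁ E ∨ T = M.side₂ E then g E T else 0 := by
    intro T₀ h0
    have := Finset.single_le_sum (f := fun T => if T = M.side₁ E ∨ T = M.side₂ E then g E T else 0)
      (fun T _ => by split_ifs <;> simp [hg]) (Finset.mem_univ T₀)
    simpa only [if_pos h0] using this
  have h1 := h _ (Or.inl rfl)
  have h2 := h _ (Or.inr rfl)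
  linarith

/-- Every facet belongs to at most two elements. -/
theorem sum_facetsOf_le {X : κ → ℝ} (hX : ∀ E, 0 ≤ X E) :
    ∑ T, ∑ E ∈ M.facetsOf T, X E ≤ 2 * ∑ E, X E := by
  classical
  rw [sum_facetsOf_comm M fun E _ => X E, Finset.mul_sum]
  refine Finset.sum_le_sum fun E _ => ?_
  have h : ∀ T, (if T = M.side₁ E ∨ T = M.side₂ E then X E else 0) ≤
      (if T = M.side₁ E then X E else 0) + if T = M.side₂ E then X E else 0 := fun T => by
    have := hX E
    split_ifs with h1 h2 h3 <;> first | linarith | (exfalso; tauto)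
  refine (Finset.sum_le_sum fun T _ => h T).trans ?_
  rw [Finset.sum_add_distrib, Finset.sum_ite_eq', Finset.sum_ite_eq']
  simp
  linarith

end Sums

section DG

variable {s : Shape} {n : ℕ} {Ω : Set (Space (n + 1))} {ι κ : Type} {M : Mesh s n Ω ι κ}
  {K lo hi : ℝ} {A : Space (n + 1) → Matrix (Fin (n + 1)) (Fin (n + 1)) ℝ}

theorem facetIntegral_nonneg (E : κ) {g : Space n → ℝ} (hg : ∀ y, 0 ≤ g y) :
    0 ≤ M.facetIntegral E g := mul_nonneg (M.facetJac_pos E).le (integral_nonneg hg)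

theorem facetIntegral_mono (E : κ) {g g' : Space n → ℝ}
    (hg : Integrable g (volume.restrict (refElem s n)))
    (hg' : Integrable g' (volume.restrict (refElem s n))) (h : ∀ y, g y ≤ g' y) :
    M.facetIntegral E g ≤ M.facetIntegral E g' :=
  mul_le_mul_of_nonneg_left (integral_mono hg hg' h) (M.facetJac_pos E).le

theorem facetIntegral_add (E : κ) {g g' : Space n → ℝ}
    (hg : Integrable g (volume.restrict (refElem s n)))
    (hg' : Integrable g' (volume.restrict (refElem s n))) :
    M.facetIntegral E (fun y => g y + g' y) = M.facetIntegral E g + M.facetIntegral E g' := by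
  rw [facetIntegral, integral_add hg hg', mul_add]; rfl

theorem facetIntegral_const_mul (E : κ) (c : ℝ) (g : Space n → ℝ) :
    M.facetIntegral E (fun y => c * g y) = c * M.facetIntegral E g := by
  rw [facetIntegral, integral_const_mul, facetIntegral]; ring

theorem IsScaled.hFacet_pos' (hM : M.IsScaled K) (E : κ) : 0 < M.hFacet E := by
  obtain ⟨F, hF⟩ := (M.incident_iff E (M.side₁ E)).1 (Or.inl rfl)
  rw [← hF]; exact hM.hFacet_pos _ F

theorem IsScaled.inv_hFacet_le (hM : M.IsScaled K) {E : κ} {T : ι}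
    (h : T = M.side₁ E ∨ T = M.side₂ E) : (M.hFacet E)⁻¹ ≤ K * (M.hElem T)⁻¹ := by
  obtain ⟨F, rfl⟩ := (M.incident_iff E T).1 h
  have h1 := hM.le_hFacet T F
  have h2 := hM.hElem_pos T
  have h3 := hM.hFacet_pos T F
  rw [← div_eq_mul_inv, le_div_iff₀ h2, inv_mul_le_iff₀ h3]
  linarith

theorem IsScaled.inv_hElem_le (hM : M.IsScaled K) {E : κ} {T : ι}
    (h : T = M.side₁ E ∨ T = M.side₂ E) : (M.hElem T)⁻¹ ≤ (M.hFacet E)⁻¹ := by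
  obtain ⟨F, rfl⟩ := (M.incident_iff E T).1 h
  exact inv_anti₀ (hM.hFacet_pos T F) (hM.hFacet_le T F)

theorem mem_facetsOf' [Fintype κ] (E : κ) (T : ι) :
    E ∈ M.facetsOf T ↔ T = M.side₁ E ∨ T = M.side₂ E := by
  rw [mem_facetsOf, incident_iff]

/-- The square of the DG norm. -/
def dgSq [Fintype ι] [Fintype κ] (M : Mesh s n Ω ι κ)
    (A : Space (n + 1) → Matrix (Fin (n + 1)) (Fin (n + 1)) ℝ)
    (G : ι → Space (n + 1) → Space (n + 1)) (t : ι → κ → Space n → ℝ) : ℝ :=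
  (∑ T, ∫ x in M.elem T, matForm (A x) (G T x) (G T x)) +
    ∑ E, (M.hFacet E)⁻¹ * M.facetIntegral E (fun y => M.jump t E y ^ 2)

/-- The tensor `A` satisfies uniform bounds in `Ω`. -/
structure UniformTensor (Ω : Set (Space (n + 1))) (lo hi : ℝ)
    (A : Space (n + 1) → Matrix (Fin (n + 1)) (Fin (n + 1)) ℝ) : Prop where
  lo_pos : 0 < lo
  hi_pos : 0 < hi
  measurable : ∀ i j, AEStronglyMeasurable (fun x => A x i j) (volume.restrict Ω)
  bounds : ∀ᵐ x ∂volume.restrict Ω, TensorBounds lo hi (A x)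

theorem exists_uniformTensor (hA : IsDiffusionTensor Ω A) :
    ∃ lo hi, UniformTensor Ω lo hi A := by
  obtain ⟨lo, hi, hlo, h⟩ := hA.elliptic
  -- The upper bound is enlarged to be visibly positive.
  refine ⟨lo, max hi 1, hlo, by positivity, hA.measurable, ?_⟩
  filter_upwards [h, hA.symm] with x hx hs
  exact ⟨hs, fun ξ => (hx ξ).1, fun ξ => (hx ξ).2.trans
    (mul_le_mul_of_nonneg_right (le_max_left _ _) (by positivity))⟩

theorem UniformTensor.integrable_matForm (hA : UniformTensor Ω lo hi A)
    (hΩ : IsPolyhedralDomain Ω) (T : ι) {f g : Space (n + 1) → Space (n + 1)}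
    (hf : MemLp f 2 (volume.restrict (M.elem T))) (hg : MemLp g 2 (volume.restrict (M.elem T))) :
    Integrable (fun x => matForm (A x) (f x) (g x)) (volume.restrict (M.elem T)) := by
  simp_rw [matForm_eq_inner]
  refine integrable_inner_of_memLp hf (memLp_mulE (fun i j =>
    (hA.measurable i j).mono_measure (M.restrict_elem_le hΩ T)) (c := hi) ?_ hg)
  filter_upwards [M.ae_elem hΩ T hA.bounds] with x hx ξ
  exact hx.norm_mulE_le hA.lo_pos hA.hi_pos ξ

end DG

end Mesh

namespace Mesh

variable {s : Shape} {n : ℕ} {Ω : Set (Space (n + 1))} {ι κ : Type} {M : Mesh s n Ω ι κ}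
  {K lo hi : ℝ} {A : Space (n + 1) → Matrix (Fin (n + 1)) (Fin (n + 1)) ℝ}

theorem continuous_fn_Ψ (v : ι → MvPolynomial (Fin (n + 1)) ℝ) (T : ι) (E : κ) :
    Continuous fun y => M.fn v T (M.Ψ E y) :=
  (M.contDiff_fn v T).continuous.comp (M.Ψ E).continuous_of_finiteDimensional

theorem continuous_facetFn (μ : κ → MvPolynomial (Fin n) ℝ) (E : κ) : Continuous (facetFn μ E) :=
  continuous_pe (μ E)

theorem memLp_ref {d : ℕ} {E : Type*} [NormedAddCommGroup E] {f : Space d → E}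
    (hf : Continuous f) : MemLp f 2 (volume.restrict (refElem s d)) :=
  memLp_two_of_continuous hf (isCompact_refElem s d)

theorem memLp_elem_of_continuous (T : ι) {E : Type*} [NormedAddCommGroup E]
    {f : Space (n + 1) → E} (hf : Continuous f) : MemLp f 2 (volume.restrict (M.elem T)) :=
  memLp_two_of_continuous hf (M.isCompact_elem T)

theorem memLp_gradient_fn (v : ι → MvPolynomial (Fin (n + 1)) ℝ) (T : ι) :
    MemLp (gradient (M.fn v T)) 2 (volume.restrict (M.elem T)) :=
  memLp_elem_of_continuous T (continuous_gradient (M.contDiff_fn v T))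

theorem facetIntegral_sq_add_le (E : κ) {f g h : Space n → ℝ}
    (hf : MemLp f 2 (volume.restrict (refElem s n)))
    (hg : MemLp g 2 (volume.restrict (refElem s n)))
    (hh : MemLp h 2 (volume.restrict (refElem s n))) :
    M.facetIntegral E (fun y => (f y + g y + h y) ^ 2) ≤
      3 * (M.facetIntegral E (fun y => f y ^ 2) + M.facetIntegral E (fun y => g y ^ 2) +
        M.facetIntegral E (fun y => h y ^ 2)) := by
  rw [← facetIntegral_add E hf.integrable_sq hg.integrable_sq,
    ← facetIntegral_add E (g := fun y => f y ^ 2 + g y ^ 2) (hf.integrable_sq.add hg.integrable_sq)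
      hh.integrable_sq, ← facetIntegral_const_mul]
  refine facetIntegral_mono E ((hf.add hg).add hh).integrable_sq
    (((hf.integrable_sq.add hg.integrable_sq).add hh.integrable_sq).const_mul 3) fun y => ?_
  nlinarith [sq_nonneg (f y - g y), sq_nonneg (g y - h y), sq_nonneg (f y - h y)]

theorem facetIntegral_sq_sub_le (E : κ) {f g : Space n → ℝ}
    (hf : MemLp f 2 (volume.restrict (refElem s n)))
    (hg : MemLp g 2 (volume.restrict (refElem s n))) :
    M.facetIntegral E (fun y => (f y - g y) ^ 2) ≤
      2 * (M.facetIntegral E (fun y => f y ^ 2) + M.facetIntegral E (fun y => g y ^ 2)) := by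
  rw [← facetIntegral_add E hf.integrable_sq hg.integrable_sq, ← facetIntegral_const_mul]
  refine facetIntegral_mono E (hf.sub hg).integrable_sq
    ((hf.integrable_sq.add hg.integrable_sq).const_mul 2) fun y => ?_
  nlinarith [sq_nonneg (f y + g y)]

/-- The squared distance of `v` and `μ` on the facet `E` of `T`. -/
def gapAt (M : Mesh s n Ω ι κ) (v : ι → MvPolynomial (Fin (n + 1)) ℝ)
    (μ : κ → MvPolynomial (Fin n) ℝ) (E : κ) (T : ι) : ℝ :=
  M.facetIntegral E fun y => (M.fn v T (M.Ψ E y) - facetFn μ E y) ^ 2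

theorem gapAt_nonneg (v : ι → MvPolynomial (Fin (n + 1)) ℝ) (μ : κ → MvPolynomial (Fin n) ℝ)
    (E : κ) (T : ι) : 0 ≤ M.gapAt v μ E T := facetIntegral_nonneg E fun _ => sq_nonneg _

/-- The jump is the difference of the two gaps `v - μ`, since `μ` is single valued; on the boundary
`μ = 0` and the trace is itself the gap. -/
theorem jump_fn_le (v : ι → MvPolynomial (Fin (n + 1)) ℝ) {μ : κ → MvPolynomial (Fin n) ℝ}
    (hμ : ∀ E, M.facet E ⊆ frontier Ω → μ E = 0) (E : κ) :
    M.facetIntegral E (fun y => M.jump (fun T E y => M.fn v T (M.Ψ E y)) E y ^ 2) ≤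
      2 * (M.gapAt v μ E (M.side₁ E) + M.gapAt v μ E (M.side₂ E)) := by
  have hm : ∀ T, MemLp (fun y => M.fn v T (M.Ψ E y) - facetFn μ E y) 2
      (volume.restrict (refElem s n)) := fun T =>
    memLp_ref ((continuous_fn_Ψ v T E).sub (continuous_facetFn μ E))
  by_cases h : M.facet E ⊆ frontier Ω
  · have h1 : ∀ y, M.jump (fun T E y => M.fn v T (M.Ψ E y)) E y =
        M.fn v (M.side₁ E) (M.Ψ E y) - facetFn μ E y := fun y => by
      simp [jump, h, facetFn, hμ E h]
    simp_rw [h1]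
    have h2 := gapAt_nonneg (M := M) v μ E (M.side₁ E)
    have h3 := gapAt_nonneg (M := M) v μ E (M.side₂ E)
    change M.gapAt v μ E (M.side₁ E) ≤ _
    linarith
  · have h1 : ∀ y, M.jump (fun T E y => M.fn v T (M.Ψ E y)) E y =
        (M.fn v (M.side₁ E) (M.Ψ E y) - facetFn μ E y) -
          (M.fn v (M.side₂ E) (M.Ψ E y) - facetFn μ E y) := fun y => by
      simp [jump, h]
    simp_rw [h1]
    exact facetIntegral_sq_sub_le E (hm _) (hm _)

theorem energyAt_nonneg [Fintype κ] (v : ι → MvPolynomial (Fin (n + 1)) ℝ) (μ : κ → MvPolynomial (Fin n) ℝ)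
    (T : ι) : 0 ≤ M.energyAt v μ T :=
  add_nonneg (integral_nonneg fun _ => sq_nonneg _) (mul_nonneg (inv_nonneg.2 (M.hElem_pos T).le)
    (Finset.sum_nonneg fun E _ => gapAt_nonneg v μ E T))

variable [Fintype ι] [Fintype κ]

theorem energyAt_eq (v : ι → MvPolynomial (Fin (n + 1)) ℝ) (μ : κ → MvPolynomial (Fin n) ℝ)
    (T : ι) : M.energyAt v μ T = (∫ x in M.elem T, ‖gradient (M.fn v T) x‖ ^ 2) +
      ∑ E ∈ M.facetsOf T, (M.hElem T)⁻¹ * M.gapAt v μ E T := by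
  rw [energyAt, Finset.mul_sum]; rfl

theorem UniformTensor.setIntegral_le (hA : UniformTensor Ω lo hi A)
    (hΩ : IsPolyhedralDomain Ω) (T : ι) {G : Space (n + 1) → Space (n + 1)}
    (hG : MemLp G 2 (volume.restrict (M.elem T))) :
    ∫ x in M.elem T, matForm (A x) (G x) (G x) ≤ hi * ∫ x in M.elem T, ‖G x‖ ^ 2 := by
  rw [← integral_const_mul]
  refine integral_mono_ae (hA.integrable_matForm hΩ T hG hG)
    ((memLp_two_iff_integrable_sq_norm hG.1).1 hG |>.const_mul hi) ?_
  filter_upwards [M.ae_elem hΩ T hA.bounds] with x hx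
  exact hx.ge _

theorem UniformTensor.le_setIntegral (hA : UniformTensor Ω lo hi A)
    (hΩ : IsPolyhedralDomain Ω) (T : ι) {G : Space (n + 1) → Space (n + 1)}
    (hG : MemLp G 2 (volume.restrict (M.elem T))) :
    lo * ∫ x in M.elem T, ‖G x‖ ^ 2 ≤ ∫ x in M.elem T, matForm (A x) (G x) (G x) := by
  rw [← integral_const_mul]
  refine integral_mono_ae ((memLp_two_iff_integrable_sq_norm hG.1).1 hG |>.const_mul lo)
    (hA.integrable_matForm hΩ T hG hG) ?_
  filter_upwards [M.ae_elem hΩ T hA.bounds] with x hx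
  exact hx.le _

/-- Jumps are replaced by gaps, `h_E⁻¹` is exchanged for `h_T⁻¹`, and the sum over facets becomes a
sum over elements. This makes the DG norm of a discrete function accessible to the local inf-sup
condition. -/
theorem IsScaled.dgSq_fn_le (hM : M.IsScaled K) (hΩ : IsPolyhedralDomain Ω)
    (hA : UniformTensor Ω lo hi A) (v : ι → MvPolynomial (Fin (n + 1)) ℝ)
    {μ : κ → MvPolynomial (Fin n) ℝ} (hμ : ∀ E, M.facet E ⊆ frontier Ω → μ E = 0) :
    M.dgSq A (fun T => gradient (M.fn v T)) (fun T E y => M.fn v T (M.Ψ E y)) ≤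
      (hi + 4 * K) * ∑ T, M.energyAt v μ T := by
  have hK := hM.pos
  have h1 : ∑ E, (M.hFacet E)⁻¹ *
      M.facetIntegral E (fun y => M.jump (fun T E y => M.fn v T (M.Ψ E y)) E y ^ 2) ≤
      2 * K * ∑ E, ((M.hElem (M.side₁ E))⁻¹ * M.gapAt v μ E (M.side₁ E) +
        (M.hElem (M.side₂ E))⁻¹ * M.gapAt v μ E (M.side₂ E)) := by
    rw [Finset.mul_sum]
    refine Finset.sum_le_sum fun E _ => ?_
    have e1 := mul_le_mul_of_nonneg_right (hM.inv_hFacet_le (E := E) (T := M.side₁ E) (Or.inl rfl))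
      (gapAt_nonneg (M := M) v μ E (M.side₁ E))
    have e2 := mul_le_mul_of_nonneg_right (hM.inv_hFacet_le (E := E) (T := M.side₂ E) (Or.inr rfl))
      (gapAt_nonneg (M := M) v μ E (M.side₂ E))
    have e3 := mul_le_mul_of_nonneg_left (jump_fn_le v hμ E) (inv_nonneg.2 (hM.hFacet_pos' E).le)
    linarith
  have h2 := M.sum_sides_le (g := fun E T => (M.hElem T)⁻¹ * M.gapAt v μ E T) fun E T =>
    mul_nonneg (inv_nonneg.2 (M.hElem_pos T).le) (gapAt_nonneg v μ E T)
  have h3 : ∑ T, ∫ x in M.elem T, matForm (A x) (gradient (M.fn v T) x) (gradient (M.fn v T) x) ≤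
      hi * ∑ T, ∫ x in M.elem T, ‖gradient (M.fn v T) x‖ ^ 2 := by
    rw [Finset.mul_sum]
    exact Finset.sum_le_sum fun T _ => hA.setIntegral_le hΩ T (memLp_gradient_fn v T)
  have h4 : ∑ T, M.energyAt v μ T = (∑ T, ∫ x in M.elem T, ‖gradient (M.fn v T) x‖ ^ 2) +
      ∑ T, ∑ E ∈ M.facetsOf T, (M.hElem T)⁻¹ * M.gapAt v μ E T := by
    simp_rw [energyAt_eq, Finset.sum_add_distrib]
  have h5 : 0 ≤ ∑ T, ∫ x in M.elem T, ‖gradient (M.fn v T) x‖ ^ 2 :=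
    Finset.sum_nonneg fun T _ => integral_nonneg fun _ => sq_nonneg _
  have h6 : 0 ≤ ∑ T, ∑ E ∈ M.facetsOf T, (M.hElem T)⁻¹ * M.gapAt v μ E T :=
    Finset.sum_nonneg fun T _ => Finset.sum_nonneg fun E _ =>
      mul_nonneg (inv_nonneg.2 (M.hElem_pos T).le) (gapAt_nonneg v μ E T)
  have h7 := mul_le_mul_of_nonneg_left h2 (by positivity : 0 ≤ 2 * K)
  have h8 := mul_nonneg hA.hi_pos.le h6
  have h9 := mul_nonneg hK.le h5
  rw [dgSq, h4]
  nlinarith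

/-! ### Projection of a broken function -/

/-- The trace from `side₁` is a facet polynomial of the right degree, because the coordinate change
between the two parametrizations of a facet preserves `𝒫_p`. -/
theorem exists_facet_polynomial {p : ℕ} {v : ι → MvPolynomial (Fin (n + 1)) ℝ}
    (hv : ∀ T, v T ∈ polySpace s (n + 1) p) : ∃ μ : κ → MvPolynomial (Fin n) ℝ,
      (∀ E, μ E ∈ polySpace s n p) ∧ (∀ E, M.facet E ⊆ frontier Ω → μ E = 0) ∧
      ∀ E, ¬ M.facet E ⊆ frontier Ω → ∀ y, facetFn μ E y = M.fn v (M.side₁ E) (M.Ψ E y) := by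
  have h : ∀ E, ∃ q ∈ polySpace s n p, ∀ y, pe q y = M.fn v (M.side₁ E) (M.Ψ E y) := fun E => by
    obtain ⟨F, hF⟩ := (M.incident_iff E (M.side₁ E)).1 (Or.inl rfl)
    refine ⟨MvPolynomial.aeval (affSub (M.facetChange (M.side₁ E) F : Space n →ᵃ[ℝ] Space n))
      (MvPolynomial.aeval (facetSub F) (v (M.side₁ E))),
      (admSub_affSub _ (M.image_facetChange _ F)).aeval_mem ((admSub_facetSub F).aeval_mem (hv _)),
      fun y => ?_⟩
    rw [pe_affSub, pe_facetSub, ← M.fn_Φ]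
    congr 1
    exact ((M.Ψ_facetAt _ F y).symm).trans (by rw [hF])
  choose q hq hq' using h
  classical
  refine ⟨fun E => if M.facet E ⊆ frontier Ω then 0 else q E, fun E => ?_, fun E hE => if_pos hE,
    fun E hE y => ?_⟩
  · dsimp only
    split_ifs
    · exact zero_mem _
    · exact hq E
  · rw [← hq' E y, facetFn]; simp only [if_neg hE]; rfl

/-- The squared distance of the traces `t` and the traces of `v`. -/
def traceGap (M : Mesh s n Ω ι κ) (t : ι → κ → Space n → ℝ)
    (v : ι → MvPolynomial (Fin (n + 1)) ℝ) (E : κ) (T : ι) : ℝ :=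
  M.facetIntegral E fun y => (t T E y - M.fn v T (M.Ψ E y)) ^ 2

/-- Seen from the other side, `v₂ - μ = (v₂ - t₂) + (t₂ - t₁) + (t₁ - v₁)`, as `μ` is the trace
`v₁`. Seen from `side₁` of an interior facet the gap is zero. -/
theorem gapAt_le_traceGap {v : ι → MvPolynomial (Fin (n + 1)) ℝ} {μ : κ → MvPolynomial (Fin n) ℝ}
    (hμ : ∀ E, M.facet E ⊆ frontier Ω → μ E = 0)
    (hμ' : ∀ E, ¬ M.facet E ⊆ frontier Ω → ∀ y, facetFn μ E y = M.fn v (M.side₁ E) (M.Ψ E y))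
    {t : ι → κ → Space n → ℝ}
    (ht : ∀ T, ∀ E ∈ M.facetsOf T, MemLp (t T E) 2 (volume.restrict (refElem s n)))
    {E : κ} {T : ι} (hE : E ∈ M.facetsOf T) :
    M.gapAt v μ E T ≤ 3 * (M.traceGap t v E T +
      M.facetIntegral E (fun y => M.jump t E y ^ 2) + M.traceGap t v E (M.side₁ E)) := by
  have hs1 : E ∈ M.facetsOf (M.side₁ E) := (mem_facetsOf' E _).2 (Or.inl rfl)
  have hs2 : E ∈ M.facetsOf (M.side₂ E) := (mem_facetsOf' E _).2 (Or.inr rfl)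
  have hm : ∀ T, E ∈ M.facetsOf T → MemLp (fun y => t T E y - M.fn v T (M.Ψ E y)) 2
      (volume.restrict (refElem s n)) := fun T h => (ht T E h).sub (memLp_ref (continuous_fn_Ψ v T E))
  have hmn : ∀ T, E ∈ M.facetsOf T → MemLp (fun y => M.fn v T (M.Ψ E y) - t T E y) 2
      (volume.restrict (refElem s n)) := fun T h => (memLp_ref (continuous_fn_Ψ v T E)).sub (ht T E h)
  have hT := (mem_facetsOf' E T).1 hE
  have hj : MemLp (M.jump t E) 2 (volume.restrict (refElem s n)) := by
    unfold jump
    split_ifs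
    · exact ht _ E hs1
    · exact (ht _ E hs1).sub (ht _ E hs2)
  have n1 : 0 ≤ M.traceGap t v E T := facetIntegral_nonneg E fun _ => sq_nonneg _
  have n2 : 0 ≤ M.traceGap t v E (M.side₁ E) := facetIntegral_nonneg E fun _ => sq_nonneg _
  have n3 : 0 ≤ M.facetIntegral E (fun y => M.jump t E y ^ 2) :=
    facetIntegral_nonneg E fun _ => sq_nonneg _
  have e1 : M.traceGap t v E T = M.facetIntegral E fun y => (M.fn v T (M.Ψ E y) - t T E y) ^ 2 := by
    rw [traceGap]; congr 1; funext y; ring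
  have e2 : M.facetIntegral E (fun y => M.jump t E y ^ 2) =
      M.facetIntegral E fun y => (-M.jump t E y) ^ 2 := by congr 1; funext y; ring
  by_cases hb : M.facet E ⊆ frontier Ω
  · have h12 := (M.boundary E).2 hb
    have hT1 : T = M.side₁ E := hT.elim id fun h => h.trans h12.symm
    have h0 : M.gapAt v μ E T = M.facetIntegral E fun y =>
        ((M.fn v T (M.Ψ E y) - t T E y) + M.jump t E y + 0) ^ 2 := by
      rw [gapAt]; congr 1; funext y
      simp [jump, hb, facetFn, hμ E hb, hT1]
    rw [h0, e1]
    refine (facetIntegral_sq_add_le E (hmn T hE) hj MemLp.zero').trans ?_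
    have : M.facetIntegral E (fun _ => (0 : ℝ) ^ 2) = 0 := by simp [facetIntegral]
    rw [this]
    linarith
  · rcases hT with hT1 | hT2
    · have h0 : M.gapAt v μ E T = 0 := by
        rw [gapAt, facetIntegral]
        simp [hμ' E hb, hT1]
      rw [h0]; linarith
    · have h0 : M.gapAt v μ E T = M.facetIntegral E fun y =>
          ((M.fn v T (M.Ψ E y) - t T E y) + -M.jump t E y +
            (t (M.side₁ E) E y - M.fn v (M.side₁ E) (M.Ψ E y))) ^ 2 := by
        rw [gapAt]; congr 1; funext y
        rw [hμ' E hb]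
        simp only [jump, hb, if_false, hT2]
        ring
      rw [h0, e1, e2]
      exact facetIntegral_sq_add_le E (hmn T hE) hj.neg (hm _ hs1)

end Mesh

namespace Mesh

variable {s : Shape} {n : ℕ} {Ω : Set (Space (n + 1))} {ι κ : Type} [Fintype ι] [Fintype κ]
  {M : Mesh s n Ω ι κ} {K lo hi : ℝ} {A : Space (n + 1) → Matrix (Fin (n + 1)) (Fin (n + 1)) ℝ}

/-- The competitor used to estimate the multiplier. The gap between `v` and `μ` is split into
projection errors on both sides, which the local projection estimate controls, and the jump of `w`,
which is part of its DG norm. -/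
theorem exists_energy_projection_le (s : Shape) (n p : ℕ) (hK : 0 < K) (hlo : 0 < lo) :
    ∃ C : ℝ, 0 < C ∧ ∀ {Ω : Set (Space (n + 1))} {ι κ : Type} [Fintype ι] [Fintype κ]
      {M : Mesh s n Ω ι κ} {hi : ℝ} {A : Space (n + 1) → Matrix (Fin (n + 1)) (Fin (n + 1)) ℝ},
      M.IsScaled K → IsPolyhedralDomain Ω → UniformTensor Ω lo hi A →
      ∀ (w : Space (n + 1) → ℝ) (G : ι → Space (n + 1) → Space (n + 1))
        (t : ι → κ → Space n → ℝ), M.IsBrokenH1 w G t →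
      ∀ v : ι → MvPolynomial (Fin (n + 1)) ℝ, (∀ T, v T ∈ polySpace s (n + 1) p) →
      (∀ T, ∀ z : ι → MvPolynomial (Fin (n + 1)) ℝ, z T ∈ polySpace s (n + 1) p →
        ∫ x in M.elem T, (M.fn v T x - w x) * M.fn z T x = 0) →
      ∃ μ : κ → MvPolynomial (Fin n) ℝ, (∀ E, μ E ∈ polySpace s n p) ∧
        (∀ E, M.facet E ⊆ frontier Ω → μ E = 0) ∧ ∑ T, M.energyAt v μ T ≤ C * M.dgSq A G t := by
  obtain ⟨Cp, hCp, hp⟩ := exists_projection_at_le s n p hK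
  -- The factor `3` comes from the three-term splitting. The jumps pick up another `2` from the sum
  -- over elements; the error on `side₁` picks up `2 · 2 · K` from two passages between elements and
  -- facets and from replacing `h_E` by `h_T`.
  refine ⟨(3 + 12 * K) * Cp / lo + 6, by positivity, ?_⟩
  intro Ω ι κ _ _ M hi A hM hΩ hA w G t hw v hv hpr
  obtain ⟨μ, hμp, hμ, hμ'⟩ := exists_facet_polynomial (M := M) hv
  refine ⟨μ, hμp, hμ, ?_⟩
  have ht : ∀ T, ∀ E ∈ M.facetsOf T, MemLp (t T E) 2 (volume.restrict (refElem s n)) :=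
    fun T => (hw.2 T).2.2.1
  have hG : ∀ T, MemLp (G T) 2 (volume.restrict (M.elem T)) := fun T => (hw.2 T).1
  have h1 : ∀ T, (∫ x in M.elem T, ‖gradient (M.fn v T) x‖ ^ 2) +
      ∑ E ∈ M.facetsOf T, (M.hElem T)⁻¹ * M.traceGap t v E T ≤
        Cp * ∫ x in M.elem T, ‖G T x‖ ^ 2 := fun T => by
    obtain ⟨a, ha, ha1, ha2, ha3⟩ := (hw.2 T).2.2.2
    have := hp hM T w (G T) (t T) a (M.memLp_elem hΩ T hw.1) (hG T) (ht T) ha ha1 ha2 ha3 v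
      (hv T) (hpr T)
    rw [Finset.mul_sum] at this
    exact this
  have hinv : ∀ T, 0 ≤ (M.hElem T)⁻¹ := fun T => inv_nonneg.2 (M.hElem_pos T).le
  have hJ : ∀ E, 0 ≤ (M.hFacet E)⁻¹ * M.facetIntegral E (fun y => M.jump t E y ^ 2) := fun E =>
    mul_nonneg (inv_nonneg.2 (hM.hFacet_pos' E).le) (facetIntegral_nonneg E fun _ => sq_nonneg _)
  have hc : ∀ E T, 0 ≤ M.traceGap t v E T := fun E T =>
    facetIntegral_nonneg E fun _ => sq_nonneg _
  have hX : ∀ E, 0 ≤ (M.hFacet E)⁻¹ * M.traceGap t v E (M.side₁ E) := fun E =>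
    mul_nonneg (inv_nonneg.2 (hM.hFacet_pos' E).le) (hc _ _)
  have h2 : ∑ T, ∑ E ∈ M.facetsOf T, (M.hElem T)⁻¹ * M.gapAt v μ E T ≤
      3 * (∑ T, ∑ E ∈ M.facetsOf T, (M.hElem T)⁻¹ * M.traceGap t v E T +
        ∑ T, ∑ E ∈ M.facetsOf T,
          (M.hFacet E)⁻¹ * M.facetIntegral E (fun y => M.jump t E y ^ 2) +
        ∑ T, ∑ E ∈ M.facetsOf T, (M.hFacet E)⁻¹ * M.traceGap t v E (M.side₁ E)) := by
    simp_rw [← Finset.sum_add_distrib, Finset.mul_sum]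
    refine Finset.sum_le_sum fun T _ => Finset.sum_le_sum fun E hE => ?_
    have e1 := mul_le_mul_of_nonneg_left (gapAt_le_traceGap hμ hμ' ht hE) (hinv T)
    have hT := hM.inv_hElem_le ((mem_facetsOf' E T).1 hE)
    have e2 := mul_le_mul_of_nonneg_right hT
      (facetIntegral_nonneg (M := M) E fun y => sq_nonneg (M.jump t E y))
    have e3 := mul_le_mul_of_nonneg_right hT (hc E (M.side₁ E))
    linarith
  have h3 := M.sum_facetsOf_le hJ
  have h4 := M.sum_facetsOf_le hX
  have h5 : ∑ E, (M.hFacet E)⁻¹ * M.traceGap t v E (M.side₁ E) ≤ K *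
      ∑ E, ((M.hElem (M.side₁ E))⁻¹ * M.traceGap t v E (M.side₁ E) +
        (M.hElem (M.side₂ E))⁻¹ * M.traceGap t v E (M.side₂ E)) := by
    rw [Finset.mul_sum]
    refine Finset.sum_le_sum fun E _ => ?_
    have e1 := mul_le_mul_of_nonneg_right (hM.inv_hFacet_le (E := E) (T := M.side₁ E) (Or.inl rfl))
      (hc E (M.side₁ E))
    have e2 := mul_nonneg hK.le (mul_nonneg (hinv (M.side₂ E)) (hc E (M.side₂ E)))
    linarith
  have h6 := mul_le_mul_of_nonneg_left (M.sum_sides_le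
    (g := fun E T => (M.hElem T)⁻¹ * M.traceGap t v E T)
    fun E T => mul_nonneg (hinv T) (hc E T)) hK.le
  have h7 : (∑ T, ∫ x in M.elem T, ‖gradient (M.fn v T) x‖ ^ 2) +
      ∑ T, ∑ E ∈ M.facetsOf T, (M.hElem T)⁻¹ * M.traceGap t v E T ≤
        Cp * (lo⁻¹ * ∑ T, ∫ x in M.elem T, matForm (A x) (G T x) (G T x)) := by
    rw [← Finset.sum_add_distrib, Finset.mul_sum, Finset.mul_sum]
    refine Finset.sum_le_sum fun T _ => (h1 T).trans (mul_le_mul_of_nonneg_left ?_ hCp.le)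
    rw [le_inv_mul_iff₀ hlo]
    exact hA.le_setIntegral hΩ T (hG T)
  have h8 : 0 ≤ ∑ T, ∫ x in M.elem T, ‖gradient (M.fn v T) x‖ ^ 2 :=
    Finset.sum_nonneg fun T _ => integral_nonneg fun _ => sq_nonneg _
  have h9 : ∑ T, M.energyAt v μ T = (∑ T, ∫ x in M.elem T, ‖gradient (M.fn v T) x‖ ^ 2) +
      ∑ T, ∑ E ∈ M.facetsOf T, (M.hElem T)⁻¹ * M.gapAt v μ E T := by
    simp_rw [energyAt_eq, Finset.sum_add_distrib]
  have h10 : 0 ≤ ∑ T, ∫ x in M.elem T, matForm (A x) (G T x) (G T x) :=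
    Finset.sum_nonneg fun T _ => le_trans (mul_nonneg hlo.le (integral_nonneg fun _ => sq_nonneg _))
      (hA.le_setIntegral hΩ T (hG T))
  have h11 := mul_le_mul_of_nonneg_left h7 (by positivity : 0 ≤ 3 + 12 * K)
  have h12 : 0 ≤ (3 + 12 * K) * Cp / lo *
      ∑ E, (M.hFacet E)⁻¹ * M.facetIntegral E (fun y => M.jump t E y ^ 2) :=
    mul_nonneg (by positivity) (Finset.sum_nonneg fun E _ => hJ E)
  have h13 := mul_nonneg hK.le h8
  rw [h9, dgSq]
  have h14 : ((3 + 12 * K) * Cp / lo + 6) *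
      ((∑ T, ∫ x in M.elem T, matForm (A x) (G T x) (G T x)) +
        ∑ E, (M.hFacet E)⁻¹ * M.facetIntegral E (fun y => M.jump t E y ^ 2)) =
      (3 + 12 * K) * (Cp * (lo⁻¹ * ∑ T, ∫ x in M.elem T, matForm (A x) (G T x) (G T x))) +
      6 * (∑ T, ∫ x in M.elem T, matForm (A x) (G T x) (G T x)) +
      (3 + 12 * K) * Cp / lo *
        (∑ E, (M.hFacet E)⁻¹ * M.facetIntegral E (fun y => M.jump t E y ^ 2)) +
      6 * ∑ E, (M.hFacet E)⁻¹ * M.facetIntegral E (fun y => M.jump t E y ^ 2) := by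
    rw [div_eq_mul_inv]; ring
  rw [h14]
  linarith

/-! ### The dual norm -/

theorem dualNorm_le {f : ι → Space (n + 1) → ℝ} {B : ℝ} (hB : 0 ≤ B)
    (h : ∀ w G t, M.IsBrokenH1 w G t → M.ip f (fun _ => w) ≤ B * M.dgNorm A G t) :
    M.dualNorm A f ≤ ENNReal.ofReal B :=
  iSup_le fun w => iSup_le fun G => iSup_le fun t => iSup_le fun hw =>
    ENNReal.ofReal_le_ofReal (div_le_of_le_mul₀ (Real.sqrt_nonneg _) hB (h w G t hw))

/-- Positivity of the DG norm matters: a quotient with denominator zero counts as zero and carries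
no information about the pairing. -/
theorem ip_le_dualNorm {f : ι → Space (n + 1) → ℝ} (hf : M.dualNorm A f ≠ ⊤)
    {w : Space (n + 1) → ℝ} {G : ι → Space (n + 1) → Space (n + 1)} {t : ι → κ → Space n → ℝ}
    (hw : M.IsBrokenH1 w G t) (h0 : 0 < M.dgNorm A G t) :
    M.ip f (fun _ => w) ≤ (M.dualNorm A f).toReal * M.dgNorm A G t := by
  rw [← div_le_iff₀ h0]
  refine (ENNReal.ofReal_le_iff_le_toReal hf).1 ?_
  exact le_iSup_of_le w (le_iSup_of_le G (le_iSup_of_le t (le_iSup_of_le hw le_rfl)))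

theorem ip_glue (f b : ι → Space (n + 1) → ℝ) : M.ip f (fun _ => M.glue b) = M.ip f b :=
  Finset.sum_congr rfl fun T _ => integral_congr_ae <| by
    filter_upwards [M.glue_ae b T] with x hx
    rw [hx]

/-- The squared DG norm of a broken smooth function. -/
def smoothDg (M : Mesh s n Ω ι κ) (A : Space (n + 1) → Matrix (Fin (n + 1)) (Fin (n + 1)) ℝ)
    (b : ι → Space (n + 1) → ℝ) : ℝ :=
  M.dgSq A (fun T => gradient (b T)) (fun T E y => b T (M.Ψ E y))

theorem UniformTensor.setIntegral_nonneg (hA : UniformTensor Ω lo hi A)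
    (hΩ : IsPolyhedralDomain Ω) (T : ι) (G : Space (n + 1) → Space (n + 1)) :
    0 ≤ ∫ x in M.elem T, matForm (A x) (G x) (G x) := by
  refine integral_nonneg_of_ae ?_
  filter_upwards [M.ae_elem hΩ T hA.bounds] with x hx
  exact hx.nonneg hA.lo_pos _

theorem IsScaled.dgSq_nonneg (hM : M.IsScaled K) (hA : UniformTensor Ω lo hi A)
    (hΩ : IsPolyhedralDomain Ω) (G : ι → Space (n + 1) → Space (n + 1))
    (t : ι → κ → Space n → ℝ) : 0 ≤ M.dgSq A G t :=
  add_nonneg (Finset.sum_nonneg fun T _ => hA.setIntegral_nonneg hΩ T _)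
    (Finset.sum_nonneg fun E _ => mul_nonneg (inv_nonneg.2 (hM.hFacet_pos' E).le)
      (facetIntegral_nonneg E fun _ => sq_nonneg _))

theorem gradient_add_smul {d : ℕ} {a b : Space d → ℝ} (ha : ContDiff ℝ ∞ a)
    (hb : ContDiff ℝ ∞ b) (c : ℝ) (x : Space d) :
    gradient (fun x => a x + c * b x) x = gradient a x + c • gradient b x := by
  have h1 := (ha.differentiable (by simp)).differentiableAt (x := x)
  have h2 := (hb.differentiable (by simp)).differentiableAt (x := x)
  refine ext_inner_right ℝ fun z => ?_
  rw [inner_gradient, inner_add_left, inner_smul_left, inner_gradient, inner_gradient,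
    fderiv_fun_add h1 (h2.const_mul c), fderiv_const_mul h2]
  simp

theorem IsScaled.smoothDg_add_le (hM : M.IsScaled K) (hA : UniformTensor Ω lo hi A)
    (hΩ : IsPolyhedralDomain Ω) {a b : ι → Space (n + 1) → ℝ} (ha : ∀ T, ContDiff ℝ ∞ (a T))
    (hb : ∀ T, ContDiff ℝ ∞ (b T)) (c : ℝ) :
    M.smoothDg A (fun T x => a T x + c * b T x) ≤
      2 * (M.smoothDg A a + c ^ 2 * M.smoothDg A b) := by
  have hga : ∀ T, MemLp (gradient (a T)) 2 (volume.restrict (M.elem T)) := fun T =>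
    memLp_elem_of_continuous T (continuous_gradient (ha T))
  have hgb : ∀ T, MemLp (gradient (b T)) 2 (volume.restrict (M.elem T)) := fun T =>
    memLp_elem_of_continuous T (continuous_gradient (hb T))
  have hj : ∀ {a : ι → Space (n + 1) → ℝ}, (∀ T, ContDiff ℝ ∞ (a T)) → ∀ E,
      MemLp (M.jump (fun T E y => a T (M.Ψ E y)) E) 2 (volume.restrict (refElem s n)) := by
    intro a ha E
    have hc : ∀ T, Continuous fun y => a T (M.Ψ E y) := fun T =>
      (ha T).continuous.comp (M.Ψ E).continuous_of_finiteDimensional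
    refine memLp_ref ?_
    unfold jump
    split_ifs
    · exact hc _
    · exact (hc _).sub (hc _)
  have h1 : ∀ T, ∫ x in M.elem T, matForm (A x) (gradient (fun x => a T x + c * b T x) x)
      (gradient (fun x => a T x + c * b T x) x) ≤
      2 * ((∫ x in M.elem T, matForm (A x) (gradient (a T) x) (gradient (a T) x)) +
        c ^ 2 * ∫ x in M.elem T, matForm (A x) (gradient (b T) x) (gradient (b T) x)) := fun T => by
    have i1 := hA.integrable_matForm hΩ T (hga T) (hga T)
    have i2 := hA.integrable_matForm hΩ T (hgb T) (hgb T)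
    rw [← integral_const_mul, ← integral_add i1 (i2.const_mul _), ← integral_const_mul]
    have hs : MemLp (gradient fun x => a T x + c * b T x) 2 (volume.restrict (M.elem T)) :=
      memLp_elem_of_continuous T (continuous_gradient ((ha T).add (contDiff_const.mul (hb T))))
    refine integral_mono_ae (hA.integrable_matForm hΩ T hs hs)
      ((i1.add (i2.const_mul _)).const_mul 2) ?_
    filter_upwards [M.ae_elem hΩ T hA.bounds] with x hx
    -- Parallelogram argument: the form at `∇a + c ∇b` plus the form at `∇a - c ∇b` is twice the sum
    -- of the two forms, and the second term is nonnegative.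
    have h0 := hx.nonneg hA.lo_pos (gradient (a T) x + (-c) • gradient (b T) x)
    simp only [gradient_add_smul (ha T) (hb T)]
    simp only [matForm_eq_inner, mulE_add, mulE_smul, inner_add_left, inner_add_right,
      inner_smul_left, inner_smul_right, conj_trivial] at h0 ⊢
    linarith
  have h2 : ∀ E, M.facetIntegral E
      (fun y => M.jump (fun T E y => a T (M.Ψ E y) + c * b T (M.Ψ E y)) E y ^ 2) ≤
      2 * (M.facetIntegral E (fun y => M.jump (fun T E y => a T (M.Ψ E y)) E y ^ 2) +
        c ^ 2 * M.facetIntegral E (fun y => M.jump (fun T E y => b T (M.Ψ E y)) E y ^ 2)) := by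
    intro E
    have e : ∀ y, M.jump (fun T E y => a T (M.Ψ E y) + c * b T (M.Ψ E y)) E y =
        M.jump (fun T E y => a T (M.Ψ E y)) E y -
          (-c) * M.jump (fun T E y => b T (M.Ψ E y)) E y := fun y => by
      unfold jump; split_ifs <;> ring
    simp_rw [e]
    refine (facetIntegral_sq_sub_le E (hj ha E) ((hj hb E).const_mul _)).trans (le_of_eq ?_)
    rw [← facetIntegral_const_mul]
    congr 3
    funext y
    ring
  unfold smoothDg dgSq
  have h3 := Finset.sum_le_sum fun T (_ : T ∈ Finset.univ) => h1 T
  have h4 := Finset.sum_le_sum fun E (_ : E ∈ Finset.univ) =>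
    mul_le_mul_of_nonneg_left (h2 E) (inv_nonneg.2 (hM.hFacet_pos' E).le)
  refine (add_le_add h3 h4).trans (le_of_eq ?_)
  simp only [mul_add, Finset.mul_sum, Finset.sum_add_distrib]
  have e1 : ∀ E, (M.hFacet E)⁻¹ * (2 * (c ^ 2 *
      M.facetIntegral E (fun y => M.jump (fun T E y => b T (M.Ψ E y)) E y ^ 2))) =
      2 * (c ^ 2 * ((M.hFacet E)⁻¹ *
        M.facetIntegral E (fun y => M.jump (fun T E y => b T (M.Ψ E y)) E y ^ 2))) :=
    fun E => by ring
  have e2 : ∀ E, (M.hFacet E)⁻¹ * (2 *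
      M.facetIntegral E (fun y => M.jump (fun T E y => a T (M.Ψ E y)) E y ^ 2)) =
      2 * ((M.hFacet E)⁻¹ *
        M.facetIntegral E (fun y => M.jump (fun T E y => a T (M.Ψ E y)) E y ^ 2)) :=
    fun E => by ring
  simp only [e1, e2]
  ring

end Mesh

namespace Mesh

variable {s : Shape} {n : ℕ} {Ω : Set (Space (n + 1))} {ι κ : Type} [Fintype ι] [Fintype κ]
  {M : Mesh s n Ω ι κ} {K lo hi : ℝ} {A : Space (n + 1) → Matrix (Fin (n + 1)) (Fin (n + 1)) ℝ}

theorem nonempty_index (M : Mesh s n Ω ι κ) (hΩ : IsPolyhedralDomain Ω) : Nonempty ι := by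
  obtain ⟨x, hx⟩ := hΩ.isConnected.nonempty
  have h := subset_closure hx
  rw [← M.cover, mem_iUnion] at h
  exact h.nonempty

/-- The first coordinate on every element. -/
def coordFn (n : ℕ) (ι : Type) (_ : ι) (x : Space (n + 1)) : ℝ := x 0

theorem contDiff_coordFn (T : ι) : ContDiff ℝ ∞ (coordFn n ι T) :=
  (EuclideanSpace.proj (𝕜 := ℝ) (0 : Fin (n + 1))).contDiff

/-- A coordinate function has a gradient of length at least one. It is the perturbation used in
`ip_smooth_le` to leave the null set of the DG norm. -/
theorem IsScaled.smoothDg_coordFn_pos (hM : M.IsScaled K) (hA : UniformTensor Ω lo hi A)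
    (hΩ : IsPolyhedralDomain Ω) : 0 < M.smoothDg A (coordFn n ι) := by
  obtain ⟨T₀⟩ := M.nonempty_index hΩ
  have hg : ∀ T x, 1 ≤ ‖gradient (coordFn n ι T) x‖ ^ 2 := fun T x => by
    have h1 : gradient (coordFn n ι T) x 0 = 1 := by
      rw [gradient_apply]
      have : coordFn n ι T = EuclideanSpace.proj (𝕜 := ℝ) (0 : Fin (n + 1)) := rfl
      rw [this, ContinuousLinearMap.fderiv]
      simp
    have h2 := PiLp.norm_apply_le (gradient (coordFn n ι T) x) 0
    rw [h1, norm_one] at h2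
    nlinarith
  have hm : ∀ T, MemLp (gradient (coordFn n ι T)) 2 (volume.restrict (M.elem T)) := fun T =>
    memLp_elem_of_continuous T (continuous_gradient (contDiff_coordFn T))
  have hv : 0 < ∫ _ in M.elem T₀, (1 : ℝ) := by
    rw [setIntegral_elem]
    refine mul_pos (volChange_pos _) ?_
    rw [setIntegral_const]
    simp only [smul_eq_mul, mul_one]
    exact ENNReal.toReal_pos (Measure.measure_pos_of_nonempty_interior _ (interior_refElem_nonempty s _)).ne'
      (isCompact_refElem s _).measure_lt_top.ne
  have h3 : ∫ _ in M.elem T₀, (1 : ℝ) ≤ ∫ x in M.elem T₀, ‖gradient (coordFn n ι T₀) x‖ ^ 2 :=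
    integral_mono (integrable_const_iff.2 (Or.inr ⟨by
      simpa using (M.isCompact_elem T₀).measure_lt_top⟩))
      ((memLp_two_iff_integrable_sq_norm (hm T₀).1).1 (hm T₀)) (hg T₀)
  refine add_pos_of_pos_of_nonneg ?_ (Finset.sum_nonneg fun E _ =>
    mul_nonneg (inv_nonneg.2 (hM.hFacet_pos' E).le) (facetIntegral_nonneg E fun _ => sq_nonneg _))
  refine lt_of_lt_of_le (mul_pos hA.lo_pos (hv.trans_le h3)) ((hA.le_setIntegral hΩ T₀ (hm T₀)).trans ?_)
  exact Finset.single_le_sum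
    (f := fun T => ∫ x in M.elem T, matForm (A x) (gradient (coordFn n ι T) x)
      (gradient (coordFn n ι T) x))
    (fun T _ => hA.setIntegral_nonneg hΩ T _) (Finset.mem_univ T₀)

theorem ip_add_smul (hΩ : IsPolyhedralDomain Ω) {f : Space (n + 1) → ℝ}
    (hf : MemLp f 2 (volume.restrict Ω)) {a b : ι → Space (n + 1) → ℝ}
    (ha : ∀ T, Continuous (a T)) (hb : ∀ T, Continuous (b T)) (c : ℝ) :
    M.ip (fun _ => f) (fun T x => a T x + c * b T x) =
      M.ip (fun _ => f) a + c * M.ip (fun _ => f) b := by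
  unfold ip
  rw [Finset.mul_sum, ← Finset.sum_add_distrib]
  refine Finset.sum_congr rfl fun T _ => ?_
  have i1 : Integrable (fun x => f x * a T x) (volume.restrict (M.elem T)) :=
    (M.memLp_elem hΩ T hf).integrable_mul (memLp_elem_of_continuous T (ha T))
  have i2 : Integrable (fun x => f x * b T x) (volume.restrict (M.elem T)) :=
    (M.memLp_elem hΩ T hf).integrable_mul (memLp_elem_of_continuous T (hb T))
  rw [← integral_const_mul, ← integral_add i1 (i2.const_mul c)]
  congr 1
  funext x
  ring

/-- The dual norm bounds the pairing with every broken smooth function, also if its DG norm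
vanishes. -/
theorem IsScaled.ip_smooth_le (hM : M.IsScaled K) (hA : UniformTensor Ω lo hi A)
    (hΩ : IsPolyhedralDomain Ω) {f : Space (n + 1) → ℝ} (hf : MemLp f 2 (volume.restrict Ω))
    (hd : M.dualNorm A (fun _ => f) ≠ ⊤) {b : ι → Space (n + 1) → ℝ}
    (hb : ∀ T, ContDiff ℝ ∞ (b T)) :
    M.ip (fun _ => f) b ≤ (M.dualNorm A (fun _ => f)).toReal * √(M.smoothDg A b) := by
  set N := (M.dualNorm A (fun _ => f)).toReal with hN
  have key : ∀ b : ι → Space (n + 1) → ℝ, (∀ T, ContDiff ℝ ∞ (b T)) → 0 < M.smoothDg A b →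
      M.ip (fun _ => f) b ≤ N * √(M.smoothDg A b) := fun b hb h0 => by
    have := ip_le_dualNorm hd (M.isBrokenH1_glue hΩ hb) (Real.sqrt_pos.2 h0)
    rwa [ip_glue] at this
  rcases (hM.dgSq_nonneg hA hΩ (fun T => gradient (b T)) fun T E y => b T (M.Ψ E y)).eq_or_lt
    with h0 | h0
  swap
  · exact key b hb h0
  change 0 = M.smoothDg A b at h0
  rw [← h0, Real.sqrt_zero, mul_zero]
  set a := coordFn n ι
  have ha := contDiff_coordFn (n := n) (ι := ι)
  have ha0 : 0 < M.smoothDg A a := hM.smoothDg_coordFn_pos hA hΩ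
  -- If `b` has DG norm zero, then `b + ε a` has positive DG norm of order `ε`. The regular case for
  -- `b + ε a` bounds the pairing with `b` by `ε D`, and `ε → 0` concludes.
  set D := N * √(2 * M.smoothDg A a) - M.ip (fun _ => f) a
  have hε : ∀ ε : ℝ, 0 < ε → M.ip (fun _ => f) b ≤ ε * D := fun ε hε => by
    have hs : ∀ T, ContDiff ℝ ∞ fun x => b T x + ε * a T x := fun T =>
      (hb T).add (contDiff_const.mul (ha T))
    have h1 := hM.smoothDg_add_le hA hΩ hb ha ε
    have h2 := hM.smoothDg_add_le hA hΩ (a := fun T x => b T x + ε * a T x) hs hb (-1)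
    have h3 := hM.smoothDg_add_le hA hΩ (a := fun _ _ => (0 : ℝ))
      (fun _ => contDiff_const) (b := fun T x => ε * a T x) (fun T => contDiff_const.mul (ha T)) ε⁻¹
    have hz : M.smoothDg A (fun _ _ => (0 : ℝ)) = 0 := by
      unfold smoothDg dgSq
      have : gradient (fun _ : Space (n + 1) => (0 : ℝ)) = 0 := by
        funext x; simp [gradient]
      simp [this, matForm, facetIntegral, jump]
    have e2 : (fun (T : ι) x => b T x + ε * a T x + -1 * b T x) = fun T x => ε * a T x := by
      funext T x; ring
    have e3 : (fun (T : ι) x => (0 : ℝ) + ε⁻¹ * (ε * a T x)) = a := by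
      funext T x; field_simp; ring
    rw [e2, ← h0] at h2
    rw [e3, hz] at h3
    rw [← h0] at h1
    -- Otherwise `ε a = (b + ε a) - b`, and with it `a`, would have DG norm zero.
    have hp : 0 < M.smoothDg A fun T x => b T x + ε * a T x := by
      by_contra h
      have : M.smoothDg A a ≤ 2 * ((ε⁻¹) ^ 2 * 0) := h3.trans (by
        have : 0 ≤ (ε⁻¹) ^ 2 := by positivity
        nlinarith)
      linarith
    have h4 := key _ hs hp
    rw [ip_add_smul hΩ hf (fun T => (hb T).continuous) (fun T => (ha T).continuous)] at h4
    have h5 : √(M.smoothDg A fun T x => b T x + ε * a T x) ≤ ε * √(2 * M.smoothDg A a) := by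
      rw [Real.sqrt_le_left (by positivity), mul_pow, Real.sq_sqrt (by positivity)]
      linarith
    have h6 := mul_le_mul_of_nonneg_left h5 (ENNReal.toReal_nonneg : 0 ≤ N)
    simp only [D]
    linarith
  have hl : Tendsto (fun ε : ℝ => ε * D) (𝓝[>] 0) (𝓝 (0 * D)) :=
    ((continuous_id.mul continuous_const).tendsto 0).mono_left nhdsWithin_le_nhds
  rw [zero_mul] at hl
  exact ge_of_tendsto hl (by filter_upwards [self_mem_nhdsWithin] with ε h using hε ε h)

end Mesh

/-! ### Finite dimension, discrete projection and linear structure of the discrete spaces -/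

theorem finiteDimensional_pi {I : Type*} [Finite I] {V : I → Type*} [∀ i, AddCommGroup (V i)]
    [∀ i, Module ℝ (V i)] (W : ∀ i, Submodule ℝ (V i)) [∀ i, FiniteDimensional ℝ (W i)] :
    FiniteDimensional ℝ (Submodule.pi univ W) := by
  let f : Submodule.pi univ W →ₗ[ℝ] ∀ i, W i :=
    LinearMap.pi fun i => ((LinearMap.proj i).comp (Submodule.subtype _)).codRestrict (W i)
      fun x => x.2 i trivial
  refine FiniteDimensional.of_injective f fun a b h => ?_
  ext1
  funext i
  exact congrArg (fun z => (z i : V i)) h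

/-- The functional of a square-integrable function has a representative among the polynomials. -/
theorem exists_refInt_representative (s : Shape) (d p : ℕ)
    (l : MvPolynomial (Fin d) ℝ →ₗ[ℝ] ℝ) :
    ∃ q ∈ polySpace s d p, ∀ z ∈ polySpace s d p, refInt s d (q * z) = l z := by
  let b : polySpace s d p →ₗ[ℝ] Module.Dual ℝ (polySpace s d p) :=
    ((LinearMap.mul ℝ (MvPolynomial (Fin d) ℝ)).compr₂ (refInt s d)).compl₁₂
      (Submodule.subtype _) (Submodule.subtype _)
  have hb : ∀ q z, b q z = refInt s d (q.1 * z.1) := fun q z => rfl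
  -- The Gram form of the polynomial space is definite, so in finite dimension it represents every
  -- functional.
  have hinj : Function.Injective b := by
    rw [← LinearMap.ker_eq_bot, LinearMap.ker_eq_bot']
    intro q hq
    have h1 : refInt s d (q.1 * q.1) = 0 := by rw [← hb, hq]; rfl
    ext1
    refine eq_zero_of_integral_pe_sq q.1 (isCompact_refElem s d) (interior_refElem_nonempty s d) ?_
    rw [← h1, refInt_apply]
    congr 1
    funext x
    rw [pe_mul, sq]
  have hsur := (LinearMap.injective_iff_surjective_of_finrank_eq_finrank
    (Subspace.dual_finrank_eq (K := ℝ) (V := polySpace s d p)).symm).1 hinj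
  obtain ⟨q, hq⟩ := hsur (l.comp (Submodule.subtype _))
  exact ⟨q.1, q.2, fun z hz => by rw [← hb q ⟨z, hz⟩, hq]; rfl⟩

namespace Mesh

variable {s : Shape} {n : ℕ} {Ω : Set (Space (n + 1))} {ι κ : Type}
  {M : Mesh s n Ω ι κ} {K lo hi : ℝ} {A : Space (n + 1) → Matrix (Fin (n + 1)) (Fin (n + 1)) ℝ}

theorem continuous_fn (v : ι → MvPolynomial (Fin (n + 1)) ℝ) (T : ι) : Continuous (M.fn v T) :=
  (M.contDiff_fn v T).continuous

theorem memLp_fn (v : ι → MvPolynomial (Fin (n + 1)) ℝ) (T : ι) :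
    MemLp (M.fn v T) 2 (volume.restrict (M.elem T)) := memLp_elem_of_continuous T (continuous_fn v T)

theorem memLp_field (r : ι → Fin (n + 1) → MvPolynomial (Fin (n + 1)) ℝ) (T : ι) :
    MemLp (M.field r T) 2 (volume.restrict (M.elem T)) :=
  memLp_elem_of_continuous T (M.continuous_field r T)

theorem fn_add (v w : ι → MvPolynomial (Fin (n + 1)) ℝ) (T : ι) (x : Space (n + 1)) :
    M.fn (v + w) T x = M.fn v T x + M.fn w T x := by simp [fn]

theorem fn_smul (c : ℝ) (v : ι → MvPolynomial (Fin (n + 1)) ℝ) (T : ι) (x : Space (n + 1)) :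
    M.fn (c • v) T x = c * M.fn v T x := by simp [fn]

theorem fn_zero (T : ι) (x : Space (n + 1)) :
    M.fn (0 : ι → MvPolynomial (Fin (n + 1)) ℝ) T x = 0 := by simp [fn]

theorem field_congr {r r' : ι → Fin (n + 1) → MvPolynomial (Fin (n + 1)) ℝ} {T : ι}
    (h : r T = r' T) : M.field r T = M.field r' T := by
  funext x; simp [field, h]

theorem field_add (r r' : ι → Fin (n + 1) → MvPolynomial (Fin (n + 1)) ℝ) (T : ι)
    (x : Space (n + 1)) : M.field (r + r') T x = M.field r T x + M.field r' T x := by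
  simp only [field]
  rw [← smul_add, ← map_add]
  congr 2
  ext i
  simp

theorem field_smul (c : ℝ) (r : ι → Fin (n + 1) → MvPolynomial (Fin (n + 1)) ℝ) (T : ι)
    (x : Space (n + 1)) : M.field (c • r) T x = c • M.field r T x := by
  simp only [field]
  rw [smul_comm c, ← map_smul _ c]
  congr 2
  ext i
  exact MvPolynomial.smul_eval (fun j => (M.Φ T).symm x j) (r T i) c

theorem field_zero (T : ι) (x : Space (n + 1)) :
    M.field (0 : ι → Fin (n + 1) → MvPolynomial (Fin (n + 1)) ℝ) T x = 0 := by
  simpa using field_smul (M := M) 0 0 T x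

theorem eq_zero_of_integral_fn_sq {v : ι → MvPolynomial (Fin (n + 1)) ℝ} {T : ι}
    (h : ∫ x in M.elem T, M.fn v T x ^ 2 = 0) : v T = 0 := by
  rw [setIntegral_elem] at h
  simp_rw [fn_Φ] at h
  exact eq_zero_of_integral_pe_sq _ (isCompact_refElem s _) (interior_refElem_nonempty s _)
    ((mul_eq_zero.1 h).resolve_left (volChange_pos _).ne')

/-- The `L²` projection of a function to the polynomials on every element. -/
theorem exists_projection (p : ℕ) {w : Space (n + 1) → ℝ}
    (hw : ∀ T, MemLp w 2 (volume.restrict (M.elem T))) :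
    ∃ v : ι → MvPolynomial (Fin (n + 1)) ℝ, (∀ T, v T ∈ polySpace s (n + 1) p) ∧
      ∀ T, ∀ z : ι → MvPolynomial (Fin (n + 1)) ℝ, z T ∈ polySpace s (n + 1) p →
        ∫ x in M.elem T, (M.fn v T x - w x) * M.fn z T x = 0 := by
  have hi : ∀ T (z : ι → MvPolynomial (Fin (n + 1)) ℝ),
      Integrable (fun x => w x * M.fn z T x) (volume.restrict (M.elem T)) :=
    fun T z => (hw T).integrable_mul (memLp_fn z T)
  have h : ∀ T, ∃ q ∈ polySpace s (n + 1) p, ∀ z ∈ polySpace s (n + 1) p,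
      refInt s (n + 1) (q * z) = (volChange (M.Φ T))⁻¹ *
        ∫ x in M.elem T, w x * M.fn (fun _ => z) T x := fun T =>
    exists_refInt_representative s (n + 1) p
      { toFun := fun z => (volChange (M.Φ T))⁻¹ * ∫ x in M.elem T, w x * M.fn (fun _ => z) T x
        map_add' := fun z z' => by
          rw [← mul_add, ← integral_add (hi _ _) (hi _ _)]
          congr 2
          funext x
          rw [← mul_add, ← fn_add]; rfl
        map_smul' := fun c z => by
          rw [RingHom.id_apply, smul_eq_mul, mul_left_comm, ← integral_const_mul c]
          congr 2
          funext x
          rw [mul_left_comm c]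
          exact congrArg (w x * ·) (fn_smul c (fun _ => z) T x) }
  choose v hv hv' using h
  refine ⟨v, hv, fun T z hz => ?_⟩
  have h1 := hv' T (z T) hz
  rw [eq_inv_mul_iff_mul_eq₀ (volChange_pos _).ne', refInt_apply] at h1
  have h2 : ∫ x in M.elem T, M.fn v T x * M.fn z T x = ∫ x in M.elem T, w x * M.fn z T x := by
    rw [setIntegral_elem]
    simp_rw [fn_Φ, ← pe_mul]
    exact h1
  simp_rw [sub_mul]
  have h3 : Integrable (fun x => M.fn v T x * M.fn z T x) (volume.restrict (M.elem T)) :=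
    (memLp_fn v T).integrable_mul (memLp_fn z T)
  rw [integral_sub h3 (hi T z), h2, sub_self]

/-! ### The bilinear forms -/

theorem traceAt_add (μ μ' : κ → MvPolynomial (Fin n) ℝ) (T : ι) :
    M.traceAt (μ + μ') T = M.traceAt μ T + M.traceAt μ' T := by
  funext F; simp [traceAt]

theorem traceAt_smul (c : ℝ) (μ : κ → MvPolynomial (Fin n) ℝ) (T : ι) :
    M.traceAt (c • μ) T = c • M.traceAt μ T := by
  funext F; simp [traceAt]

variable [Fintype ι] [Fintype κ]

/-- `ℬ_h` as a bilinear map. -/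
def formBL (M : Mesh s n Ω ι κ) : (ι → Fin (n + 1) → MvPolynomial (Fin (n + 1)) ℝ) →ₗ[ℝ]
    ((ι → MvPolynomial (Fin (n + 1)) ℝ) × (κ → MvPolynomial (Fin n) ℝ)) →ₗ[ℝ] ℝ :=
  ∑ T, M.orientation T • (bRefL s n).compl₁₂ (LinearMap.proj T)
    { toFun := fun x => (x.1 T, M.traceAt x.2 T)
      map_add' := fun x y => by simp [traceAt_add]
      map_smul' := fun c x => by simp [traceAt_smul] }

theorem formBL_apply (r : ι → Fin (n + 1) → MvPolynomial (Fin (n + 1)) ℝ)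
    (v : ι → MvPolynomial (Fin (n + 1)) ℝ) (μ : κ → MvPolynomial (Fin n) ℝ) :
    M.formBL r (v, μ) = M.formB r v μ := by
  rw [formB_eq, formBL]
  simp [LinearMap.sum_apply, bRefL_apply]

theorem integrable_mass (hΩ : IsPolyhedralDomain Ω) {m : Space (n + 1) → ℝ}
    (hm : MemLp m ∞ (volume.restrict Ω)) (T : ι) {f g : Space (n + 1) → ℝ}
    (hf : MemLp f 2 (volume.restrict (M.elem T))) (hg : MemLp g 2 (volume.restrict (M.elem T))) :
    Integrable (fun x => m x * f x * g x) (volume.restrict (M.elem T)) :=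
  (hf.mul (p := ∞) (q := 2) (r := 2) (M.memLp_elem hΩ T hm)).integrable_mul hg

/-- The weighted mass form `(m v, w)` on broken polynomials. -/
def massL (M : Mesh s n Ω ι κ) (hΩ : IsPolyhedralDomain Ω) {m : Space (n + 1) → ℝ}
    (hm : MemLp m ∞ (volume.restrict Ω)) : (ι → MvPolynomial (Fin (n + 1)) ℝ) →ₗ[ℝ]
      (ι → MvPolynomial (Fin (n + 1)) ℝ) →ₗ[ℝ] ℝ :=
  have hi : ∀ T v w, Integrable (fun x => m x * M.fn v T x * M.fn w T x)
    (volume.restrict (M.elem T)) := fun T v w => integrable_mass hΩ hm T (memLp_fn v T) (memLp_fn w T)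
  LinearMap.mk₂ ℝ (fun v w => ∑ T, ∫ x in M.elem T, m x * M.fn v T x * M.fn w T x)
    (fun v v' w => by
      rw [← Finset.sum_add_distrib]
      refine Finset.sum_congr rfl fun T _ => ?_
      rw [← integral_add (hi T v w) (hi T v' w)]
      congr 1; funext x; rw [fn_add]; ring)
    (fun c v w => by
      rw [smul_eq_mul, Finset.mul_sum]
      refine Finset.sum_congr rfl fun T _ => ?_
      rw [← integral_const_mul]
      congr 1; funext x; rw [fn_smul]; ring)
    (fun v w w' => by
      rw [← Finset.sum_add_distrib]
      refine Finset.sum_congr rfl fun T _ => ?_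
      rw [← integral_add (hi T v w) (hi T v w')]
      congr 1; funext x; rw [fn_add]; ring)
    (fun c v w => by
      rw [smul_eq_mul, Finset.mul_sum]
      refine Finset.sum_congr rfl fun T _ => ?_
      rw [← integral_const_mul]
      congr 1; funext x; rw [fn_smul]; ring)

theorem memLp_inv_field (hΩ : IsPolyhedralDomain Ω) (hA : UniformTensor Ω lo hi A) (T : ι)
    (q : ι → Fin (n + 1) → MvPolynomial (Fin (n + 1)) ℝ) :
    MemLp (fun x => mulE (A x)⁻¹ (M.field q T x)) 2 (volume.restrict (M.elem T)) := by
  refine memLp_mulE (aestronglyMeasurable_inv fun i j =>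
    (hA.measurable i j).mono_measure (M.restrict_elem_le hΩ T)) (c := lo⁻¹) ?_ (memLp_field q T)
  filter_upwards [M.ae_elem hΩ T hA.bounds] with x hx ξ
  exact hx.norm_inv_le hA.lo_pos ξ

theorem integrable_inv_form (hΩ : IsPolyhedralDomain Ω) (hA : UniformTensor Ω lo hi A) (T : ι)
    (r q : ι → Fin (n + 1) → MvPolynomial (Fin (n + 1)) ℝ) :
    Integrable (fun x => matForm (A x)⁻¹ (M.field r T x) (M.field q T x))
      (volume.restrict (M.elem T)) := by
  simp_rw [matForm_eq_inner]
  exact integrable_inner_of_memLp (memLp_field r T) (memLp_inv_field hΩ hA T q)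

/-- The form `(A⁻¹ q, r)` as a bilinear map. -/
def fluxL (M : Mesh s n Ω ι κ) (hΩ : IsPolyhedralDomain Ω) (hA : UniformTensor Ω lo hi A) :
    (ι → Fin (n + 1) → MvPolynomial (Fin (n + 1)) ℝ) →ₗ[ℝ]
      (ι → Fin (n + 1) → MvPolynomial (Fin (n + 1)) ℝ) →ₗ[ℝ] ℝ :=
  have hi := fun T r q => integrable_inv_form (M := M) hΩ hA T r q
  LinearMap.mk₂ ℝ
    (fun r q => ∑ T, ∫ x in M.elem T, matForm (A x)⁻¹ (M.field r T x) (M.field q T x))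
    (fun v v' w => by
      rw [← Finset.sum_add_distrib]
      refine Finset.sum_congr rfl fun T _ => ?_
      rw [← integral_add (hi T v w) (hi T v' w)]
      congr 1; funext x; simp only [field_add, matForm_eq_inner, inner_add_left])
    (fun c v w => by
      rw [smul_eq_mul, Finset.mul_sum]
      refine Finset.sum_congr rfl fun T _ => ?_
      rw [← integral_const_mul]
      congr 1; funext x
      simp only [field_smul, matForm_eq_inner, inner_smul_left, conj_trivial])
    (fun v w w' => by
      rw [← Finset.sum_add_distrib]
      refine Finset.sum_congr rfl fun T _ => ?_
      rw [← integral_add (hi T v w) (hi T v w')]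
      congr 1; funext x; simp only [field_add, matForm_eq_inner, mulE_add, inner_add_right])
    (fun c v w => by
      rw [smul_eq_mul, Finset.mul_sum]
      refine Finset.sum_congr rfl fun T _ => ?_
      rw [← integral_const_mul]
      congr 1; funext x
      simp only [field_smul, matForm_eq_inner, mulE_smul, inner_smul_right])

end Mesh

/-! ### Consequences of the discrete equations -/

namespace Mesh

variable {s : Shape} {n : ℕ} {Ω : Set (Space (n + 1))} {ι κ : Type} [Fintype ι] [Fintype κ]
  {M : Mesh s n Ω ι κ} {K lo hi : ℝ} {A : Space (n + 1) → Matrix (Fin (n + 1)) (Fin (n + 1)) ℝ}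
  {rt : RTForm} {p : ℕ} {α : ℝ} {m f g : Space (n + 1) → ℝ} {X : M.Unknowns rt p}

theorem ip_fn_zero (w : ι → Space (n + 1) → ℝ) :
    M.ip w (M.fn (0 : ι → MvPolynomial (Fin (n + 1)) ℝ)) = 0 := by simp [ip, fn_zero]

theorem ip_comm (v w : ι → Space (n + 1) → ℝ) : M.ip v w = M.ip w v := by
  simp only [ip, mul_comm]

theorem formB_zero_left (v : ι → MvPolynomial (Fin (n + 1)) ℝ) (μ : κ → MvPolynomial (Fin n) ℝ) :
    M.formB 0 v μ = 0 := by rw [← formBL_apply, map_zero, LinearMap.zero_apply]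

theorem formB_zero_right (r : ι → Fin (n + 1) → MvPolynomial (Fin (n + 1)) ℝ) :
    M.formB r 0 0 = 0 := by rw [← formBL_apply]; exact map_zero _

theorem bRef_zero_left (u : MvPolynomial (Fin (n + 1)) ℝ) (μ : FIdx s n → MvPolynomial (Fin n) ℝ) :
    bRef (s := s) 0 u μ = 0 := by
  rw [← bRefL_apply s n 0 (u, μ), map_zero, LinearMap.zero_apply]

/-- The squared norm `‖A^{-1/2} q‖²` on the element `T`. -/
def fluxAt (M : Mesh s n Ω ι κ) (A : Space (n + 1) → Matrix (Fin (n + 1)) (Fin (n + 1)) ℝ)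
    (q : ι → Fin (n + 1) → MvPolynomial (Fin (n + 1)) ℝ) (T : ι) : ℝ :=
  ∫ x in M.elem T, matForm (A x)⁻¹ (M.field q T x) (M.field q T x)

theorem fluxAt_nonneg (hΩ : IsPolyhedralDomain Ω) (hA : UniformTensor Ω lo hi A)
    (q : ι → Fin (n + 1) → MvPolynomial (Fin (n + 1)) ℝ) (T : ι) : 0 ≤ M.fluxAt A q T := by
  refine integral_nonneg_of_ae ?_
  filter_upwards [M.ae_elem hΩ T hA.bounds] with x hx
  exact hx.inv_nonneg hA.lo_pos _

theorem integral_field_sq_le (hΩ : IsPolyhedralDomain Ω) (hA : UniformTensor Ω lo hi A)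
    (q : ι → Fin (n + 1) → MvPolynomial (Fin (n + 1)) ℝ) (T : ι) :
    ∫ x in M.elem T, ‖M.field q T x‖ ^ 2 ≤ hi * M.fluxAt A q T := by
  rw [fluxAt, ← integral_const_mul]
  refine integral_mono_ae ((memLp_two_iff_integrable_sq_norm (memLp_field q T).1).1 (memLp_field q T))
    ((integrable_inv_form hΩ hA T q q).const_mul hi) ?_
  filter_upwards [M.ae_elem hΩ T hA.bounds] with x hx
  exact hx.norm_sq_le hA.lo_pos _

theorem integral_inv_field_sq_le (hΩ : IsPolyhedralDomain Ω) (hA : UniformTensor Ω lo hi A)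
    (q : ι → Fin (n + 1) → MvPolynomial (Fin (n + 1)) ℝ) (T : ι) :
    ∫ x in M.elem T, ‖mulE (A x)⁻¹ (M.field q T x)‖ ^ 2 ≤ lo⁻¹ * M.fluxAt A q T := by
  rw [fluxAt, ← integral_const_mul]
  have h := memLp_inv_field (M := M) hΩ hA T q
  refine integral_mono_ae ((memLp_two_iff_integrable_sq_norm h.1).1 h)
    ((integrable_inv_form hΩ hA T q q).const_mul _) ?_
  filter_upwards [M.ae_elem hΩ T hA.bounds] with x hx
  rw [le_inv_mul_iff₀ hA.lo_pos]
  exact hx.norm_inv_sq_le hA.lo_pos _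

theorem IsSolution.flux_test (hX : M.IsSolution A rt p α m f g X) (hα : 0 < α)
    (τ : Sig s n ι rt p) :
    (∑ T, ∫ x in M.elem T, matForm (A x)⁻¹ (M.field τ T x) (M.field X.1 T x)) +
      M.formB τ X.2.1 X.2.2.1 = 0 := by
  have h := hX.1 τ 0 0
  simp only [formA, Submodule.coe_zero, ip_fn_zero, formB_zero_right, sub_zero, add_zero] at h
  exact (mul_eq_zero.1 h).resolve_left hα.ne'

/-- A test flux supported on one element is admissible, because no continuity across facets is
imposed. This localizes the flux equation and provides the hypothesis of the local inf-sup
condition. -/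
theorem IsSolution.bRef_sq_le (hX : M.IsSolution A rt p α m f g X) (hα : 0 < α)
    (hΩ : IsPolyhedralDomain Ω) (hA : UniformTensor Ω lo hi A) (T : ι)
    {r : ι → Fin (n + 1) → MvPolynomial (Fin (n + 1)) ℝ} (hr : r T ∈ rtSpace s (n + 1) p rt) :
    bRef (r T) (X.2.1.1 T) (M.traceAt X.2.2.1.1 T) ^ 2 ≤
      (lo⁻¹ * M.fluxAt A X.1 T) * ∫ x in M.elem T, ‖M.field r T x‖ ^ 2 := by
  classical
  let τ : Sig s n ι rt p := ⟨fun T' => if T' = T then r T' else 0, fun T' _ => by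
    dsimp only
    split_ifs with h
    · rw [h]; exact hr
    · exact zero_mem _⟩
  have h := hX.flux_test hα τ
  have e1 : M.formB τ X.2.1 X.2.2.1 =
      M.orientation T * bRef (r T) (X.2.1.1 T) (M.traceAt X.2.2.1.1 T) := by
    rw [formB_eq, Finset.sum_eq_single T]
    · simp [τ]
    · intro T' _ hT
      have : τ.1 T' = 0 := if_neg hT
      rw [this, bRef_zero_left, mul_zero]
    · simp
  have hτ : M.field τ T = M.field r T := field_congr (if_pos rfl)
  have e2 : ∑ T, ∫ x in M.elem T, matForm (A x)⁻¹ (M.field τ T x) (M.field X.1 T x) =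
      ∫ x in M.elem T, matForm (A x)⁻¹ (M.field r T x) (M.field X.1 T x) := by
    rw [Finset.sum_eq_single T]
    · rw [hτ]
    · intro T' _ hT
      have h0 : M.field τ T' = M.field 0 T' := field_congr (if_neg hT)
      simp [h0, field_zero, matForm]
    · simp
  rw [e1, e2] at h
  have h1 : bRef (r T) (X.2.1.1 T) (M.traceAt X.2.2.1.1 T) ^ 2 =
      (∫ x in M.elem T, inner ℝ (M.field r T x) (mulE (A x)⁻¹ (M.field X.1 T x))) ^ 2 := by
    have h2 : (M.orientation T * bRef (r T) (X.2.1.1 T) (M.traceAt X.2.2.1.1 T)) ^ 2 =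
        (∫ x in M.elem T, matForm (A x)⁻¹ (M.field r T x) (M.field X.1 T x)) ^ 2 := by
      rw [eq_neg_of_add_eq_zero_right h, neg_sq]
    rw [mul_pow, orientation_sq, one_mul] at h2
    rw [h2]
    simp_rw [matForm_eq_inner]
  rw [h1]
  refine (sq_integral_inner_le (memLp_field r T) (memLp_inv_field hΩ hA T _)).trans ?_
  rw [mul_comm]
  exact mul_le_mul_of_nonneg_right (integral_inv_field_sq_le hΩ hA _ T)
    (integral_nonneg fun _ => sq_nonneg _)

/-- The solution is its own test function in the first equation, where the two `ℬ_h` terms cancel;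
the second equation, tested with `δ`, replaces `(u, δ)`. -/
theorem IsSolution.energy_identity (hX : M.IsSolution A rt p α m f g X) :
    α * ∑ T, M.fluxAt A X.1 T + M.ip (fun T x => m x * M.fn X.2.2.2 T x) (M.fn X.2.2.2) =
      M.ip (fun _ => f) (M.fn X.2.1) - M.ip (fun _ => g) (M.fn X.2.2.2) := by
  have h1 := hX.1 X.1 X.2.1 X.2.2.1
  have h2 := hX.2 X.2.2.2
  rw [formA, add_sub_cancel_right] at h1
  rw [ip_comm (M.fn X.2.1)] at h2
  simp only [fluxAt]
  linarith

/-- With vanishing test flux the first equation expresses the multiplier through the load and the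
flux. -/
theorem IsSolution.dual_test (hX : M.IsSolution A rt p α m f g X)
    (v : V s n ι p) (μ : M.M0 p) :
    M.ip (M.fn X.2.2.2) (M.fn v) = M.ip (fun _ => f) (M.fn v) + α * M.formB X.1 v μ := by
  have h := hX.1 0 v μ
  have h0 : ∑ T, ∫ x in M.elem T, matForm (A x)⁻¹
      (M.field (0 : ι → Fin (n + 1) → MvPolynomial (Fin (n + 1)) ℝ) T x) (M.field X.1 T x) = 0 := by
    simp [field_zero, matForm]
  rw [formA, Submodule.coe_zero, h0, formB_zero_left] at h
  linarith

theorem mem_M0 (μ : κ → MvPolynomial (Fin n) ℝ) : μ ∈ M.M0 p ↔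
    (∀ E, μ E ∈ polySpace s n p) ∧ ∀ E, M.facet E ⊆ frontier Ω → μ E = 0 := by
  simp only [M0, Submodule.mem_pi, mem_univ, forall_true_left, ← forall_and]
  refine forall_congr' fun E => ?_
  split_ifs with hE
  · rw [Submodule.mem_bot]
    exact ⟨fun h => ⟨h ▸ zero_mem _, fun _ => h⟩, fun h => h.2 hE⟩
  · exact ⟨fun h => ⟨h, fun h' => absurd h' hE⟩, fun h => h.1⟩

/-- The local inf-sup condition bounds the primal variables by the flux. -/
theorem exists_energy_le_flux (hrt : rt.Admissible s p) (n : ℕ) (hK : 0 < K) (hlo : 0 < lo) :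
    ∃ C : ℝ, 0 < C ∧ ∀ {Ω : Set (Space (n + 1))} {ι κ : Type} [Fintype ι] [Fintype κ]
      {M : Mesh s n Ω ι κ} {hi α : ℝ} {A : Space (n + 1) → Matrix (Fin (n + 1)) (Fin (n + 1)) ℝ}
      {m f g : Space (n + 1) → ℝ} {X : M.Unknowns rt p},
      M.IsScaled K → IsPolyhedralDomain Ω → UniformTensor Ω lo hi A → 0 < α →
      M.IsSolution A rt p α m f g X → ∀ T,
        M.energyAt X.2.1 X.2.2.1 T ≤ C * M.fluxAt A X.1 T := by
  obtain ⟨C, hC, h⟩ := exists_energyAt_le hrt n hK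
  refine ⟨C * lo⁻¹, by positivity, ?_⟩
  intro Ω ι κ _ _ M hi α A m f g X hM hΩ hA hα hX T
  rw [mul_assoc]
  exact h hM T X.2.1 X.2.2.1 (X.2.1.2 T trivial)
    (fun F => M.traceAt_mem (((mem_M0 _).1 X.2.2.1.2).1 _)) _
    fun r hr => hX.bRef_sq_le hα hΩ hA T hr

/-- The local bounds are summed with the discrete Cauchy--Schwarz inequality; orientations drop out
as their squares are one. -/
theorem abs_formB_le {C : ℝ} (hΩ : IsPolyhedralDomain Ω) (hA : UniformTensor Ω lo hi A)
    (hC : 0 < C) {q : ι → Fin (n + 1) → MvPolynomial (Fin (n + 1)) ℝ}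
    {v : ι → MvPolynomial (Fin (n + 1)) ℝ} {μ : κ → MvPolynomial (Fin n) ℝ}
    (h : ∀ T, bRef (q T) (v T) (M.traceAt μ T) ^ 2 ≤
      C * (∫ x in M.elem T, ‖M.field q T x‖ ^ 2) * M.energyAt v μ T) :
    |M.formB q v μ| ≤ √(C * hi * ∑ T, M.fluxAt A q T) * √(∑ T, M.energyAt v μ T) := by
  have hf := fun T => fluxAt_nonneg (M := M) hΩ hA q T
  have he := fun T => energyAt_nonneg (M := M) v μ T
  have hhi := hA.hi_pos
  have h1 : ∀ T, |M.orientation T * bRef (q T) (v T) (M.traceAt μ T)| ≤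
      √(C * hi * M.fluxAt A q T) * √(M.energyAt v μ T) := fun T => by
    rw [← Real.sqrt_mul (by have := hf T; positivity)]
    refine Real.abs_le_sqrt ?_
    rw [mul_pow, orientation_sq, one_mul]
    refine (h T).trans (mul_le_mul_of_nonneg_right ?_ (he T))
    rw [mul_assoc]
    exact mul_le_mul_of_nonneg_left (integral_field_sq_le hΩ hA q T) hC.le
  rw [formB_eq]
  refine (Finset.abs_sum_le_sum_abs _ _).trans ((Finset.sum_le_sum fun T _ => h1 T).trans ?_)
  have := Real.sum_sqrt_mul_sqrt_le (Finset.univ : Finset ι)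
    (f := fun T => C * hi * M.fluxAt A q T) (g := M.energyAt v μ)
    (fun T => by have := hf T; positivity) he
  rwa [← Finset.mul_sum] at this

end Mesh

/-! ### Unique solvability of the discrete system -/

namespace Mesh

variable {s : Shape} {n : ℕ} {Ω : Set (Space (n + 1))} {ι κ : Type} [Fintype ι] [Fintype κ]
  {M : Mesh s n Ω ι κ} {K lo hi : ℝ} {A : Space (n + 1) → Matrix (Fin (n + 1)) (Fin (n + 1)) ℝ}
  {rt : RTForm} {p : ℕ} {α : ℝ} {m f g : Space (n + 1) → ℝ} {X : M.Unknowns rt p}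

theorem memLp_one (Ω : Set (Space (n + 1))) :
    MemLp (fun _ : Space (n + 1) => (1 : ℝ)) ∞ (volume.restrict Ω) :=
  memLp_top_const 1

theorem massL_apply (hΩ : IsPolyhedralDomain Ω) (hm : MemLp m ∞ (volume.restrict Ω))
    (v w : ι → MvPolynomial (Fin (n + 1)) ℝ) :
    M.massL hΩ hm v w = M.ip (fun T x => m x * M.fn v T x) (M.fn w) := rfl

theorem massL_one (hΩ : IsPolyhedralDomain Ω) (v w : ι → MvPolynomial (Fin (n + 1)) ℝ) :
    M.massL hΩ (memLp_one Ω) v w = M.ip (M.fn v) (M.fn w) := by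
  rw [massL_apply]; simp only [one_mul]

theorem ip_mul_self_nonneg (hΩ : IsPolyhedralDomain Ω) (h0 : ∀ᵐ x ∂volume.restrict Ω, 0 < m x)
    (v : ι → Space (n + 1) → ℝ) : 0 ≤ M.ip (fun T x => m x * v T x) v := by
  refine Finset.sum_nonneg fun T _ => integral_nonneg_of_ae ?_
  filter_upwards [M.ae_elem hΩ T h0] with x hx
  rw [Pi.zero_apply, mul_assoc]
  exact mul_nonneg hx.le (mul_self_nonneg _)

theorem eq_zero_of_ip_mul_self (hΩ : IsPolyhedralDomain Ω) (hm : MemLp m ∞ (volume.restrict Ω))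
    (h0 : ∀ᵐ x ∂volume.restrict Ω, 0 < m x) {v : ι → MvPolynomial (Fin (n + 1)) ℝ}
    (h : M.ip (fun T x => m x * M.fn v T x) (M.fn v) = 0) : v = 0 := by
  have hn : ∀ T, 0 ≤ᵐ[volume.restrict (M.elem T)] fun x => m x * M.fn v T x * M.fn v T x :=
    fun T => by
      filter_upwards [M.ae_elem hΩ T h0] with x hx
      rw [Pi.zero_apply, mul_assoc]
      exact mul_nonneg hx.le (mul_self_nonneg _)
  funext T
  have h1 := (Finset.sum_eq_zero_iff_of_nonneg fun T _ => integral_nonneg_of_ae (hn T)).1 h T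
    (Finset.mem_univ T)
  have h2 := (integral_eq_zero_iff_of_nonneg_ae (hn T)
    (integrable_mass hΩ hm T (memLp_fn v T) (memLp_fn v T))).1 h1
  refine eq_zero_of_integral_fn_sq (M := M) ?_
  refine integral_eq_zero_of_ae ?_
  filter_upwards [h2, M.ae_elem hΩ T h0] with x hx hx0
  rw [Pi.zero_apply, mul_assoc] at hx
  have := (mul_eq_zero.1 hx).resolve_left hx0.ne'
  rw [Pi.zero_apply, sq, this]

theorem IsScaled.eq_zero_of_fluxAt (hM : M.IsScaled K) (hΩ : IsPolyhedralDomain Ω)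
    (hA : UniformTensor Ω lo hi A) {q : ι → Fin (n + 1) → MvPolynomial (Fin (n + 1)) ℝ} {T : ι}
    (h : M.fluxAt A q T = 0) : q T = 0 := by
  have h1 := integral_field_sq_le (M := M) hΩ hA q T
  rw [h, mul_zero] at h1
  have h2 := (hM.field_ref_le T q).1
  have h3 : ∫ x in refElem s (n + 1), ‖fieldL _ (q T) x‖ ^ 2 ≤ 0 :=
    h2.trans (mul_nonpos_of_nonneg_of_nonpos
      (mul_nonneg (pow_nonneg hM.pos.le 3) (M.scale_pos T).le) h1)
  funext k
  refine eq_zero_of_integral_pe_sq _ (isCompact_refElem s _) (interior_refElem_nonempty s _) ?_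
  refine le_antisymm (le_trans (integral_mono (integrable_ref ((continuous_pe _).pow 2))
    (integrable_ref ((continuous_fieldL _).norm.pow 2)) fun x => ?_) h3)
    (integral_nonneg fun _ => sq_nonneg _)
  have := PiLp.norm_apply_le (fieldL _ (q T) x) k
  rw [fieldL_apply] at this
  simp only
  rw [← sq_abs]
  exact pow_le_pow_left₀ (abs_nonneg _) this 2

/-- The homogeneous problem has only the trivial solution. -/
theorem eq_zero_of_isSolution_zero (hrt : rt.Admissible s p) (hM : M.IsScaled K)
    (hΩ : IsPolyhedralDomain Ω) (hA : UniformTensor Ω lo hi A) (hα : 0 < α)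
    (hm : MemLp m ∞ (volume.restrict Ω)) (h0 : ∀ᵐ x ∂volume.restrict Ω, 0 < m x)
    (hX : M.IsSolution A rt p α m 0 0 X) : X = 0 := by
  have hz : ∀ w : ι → Space (n + 1) → ℝ, M.ip (fun _ => 0) w = 0 := fun w => by simp [ip]
  have h1 := hX.energy_identity
  rw [hz, hz, sub_zero] at h1
  have hW : 0 ≤ M.ip (fun T x => m x * M.fn X.2.2.2 T x) (M.fn X.2.2.2) :=
    ip_mul_self_nonneg hΩ h0 _
  have hQ0 : ∀ T, 0 ≤ M.fluxAt A X.1 T := fun T => fluxAt_nonneg hΩ hA _ T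
  have hQ : 0 ≤ ∑ T, M.fluxAt A X.1 T := Finset.sum_nonneg fun T _ => hQ0 T
  have hQ' : ∑ T, M.fluxAt A X.1 T = 0 := by
    have := mul_nonneg hα.le hQ
    have h2 : α * ∑ T, M.fluxAt A X.1 T = 0 := by linarith
    exact (mul_eq_zero.1 h2).resolve_left hα.ne'
  have hW' : M.ip (fun T x => m x * M.fn X.2.2.2 T x) (M.fn X.2.2.2) = 0 := by
    rw [hQ', mul_zero, zero_add] at h1; exact h1
  -- The weight is positive almost everywhere, though with no uniform lower bound; that is enough to
  -- make a polynomial vanish.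
  have hδ : X.2.2.2.1 = 0 := eq_zero_of_ip_mul_self hΩ hm h0 hW'
  have hF : ∀ T, M.fluxAt A X.1 T = 0 := fun T =>
    (Finset.sum_eq_zero_iff_of_nonneg fun T _ => hQ0 T).1 hQ' T (Finset.mem_univ T)
  have hq : X.1.1 = 0 := funext fun T => hM.eq_zero_of_fluxAt hΩ hA (hF T)
  -- With `δ = 0` and zero data, the second equation tested with `u` reads `‖u‖² = 0`.
  have hu : X.2.1.1 = 0 := by
    have h2 := hX.2 X.2.1
    have h3 : M.ip (fun T x => m x * M.fn X.2.2.2.1 T x) (M.fn X.2.1) = 0 := by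
      rw [hδ, ip_comm]; simp [ip, fn_zero]
    rw [h3] at h2
    refine eq_zero_of_ip_mul_self (M := M) hΩ (memLp_one Ω)
      (Eventually.of_forall fun _ => one_pos) ?_
    simp only [one_mul]
    rw [sub_zero] at h2
    exact h2.trans (hz _)
  obtain ⟨C, hC, hen⟩ := exists_energy_le_flux hrt n hM.pos hA.lo_pos
  -- Zero flux means zero local energy, and with `u = 0` the gap on each facet is `-û`.
  have hμ : X.2.2.1.1 = 0 := funext fun E => by
    have h2 := hen hM hΩ hA hα hX (M.side₁ E)
    rw [hF, mul_zero, energyAt_eq] at h2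
    have h3 : 0 ≤ ∫ x in M.elem (M.side₁ E), ‖gradient (M.fn X.2.1.1 (M.side₁ E)) x‖ ^ 2 :=
      integral_nonneg fun _ => sq_nonneg _
    have h4 := Finset.single_le_sum
      (f := fun E' => (M.hElem (M.side₁ E))⁻¹ * M.gapAt X.2.1.1 X.2.2.1.1 E' (M.side₁ E))
      (fun E' _ => mul_nonneg (inv_nonneg.2 (M.hElem_pos _).le) (gapAt_nonneg _ _ _ _))
      ((mem_facetsOf' E (M.side₁ E)).2 (Or.inl rfl))
    have h5 : M.gapAt X.2.1.1 X.2.2.1.1 E (M.side₁ E) ≤ 0 := by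
      have := inv_pos.2 (M.hElem_pos (M.side₁ E))
      by_contra hc
      push Not at hc
      have := mul_pos this hc
      linarith
    have h6 : M.facetJac E * ∫ y in refElem s n, pe (X.2.2.1.1 E) y ^ 2 = 0 := by
      have h7 := le_antisymm h5 (gapAt_nonneg _ _ _ _)
      rw [hu, gapAt, facetIntegral] at h7
      simpa [fn_zero, facetFn, pe] using h7
    exact eq_zero_of_integral_pe_sq _ (isCompact_refElem s _) (interior_refElem_nonempty s _)
      ((mul_eq_zero.1 h6).resolve_left (M.facetJac_pos E).ne')
  exact Prod.ext (Subtype.ext hq) (Prod.ext (Subtype.ext hu)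
    (Prod.ext (Subtype.ext hμ) (Subtype.ext hδ)))

instance (p : ℕ) : FiniteDimensional ℝ (V s n ι p) := finiteDimensional_pi _

instance (p : ℕ) : FiniteDimensional ℝ (Sig s n ι rt p) := finiteDimensional_pi _

instance (p : ℕ) : FiniteDimensional ℝ (M.M0 p) := by
  have : FiniteDimensional ℝ (Submodule.pi univ fun _ : κ => polySpace s n p) :=
    finiteDimensional_pi _
  have hle : M.M0 p ≤ Submodule.pi univ fun _ : κ => polySpace s n p := fun μ hμ E _ =>
    ((mem_M0 μ).1 hμ).1 E
  exact Submodule.finiteDimensional_of_le hle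

/-- The bilinear form of the linearized problem. -/
def systemL (M : Mesh s n Ω ι κ) (rt : RTForm) (p : ℕ) (α : ℝ) (hΩ : IsPolyhedralDomain Ω)
    (hA : UniformTensor Ω lo hi A) (hm : MemLp m ∞ (volume.restrict Ω)) :
    M.Unknowns rt p →ₗ[ℝ] M.Unknowns rt p →ₗ[ℝ] ℝ :=
  LinearMap.mk₂ ℝ (fun X Y => α * (M.fluxL hΩ hA Y.1.1 X.1.1 + M.formBL Y.1.1 (X.2.1.1, X.2.2.1.1) -
      M.formBL X.1.1 (Y.2.1.1, Y.2.2.1.1)) + M.massL hΩ (memLp_one Ω) X.2.2.2.1 Y.2.1.1 +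
      (M.massL hΩ (memLp_one Ω) X.2.1.1 Y.2.2.2.1 - M.massL hΩ hm X.2.2.2.1 Y.2.2.2.1))
    (fun X X' Y => by
      simp only [Prod.fst_add, Prod.snd_add, Submodule.coe_add, ← Prod.mk_add_mk, map_add,
        LinearMap.add_apply]
      ring)
    (fun c X Y => by
      simp only [Prod.smul_fst, Prod.smul_snd, Submodule.coe_smul, ← Prod.smul_mk, map_smul,
        LinearMap.smul_apply, smul_eq_mul]
      ring)
    (fun X Y Y' => by
      simp only [Prod.fst_add, Prod.snd_add, Submodule.coe_add, ← Prod.mk_add_mk, map_add,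
        LinearMap.add_apply]
      ring)
    (fun c X Y => by
      simp only [Prod.smul_fst, Prod.smul_snd, Submodule.coe_smul, ← Prod.smul_mk, map_smul,
        LinearMap.smul_apply, smul_eq_mul]
      ring)

theorem systemL_apply (hΩ : IsPolyhedralDomain Ω) (hA : UniformTensor Ω lo hi A)
    (hm : MemLp m ∞ (volume.restrict Ω)) (X Y : M.Unknowns rt p) :
    M.systemL rt p α hΩ hA hm X Y =
      (α * M.formA A X.1 X.2.1 X.2.2.1 Y.1 Y.2.1 Y.2.2.1 + M.ip (M.fn X.2.2.2) (M.fn Y.2.1)) +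
      (M.ip (M.fn X.2.1) (M.fn Y.2.2.2) -
        M.ip (fun T x => m x * M.fn X.2.2.2 T x) (M.fn Y.2.2.2)) := by
  rw [systemL, LinearMap.mk₂_apply, massL_one, massL_one, formBL_apply, formBL_apply]
  rfl

/-- The load functional. -/
def loadL (M : Mesh s n Ω ι κ) (hΩ : IsPolyhedralDomain Ω)
    (hf : MemLp f 2 (volume.restrict Ω)) : (ι → MvPolynomial (Fin (n + 1)) ℝ) →ₗ[ℝ] ℝ where
  toFun v := M.ip (fun _ => f) (M.fn v)
  map_add' v w := by
    have := ip_add_smul (M := M) hΩ hf (fun T => continuous_fn (M := M) v T) (fun T => continuous_fn (M := M) w T) 1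
    rw [one_mul] at this
    rw [← this]
    congr 1
    funext T x
    rw [fn_add, one_mul]
  map_smul' c v := by
    have := ip_add_smul (M := M) hΩ hf (fun T => continuous_fn (M := M) 0 T) (fun T => continuous_fn (M := M) v T) c
    rw [ip_fn_zero, zero_add] at this
    rw [RingHom.id_apply, smul_eq_mul, ← this]
    congr 1
    funext T x
    rw [fn_smul, fn_zero, zero_add]

theorem loadL_apply (hΩ : IsPolyhedralDomain Ω) (hf : MemLp f 2 (volume.restrict Ω))
    (v : ι → MvPolynomial (Fin (n + 1)) ℝ) : M.loadL hΩ hf v = M.ip (fun _ => f) (M.fn v) := rfl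

/-- Both equations are merged into one bilinear equation on the space of unknowns, which is also the
space of test functions; the two are recovered by setting some of the test components to zero. -/
theorem isSolution_iff (hΩ : IsPolyhedralDomain Ω) (hA : UniformTensor Ω lo hi A)
    (hm : MemLp m ∞ (volume.restrict Ω)) (hf : MemLp f 2 (volume.restrict Ω))
    (hg : MemLp g 2 (volume.restrict Ω)) : M.IsSolution A rt p α m f g X ↔
      ∀ Y : M.Unknowns rt p, M.systemL rt p α hΩ hA hm X Y =
        M.loadL hΩ hf Y.2.1.1 + M.loadL hΩ hg Y.2.2.2.1 := by
  constructor
  · intro h Y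
    rw [systemL_apply, h.1, h.2]
    rfl
  · intro h
    refine ⟨fun τ v μ => ?_, fun w => ?_⟩
    · have := h (τ, v, μ, 0)
      rw [systemL_apply] at this
      simpa [loadL_apply, ip_fn_zero] using this
    · have := h (0, 0, 0, w)
      rw [systemL_apply] at this
      have h0 : M.formA A X.1 X.2.1 X.2.2.1 0 0 0 = 0 := by
        simp [formA, formB_zero_left, formB_zero_right, field_zero, matForm]
      simpa [loadL_apply, ip_fn_zero, h0] using this

/-- An injective linear map from a finite-dimensional space to its dual is bijective, so uniqueness
for zero data gives existence for all data. -/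
theorem existsUnique_isSolution (hrt : rt.Admissible s p) (hM : M.IsScaled K)
    (hΩ : IsPolyhedralDomain Ω) (hA : UniformTensor Ω lo hi A) (hα : 0 < α)
    (hm : MemLp m ∞ (volume.restrict Ω)) (h0 : ∀ᵐ x ∂volume.restrict Ω, 0 < m x)
    (hf : MemLp f 2 (volume.restrict Ω)) (hg : MemLp g 2 (volume.restrict Ω)) :
    ∃! X : M.Unknowns rt p, M.IsSolution A rt p α m f g X := by
  have hz : ∀ w : ι → Space (n + 1) → ℝ, M.ip (fun _ => 0) w = 0 := fun w => by simp [ip]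
  have hinj : Function.Injective (M.systemL rt p α hΩ hA hm) := by
    rw [← LinearMap.ker_eq_bot, LinearMap.ker_eq_bot']
    intro X hX
    refine eq_zero_of_isSolution_zero hrt hM hΩ hA hα hm h0
      ((isSolution_iff hΩ hA hm MemLp.zero MemLp.zero).2 fun Y => ?_)
    rw [hX, LinearMap.zero_apply]
    change 0 = M.ip (fun _ => 0) _ + M.ip (fun _ => 0) _
    rw [hz, hz, add_zero]
  have hsur := (LinearMap.injective_iff_surjective_of_finrank_eq_finrank
    (Subspace.dual_finrank_eq (K := ℝ) (V := M.Unknowns rt p)).symm).1 hinj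
  let l : Module.Dual ℝ (M.Unknowns rt p) :=
    { toFun := fun Y => M.loadL hΩ hf Y.2.1.1 + M.loadL hΩ hg Y.2.2.2.1
      map_add' := fun Y Y' => by
        simp only [Prod.snd_add, Prod.fst_add, Submodule.coe_add, map_add]; ring
      map_smul' := fun c Y => by
        simp only [Prod.smul_snd, Prod.smul_fst, Submodule.coe_smul, map_smul, smul_eq_mul,
          RingHom.id_apply]; ring }
  obtain ⟨X, hX⟩ := hsur l
  refine ⟨X, (isSolution_iff hΩ hA hm hf hg).2 fun Y => by rw [hX]; rfl, fun X' hX' => hinj ?_⟩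
  rw [hX]
  exact LinearMap.ext fun Y => (isSolution_iff hΩ hA hm hf hg).1 hX' Y

end Mesh

/-! ### The quadratic inequality and the bounds that enter it -/

theorem sq_eLpNorm_two_toReal {X E : Type*} [MeasurableSpace X] {μ : Measure X}
    [NormedAddCommGroup E] [InnerProductSpace ℝ E] {u : X → E} (hu : MemLp u 2 μ) :
    (eLpNorm u 2 μ).toReal ^ 2 = ∫ x, ‖u x‖ ^ 2 ∂μ := by
  rw [← Lp.norm_toLp u hu, ← real_inner_self_eq_norm_sq, L2.inner_def]
  refine integral_congr_ae ?_
  filter_upwards [hu.coeFn_toLp] with x hx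
  rw [hx, real_inner_self_eq_norm_sq]

/-- A quadratic inequality bounds its unknowns by the data. -/
theorem exists_le_of_quadratic {α a b : ℝ} (hα : 0 < α) (ha : 0 ≤ a) (hb : 0 ≤ b) :
    ∃ c : ℝ, 0 < c ∧ ∀ F D X x y : ℝ, 0 ≤ F → 0 ≤ D → 0 ≤ X → 0 ≤ x → 0 ≤ y →
      α * x ^ 2 + y ^ 2 ≤ F * a * x + b * (F + α * x) * D + X * y →
      x ≤ c * (F + D + X) ∧ y ≤ c * (F + D + X) := by
  -- With `S = F + D + X`, Young's inequality absorbs `α x² / 2` and `y² / 2`. The three summands of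
  -- `B` come from the mixed term in `x`, from `b S²` and from `S y`.
  set B := (a + α * b) ^ 2 / (2 * α) + b + 1 / 2 with hB
  have hB0 : 0 < B := by positivity
  refine ⟨1 + 2 * B / α + 2 * B, by positivity, fun F D X x y hF hD hX hx hy h => ?_⟩
  set S := F + D + X with hS
  have hS0 : 0 ≤ S := by positivity
  have h1 : α * x ^ 2 + y ^ 2 ≤ (a + α * b) * S * x + b * S ^ 2 + S * y := by
    have e1 : F * a * x ≤ S * a * x := by gcongr; linarith
    have e2 : b * (F * D) ≤ b * S ^ 2 := by
      gcongr
      nlinarith [mul_nonneg hF hD, mul_nonneg hF hX, mul_nonneg hD hX]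
    have e3 : b * (α * x * D) ≤ b * (α * x * S) := by gcongr; linarith
    have e4 : X * y ≤ S * y := by gcongr; linarith
    linarith
  have h2 : (a + α * b) * S * x ≤ α / 2 * x ^ 2 + (a + α * b) ^ 2 / (2 * α) * S ^ 2 := by
    have : 0 ≤ (α * x - (a + α * b) * S) ^ 2 / (2 * α) := by positivity
    have e : (α * x - (a + α * b) * S) ^ 2 / (2 * α) = α / 2 * x ^ 2 - (a + α * b) * S * x +
        (a + α * b) ^ 2 / (2 * α) * S ^ 2 := by field_simp; ring
    linarith
  have h3 : S * y ≤ y ^ 2 / 2 + S ^ 2 / 2 := by nlinarith [sq_nonneg (y - S)]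
  have h4 : α / 2 * x ^ 2 + y ^ 2 / 2 ≤ B * S ^ 2 := by
    rw [hB]; linarith
  have hBS : 0 ≤ 2 * B / α := by positivity
  -- The constant is at least `1`, hence at most its own square; this avoids taking square roots of
  -- constants.
  have hc : ∀ z t : ℝ, 0 ≤ z → t ≤ 1 + 2 * B / α + 2 * B → z ^ 2 ≤ t * S ^ 2 →
      z ≤ (1 + 2 * B / α + 2 * B) * S := fun z t hz ht h => by
    refine le_of_sq_le_sq ?_ (by positivity)
    refine h.trans ?_
    rw [mul_pow]
    refine mul_le_mul_of_nonneg_right (ht.trans ?_) (sq_nonneg S)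
    nlinarith
  refine ⟨hc x (2 * B / α) hx (by linarith) ?_, hc y (2 * B) hy (by linarith) ?_⟩
  · rw [div_mul_eq_mul_div, le_div_iff₀ hα]
    nlinarith [sq_nonneg y]
  · nlinarith [mul_nonneg hα.le (sq_nonneg x)]

namespace Mesh

section

variable {s : Shape} {n : ℕ} {Ω : Set (Space (n + 1))} {ι κ : Type} [Fintype ι] [Fintype κ]
  {M : Mesh s n Ω ι κ} {K lo hi : ℝ} {A : Space (n + 1) → Matrix (Fin (n + 1)) (Fin (n + 1)) ℝ}
  {rt : RTForm} {p : ℕ} {α : ℝ} {m f g : Space (n + 1) → ℝ} {X : M.Unknowns rt p}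

theorem smoothDg_neg (b : ι → Space (n + 1) → ℝ) :
    M.smoothDg A (fun T x => -b T x) = M.smoothDg A b := by
  have h1 : ∀ T, gradient (fun x => -b T x) = fun x => -gradient (b T) x := fun T => by
    funext x
    refine ext_inner_right ℝ fun z => ?_
    rw [inner_gradient, inner_neg_left, inner_gradient, fderiv_fun_neg]
    simp
  have h2 : ∀ E y, M.jump (fun T E y => -b T (M.Ψ E y)) E y ^ 2 =
      M.jump (fun T E y => b T (M.Ψ E y)) E y ^ 2 := fun E y => by
    unfold jump; split_ifs <;> ring
  simp only [smoothDg, dgSq, h1, h2, matForm]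
  simp

theorem IsScaled.abs_ip_smooth_le (hM : M.IsScaled K) (hA : UniformTensor Ω lo hi A)
    (hΩ : IsPolyhedralDomain Ω) (hf : MemLp f 2 (volume.restrict Ω))
    (hd : M.dualNorm A (fun _ => f) ≠ ⊤) {b : ι → Space (n + 1) → ℝ}
    (hb : ∀ T, ContDiff ℝ ∞ (b T)) :
    |M.ip (fun _ => f) b| ≤ (M.dualNorm A (fun _ => f)).toReal * √(M.smoothDg A b) := by
  refine abs_le'.2 ⟨hM.ip_smooth_le hA hΩ hf hd hb, ?_⟩
  have h := hM.ip_smooth_le hA hΩ hf hd (b := fun T x => -b T x) fun T => (hb T).neg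
  rw [smoothDg_neg] at h
  refine le_trans (le_of_eq ?_) h
  simp [ip, integral_neg]

/-- The dual norm of the Lagrange multiplier is bounded by the load and the flux. -/
theorem exists_abs_ip_delta_le (s : Shape) (n p : ℕ) (rt : RTForm) (hK : 0 < K) (hlo : 0 < lo)
    (hhi : 0 < hi) : ∃ C : ℝ, 0 < C ∧ ∀ {Ω : Set (Space (n + 1))} {ι κ : Type} [Fintype ι]
      [Fintype κ] {M : Mesh s n Ω ι κ} {α : ℝ}
      {A : Space (n + 1) → Matrix (Fin (n + 1)) (Fin (n + 1)) ℝ}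
      {m f g : Space (n + 1) → ℝ} {X : M.Unknowns rt p},
      M.IsScaled K → IsPolyhedralDomain Ω → UniformTensor Ω lo hi A → 0 < α →
      MemLp f 2 (volume.restrict Ω) → M.dualNorm A (fun _ => f) ≠ ⊤ →
      M.IsSolution A rt p α m f g X → ∀ w G t, M.IsBrokenH1 w G t →
        |M.ip (M.fn X.2.2.2) (fun _ => w)| ≤
          C * ((M.dualNorm A (fun _ => f)).toReal + α * √(∑ T, M.fluxAt A X.1 T)) *
            M.dgNorm A G t := by
  obtain ⟨C₁, hC₁, h₁⟩ := exists_energy_projection_le (lo := lo) s n p hK hlo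
  obtain ⟨C₂, hC₂, h₂⟩ := exists_bRef_at_le s n p rt hK
  refine ⟨√C₁ * (√(hi + 4 * K) + √(C₂ * hi)), by positivity, ?_⟩
  intro Ω ι κ _ _ M α A m f g X hM hΩ hA hα hf hd hX w G t hw
  obtain ⟨v, hv, hpr⟩ := exists_projection (M := M) p fun T => M.memLp_elem hΩ T hw.1
  obtain ⟨μ, hμp, hμ, hen⟩ := h₁ hM hΩ hA w G t hw v hv hpr
  set F := (M.dualNorm A (fun _ => f)).toReal
  set Q := ∑ T, M.fluxAt A X.1 T
  have hF : 0 ≤ F := ENNReal.toReal_nonneg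
  -- The multiplier is piecewise polynomial, so `w` may be replaced by its projection.
  have e1 : M.ip (M.fn X.2.2.2) (fun _ => w) = M.ip (M.fn X.2.2.2) (M.fn v) := by
    refine Finset.sum_congr rfl fun T _ => ?_
    have h := hpr T X.2.2.2.1 (X.2.2.2.2 T trivial)
    have i1 : Integrable (fun x => M.fn v T x * M.fn X.2.2.2.1 T x) (volume.restrict (M.elem T)) :=
      (memLp_fn v T).integrable_mul (memLp_fn _ T)
    have i2 : Integrable (fun x => w x * M.fn X.2.2.2.1 T x) (volume.restrict (M.elem T)) :=
      (M.memLp_elem hΩ T hw.1).integrable_mul (memLp_fn _ T)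
    simp_rw [sub_mul] at h
    rw [integral_sub i1 i2] at h
    simp_rw [mul_comm (M.fn X.2.2.2.1 T _)]
    linarith
  have e2 := hX.dual_test ⟨v, fun T _ => hv T⟩ ⟨μ, (mem_M0 μ).2 ⟨hμp, hμ⟩⟩
  have hS : √(∑ T, M.energyAt v μ T) ≤ √C₁ * M.dgNorm A G t := by
    rw [dgNorm, ← Real.sqrt_mul hC₁.le]
    exact Real.sqrt_le_sqrt hen
  have h3 : |M.ip (fun _ => f) (M.fn v)| ≤ F * (√(hi + 4 * K) * √(∑ T, M.energyAt v μ T)) := by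
    refine (hM.abs_ip_smooth_le hA hΩ hf hd fun T => M.contDiff_fn v T).trans
      (mul_le_mul_of_nonneg_left ?_ hF)
    rw [← Real.sqrt_mul (by positivity)]
    exact Real.sqrt_le_sqrt (hM.dgSq_fn_le hΩ hA v hμ)
  have h4 : |M.formB X.1 v μ| ≤ √(C₂ * hi) * √Q * √(∑ T, M.energyAt v μ T) := by
    rw [← Real.sqrt_mul (by positivity)]
    exact abs_formB_le hΩ hA hC₂ fun T => h₂ hM T X.1 v μ (X.1.2 T trivial)
  rw [e1]
  have h5 : |M.ip (M.fn X.2.2.2) (M.fn v)| ≤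
      |M.ip (fun _ => f) (M.fn v)| + α * |M.formB X.1 v μ| := by
    have : M.ip (M.fn X.2.2.2) (M.fn v) = M.ip (fun _ => f) (M.fn v) + α * M.formB X.1 v μ := e2
    rw [this]
    refine (abs_add_le _ _).trans ?_
    rw [abs_mul, abs_of_pos hα]
  have hs1 : 0 ≤ √(hi + 4 * K) := Real.sqrt_nonneg _
  have hs2 : 0 ≤ √(C₂ * hi) := Real.sqrt_nonneg _
  have hs3 : 0 ≤ √Q := Real.sqrt_nonneg _
  calc |M.ip (M.fn X.2.2.2) (M.fn v)|
      ≤ (F * √(hi + 4 * K) + α * (√(C₂ * hi) * √Q)) * √(∑ T, M.energyAt v μ T) := by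
        have := mul_le_mul_of_nonneg_left h4 hα.le
        linarith
    _ ≤ ((√(hi + 4 * K) + √(C₂ * hi)) * (F + α * √Q)) * (√C₁ * M.dgNorm A G t) := by
        refine mul_le_mul ?_ hS (Real.sqrt_nonneg _) (by positivity)
        have e3 := mul_nonneg hF hs2
        have e4 := mul_nonneg hs1 (mul_nonneg hα.le hs3)
        linarith
    _ = _ := by ring

/-- Without jumps only the gradient part remains; this converts a dual norm bound of `(φ, δ)` into
one by `‖∇φ‖`. -/
theorem dgNorm_le_of_jump_eq_zero (hΩ : IsPolyhedralDomain Ω) (hA : UniformTensor Ω lo hi A)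
    {G : Space (n + 1) → Space (n + 1)} {t : ι → κ → Space n → ℝ}
    (hG : MemLp G 2 (volume.restrict Ω))
    (ht : ∀ E, M.facetIntegral E (fun y => M.jump t E y ^ 2) = 0) :
    M.dgNorm A (fun _ => G) t ≤ √hi * (eLpNorm G 2 (volume.restrict Ω)).toReal := by
  refine Real.sqrt_le_iff.2 ⟨by positivity, ?_⟩
  rw [mul_pow, Real.sq_sqrt hA.hi_pos.le, sq_eLpNorm_two_toReal hG]
  simp only [ht, mul_zero, Finset.sum_const_zero, add_zero]
  refine (Finset.sum_le_sum fun T _ => hA.setIntegral_le hΩ T (M.memLp_elem hΩ T hG)).trans ?_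
  rw [← Finset.mul_sum]
  exact mul_le_mul_of_nonneg_left (M.sum_setIntegral_le hΩ
    ((memLp_two_iff_integrable_sq_norm hG.1).1 hG) fun x => sq_nonneg _) hA.hi_pos.le

theorem weightedNorm_eq (hΩ : IsPolyhedralDomain Ω) (h0 : ∀ᵐ x ∂volume.restrict Ω, 0 < m x)
    (v : ι → Space (n + 1) → ℝ) :
    M.weightedNorm m v = √(M.ip (fun T x => m x * v T x) v) := by
  unfold weightedNorm ip
  congr 1
  refine Finset.sum_congr rfl fun T _ => integral_congr_ae ?_
  filter_upwards [M.ae_elem hΩ T h0] with x hx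
  rw [mul_pow, Real.sq_sqrt hx.le]
  ring

/-- Cauchy--Schwarz after writing `χ δ = (m^{-1/2} χ) (m^{1/2} δ)`, which is legitimate because `m >
0` almost everywhere. -/
theorem abs_ip_weighted_le (hΩ : IsPolyhedralDomain Ω) (hm : MemLp m ∞ (volume.restrict Ω))
    (h0 : ∀ᵐ x ∂volume.restrict Ω, 0 < m x) {χ : Space (n + 1) → ℝ}
    (hχ : MemLp (fun x => (√(m x))⁻¹ * χ x) 2 (volume.restrict Ω))
    (v : ι → MvPolynomial (Fin (n + 1)) ℝ) :
    |M.ip (fun _ => χ) (M.fn v)| ≤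
      (eLpNorm (fun x => (√(m x))⁻¹ * χ x) 2 (volume.restrict Ω)).toReal *
        M.weightedNorm m (M.fn v) := by
  set c : Space (n + 1) → ℝ := fun x => (√(m x))⁻¹ * χ x
  have hm1 : AEStronglyMeasurable (fun x => √(m x)) (volume.restrict Ω) :=
    Real.continuous_sqrt.comp_aestronglyMeasurable hm.1
  have hv : ∀ T, MemLp (fun x => √(m x) * M.fn v T x) 2 (volume.restrict (M.elem T)) := fun T => by
    refine (memLp_two_iff_integrable_sq ((hm1.mono_measure (M.restrict_elem_le hΩ T)).mul
      (memLp_fn v T).1)).2 ((integrable_mass hΩ hm T (memLp_fn v T) (memLp_fn v T)).congr ?_)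
    filter_upwards [M.ae_elem hΩ T h0] with x hx
    simp only [Pi.mul_apply]
    rw [mul_pow, Real.sq_sqrt hx.le]
    ring
  have h1 : ∀ T, |∫ x in M.elem T, χ x * M.fn v T x| ≤
      √(∫ x in M.elem T, c x ^ 2) * √(∫ x in M.elem T, (√(m x) * M.fn v T x) ^ 2) := fun T => by
    have e : ∫ x in M.elem T, χ x * M.fn v T x =
        ∫ x in M.elem T, c x * (√(m x) * M.fn v T x) := by
      refine integral_congr_ae ?_
      filter_upwards [M.ae_elem hΩ T h0] with x hx
      have := (Real.sqrt_pos.2 hx).ne'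
      simp only [c]
      field_simp
    rw [e, ← Real.sqrt_mul (integral_nonneg fun _ => sq_nonneg _)]
    exact Real.abs_le_sqrt (sq_integral_mul_le (M.memLp_elem hΩ T hχ) (hv T))
  refine (Finset.abs_sum_le_sum_abs _ _).trans ((Finset.sum_le_sum fun T _ => h1 T).trans
    ((Real.sum_sqrt_mul_sqrt_le _ (fun T => integral_nonneg fun _ => sq_nonneg _)
      fun T => integral_nonneg fun _ => sq_nonneg _).trans ?_))
  refine mul_le_mul_of_nonneg_right (Real.sqrt_le_iff.2 ⟨ENNReal.toReal_nonneg, ?_⟩)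
    (Real.sqrt_nonneg _)
  rw [sq_eLpNorm_two_toReal hχ]
  simp_rw [Real.norm_eq_abs, sq_abs]
  exact M.sum_setIntegral_le hΩ hχ.integrable_sq fun x => sq_nonneg _

theorem tripleNorm_le {C : ℝ} (hC : 0 < C) (hΩ : IsPolyhedralDomain Ω)
    (hA : UniformTensor Ω lo hi A) {q : ι → Fin (n + 1) → MvPolynomial (Fin (n + 1)) ℝ}
    {v : ι → MvPolynomial (Fin (n + 1)) ℝ} {μ : κ → MvPolynomial (Fin n) ℝ}
    (h : ∀ T, M.energyAt v μ T ≤ C * M.fluxAt A q T) :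
    M.tripleNorm A q v μ ≤ √(1 + (hi + 1) * C) * √(∑ T, M.fluxAt A q T) := by
  have hhi := hA.hi_pos
  rw [← Real.sqrt_mul (by positivity)]
  refine Real.sqrt_le_sqrt ?_
  rw [Finset.mul_sum]
  change (∑ T, M.fluxAt A q T) + _ + _ ≤ _
  rw [← Finset.sum_add_distrib, ← Finset.sum_add_distrib]
  refine Finset.sum_le_sum fun T _ => ?_
  have h1 := hA.setIntegral_le hΩ T (memLp_gradient_fn (M := M) v T)
  have h2 := mul_le_mul_of_nonneg_left (h T) (by positivity : 0 ≤ hi + 1)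
  have h3 : 0 ≤ ∫ x in M.elem T, ‖gradient (M.fn v T) x‖ ^ 2 :=
    integral_nonneg fun _ => sq_nonneg _
  have h4 : 0 ≤ (M.hElem T)⁻¹ * ∑ E ∈ M.facetsOf T, M.facetIntegral E fun y =>
      (M.fn v T (M.Ψ E y) - facetFn μ E y) ^ 2 :=
    mul_nonneg (inv_nonneg.2 (M.hElem_pos T).le) (Finset.sum_nonneg fun E _ => gapAt_nonneg v μ E T)
  rw [energyAt] at h2
  have h5 := mul_nonneg hhi.le h4
  linarith

end

end Mesh

/-! ### Assembly of the stability estimate -/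

namespace Mesh

/-- The stability estimate on scaled meshes. -/
theorem exists_stability {s : Shape} {rt : RTForm} {p : ℕ} (hrt : rt.Admissible s p) (n : ℕ)
    {K lo hi α : ℝ} (hK : 0 < K) (hlo : 0 < lo) (hhi : 0 < hi) (hα : 0 < α) :
    ∃ C : ℝ, 0 < C ∧ ∀ {Ω : Set (Space (n + 1))} {ι κ : Type} [Fintype ι] [Fintype κ]
      {M : Mesh s n Ω ι κ} {A : Space (n + 1) → Matrix (Fin (n + 1)) (Fin (n + 1)) ℝ}
      {m f χ φ : Space (n + 1) → ℝ} {Gφ : Space (n + 1) → Space (n + 1)} {X : M.Unknowns rt p},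
      M.IsScaled K → IsPolyhedralDomain Ω → UniformTensor Ω lo hi A →
      MemLp m ∞ (volume.restrict Ω) → (∀ᵐ x ∂volume.restrict Ω, 0 < m x) →
      MemLp f 2 (volume.restrict Ω) → MemLp χ 2 (volume.restrict Ω) → IsH10 Ω φ Gφ →
      M.IsSolution A rt p α m f (φ + χ) X →
        ENNReal.ofReal (α * M.tripleNorm A X.1 X.2.1 X.2.2.1) + M.dualNorm A (M.fn X.2.2.2)
            + ENNReal.ofReal (M.weightedNorm m (M.fn X.2.2.2))
          ≤ ENNReal.ofReal C * (M.dualNorm A (fun _ => f) + eLpNorm Gφ 2 (volume.restrict Ω)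
              + eLpNorm (fun x => (√(m x))⁻¹ * χ x) 2 (volume.restrict Ω)) := by
  obtain ⟨C₁, hC₁, h₁⟩ := exists_energy_le_flux hrt n hK hlo
  obtain ⟨C₂, hC₂, h₂⟩ := exists_abs_ip_delta_le (rt := rt) s n p hK hlo hhi
  set a := √((hi + 4 * K) * C₁)
  set b := C₂ * √hi
  obtain ⟨c, hc, hq⟩ := exists_le_of_quadratic (a := a) (b := b) hα (Real.sqrt_nonneg _)
    (by positivity)
  set c₅ := √(1 + (hi + 1) * C₁)
  refine ⟨α * c₅ * c + C₂ * (1 + α * c) + c, by positivity, ?_⟩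
  intro Ω ι κ _ _ M A m f χ φ Gφ X hM hΩ hA hm h0 hf hχ hφ hX
  have hpos : 0 < α * c₅ * c + C₂ * (1 + α * c) + c := by positivity
  -- If a term on the right is infinite there is nothing to prove, since the constant is positive;
  -- afterwards all quantities are real numbers.
  by_cases hd : M.dualNorm A (fun _ => f) = ⊤
  · rw [hd, top_add, top_add, ENNReal.mul_top (ENNReal.ofReal_pos.2 hpos).ne']
    exact le_top
  by_cases hw : eLpNorm (fun x => (√(m x))⁻¹ * χ x) 2 (volume.restrict Ω) = ⊤
  · rw [hw, add_top, ENNReal.mul_top (ENNReal.ofReal_pos.2 hpos).ne']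
    exact le_top
  have hwm : MemLp (fun x => (√(m x))⁻¹ * χ x) 2 (volume.restrict Ω) :=
    ⟨(((Real.continuous_sqrt.comp_aestronglyMeasurable hm.1).aemeasurable.inv).aestronglyMeasurable).mul
      hχ.1, lt_top_iff_ne_top.2 hw⟩
  set F := (M.dualNorm A (fun _ => f)).toReal
  set D := (eLpNorm Gφ 2 (volume.restrict Ω)).toReal
  set Y := (eLpNorm (fun x => (√(m x))⁻¹ * χ x) 2 (volume.restrict Ω)).toReal
  set x := √(∑ T, M.fluxAt A X.1 T)
  set y := M.weightedNorm m (M.fn X.2.2.2)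
  have hF : 0 ≤ F := ENNReal.toReal_nonneg
  have hD : 0 ≤ D := ENNReal.toReal_nonneg
  have hY : 0 ≤ Y := ENNReal.toReal_nonneg
  have hx : 0 ≤ x := Real.sqrt_nonneg _
  have hy : 0 ≤ y := Real.sqrt_nonneg _
  have hxQ : x ^ 2 = ∑ T, M.fluxAt A X.1 T :=
    Real.sq_sqrt (Finset.sum_nonneg fun T _ => fluxAt_nonneg hΩ hA _ T)
  have hyW : y ^ 2 = M.ip (fun T x => m x * M.fn X.2.2.2 T x) (M.fn X.2.2.2) := by
    simp only [y]
    rw [weightedNorm_eq hΩ h0, Real.sq_sqrt (ip_mul_self_nonneg hΩ h0 _)]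
  have hen := h₁ hM hΩ hA hα hX
  -- The DG norm of `u` is bounded by its local energies, and these by the flux.
  have hfu : M.ip (fun _ => f) (M.fn X.2.1) ≤ F * a * x := by
    refine (hM.ip_smooth_le hA hΩ hf hd fun T => M.contDiff_fn _ T).trans ?_
    rw [mul_assoc]
    refine mul_le_mul_of_nonneg_left ?_ hF
    simp only [a, x]
    rw [← Real.sqrt_mul (by positivity), mul_assoc]
    refine Real.sqrt_le_sqrt ((hM.dgSq_fn_le hΩ hA X.2.1 ((mem_M0 _).1 X.2.2.1.2).2).trans ?_)
    refine mul_le_mul_of_nonneg_left ?_ (by positivity)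
    rw [Finset.mul_sum]
    exact Finset.sum_le_sum fun T _ => hen T
  obtain ⟨t, ht, htj⟩ := isBrokenH1_of_isH10 hΩ hM hφ
  have hφδ : |M.ip (fun _ => φ) (M.fn X.2.2.2)| ≤ b * (F + α * x) * D := by
    rw [ip_comm]
    refine (h₂ hM hΩ hA hα hf hd hX φ (fun _ => Gφ) t ht).trans ?_
    refine (mul_le_mul_of_nonneg_left (dgNorm_le_of_jump_eq_zero hΩ hA hφ.2.1 htj)
      (by positivity)).trans (le_of_eq ?_)
    ring
  have hχδ : |M.ip (fun _ => χ) (M.fn X.2.2.2)| ≤ Y * y := abs_ip_weighted_le hΩ hm h0 hwm _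
  have hsum : M.ip (fun _ => φ + χ) (M.fn X.2.2.2) =
      M.ip (fun _ => φ) (M.fn X.2.2.2) + M.ip (fun _ => χ) (M.fn X.2.2.2) := by
    unfold ip
    rw [← Finset.sum_add_distrib]
    refine Finset.sum_congr rfl fun T _ => ?_
    have i1 : Integrable (fun x => φ x * M.fn X.2.2.2.1 T x) (volume.restrict (M.elem T)) :=
      (M.memLp_elem hΩ T hφ.1).integrable_mul (memLp_fn _ T)
    have i2 : Integrable (fun x => χ x * M.fn X.2.2.2.1 T x) (volume.restrict (M.elem T)) :=
      (M.memLp_elem hΩ T hχ).integrable_mul (memLp_fn _ T)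
    rw [← integral_add i1 i2]
    congr 1
    funext x
    exact add_mul _ _ _
  have hid := hX.energy_identity
  rw [← hxQ, ← hyW, hsum] at hid
  -- The energy identity together with the three pairing bounds is exactly the quadratic hypothesis.
  obtain ⟨hxS, hyS⟩ := hq F D Y x y hF hD hY hx hy (by
    have e1 := neg_abs_le (M.ip (fun _ => φ) (M.fn X.2.2.2))
    have e2 := neg_abs_le (M.ip (fun _ => χ) (M.fn X.2.2.2))
    linarith)
  have htr : M.tripleNorm A X.1 X.2.1 X.2.2.1 ≤ c₅ * x := tripleNorm_le hC₁ hΩ hA hen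
  have hdual : M.dualNorm A (M.fn X.2.2.2) ≤ ENNReal.ofReal (C₂ * (F + α * x)) :=
    dualNorm_le (by positivity) fun w G t hw =>
      (le_abs_self _).trans (h₂ hM hΩ hA hα hf hd hX w G t hw)
  have hRHS : M.dualNorm A (fun _ => f) + eLpNorm Gφ 2 (volume.restrict Ω)
      + eLpNorm (fun x => (√(m x))⁻¹ * χ x) 2 (volume.restrict Ω) =
      ENNReal.ofReal (F + D + Y) := by
    rw [ENNReal.ofReal_add (by positivity) hY, ENNReal.ofReal_add hF hD, ENNReal.ofReal_toReal hd,
      ENNReal.ofReal_toReal hφ.2.1.2.ne, ENNReal.ofReal_toReal hw]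
  rw [hRHS, ← ENNReal.ofReal_mul hpos.le]
  have hT0 : 0 ≤ M.tripleNorm A X.1 X.2.1 X.2.2.1 := Real.sqrt_nonneg _
  calc _ ≤ ENNReal.ofReal (α * M.tripleNorm A X.1 X.2.1 X.2.2.1) +
        ENNReal.ofReal (C₂ * (F + α * x)) + ENNReal.ofReal y := by gcongr
    _ = ENNReal.ofReal (α * M.tripleNorm A X.1 X.2.1 X.2.2.1 + C₂ * (F + α * x) + y) := by
        rw [ENNReal.ofReal_add (by positivity) hy, ENNReal.ofReal_add (by positivity)
          (by positivity)]
    _ ≤ _ := by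
        refine ENNReal.ofReal_le_ofReal ?_
        have e1 : α * M.tripleNorm A X.1 X.2.1 X.2.2.1 ≤ α * c₅ * (c * (F + D + Y)) := by
          rw [mul_assoc]
          exact mul_le_mul_of_nonneg_left
            (htr.trans (mul_le_mul_of_nonneg_left hxS (Real.sqrt_nonneg _))) hα.le
        have e2 : C₂ * (F + α * x) ≤ C₂ * ((F + D + Y) + α * (c * (F + D + Y))) := by
          gcongr
          linarith
        linarith

end Mesh

end FOSPG

end

open FOSPG
-- The theorem
theorem mainTheorem8 (n : ℕ) (hn : n = 1 ∨ n = 2) (s : Shape) (r : RTForm) (p : ℕ)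
    (hr : r.Admissible s p) (Ω : Set (Space (n + 1))) (hΩ : IsPolyhedralDomain Ω)
    (A : Space (n + 1) → Matrix (Fin (n + 1)) (Fin (n + 1)) ℝ) (hA : IsDiffusionTensor Ω A)
    (α : ℝ) (hα : 0 < α) (σ : ℝ) (hσ : 0 < σ) :
    ∃ C : ℝ, 0 < C ∧
      ∀ (ι κ : Type) [Fintype ι] [Fintype κ] (M : Mesh s n Ω ι κ), M.ShapeRegular σ →
      ∀ (ulow uupp : Space (n + 1) → EReal) (Υ : Space (n + 1) → ℝ → ℝ),
        IsObstacleMap Ω ulow uupp Υ →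
      ∀ (ψ f χ φ : Space (n + 1) → ℝ) (Gφ : Space (n + 1) → Space (n + 1)),
        MemLp ψ ∞ (volume.restrict Ω) → MemLp f 2 (volume.restrict Ω) →
        MemLp χ 2 (volume.restrict Ω) → IsH10 Ω φ Gφ →
        (∃! X : M.Unknowns r p,
          M.IsSolution A r p α (superpositionDeriv Υ ψ) f (φ + χ) X) ∧
        ∀ X : M.Unknowns r p,
          M.IsSolution A r p α (superpositionDeriv Υ ψ) f (φ + χ) X →
          ENNReal.ofReal (α * M.tripleNorm A X.1 X.2.1 X.2.2.1)
              + M.dualNorm A (M.fn X.2.2.2)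
              + ENNReal.ofReal (M.weightedNorm (superpositionDeriv Υ ψ) (M.fn X.2.2.2))
            ≤ ENNReal.ofReal C *
              (M.dualNorm A (fun _ => f)
                + eLpNorm Gφ 2 (volume.restrict Ω)
                + eLpNorm (fun x => (Real.sqrt (superpositionDeriv Υ ψ x))⁻¹ * χ x) 2
                    (volume.restrict Ω)) := by
  obtain ⟨K, hK⟩ := Mesh.isScaled_of_shapeRegular (s := s) (n := n) (by omega) hσ
  obtain ⟨lo, hi, hA'⟩ := Mesh.exists_uniformTensor hA
  -- Positivity of `K` is known only once a mesh exists. If `K ≤ 0` there is no shape regular mesh,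
  -- and the claim is vacuous.
  by_cases hK0 : 0 < K
  · obtain ⟨C, hC, h⟩ := Mesh.exists_stability hr n hK0 hA'.lo_pos hA'.hi_pos hα
    refine ⟨C, hC, ?_⟩
    intro ι κ _ _ M hM ulow uupp Υ hΥ ψ f χ φ Gφ hψ hf hχ hφ
    have hS := hK Ω ι κ M hM
    exact ⟨Mesh.existsUnique_isSolution hr hS hΩ hA' hα (hΥ.memLp_deriv ψ hψ) (hΥ.deriv_pos ψ hψ)
        hf (hφ.1.add hχ),
      fun X hX => h hS hΩ hA' (hΥ.memLp_deriv ψ hψ) (hΥ.deriv_pos ψ hψ) hf hχ hφ hX⟩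
  · exact ⟨1, one_pos, fun ι κ _ _ M hM => absurd (hK Ω ι κ M hM).pos hK0⟩
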